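/- **Setting.** Let $d\ge 1$ and let $b_\alpha,c_\alpha>0$ ($1\le\alpha\le d$). For a sign $\pm$ put $\Lambda_{\pm\alpha}(\xi)=\pm\sqrt{c_\alpha^2|\xi|^2+b_\alpha^2}$ on $\mathbb{R}^3$, and for indices $\sigma,\mu,\nu\in\{\pm1,\dots,\pm d\}$ let $$\Phi(\xi,\eta)=\Lambda_\sigma(\xi)-\Lambda_\mu(\xi-\eta)-\Lambda_\nu(\eta).$$ Call a function $h$ on $\mathbb{R}^n$ *uniformly of class $\mathcal{G}_s$ with constant $B$* if it is smooth and $|\partial^\alpha h|\le B^{|\alpha|+1}(s|\alpha|)!$ everywhere. Fix an even $\varphi:\mathbb{R}\to[0,1]$ that is uniformly of class $\mathcal{G}_4$ (with some constant), equals $1$ on $[-5/4,5/4]$ and is supported in $[-8/5,8/5]$. Put $\varphi_k(x)=\varphi(|x|/2^k)-\varphi(|x|/2^{k-1})$, $\varphi_{\le k}(x)=\varphi(|x|/2^k)$, $\varphi_{[k-2,k+2]}=\sum_{|n-k|\le2}\varphi_n$. Let $\widehat f(\xi)=\int e^{-ix\cdot\xi}f(x)\,dx$; let $P_k$, $P_{[k-2,k+2]}$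 be the Fourier multipliers $\varphi_k$, $\varphi_{[k-2,k+2]}$. For $k\in\mathbb{Z}$, $j\in\mathbb{Z}_{\ge0}$ with $k+j\ge0$ (written $(k,j)\in\mathcal{J}$), let $f_{jk}=Q_{jk}f=\varphi_j^{(k)}P_kf$, where $\varphi_j^{(k)}=\varphi_{\le j}$ if $j=\max(0,-k)$ and $\varphi_j^{(k)}=\varphi_j$ if $j>\max(0,-k)$, and let $f_{jk}^*=P_{[k-2,k+2]}Q_{jk}f$. For $l\ge0$, $S_lf$ multiplies the degree-$q$ part of the spherical harmonics expansion of $f(r\,\cdot)$ by $\varphi_l(q)$ if $l\ge1$, and by $\varphi_{\le0}(q)$ if $l=0$. Let $\Gamma=(\partial_i,\ x_i\partial_j-x_j\partial_i)_{1\le i<j\le3}$, $\Gamma^\beta$ a composition of $|\beta|$ of these fields, $N=1000$, $N_0=10^{10}$, $\langle j\rangle=(1+j^2)^{1/2}$. For $K_0\ge1$ let $$\|f\|_X=\sup_{|\beta|\le N}\|\Gamma^\beta f\|_{L^2}+\sup_{(k,j)\in\mathcal{J}}\|f_{jk}\|_{Z_{jk}},$$ where $\|f\|_{Z_{jk}}$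 is the supremum over $|\beta|\le N/2+2$ of $\langle j\rangle^{N_0}2^{\min(k/2,0)}2^{j}\|\Gamma^\beta f\|_{L^2}$ if $|k|\ge K_0$, and of $2^{5j/6}\langle j\rangle^{-N_0}\|\Gamma^\beta f\|_{L^2}+\langle j\rangle^{N_0}2^{j}\|\widehat{\Gamma^\beta f}\|_{L^1}$ if $|k|<K_0$. Let $\mathfrak{m}(\xi,\eta)$ be a weight of the form $$\sum_{i=1}^{20}\sum_{k,k_1,k_2\in\mathbb{Z}}\bigl(1+2^{\max(k,k_1,k_2)}\bigr)\,w^{i,0}_{kk_1k_2}\Bigl(\tfrac{\xi}{2^k}\Bigr)w^{i,1}_{kk_1k_2}\Bigl(\tfrac{\xi-\eta}{2^{k_1}}\Bigr)w^{i,2}_{kk_1k_2}\Bigl(\tfrac{\eta}{2^{k_2}}\Bigr),$$ where all $w$'s are supported in one annulus $R^{-1}\le|x|\le R$ and are uniformly of class $\mathcal{G}_6$ with one constant $B$. For a number $A$ and an integer $m\ge 0$ write $X\prec Y$ (or $Y\succ X$) for $X<Y-A\log m$. **Lemma.** There is an absolute constant $0<A\le10^5$ with the following property. Let $(b_\alpha,c_\alpha)$,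 $\varphi$, $K_0\ge1$, $c_0\ge1$, $R\ge1$, $B\ge1$ be given as above; let $\psi_1:\mathbb{R}\to\mathbb{C}$ be a Schwartz function uniformly of class $\mathcal{G}_6$ (with some constant), and let $\psi_2:\mathbb{R}\to\mathbb{C}$ be uniformly of class $\mathcal{G}_6$ (with some constant) and supported in $c_0^{-1}\le|z|\le c_0$. Then there is a constant $C$, depending only on these data, such that the following holds for all $\sigma,\mu,\nu$, all weights $\mathfrak{m}$ as above, all $\varepsilon_1>0$, and all $f,g$ with $\|f\|_X,\|g\|_X\le\varepsilon_1$ (for instance two profiles $f_\mu(s),f_\nu(s)$ at a fixed time $s$). Let $m,j_1,j_2,l_1,l_2\ge0$ and $k,k_1,k_2$ be integers with $(k_1,j_1),(k_2,j_2)\in\mathcal{J}$, let $|\beta_1|+|\beta_2|\le N/2+2$, and put $F=(\Gamma^{\beta_1}S_{l_1}f)^*_{j_1k_1}$, $G=(\Gamma^{\beta_2}S_{l_2}g)^*_{j_2k_2}$. Let $\kappa,\upsilon,t\in\mathbb{R}$ with $c_0^{-1}2^m\le|t|\le c_02^m$, put $\overline k=\max(0,k_1,k_2)$, $\overline l=\max(l_1,l_2)$,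 and assume $$\max(k_1,k_2)\ge-2K_0^2,\qquad \kappa\prec m,\qquad \overline l<m/10,\qquad j_1-k_1\prec m,$$ and moreover that $k_1\le K_0^2$ or $j_1\prec m$. For $\xi\in\mathbb{R}^3$ let $$I'(\xi)=\int_{\mathbb{R}^3}e^{it\Phi(\xi,\eta)}\,\psi_1\bigl(2^{\kappa}\Phi(\xi,\eta)\bigr)\,\varphi_k(\xi)\,\mathfrak{m}(\xi,\eta)\,\psi_2\bigl(2^{\upsilon}\sin\angle(\xi,\eta)\bigr)\,\widehat F(\xi-\eta)\,\widehat G(\eta)\,d\eta .$$ Then the integral converges absolutely and $|I'(\xi)|\le C\,2^{-20m}\varepsilon_1^2$ for every $\xi$, in each of the following three cases: 1. $|k_1-k_2|\le6$, $\upsilon\prec(m+k)/2-\overline k$ and $m+k\succ2\overline l$; 2. $|k-k_1|\le6$, $\upsilon\prec(m+k_2)/2-\overline k$ and $m+k_2\succ2\overline l$; 3. $|k-k_2|\le6$, $|k_1|\prec(m-\overline l)/2$ and $\upsilon\prec(m-\overline l)/2$. -/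

import Mathlib

open MeasureTheory Polynomial
open scoped SchwartzMap ENNReal

namespace MKG

/-- Physical and frequency space `ℝ³` with the Euclidean norm. -/
abbrev E3 : Type := EuclideanSpace ℝ (Fin 3)

/-! ### Gevrey classes and dyadic cutoffs -/

/-- `f` is smooth and `|∂^n f| ≤ B^{n+1} (s n)!` on the whole space. -/
def GevreyBound {V W : Type*} [NormedAddCommGroup V] [NormedSpace ℝ V]
    [NormedAddCommGroup W] [NormedSpace ℝ W] (s : ℕ) (B : ℝ) (f : V → W) : Prop :=
  ContDiff ℝ (⊤ : ℕ∞) f ∧ ∀ (n : ℕ) (x : V), ‖iteratedFDeriv ℝ n f x‖ ≤ B ^ (n + 1) * ((s * n).factorial : ℝ)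

/-- The basic cutoff: even, valued in `[0,1]`, equal to `1` on `[-5/4,5/4]`, supported in
`[-8/5,8/5]`, of Gevrey class `4`. -/
structure IsCutoff (φ : ℝ → ℝ) : Prop where
  even : ∀ x, φ (-x) = φ x
  gevrey : ∃ B : ℝ, GevreyBound 4 B φ
  nonneg : ∀ x, 0 ≤ φ x
  le_one : ∀ x, φ x ≤ 1
  eq_one : ∀ x, |x| ≤ 5 / 4 → φ x = 1
  supp : ∀ x, φ x ≠ 0 → |x| ≤ 8 / 5

/-- `φ_k(r) = φ(r/2^k) - φ(r/2^{k-1})`; on `ℝ³` it is evaluated at `r = |x|`. -/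
noncomputable def phiK (φ : ℝ → ℝ) (k : ℤ) (r : ℝ) : ℝ :=
  φ (r / 2 ^ k) - φ (r / 2 ^ (k - 1))

/-- `φ_{≤ k}(r) = φ(r/2^k)`. -/
noncomputable def phiLe (φ : ℝ → ℝ) (k : ℤ) (r : ℝ) : ℝ := φ (r / 2 ^ k)

/-- `φ_{[k-2,k+2]}`. -/
noncomputable def phiBand (φ : ℝ → ℝ) (k : ℤ) (r : ℝ) : ℝ :=
  ∑ n ∈ Finset.Icc (k - 2) (k + 2), phiK φ n r

/-- The index set `𝒥` of pairs `(k, j)` with `j ≥ 0` and `k + j ≥ 0`. -/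
def InJ (j : ℕ) (k : ℤ) : Prop := 0 ≤ k + (j : ℤ)

/-- The spatial cutoff `φ_j^{(k)}`, for `(k, j) ∈ 𝒥`. -/
noncomputable def phiJK (φ : ℝ → ℝ) (j : ℕ) (k : ℤ) (r : ℝ) : ℝ :=
  if (j : ℤ) = max 0 (-k) then phiLe φ j r else phiK φ j r

/-! ### Fourier transform and localization operators -/

/-- `f̂(ξ) = ∫ e^{-i x·ξ} f(x) dx`. -/
noncomputable def ft (f : E3 → ℂ) (ξ : E3) : ℂ :=
  ∫ x : E3, Complex.exp (-(Complex.I * ((inner ℝ x ξ : ℝ) : ℂ))) * f x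

/-- The inverse transform `(2π)^{-3} ∫ e^{i x·ξ} g(ξ) dξ`. -/
noncomputable def ift (g : E3 → ℂ) (x : E3) : ℂ :=
  ((((2 * Real.pi) ^ 3)⁻¹ : ℝ) : ℂ) *
    ∫ ξ : E3, Complex.exp (Complex.I * ((inner ℝ x ξ : ℝ) : ℂ)) * g ξ

/-- The operator with Fourier multiplier `a` (used only for `a` smooth with compact support),
i.e. convolution with the inverse Fourier transform of `a`. -/
noncomputable def multOp (a : E3 → ℝ) (f : E3 → ℂ) (x : E3) : ℂ :=
  ∫ y : E3, ift (fun ξ => ((a ξ : ℝ) : ℂ)) (x - y) * f y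

/-- `P_k`. -/
noncomputable def P (φ : ℝ → ℝ) (k : ℤ) (f : E3 → ℂ) : E3 → ℂ :=
  multOp (fun ξ => phiK φ k ‖ξ‖) f

/-- `f_{jk} = Q_{jk} f = φ_j^{(k)} · P_k f`. -/
noncomputable def Q (φ : ℝ → ℝ) (j : ℕ) (k : ℤ) (f : E3 → ℂ) (x : E3) : ℂ :=
  ((phiJK φ j k ‖x‖ : ℝ) : ℂ) * P φ k f x

/-- `f_{jk}^* = P_{[k-2,k+2]} Q_{jk} f`. -/
noncomputable def Qstar (φ : ℝ → ℝ) (j : ℕ) (k : ℤ) (f : E3 → ℂ) : E3 → ℂ :=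
  multOp (fun ξ => phiBand φ k ‖ξ‖) (Q φ j k f)

/-! ### Spherical harmonics -/

/-- The Legendre polynomial `P_q`, by Rodrigues' formula. -/
noncomputable def legendre (q : ℕ) : ℝ[X] :=
  C ((2 ^ q * (q.factorial : ℝ))⁻¹) * derivative^[q] ((X ^ 2 - 1) ^ q)

/-- The spherical harmonic `Y_q^n` (`|n| ≤ q`) at a unit vector
`x = (sin θ cos φ, sin θ sin φ, cos θ)`: the `L²`-normalized
`(sin θ)^{|n|} e^{i n φ} P_q^{(|n|)}(cos θ)`. -/
noncomputable def Y (q : ℕ) (n : ℤ) (x : E3) : ℂ :=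
  ((Real.sqrt ((2 * q + 1) / (4 * Real.pi) *
      (((q - n.natAbs).factorial : ℝ) / ((q + n.natAbs).factorial : ℝ))) : ℝ) : ℂ) *
    (((x 0 : ℝ) : ℂ) + (if 0 ≤ n then 1 else -1) * Complex.I * ((x 1 : ℝ) : ℂ)) ^ n.natAbs *
    (((derivative^[n.natAbs] (legendre q)).eval (x 2) : ℝ) : ℂ)

/-- The coefficient `f_q^n(r) = ∫_{𝕊²} f(ru) conj(Y_q^n(u)) du` of the expansion
`f(ru) = ∑_q ∑_n f_q^n(r) Y_q^n(u)`. -/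
noncomputable def sphCoeff (f : E3 → ℂ) (q : ℕ) (n : ℤ) (r : ℝ) : ℂ :=
  ∫ u : Metric.sphere (0 : E3) 1,
    f (r • (u : E3)) * (starRingEnd ℂ) (Y q n (u : E3)) ∂((volume : Measure E3).toSphere)

/-- The angular projection `S_l` onto spherical harmonics of degree about `2^l`
(`φ_{≤0}` in place of `φ_0` when `l = 0`). The sum over `q` is finite. -/
noncomputable def S (φ : ℝ → ℝ) (l : ℕ) (f : E3 → ℂ) (x : E3) : ℂ :=
  ∑' q : ℕ, ∑ n ∈ Finset.Icc (-(q : ℤ)) q,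
    (((if l = 0 then phiLe φ 0 q else phiK φ l q) : ℝ) : ℂ) *
      sphCoeff f q n ‖x‖ * Y q n (‖x‖⁻¹ • x)

/-! ### The vector fields `Γ` and the norms -/

/-- The family `Γ` of vector fields `∂_i` and `x_i ∂_j - x_j ∂_i` (`i < j`). -/
inductive VField : Type
  | trans (i : Fin 3) : VField
  | rot (i j : Fin 3) (h : i < j) : VField

/-- The value of the vector field at the point `x`. -/
noncomputable def VField.vec : VField → E3 → E3
  | .trans i, _ => EuclideanSpace.single i 1
  | .rot i j _, x => x i • EuclideanSpace.single j (1 : ℝ) - x j • EuclideanSpace.single i (1 : ℝ)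

/-- `g = Z f` in the sense of distributions (each field in `Γ` is divergence free). -/
def IsWeak (Z : VField) (f g : E3 → ℂ) : Prop :=
  ∀ χ : E3 → ℂ, ContDiff ℝ (⊤ : ℕ∞) χ → HasCompactSupport χ →
    ∫ x : E3, f x * fderiv ℝ χ x (Z.vec x) = -∫ x : E3, g x * χ x

/-- `g = Γ^w f` in the sense of distributions, for a word `w` in the fields of `Γ`, where `g`
and all intermediate derivatives are in `L²`. -/
def IsGamma : List VField → (E3 → ℂ) → (E3 → ℂ) → Prop
  | [], f, g => MemLp g 2 volume ∧ g =ᵐ[volume] f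
  | Z :: w, f, g => ∃ h : E3 → ℂ, IsGamma w f h ∧ MemLp g 2 volume ∧ IsWeak Z h g

/-- `N = 1000`. -/
def N : ℕ := 1000

/-- `N₀ = 10^{10}`. -/
noncomputable def N0 : ℝ := 10 ^ 10

/-- `⟨x⟩ = (1 + x²)^{1/2}`. -/
noncomputable def jap (x : ℝ) : ℝ := Real.sqrt (1 + x ^ 2)

/-- `‖f‖_{ℋ^N} = sup_{|w| ≤ N} ‖Γ^w f‖_{L²}`; it is `∞` unless all these derivatives are in `L²`
(`Γ^w f` is unique almost everywhere, so that the infimum is over one value or none). -/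
noncomputable def hNorm (f : E3 → ℂ) : ℝ≥0∞ :=
  ⨆ w : List VField, ⨆ _ : w.length ≤ N,
    ⨅ g : E3 → ℂ, ⨅ _ : IsGamma w f g, eLpNorm g 2 volume

/-- The norm `Z_{jk}`. -/
noncomputable def zjkNorm (K₀ : ℝ) (j : ℕ) (k : ℤ) (f : E3 → ℂ) : ℝ≥0∞ :=
  ⨆ w : List VField, ⨆ _ : w.length ≤ N / 2 + 2,
    ⨅ g : E3 → ℂ, ⨅ _ : IsGamma w f g,
      if K₀ ≤ |(k : ℝ)| then
        ENNReal.ofReal (jap j ^ N0 * (2 : ℝ) ^ (min ((k : ℝ) / 2) 0) * 2 ^ j) *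
          eLpNorm g 2 volume
      else
        ENNReal.ofReal ((2 : ℝ) ^ (5 * (j : ℝ) / 6) * jap j ^ (-N0)) * eLpNorm g 2 volume +
          ENNReal.ofReal (jap j ^ N0 * 2 ^ j) * eLpNorm (ft g) 1 volume

/-- `‖f‖_Z = sup_{(k,j) ∈ 𝒥} ‖f_{jk}‖_{Z_{jk}}`. -/
noncomputable def zNorm (φ : ℝ → ℝ) (K₀ : ℝ) (f : E3 → ℂ) : ℝ≥0∞ :=
  ⨆ j : ℕ, ⨆ k : ℤ, ⨆ _ : InJ j k, zjkNorm K₀ j k (Q φ j k f)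

/-- `‖f‖_X = sup_{|w| ≤ N} ‖Γ^w f‖_{L²} + ‖f‖_Z`. -/
noncomputable def xNorm (φ : ℝ → ℝ) (K₀ : ℝ) (f : E3 → ℂ) : ℝ≥0∞ :=
  hNorm f + zNorm φ K₀ f

/-- `F = (Γ^β S_l f)_{jk}^*`. -/
def IsPiece (φ : ℝ → ℝ) (β : List VField) (l j : ℕ) (k : ℤ) (f F : E3 → ℂ) : Prop :=
  ∃ g : E3 → ℂ, IsGamma β (S φ l f) g ∧ F = Qstar φ j k g

/-! ### Phases, weights and the bilinear integral -/

/-- `Λ_{±α}(ξ) = ± (c_α² |ξ|² + b_α²)^{1/2}`; the index `±α` is the pair `(α, ±1)`. -/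
noncomputable def Lam {d : ℕ} (b c : Fin d → ℝ) (a : Fin d × ℤˣ) (ξ : E3) : ℝ :=
  ((a.2 : ℤ) : ℝ) * Real.sqrt (c a.1 ^ 2 * ‖ξ‖ ^ 2 + b a.1 ^ 2)

/-- `Φ_{σμν}(ξ,η) = Λ_σ(ξ) - Λ_μ(ξ-η) - Λ_ν(η)`. -/
noncomputable def Phase {d : ℕ} (b c : Fin d → ℝ) (σ μ ν : Fin d × ℤˣ) (ξ η : E3) : ℝ :=
  Lam b c σ ξ - Lam b c μ (ξ - η) - Lam b c ν η

/-- The profiles of a weight: all supported in one annulus `R⁻¹ ≤ |x| ≤ R` and uniformly bounded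
in the Gevrey class `6`. -/
def IsWeightFamily (R B : ℝ) (w : ℤ → ℤ → ℤ → Fin 20 → Fin 3 → E3 → ℂ) : Prop :=
  ∀ k k₁ k₂ i r, GevreyBound 6 B (w k k₁ k₂ i r) ∧
    ∀ x, w k k₁ k₂ i r x ≠ 0 → R⁻¹ ≤ ‖x‖ ∧ ‖x‖ ≤ R

/-- The weight `m(ξ,η) = ∑_i ∑_{k,k₁,k₂} (1 + 2^{max(k,k₁,k₂)})
w⁰(ξ/2^k) w¹((ξ-η)/2^{k₁}) w²(η/2^{k₂})`; at each point only finitely many terms do not vanish. -/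
noncomputable def weight (w : ℤ → ℤ → ℤ → Fin 20 → Fin 3 → E3 → ℂ) (ξ η : E3) : ℂ :=
  ∑' p : ℤ × ℤ × ℤ, ∑ i : Fin 20,
    (((1 + (2 : ℝ) ^ (max p.1 (max p.2.1 p.2.2)) : ℝ)) : ℂ) *
      w p.1 p.2.1 p.2.2 i 0 (((2 : ℝ) ^ p.1)⁻¹ • ξ) *
      w p.1 p.2.1 p.2.2 i 1 (((2 : ℝ) ^ p.2.1)⁻¹ • (ξ - η)) *
      w p.1 p.2.1 p.2.2 i 2 (((2 : ℝ) ^ p.2.2)⁻¹ • η)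

/-- The integrand (in `η`) of the angularly localized bilinear integral. -/
noncomputable def integrand {d : ℕ} (b c : Fin d → ℝ) (φ : ℝ → ℝ) (σ μ ν : Fin d × ℤˣ)
    (w : ℤ → ℤ → ℤ → Fin 20 → Fin 3 → E3 → ℂ) (ψ₁ ψ₂ : ℝ → ℂ) (κ υ t : ℝ) (k : ℤ)
    (F G : E3 → ℂ) (ξ η : E3) : ℂ :=
  Complex.exp (Complex.I * ((t * Phase b c σ μ ν ξ η : ℝ) : ℂ)) *
    ψ₁ ((2 : ℝ) ^ κ * Phase b c σ μ ν ξ η) *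
    ((phiK φ k ‖ξ‖ : ℝ) : ℂ) *
    weight w ξ η *
    ψ₂ ((2 : ℝ) ^ υ * Real.sin (InnerProductGeometry.angle ξ η)) *
    ft F (ξ - η) * ft G η

/-- `X ≺ Y`, i.e. `X < Y - A log m`. -/
def Prec (A : ℝ) (m : ℕ) (X Y : ℝ) : Prop := X < Y - A * Real.log m

/-- The three frequency configurations, with `k̄ = max(0,k₁,k₂)` and `l̄ = max(l₁,l₂)`. -/
def Config (A : ℝ) (m : ℕ) (k k₁ k₂ : ℤ) (l₁ l₂ : ℕ) (υ : ℝ) : Prop :=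
  (|k₁ - k₂| ≤ 6 ∧ Prec A m υ (((m : ℝ) + k) / 2 - max 0 (max (k₁ : ℝ) k₂)) ∧
    Prec A m (2 * max (l₁ : ℝ) l₂) ((m : ℝ) + k)) ∨
  (|k - k₁| ≤ 6 ∧ Prec A m υ (((m : ℝ) + k₂) / 2 - max 0 (max (k₁ : ℝ) k₂)) ∧
    Prec A m (2 * max (l₁ : ℝ) l₂) ((m : ℝ) + k₂)) ∨
  (|k - k₂| ≤ 6 ∧ Prec A m |(k₁ : ℝ)| (((m : ℝ) - max (l₁ : ℝ) l₂) / 2) ∧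
    Prec A m υ (((m : ℝ) - max (l₁ : ℝ) l₂) / 2))

end MKG

namespace MKG

open Topology Filter

/-! ### Quantitative smoothness to finite order at a point -/

/-! Write ξ = R e and describe η by spherical coordinates with axis e: radius ρ, azimuth, and polar
angle θ, which is the angle between ξ and η. On a half circle of fixed radius and azimuth, Λ_σ(ξ)
and Λ_ν(η) are constant, so the phase moves only through |ξ-η|, which the law of cosines gives. Its
θ-derivative has modulus c²Rρ sin θ / √(c²|ξ-η|²+b²), with b and c belonging to the index μ. It does
not vanish on the support of ψ₂, where sin θ is comparable to 2^{-υ}; this support also stays away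
from θ = 0 and θ = π, so there are no boundary terms. The proof integrates by parts exactly m times
in θ (`norm_integral_le_of_ibp`, `norm_integral_circle_le`).

One integration by parts gains the reciprocal H of the phase derivative and loses (m+1)Λ, where Λ
bounds the rate at which the amplitude varies. The product HΛ splits into five terms. They come from
the cutoffs, from ψ₁, from the angular degree of F, from the spatial support of F and from the
angular degree of G, and the hypotheses on υ, κ, the l's and j₁ make each of them at most C 2^{-A
log m} (`recip_mul_ampScale`, `exponent_bounds`, `exists_phase_bounds`). Gevrey regularity of order
6 costs m^6, and the count of integrations one more m. With A = 12 a single step gains C/m, and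
(C/m)^m is smaller than e^{-Km} for every K, up to a constant. This absorbs 2^{20m} and every loss
of the form 2^{O(m)}, so all norms may be estimated crudely; of the norm X only the L² norm of f and
g is needed.

Angular regularity is expressed by `AngDeg`: along every circle the function is a trigonometric
polynomial. S_l f has degree at most 2^{l+1}, and rotation-invariant operations preserve this. A
rotation field applied to such a function is a finite combination of rotations, because a
trigonometric polynomial is determined by its values at 2D+1 nodes; hence `conv_isGamma` and
`IsPiece.pieceData`. On the circle, Ĝ is controlled by its degree and its L¹ norm, and integrating
over all circles restores the L¹ norm of Ĝ. For F̂(ξ-η), `angular_expansion` separates the direction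
of ξ-η, which enters as powers of a unit complex number, from the distance |ξ-η|, at which F̂ is
evaluated along fixed rays.

The crude bounds also need all frequencies to be at most a constant times 2^m. This follows from the
support relations whenever a circle meets the support (`dyadic_relations`); the other circles
contribute zero. -/

/-- `f` is smooth at `x` and its derivatives of order at most `n` satisfy `|f^{(k)}(x)| ≤ M L^k`. -/
def EB {F : Type*} [NormedAddCommGroup F] [NormedSpace ℝ F] (n : ℕ) (f : ℝ → F) (x M L : ℝ) :
    Prop :=
  ContDiffAt ℝ (⊤ : ℕ∞) f x ∧ ∀ k ≤ n, ‖iteratedDeriv k f x‖ ≤ M * L ^ k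

lemma contDiffAt_deriv_top {F : Type*} [NormedAddCommGroup F] [NormedSpace ℝ F] {f : ℝ → F} {x : ℝ}
    (h : ContDiffAt ℝ (⊤ : ℕ∞) f x) : ContDiffAt ℝ (⊤ : ℕ∞) (deriv f) x := by
  have h1 : ContDiffAt ℝ (⊤ : ℕ∞) (fun y => fderiv ℝ f y 1) x :=
    (h.fderiv_right (m := (⊤ : ℕ∞)) (by simp)).clm_apply contDiffAt_const
  exact h1

section EBBasic

variable {F : Type*} [NormedAddCommGroup F] [NormedSpace ℝ F]
variable {n : ℕ} {f g : ℝ → F} {x M L M' L' : ℝ}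

lemma ContDiffAt.nat_of_top (h : ContDiffAt ℝ (⊤ : ℕ∞) f x) (k : ℕ) : ContDiffAt ℝ k f x :=
  h.of_le (by exact_mod_cast le_top)

lemma EB.norm_le (h : EB n f x M L) : ‖f x‖ ≤ M := by
  simpa using h.2 0 (Nat.zero_le _)

lemma EB.nonneg (h : EB n f x M L) : 0 ≤ M := (norm_nonneg _).trans h.norm_le

lemma EB.mono (h : EB n f x M L) (hM : M ≤ M') (hL : 0 ≤ L) (hLL : L ≤ L') : EB n f x M' L' := by
  refine ⟨h.1, fun k hk => (h.2 k hk).trans ?_⟩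
  have := h.nonneg
  gcongr
  exact this.trans hM

lemma EB.mono_order {n' : ℕ} (h : EB n f x M L) (hn : n' ≤ n) : EB n' f x M L :=
  ⟨h.1, fun k hk => h.2 k (hk.trans hn)⟩

lemma EB.congr (h : EB n f x M L) (hfg : f =ᶠ[𝓝 x] g) : EB n g x M L :=
  ⟨h.1.congr_of_eventuallyEq hfg.symm, fun k hk => by rw [← hfg.iteratedDeriv_eq k]; exact h.2 k hk⟩

lemma EB.add (hf : EB n f x M L) (hg : EB n g x M' L) : EB n (fun y => f y + g y) x (M + M') L := by
  refine ⟨hf.1.add hg.1, fun k hk => ?_⟩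
  have := iteratedDeriv_add (ContDiffAt.nat_of_top hf.1 k) (ContDiffAt.nat_of_top hg.1 k)
  change ‖iteratedDeriv k (f + g) x‖ ≤ _
  rw [this, add_mul]
  exact (norm_add_le _ _).trans (add_le_add (hf.2 k hk) (hg.2 k hk))

lemma EB.neg (hf : EB n f x M L) : EB n (fun y => - f y) x M L := by
  refine ⟨hf.1.neg, fun k hk => ?_⟩
  rw [iteratedDeriv_fun_neg, norm_neg]
  exact hf.2 k hk

lemma EB.sub (hf : EB n f x M L) (hg : EB n g x M' L) : EB n (fun y => f y - g y) x (M + M') L := by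
  simpa [sub_eq_add_neg] using hf.add hg.neg

lemma EB.const (c : F) (hL : 0 ≤ L) : EB n (fun _ => c) x ‖c‖ L := by
  refine ⟨contDiffAt_const, fun k _ => ?_⟩
  rw [iteratedDeriv_const]
  split_ifs with h
  · simp [h]
  · simp; positivity

lemma EB.sum {ι : Type*} (s : Finset ι) {f : ι → ℝ → F} {M : ι → ℝ} (hL : 0 ≤ L)
    (h : ∀ i ∈ s, EB n (f i) x (M i) L) : EB n (fun y => ∑ i ∈ s, f i y) x (∑ i ∈ s, M i) L := by
  classical
  induction s using Finset.induction_on with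
  | empty => simpa using EB.const (n := n) (x := x) (0 : F) hL
  | insert a s ha ih =>
    simp only [Finset.sum_insert ha]
    exact (h a (by simp)).add (ih fun i hi => h i (by simp [hi]))

lemma EB.deriv (h : EB (n + 1) f x M L) : EB n (deriv f) x (M * L) L := by
  refine ⟨?_, fun k hk => ?_⟩
  · simpa [iteratedDeriv_one] using contDiffAt_deriv_top h.1
  · rw [← iteratedDeriv_succ', mul_assoc, ← pow_succ']
    exact h.2 (k + 1) (by omega)

/-- Bounds for `f` from bounds for its derivative. -/
lemma EB.of_deriv (hf : ContDiffAt ℝ (⊤ : ℕ∞) f x) (h0 : ‖f x‖ ≤ M) (h : EB n (_root_.deriv f) x (M * L) L) :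
    EB (n + 1) f x M L := by
  refine ⟨hf, fun k hk => ?_⟩
  rcases k with _ | k
  · simpa using h0
  · rw [iteratedDeriv_succ', pow_succ', ← mul_assoc]
    exact h.2 k (by omega)

lemma EB.ofReal {f : ℝ → ℝ} (h : EB n f x M L) : EB n (fun y => ((f y : ℝ) : ℂ)) x M L := by
  have hc : ContDiffAt ℝ (⊤ : ℕ∞) (fun y => ((f y : ℝ) : ℂ)) x :=
    Complex.ofRealCLM.contDiff.contDiffAt.comp x h.1
  refine ⟨hc, fun k hk => ?_⟩
  have := Complex.ofRealLI.norm_iteratedFDeriv_comp_left (𝕜 := ℝ) (f := f) (x := x) (i := k) (ContDiffAt.nat_of_top h.1 k) le_rfl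
  rw [← norm_iteratedFDeriv_eq_norm_iteratedDeriv]
  have h2 := h.2 k hk
  rw [← norm_iteratedFDeriv_eq_norm_iteratedDeriv, ← this] at h2
  exact h2

end EBBasic

section EBMul

variable {A : Type*} [NormedCommRing A] [NormedAlgebra ℝ A]
variable {n : ℕ} {f g : ℝ → A} {x M L M' L' : ℝ}

lemma norm_iteratedDeriv_mul_le (hf : ContDiffAt ℝ (⊤ : ℕ∞) f x) (hg : ContDiffAt ℝ (⊤ : ℕ∞) g x)
    (k : ℕ) : ‖iteratedDeriv k (fun y => f y * g y) x‖ ≤ ∑ i ∈ Finset.range (k + 1),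
      (k.choose i : ℝ) * (‖iteratedDeriv i f x‖ * ‖iteratedDeriv (k - i) g x‖) := by
  rw [iteratedDeriv_fun_mul (ContDiffAt.nat_of_top hf k) (ContDiffAt.nat_of_top hg k)]
  refine (norm_sum_le _ _).trans (Finset.sum_le_sum fun i _ => ?_)
  rw [mul_assoc, ← nsmul_eq_mul (k.choose i), ← nsmul_eq_mul (k.choose i)]
  refine norm_nsmul_le.trans ?_
  simp only [nsmul_eq_mul]
  gcongr
  exact norm_mul_le _ _

/-- The Leibniz rule becomes the binomial expansion of (L + L')^k, so the rates simply add and no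
combinatorial factor is lost. -/
lemma EB.mul (hf : EB n f x M L) (hg : EB n g x M' L') :
    EB n (fun y => f y * g y) x (M * M') (L + L') := by
  refine ⟨hf.1.mul hg.1, fun k hk => (norm_iteratedDeriv_mul_le hf.1 hg.1 k).trans ?_⟩
  rw [add_pow, Finset.mul_sum]
  refine Finset.sum_le_sum fun i hi => ?_
  have hi' : i ≤ k := Nat.lt_succ_iff.mp (Finset.mem_range.mp hi)
  have h1 := hf.2 i (hi'.trans hk)
  have h2 := hg.2 (k - i) ((Nat.sub_le _ _).trans hk)
  calc _ ≤ (k.choose i : ℝ) * ((M * L ^ i) * (M' * L' ^ (k - i))) := by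
        gcongr
        exact (norm_nonneg _).trans h1
    _ = _ := by ring

lemma EB.const_mul (c : A) (hf : EB n f x M L) :
    EB n (fun y => c * f y) x (‖c‖ * M) L := by
  simpa using (EB.const (n := n) (x := x) c le_rfl).mul hf

end EBMul

section EBOps

variable {A : Type*} [NormedCommRing A] [NormedAlgebra ℝ A]
variable {n : ℕ} {x L : ℝ}

/-- A solution of `f' = z f` inherits the bounds of `z`. -/
lemma EB.ode {f z : ℝ → A} {Z : ℝ} (hf : ContDiffAt ℝ (⊤ : ℕ∞) f x)
    (hz : EB n z x Z L) (hL : 0 ≤ L) (h : _root_.deriv f =ᶠ[𝓝 x] fun y => z y * f y) :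
    EB n f x ‖f x‖ (Z + n * L) := by
  have hZ := hz.nonneg
  -- The rate depends on the order k, which makes the induction close: the Leibniz sum for z f is
  -- the binomial expansion of (L + (Z + kL))^k, and L + (Z + kL) = Z + (k+1)L.
  have key : ∀ k, k ≤ n → ‖iteratedDeriv k f x‖ ≤ ‖f x‖ * (Z + k * L) ^ k := by
    intro k
    induction k using Nat.strong_induction_on with
    | _ k ih =>
      intro hk
      rcases k with _ | k
      · simp
      rw [iteratedDeriv_succ', h.iteratedDeriv_eq k]
      refine (norm_iteratedDeriv_mul_le hz.1 hf k).trans ?_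
      have e1 : ∀ i ∈ Finset.range (k + 1),
          (k.choose i : ℝ) * (‖iteratedDeriv i z x‖ * ‖iteratedDeriv (k - i) f x‖) ≤
          (Z * ‖f x‖) * (L ^ i * (Z + k * L) ^ (k - i) * (k.choose i)) := by
        intro i hi
        have hi' : i ≤ k := Nat.lt_succ_iff.mp (Finset.mem_range.mp hi)
        have h1 := hz.2 i (by omega)
        have h2 := ih (k - i) (by omega) (by omega)
        have h3 : (Z + ((k - i : ℕ) : ℝ) * L) ^ (k - i) ≤ (Z + k * L) ^ (k - i) := by
          gcongr
          omega
        calc _ ≤ (k.choose i : ℝ) * ((Z * L ^ i) * (‖f x‖ * (Z + k * L) ^ (k - i))) := by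
              gcongr
              exact h2.trans (by gcongr)
          _ = _ := by ring
      refine (Finset.sum_le_sum e1).trans ?_
      rw [← Finset.mul_sum, ← add_pow]
      have e2 : L + (Z + k * L) = Z + ((k + 1 : ℕ) : ℝ) * L := by push_cast; ring
      rw [e2, pow_succ]
      have : Z ≤ Z + ((k + 1 : ℕ) : ℝ) * L := by
        have : 0 ≤ ((k + 1 : ℕ) : ℝ) * L := by positivity
        linarith
      calc Z * ‖f x‖ * (Z + ((k + 1 : ℕ) : ℝ) * L) ^ k
          = ‖f x‖ * ((Z + ((k + 1 : ℕ) : ℝ) * L) ^ k * Z) := by ring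
        _ ≤ _ := by gcongr
  refine ⟨hf, fun k hk => (key k hk).trans ?_⟩
  gcongr

end EBOps

/-- Bounds for the reciprocal of a real function. -/
lemma EB.inv {n : ℕ} {x L K δ : ℝ} {f : ℝ → ℝ} (hf : EB n f x (K * δ) L) (hδ : 0 < δ) (hK : 1 ≤ K)
    (hL : 0 ≤ L) (hx : δ ≤ |f x|) :
    EB n (fun y => (f y)⁻¹) x δ⁻¹ (2 * K * n * L) := by
  have hfx : f x ≠ 0 := by
    intro h; rw [h, abs_zero] at hx; linarith
  have hg : ContDiffAt ℝ (⊤ : ℕ∞) (fun y => (f y)⁻¹) x := hf.1.inv hfx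
  refine ⟨hg, fun k => ?_⟩
  have hinv : ‖(f x)⁻¹‖ ≤ δ⁻¹ := by
    rw [norm_inv, Real.norm_eq_abs]; exact inv_anti₀ hδ hx
  set Λ := 2 * K * n * L with hΛ
  have hΛ0 : 0 ≤ Λ := by positivity
  induction k using Nat.strong_induction_on with
  | _ k ih =>
    intro hk
    rcases Nat.eq_zero_or_pos k with rfl | hkpos
    · simpa using hinv
    have hne : ∀ᶠ y in 𝓝 x, f y ≠ 0 := hf.1.continuousAt.eventually_ne hfx
    -- Differentiating the identity f · f⁻¹ = 1 k times expresses the k-th derivative of f⁻¹ through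
    -- its lower ones.
    have h1 : (fun y => f y * (f y)⁻¹) =ᶠ[𝓝 x] fun _ => (1 : ℝ) := by
      filter_upwards [hne] with y hy using mul_inv_cancel₀ hy
    have h2 := h1.iteratedDeriv_eq k
    rw [iteratedDeriv_const, if_neg hkpos.ne',
      iteratedDeriv_fun_mul (ContDiffAt.nat_of_top hf.1 k) (ContDiffAt.nat_of_top hg k),
      Finset.sum_range_succ'] at h2
    simp only [Nat.choose_zero_right, Nat.cast_one, iteratedDeriv_zero, one_mul, Nat.sub_zero] at h2
    have h3 : iteratedDeriv k (fun y => (f y)⁻¹) x = - (f x)⁻¹ * ∑ i ∈ Finset.range k,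
        (k.choose (i + 1) : ℝ) * iteratedDeriv (i + 1) f x *
          iteratedDeriv (k - (i + 1)) (fun y => (f y)⁻¹) x := by
      rw [eq_neg_of_add_eq_zero_left h2]
      field_simp
    rw [h3, norm_mul, norm_neg]
    -- This is the reason for the factor 2Kn in the rate: for k ≤ n the relative growth of (L + Λ)^k
    -- over Λ^k is at most 1/K, which absorbs the K coming from the bound on f.
    have hnL : (1 + (1 / (2 * K * n))) ^ k ≤ 1 + 1 / K := by
      have hn : (0 : ℝ) < n := by
        have : 0 < n := lt_of_lt_of_le hkpos hk
        exact_mod_cast this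
      have a1 : (1 + (1 / (2 * K * n))) ^ k ≤ Real.exp (1 / (2 * K)) := by
        calc (1 + (1 / (2 * K * n))) ^ k ≤ (Real.exp (1 / (2 * K * n))) ^ k := by
              gcongr
              rw [add_comm]; exact Real.add_one_le_exp _
          _ = Real.exp (k * (1 / (2 * K * n))) := by rw [← Real.exp_nat_mul]
          _ ≤ Real.exp (1 / (2 * K)) := by
              apply Real.exp_le_exp.mpr
              have : (k : ℝ) ≤ n := by exact_mod_cast hk
              rw [mul_one_div, div_le_div_iff₀ (by positivity) (by positivity)]
              nlinarith
      have a2 : Real.exp (1 / (2 * K)) ≤ 1 + 1 / K := by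
        have hs : |1 / (2 * K)| ≤ 1 := by
          rw [abs_of_pos (by positivity), div_le_one (by positivity)]; linarith
        have hq := Real.abs_exp_sub_one_sub_id_le hs
        have hq2 := (abs_le.mp hq).2
        have e : 1 / K = 2 * (1 / (2 * K)) := by field_simp
        have hp : 0 < 1 / (2 * K) := by positivity
        have hp2 : 1 / (2 * K) ≤ 1 := by rwa [abs_of_pos hp] at hs
        rw [e]; nlinarith
      exact a1.trans a2
    have hn : (0 : ℝ) < n := by
      have : 0 < n := lt_of_lt_of_le hkpos hk
      exact_mod_cast this
    have hLΛ : L = Λ * (1 / (2 * K * n)) := by rw [hΛ]; field_simp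
    have hsum : ‖∑ i ∈ Finset.range k, (k.choose (i + 1) : ℝ) * iteratedDeriv (i + 1) f x *
          iteratedDeriv (k - (i + 1)) (fun y => (f y)⁻¹) x‖ ≤ Λ ^ k := by
      calc _ ≤ ∑ i ∈ Finset.range k, K * (L ^ (i + 1) * Λ ^ (k - (i + 1)) * (k.choose (i + 1))) := by
            refine (norm_sum_le _ _).trans (Finset.sum_le_sum fun i hi => ?_)
            have hik := Finset.mem_range.mp hi
            rw [norm_mul, norm_mul, Real.norm_natCast]
            have b1 := hf.2 (i + 1) (by omega)
            have b2 := ih (k - (i + 1)) (by omega) (by omega)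
            calc _ ≤ (k.choose (i + 1) : ℝ) * (K * δ * L ^ (i + 1)) * (δ⁻¹ * Λ ^ (k - (i + 1))) := by
                  gcongr
              _ = _ := by field_simp
        _ = K * ((L + Λ) ^ k - Λ ^ k) := by
            rw [← Finset.mul_sum, add_pow, Finset.sum_range_succ']
            simp
        _ = K * (Λ ^ k * ((1 + 1 / (2 * K * n)) ^ k - 1)) := by
            have : L + Λ = Λ * (1 + 1 / (2 * K * n)) := by
              nth_rw 1 [hLΛ]; ring
            rw [this, mul_pow]; ring
        _ ≤ K * (Λ ^ k * (1 / K)) := by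
            gcongr; linarith
        _ = Λ ^ k := by field_simp
    gcongr

end MKG

/-! ### Composition with curves and repeated integration by parts -/

namespace MKG

open Topology Filter

section EBComp

variable {V W : Type} [NormedAddCommGroup V] [NormedSpace ℝ V] [NormedAddCommGroup W]
  [NormedSpace ℝ W]

lemma EB.clm_apply {n : ℕ} {x M L M' L' : ℝ} {c : ℝ → V →L[ℝ] W} {v : ℝ → V}
    (hc : EB n c x M L) (hv : EB n v x M' L') :
    EB n (fun y => c y (v y)) x (M * M') (L + L') := by
  refine ⟨hc.1.clm_apply hv.1, fun k hk => ?_⟩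
  obtain ⟨u, hu, hxu, hcu⟩ := (ContDiffAt.nat_of_top hc.1 k).contDiffOn' le_rfl (by simp)
  obtain ⟨u', hu', hxu', hvu'⟩ := (ContDiffAt.nat_of_top hv.1 k).contDiffOn' le_rfl (by simp)
  have ho : IsOpen (u ∩ u') := hu.inter hu'
  have hx : x ∈ u ∩ u' := ⟨hxu, hxu'⟩
  have h1 : ContDiffOn ℝ k c (u ∩ u') := hcu.mono (by intro y hy; simp [hy.1])
  have h2 : ContDiffOn ℝ k v (u ∩ u') := hvu'.mono (by intro y hy; simp [hy.2])
  have h := norm_iteratedFDerivWithin_clm_apply h1 h2 ho.uniqueDiffOn hx (n := k) le_rfl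
  simp only [iteratedFDerivWithin_of_isOpen _ ho hx, norm_iteratedFDeriv_eq_norm_iteratedDeriv] at h
  refine h.trans ?_
  rw [add_pow, Finset.mul_sum]
  refine Finset.sum_le_sum fun i hi => ?_
  have hi' : i ≤ k := Nat.lt_succ_iff.mp (Finset.mem_range.mp hi)
  have h1 := hc.2 i (hi'.trans hk)
  have h2 := hv.2 (k - i) ((Nat.sub_le _ _).trans hk)
  have h0 := (norm_nonneg _).trans h1
  calc _ ≤ (k.choose i : ℝ) * (M * L ^ i) * (M' * L' ^ (k - i)) := by gcongr
    _ = _ := by ring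

end EBComp

/-- A substitute for the Faà di Bruno formula. The chain rule replaces w by its derivative, which
takes values in a different space, so the induction on the order must quantify over all target
spaces W. -/
lemma comp_aux {V : Type} [NormedAddCommGroup V] [NormedSpace ℝ V] {x G L B : ℝ} {γ : ℝ → V}
    (hγ : ContDiffAt ℝ (⊤ : ℕ∞) γ x) (hL : 0 ≤ L) (hB : 0 ≤ B) (hG : 0 ≤ G) (n : ℕ) :
    ∀ k ≤ n, (∀ i < k, ‖iteratedDeriv i (deriv γ) x‖ ≤ G * L ^ i) →
    ∀ (W : Type) [NormedAddCommGroup W] [NormedSpace ℝ W] (w : V → W) (M : ℝ),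
      ContDiff ℝ (⊤ : ℕ∞) w → (∀ i ≤ k, ‖iteratedFDeriv ℝ i w (γ x)‖ ≤ M * B ^ i) →
      ‖iteratedDeriv k (fun y => w (γ y)) x‖ ≤ M * (B * G + k * L) ^ k := by
  intro k
  induction k using Nat.strong_induction_on with
  | _ k ih =>
    intro hk hγk W _ _ w M hw hwk
    have hM : 0 ≤ M := (norm_nonneg _).trans (by simpa using hwk 0 (Nat.zero_le _))
    rcases k with _ | k
    · simpa using hwk 0 le_rfl
    have hd : deriv (fun y => w (γ y)) =ᶠ[𝓝 x] fun y => (fderiv ℝ w (γ y)) (deriv γ y) := by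
      have h1 : ContDiffAt ℝ 1 γ x := hγ.of_le (by exact_mod_cast le_top)
      filter_upwards [h1.eventually (by simp)] with y hy
      have h2 : HasDerivAt γ (deriv γ y) y := (hy.differentiableAt (by simp)).hasDerivAt
      have h3 : HasFDerivAt w (fderiv ℝ w (γ y)) (γ y) :=
        ((hw.differentiable (by simp)) _).hasFDerivAt
      exact (h3.comp_hasDerivAt y h2).deriv
    rw [iteratedDeriv_succ', hd.iteratedDeriv_eq k]
    set Λ := B * G + k * L with hΛ
    have hfw : ContDiff ℝ (⊤ : ℕ∞) (fderiv ℝ w) := hw.fderiv_right (by simp)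
    have hc : EB k (fun y => fderiv ℝ w (γ y)) x (M * B) Λ := by
      refine ⟨(hfw.contDiffAt).comp x hγ, fun i hi => ?_⟩
      refine (ih i (by omega) (by omega) (fun j hj => hγk j (by omega)) _ (fderiv ℝ w) (M * B)
        hfw (fun j hj => ?_)).trans ?_
      · rw [norm_iteratedFDeriv_fderiv, mul_assoc, ← pow_succ']
        exact hwk (j + 1) (by omega)
      · rw [hΛ]; gcongr
    have hv : EB k (deriv γ) x G L := ⟨contDiffAt_deriv_top hγ, fun i hi => hγk i (by omega)⟩
    have h := (hc.clm_apply hv).2 k le_rfl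
    refine h.trans ?_
    have e : Λ + L = B * G + ((k + 1 : ℕ) : ℝ) * L := by rw [hΛ]; push_cast; ring
    rw [e, pow_succ]
    have : B * G ≤ B * G + ((k + 1 : ℕ) : ℝ) * L := by
      have : 0 ≤ ((k + 1 : ℕ) : ℝ) * L := by positivity
      linarith
    calc M * B * G * (B * G + ((k + 1 : ℕ) : ℝ) * L) ^ k
        = M * ((B * G + ((k + 1 : ℕ) : ℝ) * L) ^ k * (B * G)) := by ring
      _ ≤ _ := by gcongr

/-- Composition of a smooth map with a curve. -/
lemma EB.comp {V W : Type} [NormedAddCommGroup V] [NormedSpace ℝ V] [NormedAddCommGroup W]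
    [NormedSpace ℝ W] {n : ℕ} {x G L B M : ℝ} {γ : ℝ → V} {w : V → W}
    (hγ : ContDiffAt ℝ (⊤ : ℕ∞) γ x) (hγ' : EB n (_root_.deriv γ) x G L) (hL : 0 ≤ L) (hB : 0 ≤ B)
    (hw : ContDiff ℝ (⊤ : ℕ∞) w) (hwB : ∀ i ≤ n, ‖iteratedFDeriv ℝ i w (γ x)‖ ≤ M * B ^ i) :
    EB n (fun y => w (γ y)) x M (B * G + n * L) := by
  have hG := hγ'.nonneg
  have hM : 0 ≤ M := (norm_nonneg _).trans (by simpa using hwB 0 (Nat.zero_le _))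
  refine ⟨hw.contDiffAt.comp x hγ, fun k hk => ?_⟩
  refine (comp_aux hγ hL hB hG n k hk (fun i hi => hγ'.2 i (by omega)) W w M hw
    (fun i hi => hwB i (by omega))).trans ?_
  gcongr

/-- Repeated integration by parts on a compact interval against an oscillating factor `E`,
where `E = h E'` on the set carrying the amplitude `a`. -/
lemma norm_integral_le_of_ibp {lo hi : ℝ} (hlh : lo ≤ hi) {T : Set ℝ} (hT : T ⊆ Set.Ioo lo hi)
    {E E' h : ℝ → ℂ} (hE : ∀ x, HasDerivAt E (E' x) x) (hE' : Continuous E')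
    (hE1 : ∀ x, ‖E x‖ ≤ 1) (hEh : ∀ x ∈ T, E' x * h x = E x) {H L : ℝ} (hL : 0 ≤ L) (n : ℕ)
    (hh : ∀ x ∈ T, EB n h x H L) :
    ∀ (j : ℕ) (a : ℝ → ℂ) (M : ℝ) (i : ℕ), i + j ≤ n → 0 ≤ M → (∀ x ∈ T, EB j a x M ((i + 1) * L)) →
      (∀ x ∉ T, a =ᶠ[𝓝 x] fun _ => 0) →
      ‖∫ x in lo..hi, E x * a x‖ ≤ (hi - lo) * (M * (|H| * ((n + 1) * L)) ^ j) := by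
  intro j
  induction j with
  | zero =>
    intro a M i _ hM ha ha0
    rw [pow_zero, mul_one, mul_comm]
    have : ∀ x ∈ Set.uIoc lo hi, ‖E x * a x‖ ≤ M := by
      intro x _
      rw [norm_mul]
      have h1 : ‖a x‖ ≤ M := by
        by_cases hx : x ∈ T
        · exact (ha x hx).norm_le
        · rw [(ha0 x hx).eq_of_nhds]; simpa using hM
      calc _ ≤ 1 * M := by gcongr; exact hE1 x
        _ = M := one_mul M
    have h2 := intervalIntegral.norm_integral_le_of_norm_le_const this
    rwa [abs_of_nonneg (by linarith)] at h2
  | succ j ih =>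
    intro a M i hij hM ha ha0
    -- The index i counts the integrations already made. Each multiplies the amplitude by h and so
    -- raises its rate by one L; the rate never exceeds (n+1)L.
    set b : ℝ → ℂ := fun x => a x * h x with hb
    have hbT : ∀ x ∈ T, EB (j + 1) b x (M * |H|) (((i : ℝ) + 1) * L + L) := fun x hx =>
      ((ha x hx).mul ((hh x hx).mono_order (by omega))).mono
        (by gcongr; exact le_abs_self H) (by positivity) le_rfl
    have hb0 : ∀ x ∉ T, b =ᶠ[𝓝 x] fun _ => 0 := fun x hx => by
      filter_upwards [ha0 x hx] with y hy
      simp [hb, hy]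
    have hbs : ContDiff ℝ (⊤ : ℕ∞) b := by
      rw [contDiff_iff_contDiffAt]
      intro x
      by_cases hx : x ∈ T
      · exact (hbT x hx).1
      · exact contDiffAt_const.congr_of_eventuallyEq (hb0 x hx)
    have hbd : ∀ x, HasDerivAt b (deriv b x) x := fun x =>
      (hbs.differentiable (by simp) x).hasDerivAt
    have hbc : Continuous (deriv b) := hbs.continuous_deriv (by simp)
    have e1 : ∀ x, E x * a x = b x * E' x := by
      intro x
      by_cases hx : x ∈ T
      · rw [← hEh x hx]; simp only [hb]; ring
      · rw [(ha0 x hx).eq_of_nhds, (hb0 x hx).eq_of_nhds]; simp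
    -- T lies in the open interval, so the boundary terms vanish.
    have hlo : b lo = 0 := (hb0 lo fun h => (hT h).1.false).eq_of_nhds
    have hhi : b hi = 0 := (hb0 hi fun h => (hT h).2.false).eq_of_nhds
    have e2 : ∫ x in lo..hi, E x * a x = - ∫ x in lo..hi, E x * deriv b x := by
      simp_rw [e1]
      rw [intervalIntegral.integral_mul_deriv_eq_deriv_mul (fun x _ => hbd x) (fun x _ => hE x)
        (hbc.intervalIntegrable _ _) (hE'.intervalIntegrable _ _), hlo, hhi]
      simp [mul_comm]
    rw [e2, norm_neg]
    have h3 := ih (deriv b) (M * |H| * (((i : ℝ) + 1) * L + L)) (i + 1) (by omega)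
      (by positivity) (fun x hx => by
        have := (hbT x hx).deriv
        refine this.mono le_rfl (by positivity) (by push_cast; linarith))
      (fun x hx => by
        have := (hb0 x hx).deriv
        simpa using this)
    refine h3.trans ?_
    have h4 : ((i : ℝ) + 1) * L + L ≤ ((n : ℝ) + 1) * L := by
      have : (i : ℝ) + 1 ≤ n := by exact_mod_cast (by omega : i + 1 ≤ n)
      nlinarith
    have : 0 ≤ hi - lo := by linarith
    calc _ ≤ (hi - lo) * (M * |H| * (((n : ℝ) + 1) * L) * (|H| * ((n + 1) * L)) ^ j) := by gcongr
      _ = _ := by ring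

end MKG

namespace MKG

open Topology Filter

/-! ### Trigonometric polynomials -/

/-- The character `e^{i p θ}`. -/
noncomputable def echar (p : ℤ) (θ : ℝ) : ℂ := Complex.exp (((p * θ : ℝ) : ℂ) * Complex.I)

/-- `v` is a trigonometric polynomial of degree at most `D`. -/
def TrigPoly (D : ℕ) (v : ℝ → ℂ) : Prop :=
  ∃ c : ℤ → ℂ, ∀ θ, v θ = ∑ p ∈ Finset.Icc (-(D : ℤ)) D, c p * echar p θ

lemma echar_zero_left (θ : ℝ) : echar 0 θ = 1 := by simp [echar]
lemma echar_add_left (p q : ℤ) (θ : ℝ) : echar (p + q) θ = echar p θ * echar q θ := by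
  simp only [echar, ← Complex.exp_add]; congr 1; push_cast; ring
lemma echar_add_right (p : ℤ) (θ τ : ℝ) : echar p (θ + τ) = echar p θ * echar p τ := by
  simp only [echar, ← Complex.exp_add]; congr 1; push_cast; ring
lemma echar_neg_right (p : ℤ) (θ : ℝ) : echar p (-θ) = echar (-p) θ := by
  simp only [echar]; congr 1; push_cast; ring
lemma norm_echar (p : ℤ) (θ : ℝ) : ‖echar p θ‖ = 1 := Complex.norm_exp_ofReal_mul_I _
lemma continuous_echar (p : ℤ) : Continuous (echar p) := by unfold echar; fun_prop
lemma echar_mul_nat (p : ℤ) (θ : ℝ) (j : ℕ) : echar p (j * θ) = echar p θ ^ j := by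
  simp only [echar, ← Complex.exp_nat_mul]; congr 1; push_cast; ring
lemma hasDerivAt_echar (p : ℤ) (θ : ℝ) : HasDerivAt (echar p) (p * Complex.I * echar p θ) θ := by
  have h1 : HasDerivAt (fun θ : ℝ => ((p * θ : ℝ) : ℂ) * Complex.I) (((p * 1 : ℝ) : ℂ) * Complex.I) θ :=
    (((hasDerivAt_id θ).const_mul (p : ℝ)).ofReal_comp).mul_const _
  have := h1.cexp
  simp only [echar]
  convert! this using 1
  push_cast; ring

lemma trigPoly_echar {D : ℕ} {q : ℤ} (hq : |q| ≤ D) : TrigPoly D (echar q) := by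
  refine ⟨fun p => if p = q then 1 else 0, fun θ => ?_⟩
  have : q ∈ Finset.Icc (-(D : ℤ)) D := by
    rw [Finset.mem_Icc]; exact abs_le.mp hq
  simp [ite_mul, Finset.sum_ite_eq', Finset.mem_Icc.mp this]

namespace TrigPoly

variable {D E : ℕ} {v w : ℝ → ℂ}

lemma zero : TrigPoly D (fun _ => 0) := ⟨0, fun θ => by simp⟩

lemma add (hv : TrigPoly D v) (hw : TrigPoly D w) : TrigPoly D (fun θ => v θ + w θ) := by
  obtain ⟨c, hc⟩ := hv
  obtain ⟨d, hd⟩ := hw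
  exact ⟨fun p => c p + d p, fun θ => by
    simp only [hc, hd, ← Finset.sum_add_distrib, add_mul]⟩

lemma const_mul (a : ℂ) (hv : TrigPoly D v) : TrigPoly D (fun θ => a * v θ) := by
  obtain ⟨c, hc⟩ := hv
  exact ⟨fun p => a * c p, fun θ => by
    simp only [hc, Finset.mul_sum, mul_assoc]⟩

lemma sum {ι : Type*} (s : Finset ι) {v : ι → ℝ → ℂ} (h : ∀ i ∈ s, TrigPoly D (v i)) :
    TrigPoly D (fun θ => ∑ i ∈ s, v i θ) := by
  classical
  induction s using Finset.induction_on with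
  | empty => simpa using zero
  | insert a s ha ih =>
    simp only [Finset.sum_insert ha]
    exact (h a (by simp)).add (ih fun i hi => h i (by simp [hi]))

lemma mul (hv : TrigPoly D v) (hw : TrigPoly E w) : TrigPoly (D + E) (fun θ => v θ * w θ) := by
  obtain ⟨c, hc⟩ := hv
  obtain ⟨d, hd⟩ := hw
  have : (fun θ => v θ * w θ) = fun θ => ∑ p ∈ Finset.Icc (-(D : ℤ)) D,
      ∑ q ∈ Finset.Icc (-(E : ℤ)) E, (c p * d q) * echar (p + q) θ := by
    funext θ
    rw [hc, hd, Finset.sum_mul_sum]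
    simp only [echar_add_left]
    refine Finset.sum_congr rfl fun p _ => Finset.sum_congr rfl fun q _ => by ring
  rw [this]
  refine sum _ fun p hp => sum _ fun q hq => const_mul _ (trigPoly_echar ?_)
  rw [Finset.mem_Icc] at hp hq
  rw [abs_le]; push_cast; omega

lemma mono (hv : TrigPoly D v) (h : D ≤ E) : TrigPoly E v := by
  obtain ⟨c, hc⟩ := hv
  have : v = fun θ => ∑ p ∈ Finset.Icc (-(D : ℤ)) D, c p * echar p θ := funext hc
  rw [this]
  refine sum _ fun p hp => const_mul _ (trigPoly_echar ?_)
  rw [Finset.mem_Icc] at hp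
  rw [abs_le]; omega

lemma const (a : ℂ) : TrigPoly D (fun _ => a) := by
  have := (trigPoly_echar (D := D) (q := 0) (by simp)).const_mul a
  simpa [echar_zero_left] using this

lemma pow (hv : TrigPoly D v) (n : ℕ) : TrigPoly (n * D) (fun θ => v θ ^ n) := by
  induction n with
  | zero => simpa using const (D := 0) 1
  | succ n ih =>
    have := ih.mul hv
    simp only [pow_succ]
    rwa [Nat.succ_mul]

lemma comp_neg (hv : TrigPoly D v) : TrigPoly D (fun θ => v (-θ)) := by
  obtain ⟨c, hc⟩ := hv
  have : (fun θ => v (-θ)) = fun θ => ∑ p ∈ Finset.Icc (-(D : ℤ)) D, c p * echar (-p) θ := by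
    funext θ; rw [hc]; simp [echar_neg_right]
  rw [this]
  refine sum _ fun p hp => const_mul _ (trigPoly_echar ?_)
  rw [Finset.mem_Icc] at hp
  rw [abs_le]; omega

lemma comp_add (hv : TrigPoly D v) (τ : ℝ) : TrigPoly D (fun θ => v (θ + τ)) := by
  obtain ⟨c, hc⟩ := hv
  exact ⟨fun p => c p * echar p τ, fun θ => by
    simp only [hc, echar_add_right]
    exact Finset.sum_congr rfl fun p _ => by ring⟩

lemma cos : TrigPoly 1 (fun θ => ((Real.cos θ : ℝ) : ℂ)) := by
  have h : (fun θ : ℝ => ((Real.cos θ : ℝ) : ℂ)) =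
      fun θ => (1 / 2 : ℂ) * (echar 1 θ + echar (-1) θ) := by
    funext θ
    simp only [echar, Complex.ofReal_cos, Complex.cos]
    push_cast; ring_nf
  rw [h]
  exact ((trigPoly_echar (by simp)).add (trigPoly_echar (by simp))).const_mul _

lemma sin : TrigPoly 1 (fun θ => ((Real.sin θ : ℝ) : ℂ)) := by
  have h : (fun θ : ℝ => ((Real.sin θ : ℝ) : ℂ)) =
      fun θ => (-Complex.I / 2 : ℂ) * (echar 1 θ + (-1) * echar (-1) θ) := by
    funext θ
    simp only [echar, Complex.ofReal_sin, Complex.sin]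
    push_cast; ring_nf
  rw [h]
  exact ((trigPoly_echar (by simp)).add ((trigPoly_echar (by simp)).const_mul _)).const_mul _

lemma continuous (hv : TrigPoly D v) : Continuous v := by
  obtain ⟨c, hc⟩ := hv
  have : v = fun θ => ∑ p ∈ Finset.Icc (-(D : ℤ)) D, c p * echar p θ := funext hc
  rw [this]
  exact continuous_finsetSum _ fun p _ => continuous_const.mul (continuous_echar p)

end TrigPoly

/-- The sampling nodes `2πj/(2D+1)`. -/
noncomputable def node (D j : ℕ) : ℝ := j * (2 * Real.pi / (2 * D + 1))

/-- Orthogonality of characters on 2D+1 equally spaced nodes. The range |q| ≤ 2D is that of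
differences of two frequencies of degree D, and 2D+1 nodes suffice to tell them apart. -/
lemma sum_echar_node {D : ℕ} {q : ℤ} (hq : |q| ≤ 2 * D) :
    ∑ j ∈ Finset.range (2 * D + 1), echar q (node D j) = if q = 0 then ((2 * D + 1 : ℕ) : ℂ) else 0 := by
  split_ifs with h
  · simp [h, echar_zero_left]
  · simp only [node, echar_mul_nat]
    have hne : echar q (2 * Real.pi / (2 * D + 1)) ≠ 1 := by
      intro h1
      rw [echar, Complex.exp_eq_one_iff] at h1
      obtain ⟨n, hn⟩ := h1
      have h2 : ((q * (2 * Real.pi / (2 * D + 1)) : ℝ) : ℂ) = ((n * (2 * Real.pi) : ℝ) : ℂ) := by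
        apply mul_right_cancel₀ Complex.I_ne_zero
        rw [hn]; push_cast; ring
      have h3 := Complex.ofReal_injective h2
      have h4 : (q : ℝ) = n * (2 * D + 1) := by
        have := Real.pi_pos
        field_simp at h3
        linarith
      have h5 : q = n * (2 * D + 1) := by exact_mod_cast h4
      have hn0 : n ≠ 0 := by rintro rfl; simp at h5; exact h h5
      have : (2 * D + 1 : ℤ) ≤ |q| := by
        rw [h5, abs_mul]
        have h6 : 1 ≤ |n| := Int.one_le_abs hn0
        have h7 : |(2 * D + 1 : ℤ)| = 2 * D + 1 := abs_of_nonneg (by positivity)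
        rw [h7]; nlinarith
      omega
    have hpow : echar q (2 * Real.pi / (2 * D + 1)) ^ (2 * D + 1) = 1 := by
      rw [← echar_mul_nat, echar, Complex.exp_eq_one_iff]
      refine ⟨q, ?_⟩
      have : (2 * (D : ℂ) + 1) ≠ 0 := by exact_mod_cast (by omega : 2 * D + 1 ≠ 0)
      push_cast
      field_simp
    have := geom_sum_eq hne (2 * D + 1)
    rw [this, hpow]; simp

/-- The interpolation kernel. -/
noncomputable def dker (D : ℕ) (θ : ℝ) : ℂ :=
  ((2 * D + 1 : ℕ) : ℂ)⁻¹ * ∑ p ∈ Finset.Icc (-(D : ℤ)) D, echar p θ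

lemma coeff_eq_sample {D : ℕ} {v : ℝ → ℂ} {c : ℤ → ℂ}
    (hc : ∀ θ, v θ = ∑ p ∈ Finset.Icc (-(D : ℤ)) D, c p * echar p θ) {p : ℤ}
    (hp : p ∈ Finset.Icc (-(D : ℤ)) D) :
    c p = ((2 * D + 1 : ℕ) : ℂ)⁻¹ * ∑ j ∈ Finset.range (2 * D + 1),
      v (node D j) * echar (-p) (node D j) := by
  have h1 : ∑ j ∈ Finset.range (2 * D + 1), v (node D j) * echar (-p) (node D j) =
      ∑ q ∈ Finset.Icc (-(D : ℤ)) D, c q * ∑ j ∈ Finset.range (2 * D + 1), echar (q + -p) (node D j) := by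
    simp only [hc, Finset.sum_mul, Finset.mul_sum]
    rw [Finset.sum_comm]
    refine Finset.sum_congr rfl fun q _ => Finset.sum_congr rfl fun j _ => ?_
    rw [echar_add_left]; ring
  have h2 : ∀ q ∈ Finset.Icc (-(D : ℤ)) D, c q * ∑ j ∈ Finset.range (2 * D + 1), echar (q + -p) (node D j)
      = if q = p then c p * ((2 * D + 1 : ℕ) : ℂ) else 0 := by
    intro q hq
    rw [Finset.mem_Icc] at hp hq
    rw [sum_echar_node (by rw [abs_le]; omega)]
    by_cases h : q = p
    · simp [h]
    · have : q + -p ≠ 0 := by omega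
      simp [h, this]
  rw [h1, Finset.sum_congr rfl h2, Finset.sum_ite_eq' , if_pos hp]
  have : ((2 * D + 1 : ℕ) : ℂ) ≠ 0 := by exact_mod_cast (by omega : 2 * D + 1 ≠ 0)
  field_simp

/-- Interpolation from 2D+1 values. It replaces limits, derivatives and integrals of trigonometric
polynomials by finite sums. -/
lemma TrigPoly.sample {D : ℕ} {v : ℝ → ℂ} (hv : TrigPoly D v) (θ : ℝ) :
    v θ = ∑ j ∈ Finset.range (2 * D + 1), dker D (θ - node D j) * v (node D j) := by
  obtain ⟨c, hc⟩ := hv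
  rw [hc θ]
  have h1 : ∀ p ∈ Finset.Icc (-(D : ℤ)) D, c p * echar p θ = ∑ j ∈ Finset.range (2 * D + 1),
      ((2 * D + 1 : ℕ) : ℂ)⁻¹ * echar p (θ - node D j) * v (node D j) := by
    intro p hp
    rw [coeff_eq_sample hc hp, mul_assoc, Finset.sum_mul, Finset.mul_sum]
    refine Finset.sum_congr rfl fun j _ => ?_
    rw [sub_eq_add_neg, echar_add_right, echar_neg_right]; ring
  rw [Finset.sum_congr rfl h1, Finset.sum_comm]
  refine Finset.sum_congr rfl fun j _ => ?_
  rw [dker, Finset.mul_sum, Finset.sum_mul]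

lemma trigPoly_dker (D : ℕ) (τ : ℝ) : TrigPoly D (fun θ => dker D (θ - τ)) := by
  have : TrigPoly D (fun θ => dker D θ) :=
    (TrigPoly.sum _ fun p hp => trigPoly_echar (by
      rw [Finset.mem_Icc] at hp; exact abs_le.mpr hp)).const_mul _
  simpa [sub_eq_add_neg] using this.comp_add (-τ)

lemma TrigPoly.of_sample {D : ℕ} {v : ℝ → ℂ}
    (h : ∀ θ, v θ = ∑ j ∈ Finset.range (2 * D + 1), dker D (θ - node D j) * v (node D j)) :
    TrigPoly D v := by
  have : v = fun θ => ∑ j ∈ Finset.range (2 * D + 1), v (node D j) * dker D (θ - node D j) := by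
    funext θ; rw [h θ]; simp [mul_comm]
  rw [this]
  exact TrigPoly.sum _ fun j _ => (trigPoly_dker D _).const_mul _

/-- The sampling formula is linear in the values at the nodes and passes under the integral; the
coefficients need not be examined as functions of y. -/
lemma TrigPoly.integral {α : Type*} [MeasurableSpace α] {μ : Measure α} {D : ℕ} {v : ℝ → α → ℂ}
    (hv : ∀ y, TrigPoly D (fun θ => v θ y)) (hi : ∀ θ, Integrable (v θ) μ) :
    TrigPoly D (fun θ => ∫ y, v θ y ∂μ) := by
  apply TrigPoly.of_sample
  intro θ
  have : ∀ y, v θ y = ∑ j ∈ Finset.range (2 * D + 1), dker D (θ - node D j) * v (node D j) y :=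
    fun y => (hv y).sample θ
  simp_rw [this]
  rw [integral_finsetSum _ fun j _ => (hi _).const_mul _]
  simp only [integral_const_mul]

/-- The weights that compute the derivative at `0` of a trigonometric polynomial. -/
noncomputable def dweight (D j : ℕ) : ℂ :=
  ((2 * D + 1 : ℕ) : ℂ)⁻¹ * ∑ p ∈ Finset.Icc (-(D : ℤ)) D, p * Complex.I * echar (-p) (node D j)

/-- The derivative is a fixed combination of values at nodes. It is used to trade an infinitesimal
rotation for finitely many actual rotations, which preserve L² norms. -/
lemma TrigPoly.hasDerivAt_zero {D : ℕ} {v : ℝ → ℂ} (hv : TrigPoly D v) :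
    HasDerivAt v (∑ j ∈ Finset.range (2 * D + 1), dweight D j * v (node D j)) 0 := by
  have h1 : v = fun θ => ∑ j ∈ Finset.range (2 * D + 1), dker D (θ - node D j) * v (node D j) :=
    funext fun θ => hv.sample θ
  have h2 : ∀ j, HasDerivAt (fun θ => dker D (θ - node D j)) (dweight D j) 0 := by
    intro j
    unfold dker dweight
    refine HasDerivAt.const_mul _ (HasDerivAt.fun_sum fun p _ => ?_)
    have h := (hasDerivAt_echar p (0 - node D j)).comp_sub_const 0 (node D j)
    rw [zero_sub, echar_neg_right] at h
    exact h
  rw [h1]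
  convert! HasDerivAt.fun_sum (u := Finset.range (2 * D + 1)) fun j _ => (h2 j).mul_const (v (node D j)) using 1
  refine Finset.sum_congr rfl fun j _ => ?_
  rw [← h1]

lemma card_Icc_neg (D : ℕ) : (Finset.Icc (-(D : ℤ)) D).card = 2 * D + 1 := by
  rw [Int.card_Icc]; omega

lemma norm_dweight_le (D j : ℕ) : ‖dweight D j‖ ≤ D := by
  rw [dweight, norm_mul, norm_inv, Complex.norm_natCast]
  have : ‖∑ p ∈ Finset.Icc (-(D : ℤ)) D, (p : ℂ) * Complex.I * echar (-p) (node D j)‖ ≤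
      ((2 * D + 1 : ℕ) : ℝ) * D := by
    refine (norm_sum_le _ _).trans ?_
    rw [← card_Icc_neg D, ← nsmul_eq_mul]
    refine Finset.sum_le_card_nsmul _ _ _ fun p hp => ?_
    rw [norm_mul, norm_mul, norm_echar, Complex.norm_I, mul_one, mul_one, Complex.norm_intCast]
    rw [Finset.mem_Icc] at hp
    exact_mod_cast abs_le.mpr hp
  have h0 : (0 : ℝ) < ((2 * D + 1 : ℕ) : ℝ) := by positivity
  rw [inv_mul_le_iff₀ h0]
  exact this

lemma integral_echar {p : ℤ} (hp : p ≠ 0) : ∫ θ in (-Real.pi)..Real.pi, echar p θ = 0 := by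
  have h : ∀ θ ∈ Set.uIcc (-Real.pi) Real.pi,
      HasDerivAt (fun θ => (p * Complex.I)⁻¹ * echar p θ) (echar p θ) θ := by
    intro θ _
    have := (hasDerivAt_echar p θ).const_mul ((p * Complex.I : ℂ)⁻¹)
    convert! this using 1
    have : (p : ℂ) * Complex.I ≠ 0 := by simp [hp]
    field_simp
  rw [intervalIntegral.integral_eq_sub_of_hasDerivAt h ((continuous_echar p).intervalIntegrable _ _)]
  have : echar p Real.pi = echar p (-Real.pi) := by
    have e : (Real.pi : ℝ) = -Real.pi + 2 * Real.pi := by ring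
    conv_lhs => rw [e, echar_add_right]
    have : echar p (2 * Real.pi) = 1 := by
      rw [echar, Complex.exp_eq_one_iff]; exact ⟨p, by push_cast; ring⟩
    rw [this, mul_one]
  rw [this, sub_self]

/-- Fourier inversion with the factor 1/(2π) dropped. The L¹ norm is the right one because the final
estimate integrates these bounds over all circles against the L¹ norm of the transform of G. -/
lemma TrigPoly.norm_coeff_le {D : ℕ} {v : ℝ → ℂ} {c : ℤ → ℂ}
    (hc : ∀ θ, v θ = ∑ p ∈ Finset.Icc (-(D : ℤ)) D, c p * echar p θ) {p : ℤ}
    (hp : p ∈ Finset.Icc (-(D : ℤ)) D) :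
    ‖c p‖ ≤ ∫ θ in (-Real.pi)..Real.pi, ‖v θ‖ := by
  have hcont : Continuous v := TrigPoly.continuous ⟨c, hc⟩
  have hpi := Real.pi_gt_three
  have h1 : ∫ θ in (-Real.pi)..Real.pi, v θ * echar (-p) θ = 2 * Real.pi * c p := by
    have : ∀ θ, v θ * echar (-p) θ = ∑ q ∈ Finset.Icc (-(D : ℤ)) D, c q * echar (q + -p) θ := by
      intro θ
      rw [hc, Finset.sum_mul]
      refine Finset.sum_congr rfl fun q _ => ?_
      rw [echar_add_left]; ring
    simp_rw [this]
    rw [intervalIntegral.integral_finsetSum (f := fun q θ => c q * echar (q + -p) θ) fun q _ =>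
      ((continuous_const.mul (continuous_echar _)).intervalIntegrable _ _)]
    rw [Finset.sum_eq_single_of_mem p hp]
    · simp only [add_neg_cancel, echar_zero_left, mul_one]
      rw [intervalIntegral.integral_const, sub_neg_eq_add, Complex.real_smul]
      push_cast; ring
    · intro q _ hq
      rw [intervalIntegral.integral_const_mul, integral_echar (by omega), mul_zero]
  have h2 : ‖∫ θ in (-Real.pi)..Real.pi, v θ * echar (-p) θ‖ ≤ ∫ θ in (-Real.pi)..Real.pi, ‖v θ‖ := by
    refine (intervalIntegral.norm_integral_le_integral_norm (by linarith)).trans (le_of_eq ?_)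
    simp [norm_echar]
  rw [h1, norm_mul, norm_mul, Complex.norm_real, Complex.norm_ofNat, Real.norm_of_nonneg (by linarith)] at h2
  have := norm_nonneg (c p)
  nlinarith

lemma iteratedDeriv_echar (p : ℤ) (k : ℕ) :
    iteratedDeriv k (echar p) = fun θ => (p * Complex.I) ^ k * echar p θ := by
  induction k with
  | zero => simp
  | succ k ih =>
    rw [iteratedDeriv_succ, ih]
    funext θ
    rw [((hasDerivAt_echar p θ).const_mul _).deriv]; ring

lemma contDiff_echar (p : ℤ) : ContDiff ℝ (⊤ : ℕ∞) (echar p) := by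
  have h : echar p = fun θ : ℝ => Complex.exp ((p : ℂ) * Complex.I * Complex.ofRealCLM θ) := by
    funext θ; simp only [echar]; congr 1; simp; ring
  rw [h]
  exact (contDiff_const.mul Complex.ofRealCLM.contDiff).cexp

lemma EB.echar (n : ℕ) (p : ℤ) (x : ℝ) : EB n (echar p) x 1 |(p : ℝ)| := by
  refine ⟨(contDiff_echar p).contDiffAt, fun k _ => ?_⟩
  rw [iteratedDeriv_echar]
  simp [norm_echar]

/-- A Bernstein inequality from L¹ to the supremum of derivatives: each of the 2D+1 characters has
rate at most D. -/
lemma TrigPoly.eb {D : ℕ} {v : ℝ → ℂ} (hv : TrigPoly D v) (n : ℕ) (x : ℝ) :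
    EB n v x ((2 * D + 1) * ∫ θ in (-Real.pi)..Real.pi, ‖v θ‖) D := by
  obtain ⟨c, hc⟩ := hv
  have h : v = fun θ => ∑ p ∈ Finset.Icc (-(D : ℤ)) D, c p * MKG.echar p θ := funext hc
  have hb : ∀ p ∈ Finset.Icc (-(D : ℤ)) D, EB n (fun θ => c p * MKG.echar p θ) x
      (∫ θ in (-Real.pi)..Real.pi, ‖v θ‖) D := by
    intro p hp
    refine ((EB.echar n p x).const_mul (c p)).mono ?_ (abs_nonneg _) ?_
    · rw [mul_one]; exact norm_coeff_le hc hp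
    · rw [Finset.mem_Icc] at hp; exact_mod_cast abs_le.mpr hp
  have := EB.sum _ (Nat.cast_nonneg D) hb
  rw [Finset.sum_const, card_Icc_neg, ← h] at this
  simpa using this

end MKG

namespace MKG

open Topology Filter

/-! ### Rotations and angular degree -/

/-- An orthonormal pair of vectors. -/
structure OrthoPair (e w : E3) : Prop where
  norm_left : ‖e‖ = 1
  norm_right : ‖w‖ = 1
  inner_eq : inner ℝ e w = 0

/-- The rotation by the angle `θ` in the oriented plane spanned by `e` and `w`. -/
noncomputable def Rot (e w : E3) (θ : ℝ) (x : E3) : E3 :=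
  x + ((Real.cos θ - 1) * inner ℝ e x - Real.sin θ * inner ℝ w x) • e +
    (Real.sin θ * inner ℝ e x + (Real.cos θ - 1) * inner ℝ w x) • w

section Rot

variable {e w : E3}

lemma OrthoPair.inner_self (h : OrthoPair e w) : inner ℝ e e = 1 ∧ inner ℝ w w = 1 ∧
    inner ℝ w e = 0 := by
  refine ⟨?_, ?_, ?_⟩
  · rw [real_inner_self_eq_norm_sq, h.norm_left]; norm_num
  · rw [real_inner_self_eq_norm_sq, h.norm_right]; norm_num
  · rw [real_inner_comm]; exact h.inner_eq

lemma Rot_zero (x : E3) : Rot e w 0 x = x := by simp [Rot]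

lemma inner_Rot (h : OrthoPair e w) (θ : ℝ) (x : E3) :
    inner ℝ e (Rot e w θ x) = Real.cos θ * inner ℝ e x - Real.sin θ * inner ℝ w x ∧
    inner ℝ w (Rot e w θ x) = Real.sin θ * inner ℝ e x + Real.cos θ * inner ℝ w x := by
  obtain ⟨h1, h2, h3⟩ := h.inner_self
  constructor
  · simp only [Rot, inner_add_right, inner_smul_right, h1, h.inner_eq]; ring
  · simp only [Rot, inner_add_right, inner_smul_right, h2, h3]; ring

lemma Rot_add (h : OrthoPair e w) (θ τ : ℝ) (x : E3) :
    Rot e w (θ + τ) x = Rot e w θ (Rot e w τ x) := by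
  obtain ⟨h1, h2⟩ := inner_Rot h τ x
  conv_rhs => rw [Rot, h1, h2]
  simp only [Rot, Real.cos_add, Real.sin_add]
  module

lemma Rot_neg_cancel (h : OrthoPair e w) (θ : ℝ) (x : E3) :
    Rot e w (-θ) (Rot e w θ x) = x ∧ Rot e w θ (Rot e w (-θ) x) = x := by
  rw [← Rot_add h, ← Rot_add h]; simp [Rot_zero]

/-- The rotation as a linear isometry. -/
noncomputable def rotL (h : OrthoPair e w) (θ : ℝ) : E3 ≃ₗᵢ[ℝ] E3 where
  toFun := Rot e w θ
  invFun := Rot e w (-θ)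
  left_inv x := (Rot_neg_cancel h θ x).1
  right_inv x := (Rot_neg_cancel h θ x).2
  map_add' x y := by
    simp only [Rot, inner_add_right]; module
  map_smul' c x := by
    simp only [Rot, inner_smul_right, RingHom.id_apply]; module
  norm_map' x := by
    change ‖Rot e w θ x‖ = ‖x‖
    have hs : ‖Rot e w θ x‖ ^ 2 = ‖x‖ ^ 2 := by
      obtain ⟨h1, h2, h3⟩ := h.inner_self
      rw [← real_inner_self_eq_norm_sq, ← real_inner_self_eq_norm_sq]
      simp only [Rot, inner_add_left, inner_add_right, real_inner_smul_left, real_inner_smul_right,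
        h1, h2, h3, h.inner_eq]
      rw [real_inner_comm e x, real_inner_comm w x]
      have := Real.sin_sq_add_cos_sq θ
      linear_combination (inner ℝ e x ^ 2 + inner ℝ w x ^ 2) * this
    exact (sq_eq_sq₀ (norm_nonneg _) (norm_nonneg _)).mp hs

@[simp] lemma rotL_apply (h : OrthoPair e w) (θ : ℝ) (x : E3) : rotL h θ x = Rot e w θ x := rfl

lemma norm_Rot (h : OrthoPair e w) (θ : ℝ) (x : E3) : ‖Rot e w θ x‖ = ‖x‖ := (rotL h θ).norm_map x

lemma Rot_sub (h : OrthoPair e w) (θ : ℝ) (x y : E3) :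
    Rot e w θ (x - y) = Rot e w θ x - Rot e w θ y := (rotL h θ).map_sub x y

lemma map_Rot (R : E3 ≃ₗᵢ[ℝ] E3) (θ : ℝ) (x : E3) :
    R (Rot e w θ x) = Rot (R e) (R w) θ (R x) := by
  simp [Rot, R.inner_map_map]

lemma OrthoPair.map (h : OrthoPair e w) (R : E3 ≃ₗᵢ[ℝ] E3) : OrthoPair (R e) (R w) :=
  ⟨by simp [h.norm_left], by simp [h.norm_right], by simp [R.inner_map_map, h.inner_eq]⟩

lemma Rot_self (h : OrthoPair e w) (θ ρ : ℝ) :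
    Rot e w θ (ρ • e) = ρ • (Real.cos θ • e + Real.sin θ • w) := by
  obtain ⟨h1, h2, h3⟩ := h.inner_self
  simp only [Rot, inner_smul_right, h1, h3]
  module

lemma measurePreserving_Rot (h : OrthoPair e w) (θ : ℝ) :
    MeasurePreserving (Rot e w θ) volume volume := (rotL h θ).measurePreserving

lemma hasDerivAt_Rot_zero (x : E3) :
    HasDerivAt (fun θ => Rot e w θ x) (inner ℝ e x • w - inner ℝ w x • e) 0 := by
  have hc : HasDerivAt Real.cos 0 0 := by simpa using Real.hasDerivAt_cos 0
  have hs : HasDerivAt Real.sin 1 0 := by simpa using Real.hasDerivAt_sin 0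
  have h1 := (((hc.sub_const 1).mul_const (inner ℝ e x)).sub (hs.mul_const (inner ℝ w x))).smul_const e
  have h2 := ((hs.mul_const (inner ℝ e x)).add ((hc.sub_const 1).mul_const (inner ℝ w x))).smul_const w
  have := (h1.const_add x).add h2
  unfold Rot
  convert! this using 1
  module

end Rot

lemma orthoPair_single {i j : Fin 3} (h : i < j) :
    OrthoPair (EuclideanSpace.single i (1 : ℝ)) (EuclideanSpace.single j (1 : ℝ)) :=
  ⟨by simp, by simp, by simp [EuclideanSpace.inner_single_left, h.ne]⟩

/-- `h` has angular degree at most `D`: its restriction to every circle centred on an axis is a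
trigonometric polynomial of degree at most `D`. -/
def AngDeg (D : ℕ) (h : E3 → ℂ) : Prop :=
  ∀ e w : E3, OrthoPair e w → ∀ x, TrigPoly D (fun θ => h (Rot e w θ x))

namespace AngDeg

variable {D E : ℕ} {f g : E3 → ℂ}

lemma mono (hf : AngDeg D f) (h : D ≤ E) : AngDeg E f := fun e w hw x => (hf e w hw x).mono h
lemma add (hf : AngDeg D f) (hg : AngDeg D g) : AngDeg D (fun x => f x + g x) :=
  fun e w hw x => (hf e w hw x).add (hg e w hw x)
lemma mul (hf : AngDeg D f) (hg : AngDeg E g) : AngDeg (D + E) (fun x => f x * g x) :=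
  fun e w hw x => (hf e w hw x).mul (hg e w hw x)
lemma const_mul (c : ℂ) (hf : AngDeg D f) : AngDeg D (fun x => c * f x) :=
  fun e w hw x => (hf e w hw x).const_mul c
lemma sum {ι : Type*} (s : Finset ι) {f : ι → E3 → ℂ} (h : ∀ i ∈ s, AngDeg D (f i)) :
    AngDeg D (fun x => ∑ i ∈ s, f i x) :=
  fun e w hw x => TrigPoly.sum s fun i hi => h i hi e w hw x
lemma radial (f : ℝ → ℂ) : AngDeg D (fun x => f ‖x‖) := fun e w hw x => by
  simp only [norm_Rot hw]; exact TrigPoly.const _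
lemma pow (hf : AngDeg D f) (n : ℕ) : AngDeg (n * D) (fun x => f x ^ n) :=
  fun e w hw x => (hf e w hw x).pow n
lemma inner (v : E3) : AngDeg 1 (fun x => ((inner ℝ v x : ℝ) : ℂ)) := fun e w hw x => by
  have : (fun θ => ((Inner.inner ℝ v (Rot e w θ x) : ℝ) : ℂ)) = fun θ =>
      ((Inner.inner ℝ v x - Inner.inner ℝ e x * Inner.inner ℝ v e - Inner.inner ℝ w x * Inner.inner ℝ v w : ℝ) : ℂ) +
      (((Inner.inner ℝ e x * Inner.inner ℝ v e + Inner.inner ℝ w x * Inner.inner ℝ v w : ℝ) : ℂ) * ((Real.cos θ : ℝ) : ℂ) +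
      ((Inner.inner ℝ e x * Inner.inner ℝ v w - Inner.inner ℝ w x * Inner.inner ℝ v e : ℝ) : ℂ) * ((Real.sin θ : ℝ) : ℂ)) := by
    funext θ
    rw [← Complex.ofReal_mul, ← Complex.ofReal_mul, ← Complex.ofReal_add, ← Complex.ofReal_add]
    congr 1
    simp only [Rot, inner_add_right, inner_smul_right]
    ring
  rw [this]
  exact (TrigPoly.const _).add ((TrigPoly.cos.const_mul _).add (TrigPoly.sin.const_mul _))
lemma comp_isometry (hf : AngDeg D f) (R : E3 ≃ₗᵢ[ℝ] E3) : AngDeg D (fun x => f (R x)) :=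
  fun e w hw x => by
    simp only [map_Rot]
    exact hf _ _ (hw.map R) _
lemma coord (i : Fin 3) : AngDeg 1 (fun x : E3 => ((x i : ℝ) : ℂ)) := by
  simpa [EuclideanSpace.inner_single_left] using inner (EuclideanSpace.single i (1 : ℝ))

end AngDeg

end MKG

namespace MKG

open Topology Filter FourierTransform

/-! ### Fourier analysis -/

/-- Convolution. -/
noncomputable def conv (K f : E3 → ℂ) (x : E3) : ℂ := ∫ y : E3, K (x - y) * f y

lemma ft_eq_fourier (f : E3 → ℂ) (ξ : E3) : ft f ξ = 𝓕 f ((2 * Real.pi)⁻¹ • ξ) := by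
  rw [Real.fourier_eq', ft]
  congr 1
  funext x
  rw [smul_eq_mul, inner_smul_right]
  congr 2
  have : (Real.pi : ℂ) ≠ 0 := by exact_mod_cast Real.pi_ne_zero
  push_cast
  field_simp

lemma ift_eq_fourierInv (g : E3 → ℂ) (x : E3) :
    ift g x = 𝓕⁻ (fun ξ => g ((2 * Real.pi) • ξ)) x := by
  rw [Real.fourierInv_eq', ift]
  have h := Measure.integral_comp_smul (volume : Measure E3)
    (fun ξ => Complex.exp (Complex.I * ((inner ℝ x ξ : ℝ) : ℂ)) * g ξ) (2 * Real.pi)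
  have hf : Module.finrank ℝ E3 = 3 := by simp
  rw [hf, abs_of_pos (by have := Real.pi_pos; positivity), Complex.real_smul] at h
  rw [← h]
  congr 1
  funext ξ
  rw [smul_eq_mul, inner_smul_right, real_inner_comm]
  congr 2
  push_cast
  ring

/-- The kernel of a smooth compactly supported multiplier is a Schwartz function. -/
lemma exists_kernel {a : E3 → ℂ} (ha : ContDiff ℝ (⊤ : ℕ∞) a) (hc : HasCompactSupport a) :
    ∃ K : 𝓢(E3, ℂ), (K : E3 → ℂ) = ift a ∧ ∀ ξ, 𝓕 K ξ = a ((2 * Real.pi) • ξ) := by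
  have h2 : (2 * Real.pi) ≠ 0 := by have := Real.pi_pos; positivity
  have hc' : HasCompactSupport (fun ξ => a ((2 * Real.pi) • ξ)) := hc.comp_smul h2
  have ha' : ContDiff ℝ (⊤ : ℕ∞) (fun ξ => a ((2 * Real.pi) • ξ)) := by fun_prop
  refine ⟨𝓕⁻ (hc'.toSchwartzMap ha'), ?_, fun ξ => ?_⟩
  · funext x
    rw [SchwartzMap.fourierInv_coe, ift_eq_fourierInv]
    rfl
  · rw [FourierTransform.fourier_fourierInv_eq]
    rfl

lemma memLp_reflect_translate (K : 𝓢(E3, ℂ)) (x : E3) : MemLp (fun y => K (x - y)) 2 volume :=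
  (K.memLp 2 volume).comp_measurePreserving (Measure.measurePreserving_sub_left volume x)

lemma integrable_kernel_mul (K : 𝓢(E3, ℂ)) {h : E3 → ℂ} (hh : MemLp h 2 volume) (x : E3) :
    Integrable (fun y => K (x - y) * h y) volume :=
  (memLp_reflect_translate K x).integrable_mul hh

lemma conv_congr_ae (K : E3 → ℂ) {f g : E3 → ℂ} (h : f =ᵐ[volume] g) : conv K f = conv K g := by
  funext x
  refine integral_congr_ae ?_
  filter_upwards [h] with y hy
  rw [hy]

lemma conv_eq_convolution (K f : 𝓢(E3, ℂ)) (x : E3) :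
    conv K f x = SchwartzMap.convolution (ContinuousLinearMap.mul ℂ ℂ) K f x := by
  rw [SchwartzMap.convolution_apply, convolution_eq_swap]
  simp [conv]

lemma eLpNorm_two_fourier (f : 𝓢(E3, ℂ)) : eLpNorm (𝓕 f : 𝓢(E3, ℂ)) 2 volume = eLpNorm f 2 volume := by
  have h := SchwartzMap.norm_fourier_toL2_eq f
  rw [SchwartzMap.norm_toLp, SchwartzMap.norm_toLp] at h
  exact (ENNReal.toReal_eq_toReal_iff' ((𝓕 f).memLp 2 volume).eLpNorm_lt_top.ne (f.memLp 2 volume).eLpNorm_lt_top.ne).mp h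

lemma eLpNorm_conv_schwartz_le (K f : 𝓢(E3, ℂ)) {M : ℝ} (hM : ∀ ξ, ‖𝓕 K ξ‖ ≤ M) :
    eLpNorm (conv K f) 2 volume ≤ ENNReal.ofReal M * eLpNorm f 2 volume := by
  have h1 : conv K f = SchwartzMap.convolution (ContinuousLinearMap.mul ℂ ℂ) K f :=
    funext (conv_eq_convolution K f)
  rw [h1, ← eLpNorm_two_fourier, ← eLpNorm_two_fourier f, SchwartzMap.fourier_convolution]
  refine eLpNorm_le_mul_eLpNorm_of_ae_le_mul (ae_of_all _ fun ξ => ?_) 2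
  simp only [SchwartzMap.pairing_apply_apply, ContinuousLinearMap.mul_apply', norm_mul]
  gcongr
  exact hM ξ

lemma aestronglyMeasurable_conv (K : 𝓢(E3, ℂ)) {h : E3 → ℂ} (hh : AEStronglyMeasurable h volume) :
    AEStronglyMeasurable (conv K h) volume := by
  rw [conv_congr_ae K hh.ae_eq_mk]
  have : StronglyMeasurable (fun p : E3 × E3 => K (p.1 - p.2) * hh.mk h p.2) := by
    refine StronglyMeasurable.mul ?_ (hh.stronglyMeasurable_mk.comp_measurable measurable_snd)
    exact (K.continuous.comp (continuous_fst.sub continuous_snd)).stronglyMeasurable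
  exact this.integral_prod_right.aestronglyMeasurable

/-- The `L²` bound for a Fourier multiplier. -/
lemma eLpNorm_conv_le (K : 𝓢(E3, ℂ)) {M : ℝ} (hM : ∀ ξ, ‖𝓕 K ξ‖ ≤ M) {h : E3 → ℂ}
    (hh : MemLp h 2 volume) :
    eLpNorm (conv K h) 2 volume ≤ ENNReal.ofReal M * eLpNorm h 2 volume := by
  -- Schwartz functions v n approximate h in L². The convolutions converge at every point by
  -- Cauchy-Schwarz with the fixed kernel, and the norms of v n converge.
  have hd := SchwartzMap.denseRange_toLpCLM (E := E3) (F := ℂ) (p := 2) (μ := volume) ENNReal.ofNat_ne_top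
  obtain ⟨u, hu, hul⟩ := mem_closure_iff_seq_limit.mp (hd (hh.toLp h))
  choose v hv using hu
  have hlim : Tendsto (fun n => eLpNorm (fun y => v n y - h y) 2 volume) atTop (𝓝 0) := by
    have h1 := (Lp.tendsto_Lp_iff_tendsto_eLpNorm' u (hh.toLp h)).mp hul
    refine h1.congr fun n => eLpNorm_congr_ae ?_
    rw [← hv n]
    filter_upwards [(v n).coeFn_toLp 2 volume, hh.coeFn_toLp] with y h2 h3
    simp only [Pi.sub_apply, h3]
    rw [← h2]; rfl
  have hpt : ∀ x, Tendsto (fun n => conv K (v n) x) atTop (𝓝 (conv K h x)) := by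
    intro x
    rw [tendsto_iff_norm_sub_tendsto_zero]
    set CK := (eLpNorm (fun y => K (x - y)) 2 volume).toReal with hCK
    have hb : ∀ n, ‖conv K (v n) x - conv K h x‖ ≤ CK * (eLpNorm (fun y => v n y - h y) 2 volume).toReal := by
      intro n
      have hvn : MemLp (v n) 2 volume := (v n).memLp 2 volume
      rw [conv, conv, ← integral_sub (integrable_kernel_mul K hvn x) (integrable_kernel_mul K hh x)]
      have e : ∀ y, K (x - y) * v n y - K (x - y) * h y = K (x - y) * (v n y - h y) := fun y => by ring
      simp_rw [e]
      have hm := memLp_reflect_translate K x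
      have hs : MemLp (fun y => v n y - h y) 2 volume := hvn.sub hh
      refine (norm_integral_le_integral_norm _).trans ?_
      have h4 : eLpNorm (fun y => K (x - y) * (v n y - h y)) 1 volume ≤
          eLpNorm (fun y => K (x - y)) 2 volume * eLpNorm (fun y => v n y - h y) 2 volume := by
        have := eLpNorm_smul_le_mul_eLpNorm (p := 2) (q := 2) (r := 1) (f := fun y => v n y - h y)
          (φ := fun y => K (x - y)) hs.1 hm.1
        exact this
      have h6 : AEStronglyMeasurable (fun y => K (x - y) * (v n y - h y)) volume := hm.1.mul hs.1
      rw [integral_norm_eq_lintegral_enorm h6, ← eLpNorm_one_eq_lintegral_enorm, hCK,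
        ← ENNReal.toReal_mul]
      exact ENNReal.toReal_mono (ENNReal.mul_ne_top hm.eLpNorm_lt_top.ne hs.eLpNorm_lt_top.ne) h4
    refine squeeze_zero (fun _ => norm_nonneg _) hb ?_
    have : Tendsto (fun n => (eLpNorm (fun y => v n y - h y) 2 volume).toReal) atTop (𝓝 0) := by
      exact (ENNReal.tendsto_toReal ENNReal.zero_ne_top).comp hlim
    simpa using this.const_mul CK
  have hnorm : Tendsto (fun n => eLpNorm (v n) 2 volume) atTop (𝓝 (eLpNorm h 2 volume)) := by
    have h1 : Tendsto (fun n => ‖u n‖ₑ) atTop (𝓝 ‖hh.toLp h‖ₑ) := (continuous_enorm.tendsto _).comp hul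
    simp only [Lp.enorm_def] at h1
    rw [eLpNorm_congr_ae hh.coeFn_toLp] at h1
    refine h1.congr fun n => eLpNorm_congr_ae ?_
    rw [← hv n]
    exact (v n).coeFn_toLp 2 volume
  -- Fatou's lemma carries the bound from the Schwartz functions to the limit.
  refine (Lp.eLpNorm_lim_le_liminf_eLpNorm (fun n => aestronglyMeasurable_conv K ((v n).memLp 2 volume).1)
    (conv K h) (ae_of_all _ hpt)).trans ?_
  have h2 : liminf (fun n => eLpNorm (conv K (v n)) 2 volume) atTop ≤
      liminf (fun n => ENNReal.ofReal M * eLpNorm (v n) 2 volume) atTop :=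
    liminf_le_liminf (Eventually.of_forall fun n => eLpNorm_conv_schwartz_le K (v n) hM)
  refine h2.trans (le_of_eq ?_)
  exact (ENNReal.Tendsto.const_mul hnorm (Or.inr ENNReal.ofReal_ne_top)).liminf_eq

/-- Plancherel's theorem for integrable square integrable functions. -/
lemma eLpNorm_fourier {q : E3 → ℂ} (h1 : Integrable q) (h2 : MemLp q 2 volume) :
    eLpNorm (𝓕 q) 2 volume = eLpNorm q 2 volume := by
  set qL : Lp (α := E3) ℂ 2 volume := h2.toLp q with hqL
  -- The L² transform is defined by extension, so it has to be identified with the integral formula.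
  -- Both are tested against smooth functions of compact support, and the transform is moved onto
  -- the test function.
  have hae : (𝓕 qL : Lp (α := E3) ℂ 2 volume) =ᵐ[volume] 𝓕 q := by
    have hcont : Continuous (𝓕 q) := VectorFourier.fourierIntegral_continuous Real.continuous_fourierChar (by exact continuous_inner) h1
    refine ae_eq_of_integral_contDiff_smul_eq ((Lp.memLp _).locallyIntegrable (by norm_num)) hcont.locallyIntegrable ?_
    intro g hg hgc
    have hg' : ContDiff ℝ (⊤ : ℕ∞) (fun x => ((g x : ℝ) : ℂ)) := Complex.ofRealCLM.contDiff.comp hg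
    have hgc' : HasCompactSupport (fun x => ((g x : ℝ) : ℂ)) := hgc.comp_left (g := fun r : ℝ => (r : ℂ)) (by simp)
    set χ : 𝓢(E3, ℂ) := hgc'.toSchwartzMap hg' with hχ
    have e1 := congrArg (fun T => T χ) (Lp.fourier_toTemperedDistribution_eq qL)
    simp only [TemperedDistribution.fourier_apply, Lp.toTemperedDistribution_apply] at e1
    have e2 : ∫ x, (𝓕 χ : 𝓢(E3, ℂ)) x • qL x = ∫ x, χ x • 𝓕 q x := by
      have e3 := VectorFourier.integral_fourierIntegral_smul_eq_flip (μ := (volume : Measure E3)) (ν := (volume : Measure E3)) (e := Real.fourierChar) (L := innerₗ E3)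
        (f := χ) (g := q) Real.continuous_fourierChar (by exact continuous_inner) χ.integrable h1
      rw [flip_innerₗ] at e3
      refine Eq.trans ?_ e3
      refine integral_congr_ae ?_
      filter_upwards [h2.coeFn_toLp] with y hy
      rw [hqL, hy]
      rfl
    have e4 : ∀ x, g x • (𝓕 qL : Lp (α := E3) ℂ 2 volume) x = χ x • (𝓕 qL : Lp (α := E3) ℂ 2 volume) x := fun x => by
      rw [Complex.real_smul]; rfl
    have e5 : ∀ x, g x • 𝓕 q x = χ x • 𝓕 q x := fun x => by
      rw [Complex.real_smul]; rfl
    simp_rw [e4, e5]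
    rw [← e1, e2]
  rw [← eLpNorm_congr_ae hae]
  have := Lp.norm_fourier_eq qL
  rw [Lp.norm_def, Lp.norm_def] at this
  rw [(ENNReal.toReal_eq_toReal_iff' (Lp.eLpNorm_ne_top _) (Lp.eLpNorm_ne_top _)).mp this]
  exact eLpNorm_congr_ae h2.coeFn_toLp

end MKG

/-! ### Weak derivatives tested against Schwartz functions -/

namespace MKG

open Topology Filter FourierTransform

/-- Four powers of decay are split as one, which absorbs the linear growth of the rotation fields,
and three, because (1+|x|)^{-3} is square integrable on ℝ³ and can be paired with an L² function. -/
lemma SchwartzMap.exists_decay (χ : 𝓢(E3, ℂ)) : ∃ C : ℝ, 0 ≤ C ∧ ∀ x,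
    (1 + ‖x‖) * ‖χ x‖ ≤ C * ((1 + ‖x‖) ^ 3)⁻¹ ∧ (1 + ‖x‖) * ‖fderiv ℝ χ x‖ ≤ C * ((1 + ‖x‖) ^ 3)⁻¹ := by
  set C := 2 ^ 4 * ((Finset.Iic (4, 1)).sup fun m => SchwartzMap.seminorm ℝ m.1 m.2) χ with hC
  have h0 := fun x => SchwartzMap.one_add_le_sup_seminorm_apply (𝕜 := ℝ) (m := (4, 1)) (k := 4) (n := 0) le_rfl (by norm_num) χ x
  have h1 := fun x => SchwartzMap.one_add_le_sup_seminorm_apply (𝕜 := ℝ) (m := (4, 1)) (k := 4) (n := 1) le_rfl le_rfl χ x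
  refine ⟨C, le_trans (by positivity) (h0 0), fun x => ⟨?_, ?_⟩⟩
  · have := h0 x
    rw [norm_iteratedFDeriv_zero] at this
    rw [← div_eq_mul_inv, le_div_iff₀ (by positivity)]
    calc _ = (1 + ‖x‖) ^ 4 * ‖χ x‖ := by ring
      _ ≤ C := this
  · have := h1 x
    rw [norm_iteratedFDeriv_one] at this
    rw [← div_eq_mul_inv, le_div_iff₀ (by positivity)]
    calc _ = (1 + ‖x‖) ^ 4 * ‖fderiv ℝ χ x‖ := by ring
      _ ≤ C := this

lemma memLp_decay : MemLp (fun x : E3 => ((1 + ‖x‖) ^ 3)⁻¹) 2 volume := by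
  have hc : Continuous (fun x : E3 => ((1 + ‖x‖) ^ 3)⁻¹) :=
    Continuous.inv₀ (by fun_prop) fun x => by positivity
  rw [memLp_two_iff_integrable_sq hc.aestronglyMeasurable]
  have := integrable_one_add_norm (E := E3) (μ := volume) (r := 6) (by simp; norm_num)
  refine this.congr (ae_of_all _ fun x => ?_)
  change (1 + ‖x‖) ^ (-6 : ℝ) = (((1 + ‖x‖) ^ 3)⁻¹) ^ 2
  rw [Real.rpow_neg (by positivity), inv_pow, ← pow_mul]
  norm_cast

lemma VField.norm_vec_le (Z : VField) (x : E3) : ‖Z.vec x‖ ≤ 2 * (1 + ‖x‖) := by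
  cases Z with
  | trans i => simp [VField.vec]; linarith [norm_nonneg x]
  | rot i j h =>
    simp only [VField.vec]
    refine (norm_sub_le _ _).trans ?_
    rw [norm_smul, norm_smul]
    have hi : ∀ i, ‖x i‖ ≤ ‖x‖ := fun i => PiLp.norm_apply_le x i
    have := hi i
    have := hi j
    simp
    simp at *
    linarith

lemma VField.continuous_vec (Z : VField) : Continuous Z.vec := by
  cases Z with
  | trans i => exact continuous_const
  | rot i j h =>
    change Continuous fun x : E3 =>
      x i • EuclideanSpace.single j (1 : ℝ) - x j • EuclideanSpace.single i (1 : ℝ)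
    fun_prop

/-- The weak derivative may be tested against Schwartz functions. -/
lemma IsWeak.schwartz {Z : VField} {h g : E3 → ℂ} (hw : IsWeak Z h g) (hh : MemLp h 2 volume)
    (hg : MemLp g 2 volume) (χ : 𝓢(E3, ℂ)) :
    ∫ x : E3, h x * fderiv ℝ χ x (Z.vec x) = -∫ x : E3, g x * χ x := by
  -- The Schwartz function is cut off by a bump dilated by n+1. Near a given point the cutoff is
  -- eventually 1, and its gradient is bounded uniformly in n, so dominated convergence gives the
  -- limit.
  let η : ContDiffBump (0 : E3) := ⟨1, 2, one_pos, one_lt_two⟩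
  have hηs : ContDiff ℝ (⊤ : ℕ∞) η := η.contDiff
  let ηn : ℕ → E3 → ℝ := fun n x => η (((n : ℝ) + 1)⁻¹ • x)
  have hηns : ∀ n, ContDiff ℝ (⊤ : ℕ∞) (ηn n) := fun n => hηs.comp (contDiff_const_smul _)
  have hn0 : ∀ n : ℕ, ((n : ℝ) + 1)⁻¹ ≠ 0 := fun n => by positivity
  have hηnc : ∀ n, HasCompactSupport (ηn n) := fun n => η.hasCompactSupport.comp_smul (hn0 n)
  obtain ⟨B, hB⟩ : ∃ B, ∀ x, ‖fderiv ℝ η x‖ ≤ B := by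
    have hc : HasCompactSupport (fderiv ℝ η) := η.hasCompactSupport.fderiv ℝ
    exact hc.exists_bound_of_continuous (hηs.continuous_fderiv (by simp))
  have hB0 : 0 ≤ B := (norm_nonneg _).trans (hB 0)
  have hfd : ∀ n x, fderiv ℝ (ηn n) x = ((n : ℝ) + 1)⁻¹ • fderiv ℝ η (((n : ℝ) + 1)⁻¹ • x) := by
    intro n x
    exact fderiv_comp_smul (f := η) (x := x) (((n : ℝ) + 1)⁻¹)
  have hfdB : ∀ n x, ‖fderiv ℝ (ηn n) x‖ ≤ B := by
    intro n x
    rw [hfd, norm_smul, norm_inv]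
    have h1 : ‖((n : ℝ) + 1)‖⁻¹ ≤ 1 := by
      rw [Real.norm_of_nonneg (by positivity)]
      exact inv_le_one_of_one_le₀ (by linarith [(Nat.cast_nonneg n : (0 : ℝ) ≤ n)])
    calc _ ≤ 1 * B := by gcongr; exact hB _
      _ = B := one_mul B
  have hev : ∀ x, ∀ᶠ n : ℕ in atTop, ηn n =ᶠ[𝓝 x] fun _ => 1 := by
    intro x
    obtain ⟨N, hN⟩ := exists_nat_gt ‖x‖
    filter_upwards [eventually_ge_atTop N] with n hn
    have hlt : ‖x‖ < (n : ℝ) + 1 := by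
      have : (N : ℝ) ≤ n := by exact_mod_cast hn
      linarith
    have : ∀ᶠ y in 𝓝 x, ‖y‖ < (n : ℝ) + 1 := continuous_norm.continuousAt.eventually_lt_const hlt
    filter_upwards [this] with y hy
    apply η.one_of_mem_closedBall
    rw [mem_closedBall_zero_iff, norm_smul, norm_inv, Real.norm_of_nonneg (by positivity)]
    rw [inv_mul_le_iff₀ (by positivity)]
    change ‖y‖ ≤ ((n : ℝ) + 1) * 1
    linarith
  have hη1 : ∀ n x, |ηn n x| ≤ 1 := fun n x => by
    rw [abs_of_nonneg η.nonneg]; exact η.le_one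
  have hχs : ContDiff ℝ (⊤ : ℕ∞) χ := χ.smooth ⊤
  have hχd : ∀ x, HasFDerivAt χ (fderiv ℝ χ x) x := fun x => (χ.differentiable x).hasFDerivAt
  have hprod : ∀ n x, fderiv ℝ (fun y => ηn n y • χ y) x =
      ηn n x • fderiv ℝ χ x + (fderiv ℝ (ηn n) x).smulRight (χ x) := fun n x =>
    fderiv_fun_smul ((hηns n).differentiable (by simp) x) (χ.differentiable x)
  obtain ⟨C, hC0, hC⟩ := SchwartzMap.exists_decay χ
  have hweak : ∀ n, ∫ x : E3, h x * fderiv ℝ (fun y => ηn n y • χ y) x (Z.vec x) =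
      -∫ x : E3, g x * (ηn n x • χ x) := fun n =>
    hw (fun y => ηn n y • χ y) ((hηns n).smul hχs) ((hηnc n).smul_right)
  have hdom : ∀ {f : E3 → ℂ}, MemLp f 2 volume → ∀ c : ℝ,
      Integrable (fun x => c * (((1 + ‖x‖) ^ 3)⁻¹ * ‖f x‖)) volume := fun hf c =>
    (memLp_decay.integrable_mul hf.norm).const_mul c
  have lim1 : Tendsto (fun n => ∫ x : E3, h x * fderiv ℝ (fun y => ηn n y • χ y) x (Z.vec x)) atTop
      (𝓝 (∫ x : E3, h x * fderiv ℝ χ x (Z.vec x))) := by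
    refine tendsto_integral_of_dominated_convergence
      (fun x => (2 * C * (1 + B)) * (((1 + ‖x‖) ^ 3)⁻¹ * ‖h x‖)) (fun n => ?_) (hdom hh _)
      (fun n => ae_of_all _ fun x => ?_) (ae_of_all _ fun x => ?_)
    · refine hh.1.mul (Continuous.aestronglyMeasurable ?_)
      exact (((hηns n).smul hχs).continuous_fderiv (by simp)).clm_apply Z.continuous_vec
    · rw [norm_mul, hprod]
      obtain ⟨c1, c2⟩ := hC x
      have hz := Z.norm_vec_le x
      have h3 : ‖(ηn n x • fderiv ℝ χ x + (fderiv ℝ (ηn n) x).smulRight (χ x)) (Z.vec x)‖ ≤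
          ‖fderiv ℝ χ x‖ * (2 * (1 + ‖x‖)) + B * (2 * (1 + ‖x‖)) * ‖χ x‖ := by
        rw [add_apply, smul_apply,
          ContinuousLinearMap.smulRight_apply]
        refine (norm_add_le _ _).trans (add_le_add ?_ ?_)
        · rw [norm_smul]
          calc _ ≤ 1 * (‖fderiv ℝ χ x‖ * ‖Z.vec x‖) := by
                gcongr
                · exact hη1 n x
                · exact ContinuousLinearMap.le_opNorm _ _
            _ ≤ _ := by rw [one_mul]; gcongr
        · rw [norm_smul]
          gcongr
          refine (ContinuousLinearMap.le_opNorm _ _).trans ?_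
          gcongr
          exact hfdB n x
      calc _ ≤ ‖h x‖ * (‖fderiv ℝ χ x‖ * (2 * (1 + ‖x‖)) + B * (2 * (1 + ‖x‖)) * ‖χ x‖) := by gcongr
        _ = ‖h x‖ * (2 * ((1 + ‖x‖) * ‖fderiv ℝ χ x‖) + 2 * B * ((1 + ‖x‖) * ‖χ x‖)) := by ring
        _ ≤ ‖h x‖ * (2 * (C * ((1 + ‖x‖) ^ 3)⁻¹) + 2 * B * (C * ((1 + ‖x‖) ^ 3)⁻¹)) := by gcongr
        _ = _ := by ring
    · refine tendsto_const_nhds.congr' ?_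
      filter_upwards [hev x] with n hn
      have : (fun y => ηn n y • χ y) =ᶠ[𝓝 x] χ := by
        filter_upwards [hn] with y hy
        rw [hy, one_smul]
      rw [this.fderiv_eq]
  have lim2 : Tendsto (fun n => -∫ x : E3, g x * (ηn n x • χ x)) atTop
      (𝓝 (-∫ x : E3, g x * χ x)) := by
    refine (tendsto_integral_of_dominated_convergence
      (fun x => C * (((1 + ‖x‖) ^ 3)⁻¹ * ‖g x‖)) (fun n => ?_) (hdom hg _)
      (fun n => ae_of_all _ fun x => ?_) (ae_of_all _ fun x => ?_)).neg
    · exact hg.1.mul (((hηns n).continuous.smul χ.continuous).aestronglyMeasurable)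
    · rw [norm_mul, norm_smul]
      have c1 := (hC x).1
      have c2 : ‖χ x‖ ≤ C * ((1 + ‖x‖) ^ 3)⁻¹ := by
        refine le_trans ?_ c1
        nlinarith [norm_nonneg (χ x), norm_nonneg x]
      calc _ ≤ ‖g x‖ * (1 * (C * ((1 + ‖x‖) ^ 3)⁻¹)) := by gcongr; exact hη1 n x
        _ = _ := by ring
    · refine tendsto_const_nhds.congr' ?_
      filter_upwards [hev x] with n hn
      rw [hn.eq_of_nhds, one_smul]
  have := tendsto_nhds_unique lim1 (lim2.congr fun n => (hweak n).symm)
  exact this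

end MKG

/-! ### Vector fields acting on frequency localized functions -/

namespace MKG

open Topology Filter FourierTransform

/-- A smooth multiplier supported in the ball of radius `ϱ`, bounded by `M`, of angular degree at
most `E`. -/
structure Mult (E : ℕ) (ϱ M : ℝ) (a : E3 → ℂ) : Prop where
  smooth : ContDiff ℝ (⊤ : ℕ∞) a
  supp : ∀ ξ, a ξ ≠ 0 → ‖ξ‖ ≤ ϱ
  nonneg : 0 ≤ ϱ
  bound : ∀ ξ, ‖a ξ‖ ≤ M
  ang : AngDeg E a

namespace Mult

variable {E : ℕ} {ϱ M : ℝ} {a : E3 → ℂ}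

lemma hasCompactSupport (h : Mult E ϱ M a) : HasCompactSupport a :=
  HasCompactSupport.intro (isCompact_closedBall (0 : E3) ϱ) fun x hx => by
    by_contra h0
    exact hx (by simpa using h.supp x h0)

lemma kernel (h : Mult E ϱ M a) :
    ∃ K : 𝓢(E3, ℂ), (K : E3 → ℂ) = ift a ∧ ∀ ξ, 𝓕 K ξ = a ((2 * Real.pi) • ξ) :=
  exists_kernel h.smooth h.hasCompactSupport

lemma comp_isometry (h : Mult E ϱ M a) (R : E3 ≃ₗᵢ[ℝ] E3) : Mult E ϱ M (fun ξ => a (R ξ)) where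
  smooth := h.smooth.comp R.contDiff
  supp ξ hξ := by simpa using h.supp _ hξ
  nonneg := h.nonneg
  bound ξ := h.bound _
  ang := h.ang.comp_isometry R

/-- The multiplier iξ_i represents ∂_i. On the support it costs a factor ϱ, and a coordinate
function has angular degree one. -/
lemma mul_coord (h : Mult E ϱ M a) (i : Fin 3) :
    Mult (E + 1) ϱ (ϱ * M) (fun ξ => Complex.I * ((ξ i : ℝ) : ℂ) * a ξ) where
  smooth := by
    have h1 : ContDiff ℝ (⊤ : ℕ∞) (fun ξ : E3 => ((ξ i : ℝ) : ℂ)) :=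
      Complex.ofRealCLM.contDiff.comp (by fun_prop)
    exact (contDiff_const.mul h1).mul h.smooth
  supp ξ hξ := h.supp ξ (right_ne_zero_of_mul hξ)
  nonneg := h.nonneg
  bound ξ := by
    by_cases h0 : a ξ = 0
    · have := h.bound ξ
      rw [h0, norm_zero] at this
      rw [h0, mul_zero, norm_zero]
      exact mul_nonneg h.nonneg this
    · have h1 := h.supp ξ h0
      have h2 : ‖((ξ i : ℝ) : ℂ)‖ ≤ ‖ξ‖ := by
        rw [Complex.norm_real]; exact PiLp.norm_apply_le ξ i
      rw [norm_mul, norm_mul, Complex.norm_I, one_mul]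
      have := h.bound ξ
      gcongr
      · exact (norm_nonneg _).trans h1
      · exact h2.trans h1
  ang := by
    have := ((AngDeg.coord i).mul h.ang).const_mul Complex.I
    rw [add_comm]
    simpa [mul_assoc] using this

end Mult

lemma ift_comp_isometry (a : E3 → ℂ) (R : E3 ≃ₗᵢ[ℝ] E3) (x : E3) :
    ift (fun ξ => a (R ξ)) x = ift a (R x) := by
  unfold ift
  congr 1
  conv_rhs => rw [← R.measurePreserving.integral_comp' (f := R.toMeasurableEquiv)]
  simp [R.inner_map_map]

/-- The transform commutes with rotations, so a rotation of x can be moved onto a; the exponential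
is then independent of θ and only the trigonometric polynomial a(Rot θ ξ) remains. -/
lemma angDeg_ift {E : ℕ} {a : E3 → ℂ} (ha : AngDeg E a) (hi : Integrable a) : AngDeg E (ift a) := by
  intro e w hw x
  have h1 : (fun θ => ift a (Rot e w θ x)) = fun θ => ((((2 * Real.pi) ^ 3)⁻¹ : ℝ) : ℂ) *
      ∫ ξ : E3, Complex.exp (Complex.I * ((inner ℝ x ξ : ℝ) : ℂ)) * a (Rot e w θ ξ) := by
    funext θ
    rw [← rotL_apply hw, ← ift_comp_isometry]
    rfl
  rw [h1]
  refine TrigPoly.const_mul _ (TrigPoly.integral (fun ξ => (ha e w hw ξ).const_mul _) fun θ => ?_)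
  have h2 : Integrable (fun ξ => a (Rot e w θ ξ)) := (measurePreserving_Rot hw θ).integrable_comp_of_integrable hi
  refine h2.bdd_mul (c := 1) ?_ (ae_of_all _ fun ξ => ?_)
  · exact Continuous.aestronglyMeasurable (by fun_prop)
  · rw [mul_comm, Complex.norm_exp_ofReal_mul_I]

/-- Convolution is compatible with rotations. -/
lemma conv_isometry (K f : E3 → ℂ) (R : E3 ≃ₗᵢ[ℝ] E3) (x : E3) :
    conv K f (R x) = conv (fun z => K (R z)) (fun y => f (R y)) x := by
  unfold conv
  rw [← R.measurePreserving.integral_comp' (f := R.toMeasurableEquiv)]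
  simp

/-- After rotating the integration variable both factors are evaluated on circles, and the degrees
of a product add. -/
lemma angDeg_conv {E D : ℕ} {K : 𝓢(E3, ℂ)} {f : E3 → ℂ} (hK : AngDeg E K) (hf : AngDeg D f)
    (h2 : MemLp f 2 volume) : AngDeg (E + D) (conv K f) := by
  intro e w hw x
  have h1 : (fun θ => conv K f (Rot e w θ x)) = fun θ =>
      ∫ y : E3, K (Rot e w θ (x - y)) * f (Rot e w θ y) := by
    funext θ
    rw [← rotL_apply hw, conv_isometry]
    rfl
  rw [h1]
  refine TrigPoly.integral (fun y => (hK e w hw _).mul (hf e w hw _)) fun θ => ?_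
  have h3 := integrable_kernel_mul K h2 (Rot e w θ x)
  have h4 := (measurePreserving_Rot hw θ).integrable_comp_of_integrable h3
  simpa [Function.comp_def, Rot_sub hw] using h4

/-- The derivative of the kernel. -/
lemma fderiv_kernel {a : E3 → ℂ} {E : ℕ} {ϱ M : ℝ} (h : Mult E ϱ M a) {K K' : 𝓢(E3, ℂ)}
    (hK : (K : E3 → ℂ) = ift a) (i : Fin 3)
    (hK' : (K' : E3 → ℂ) = ift fun ξ => Complex.I * ((ξ i : ℝ) : ℂ) * a ξ) (z : E3) :
    fderiv ℝ K z (EuclideanSpace.single i 1) = K' z := by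
  obtain ⟨K₁, h1, h2⟩ := h.kernel
  obtain ⟨K₂, h3, h4⟩ := (h.mul_coord i).kernel
  have e1 : K = K₁ := DFunLike.coe_injective (hK.trans h1.symm)
  have e2 : K' = K₂ := DFunLike.coe_injective (hK'.trans h3.symm)
  subst e1 e2
  open LineDeriv in
  have h5 : ∂_{EuclideanSpace.single i (1 : ℝ)} K = K' := by
    have h6 : 𝓕 (∂_{EuclideanSpace.single i (1 : ℝ)} K) = 𝓕 K' := by
      rw [SchwartzMap.fourier_lineDerivOp_eq]
      ext ξ
      have ht : (fun x : E3 => inner ℝ x (EuclideanSpace.single i (1 : ℝ))).HasTemperateGrowth := by fun_prop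
      rw [h4, smul_apply, SchwartzMap.smulLeftCLM_apply_apply ht, h2]
      simp [EuclideanSpace.inner_single_right]
      ring
    have := congrArg (fun f => 𝓕⁻ f) h6
    simpa using this
  rw [← h5, SchwartzMap.lineDerivOp_apply_eq_fderiv]

lemma exists_reflect_translate (K : 𝓢(E3, ℂ)) (x : E3) :
    ∃ χ : 𝓢(E3, ℂ), (∀ y, χ y = K (x - y)) ∧ ∀ y v, fderiv ℝ χ y v = - fderiv ℝ K (x - y) v := by
  let g : E3 → E3 := fun y => x - y
  have hg : g.HasTemperateGrowth := by
    unfold g; fun_prop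
  have hg' : ∃ (k : ℕ) (C : ℝ), ∀ y, ‖y‖ ≤ C * (1 + ‖g y‖) ^ k := by
    refine ⟨1, 1 + ‖x‖, fun y => ?_⟩
    have : ‖y‖ ≤ ‖x‖ + ‖x - y‖ := by
      calc ‖y‖ = ‖x - (x - y)‖ := by simp
        _ ≤ _ := norm_sub_le _ _
    simp only [g, pow_one]
    nlinarith [norm_nonneg x, norm_nonneg (x - y)]
  refine ⟨SchwartzMap.compCLM ℝ hg hg' K, fun y => rfl, fun y v => ?_⟩
  change fderiv ℝ (fun y => K (x - y)) y v = _
  have h1 : HasFDerivAt (fun y : E3 => x - y) (-ContinuousLinearMap.id ℝ E3) y :=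
    (hasFDerivAt_id y).const_sub x
  have h2 := ((K.differentiable (x - y)).hasFDerivAt.comp y h1).fderiv
  rw [show (fun y => K (x - y)) = K ∘ fun y => x - y from rfl, h2]
  simp

/-- Convolution of the kernel with a weak translation derivative. -/
lemma conv_weak_trans {a : E3 → ℂ} {E : ℕ} {ϱ M : ℝ} (ha : Mult E ϱ M a) {i : Fin 3} {h g : E3 → ℂ}
    (hw : IsWeak (.trans i) h g) (hh : MemLp h 2 volume) (hg : MemLp g 2 volume) :
    conv (ift a) g = conv (ift fun ξ => Complex.I * ((ξ i : ℝ) : ℂ) * a ξ) h := by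
  obtain ⟨K, hK, -⟩ := ha.kernel
  obtain ⟨K', hK', -⟩ := (ha.mul_coord i).kernel
  rw [← hK, ← hK']
  funext x
  obtain ⟨χ, h1, h2⟩ := exists_reflect_translate K x
  have h3 := hw.schwartz hh hg χ
  simp only [h1, h2, VField.vec, fderiv_kernel ha hK i hK'] at h3
  unfold conv
  simp only [mul_neg, integral_neg, neg_inj] at h3
  simp only [mul_comm (K _), mul_comm (K' _)]
  exact h3.symm

lemma rot_vec_eq {i j : Fin 3} (h : i < j) (y : E3) :
    (VField.rot i j h).vec y = inner ℝ (EuclideanSpace.single i (1 : ℝ)) y • EuclideanSpace.single j (1 : ℝ) -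
      inner ℝ (EuclideanSpace.single j (1 : ℝ)) y • EuclideanSpace.single i (1 : ℝ) := by
  simp [VField.vec, EuclideanSpace.inner_single_left]

/-- Differentiation of a pairing with a rotated Schwartz function. -/
lemma hasDerivAt_pairing_Rot {e w : E3} (hew : OrthoPair e w) {h : E3 → ℂ} (hh : MemLp h 2 volume)
    (χ : 𝓢(E3, ℂ)) :
    HasDerivAt (fun θ => ∫ y : E3, h y * χ (Rot e w θ y))
      (∫ y : E3, h y * fderiv ℝ χ y (inner ℝ e y • w - inner ℝ w y • e)) 0 := by
  obtain ⟨C, hC0, hC⟩ := SchwartzMap.exists_decay χ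
  let gen : E3 → E3 := fun y => inner ℝ e y • w - inner ℝ w y • e
  have hgen : ∀ y, ‖gen y‖ ≤ 2 * (1 + ‖y‖) := by
    intro y
    refine (norm_sub_le _ _).trans ?_
    rw [norm_smul, norm_smul, hew.norm_left, hew.norm_right]
    have h1 := abs_real_inner_le_norm e y
    have h2 := abs_real_inner_le_norm w y
    rw [hew.norm_left] at h1
    rw [hew.norm_right] at h2
    rw [Real.norm_eq_abs, Real.norm_eq_abs]
    linarith
  have hder : ∀ y θ, HasDerivAt (fun θ => h y * χ (Rot e w θ y))
      (h y * fderiv ℝ χ (Rot e w θ y) (gen (Rot e w θ y))) θ := by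
    intro y θ
    -- The group law reduces the derivative at θ to the derivative at 0 started from the rotated
    -- point.
    have h1 : HasDerivAt (fun τ => Rot e w τ y) (gen (Rot e w θ y)) θ := by
      have h2 := hasDerivAt_Rot_zero (e := e) (w := w) (Rot e w θ y)
      have h3 : HasDerivAt (fun τ => Rot e w (τ - θ) (Rot e w θ y)) (gen (Rot e w θ y)) θ := by
        have := HasDerivAt.comp_sub_const (f := fun τ => Rot e w τ (Rot e w θ y)) (a := θ) (f' := gen (Rot e w θ y)) θ (by simpa using h2)
        exact this
      refine h3.congr_of_eventuallyEq (Eventually.of_forall fun τ => ?_)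
      change Rot e w τ y = Rot e w (τ - θ) (Rot e w θ y)
      rw [← Rot_add hew]; simp
    have h4 := (χ.differentiable (Rot e w θ y)).hasFDerivAt.comp_hasDerivAt θ h1
    exact h4.const_mul (h y)
  have hint : Integrable (fun y => (2 * C) * (((1 + ‖y‖) ^ 3)⁻¹ * ‖h y‖)) volume :=
    (memLp_decay.integrable_mul hh.norm).const_mul _
  have hmeas : ∀ θ, AEStronglyMeasurable (fun y => h y * χ (Rot e w θ y)) volume := fun θ =>
    hh.1.mul ((χ.continuous.comp (rotL hew θ).continuous).aestronglyMeasurable)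
  have := hasDerivAt_integral_of_dominated_loc_of_deriv_le (μ := (volume : Measure E3))
    (F := fun θ y => h y * χ (Rot e w θ y)) (x₀ := (0 : ℝ)) (s := Set.univ)
    (F' := fun θ y => h y * fderiv ℝ χ (Rot e w θ y) (gen (Rot e w θ y)))
    (bound := fun y => (2 * C) * (((1 + ‖y‖) ^ 3)⁻¹ * ‖h y‖)) Filter.univ_mem
    (Eventually.of_forall hmeas) ?_ ?_ ?_ hint (ae_of_all _ fun y θ _ => hder y θ)
  · simpa [Rot_zero, gen] using this.2
  · have h2 : MemLp (fun y => χ (Rot e w 0 y)) 2 volume := by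
      simpa [Rot_zero] using χ.memLp 2 volume
    exact hh.integrable_mul h2
  · simp only [Rot_zero]
    refine hh.1.mul (Continuous.aestronglyMeasurable ?_)
    have : Continuous (fderiv ℝ χ) := (χ.smooth ⊤).continuous_fderiv (by simp)
    exact this.clm_apply (by unfold gen; fun_prop)
  · refine ae_of_all _ fun y θ _ => ?_
    rw [norm_mul]
    have h1 := (hC (Rot e w θ y)).2
    rw [norm_Rot hew] at h1
    calc _ ≤ ‖h y‖ * (‖fderiv ℝ χ (Rot e w θ y)‖ * (2 * (1 + ‖y‖))) := by
          gcongr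
          refine (ContinuousLinearMap.le_opNorm _ _).trans ?_
          gcongr
          have := hgen (Rot e w θ y)
          rwa [norm_Rot hew] at this
      _ = ‖h y‖ * (2 * ((1 + ‖y‖) * ‖fderiv ℝ χ (Rot e w θ y)‖)) := by ring
      _ ≤ ‖h y‖ * (2 * (C * ((1 + ‖y‖) ^ 3)⁻¹)) := by gcongr
      _ = _ := by ring

end MKG

namespace MKG

open Topology Filter FourierTransform

/-- The rotated pairing appearing when a rotation field is moved onto the kernel. -/
lemma trigPoly_pairing {E P : ℕ} {ϱ M : ℝ} {a : E3 → ℂ} (ha : Mult E ϱ M a) {h : E3 → ℂ}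
    (hh : MemLp h 2 volume)
    (hP : ∀ b : E3 → ℂ, Mult E ϱ M b → AngDeg P (conv (ift b) h)) {e w : E3} (hew : OrthoPair e w)
    (x : E3) :
    TrigPoly (E + P) (fun θ => conv (ift fun ξ => a (Rot e w θ ξ)) h (Rot e w (-θ) x)) := by
  have hb : ∀ θ, Mult E ϱ M (fun ξ => a (Rot e w θ ξ)) := fun θ => ha.comp_isometry (rotL hew θ)
  choose K hK _ using fun θ => (hb θ).kernel
  -- All the rotated kernels lie in the span of the 2E+1 kernels at the nodes, with coefficients
  -- that are trigonometric polynomials in θ. The dependence on θ is thus separated from the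
  -- convolution.
  have h1 : ∀ θ, ∀ z, ift (fun ξ => a (Rot e w θ ξ)) z = ∑ j ∈ Finset.range (2 * E + 1),
      dker E (θ - node E j) * ift (fun ξ => a (Rot e w (node E j) ξ)) z := by
    intro θ z
    have := (angDeg_ift ha.ang (ha.smooth.continuous.integrable_of_hasCompactSupport
      ha.hasCompactSupport) e w hew z).sample θ
    have h2 : ∀ τ, ift (fun ξ => a (Rot e w τ ξ)) z = ift a (Rot e w τ z) := fun τ =>
      ift_comp_isometry a (rotL hew τ) z
    simp only [h2]
    exact this
  have h3 : (fun θ => conv (ift fun ξ => a (Rot e w θ ξ)) h (Rot e w (-θ) x)) = fun θ =>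
      ∑ j ∈ Finset.range (2 * E + 1), dker E (θ - node E j) *
        conv (ift fun ξ => a (Rot e w (node E j) ξ)) h (Rot e w (-θ) x) := by
    funext θ
    unfold conv
    simp only [h1 θ, Finset.sum_mul]
    rw [integral_finsetSum]
    · simp only [mul_assoc, integral_const_mul]
    · intro j _
      have := (integrable_kernel_mul (K (node E j)) hh (Rot e w (-θ) x)).const_mul (dker E (θ - node E j))
      simpa [hK, mul_assoc] using this
  rw [h3]
  exact TrigPoly.sum _ fun j _ => (trigPoly_dker E _).mul ((hP _ (hb _) e w hew x).comp_neg)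

/-- Convolution of the kernel with a weak rotation derivative. -/
lemma conv_weak_rot {E P : ℕ} {ϱ M : ℝ} {a : E3 → ℂ} (ha : Mult E ϱ M a) {i j : Fin 3} (hij : i < j)
    {h g : E3 → ℂ} (hw : IsWeak (.rot i j hij) h g) (hh : MemLp h 2 volume) (hg : MemLp g 2 volume)
    (hP : ∀ b : E3 → ℂ, Mult E ϱ M b → AngDeg P (conv (ift b) h)) (x : E3) :
    conv (ift a) g x = ∑ n ∈ Finset.range (2 * (E + P) + 1), -dweight (E + P) n *
      conv (ift fun ξ => a (Rot (EuclideanSpace.single i 1) (EuclideanSpace.single j 1)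
        (node (E + P) n) ξ)) h
        (Rot (EuclideanSpace.single i 1) (EuclideanSpace.single j 1) (-node (E + P) n) x) := by
  have hew := orthoPair_single hij
  set e : E3 := EuclideanSpace.single i 1
  set w : E3 := EuclideanSpace.single j 1
  obtain ⟨K, hK, -⟩ := ha.kernel
  obtain ⟨χ, h1, -⟩ := exists_reflect_translate K x
  have h3 := hw.schwartz hh hg χ
  -- The weak identity makes the convolution with g equal to minus the derivative at 0 of the
  -- pairing of h with a rotated kernel. That pairing is a trigonometric polynomial of degree E + P,
  -- so its derivative is a sum over nodes.
  have h4 := hasDerivAt_pairing_Rot hew hh χ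
  have h5 : (fun θ => ∫ y : E3, h y * χ (Rot e w θ y)) =
      fun θ => conv (ift fun ξ => a (Rot e w θ ξ)) h (Rot e w (-θ) x) := by
    funext θ
    unfold conv
    refine integral_congr_ae (ae_of_all _ fun y => ?_)
    have h6 : ift (fun ξ => a (Rot e w θ ξ)) (Rot e w (-θ) x - y) = ift a (Rot e w θ (Rot e w (-θ) x - y)) :=
      ift_comp_isometry a (rotL hew θ) _
    simp only [h6, h1, hK, Rot_sub hew, (Rot_neg_cancel hew θ x).2]
    ring
  rw [h5] at h4
  have h7 := h4.unique (trigPoly_pairing ha hh hP hew x).hasDerivAt_zero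
  simp only [rot_vec_eq] at h3
  rw [h7] at h3
  have h8 : conv (ift a) g x = ∫ y, g y * χ y := by
    unfold conv
    refine integral_congr_ae (ae_of_all _ fun y => ?_)
    simp only [h1, hK]; ring
  rw [h8, ← neg_eq_iff_eq_neg.mpr h3, ← Finset.sum_neg_distrib]
  simp only [neg_mul]

lemma IsGamma.memLp {w : List VField} {f g : E3 → ℂ} (h : IsGamma w f g) : MemLp g 2 volume := by
  cases w with
  | nil => exact h.1
  | cons Z w => obtain ⟨_, _, h1, _⟩ := h; exact h1

/-- Frequency localized vector field derivatives of a function of bounded angular degree. -/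
theorem conv_isGamma {f : E3 → ℂ} {D : ℕ} (hf : AngDeg D f) (Q : ℕ) {ϱ : ℝ} :
    ∀ (w : List VField) (g : E3 → ℂ), IsGamma w f g → ∀ (E : ℕ) (M : ℝ) (a : E3 → ℂ), Mult E ϱ M a →
      2 * (E + w.length) + D + w.length ≤ Q →
      AngDeg (E + D + w.length) (conv (ift a) g) ∧
      eLpNorm (conv (ift a) g) 2 volume ≤
        ENNReal.ofReal ((ϱ + (2 * Q + 1) * Q) ^ w.length * M) * eLpNorm f 2 volume := by
  -- The budget 2(E + |w|) + D + |w| ≤ Q survives both kinds of field. A translation trades one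
  -- letter of w for one unit of E and costs ϱ. A rotation samples a polynomial of degree P = 2E + D
  -- + |w|, with w the remaining word: 2P+1 nodes with weights at most P, hence a factor at most
  -- (2Q+1)Q.
  intro w
  induction w with
  | nil =>
    intro g hg E M a ha _
    obtain ⟨h1, h2⟩ := hg
    have hf2 : MemLp f 2 volume := (memLp_congr_ae h2).mp h1
    obtain ⟨K, hK, hKa⟩ := ha.kernel
    rw [conv_congr_ae _ h2, ← hK]
    refine ⟨?_, ?_⟩
    · simp only [List.length_nil, Nat.add_zero]
      refine angDeg_conv ?_ hf hf2
      rw [hK]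
      exact angDeg_ift ha.ang (ha.smooth.continuous.integrable_of_hasCompactSupport ha.hasCompactSupport)
    · simpa using eLpNorm_conv_le K (fun ξ => by rw [hKa]; exact ha.bound _) hf2
  | cons Z w ih =>
    intro g hg E M a ha hQ
    obtain ⟨h, hh, hg2, hw⟩ := hg
    have hh2 := hh.memLp
    have hM : 0 ≤ M := (norm_nonneg _).trans (ha.bound 0)
    have hϱ := ha.nonneg
    simp only [List.length_cons] at hQ ⊢
    cases Z with
    | trans i =>
      rw [conv_weak_trans ha hw hh2 hg2]
      obtain ⟨h1, h2⟩ := ih h hh (E + 1) (ϱ * M) _ (ha.mul_coord i) (by omega)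
      refine ⟨h1.mono (by omega), h2.trans ?_⟩
      have h3 : (0 : ℝ) ≤ (2 * Q + 1) * Q := by positivity
      generalize hBdef : ϱ + (2 * (Q : ℝ) + 1) * Q = b
      have h4 : 0 ≤ b := by linarith
      have h5 : b ^ w.length * (ϱ * M) ≤ b ^ (w.length + 1) * M := by
        calc b ^ w.length * (ϱ * M) ≤ b ^ w.length * (b * M) :=
              mul_le_mul_of_nonneg_left (mul_le_mul_of_nonneg_right (by linarith) hM) (by positivity)
          _ = _ := by ring
      exact mul_le_mul' (ENNReal.ofReal_le_ofReal h5) le_rfl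
    | rot i j hij =>
      have hP : ∀ b : E3 → ℂ, Mult E ϱ M b → AngDeg (E + D + w.length) (conv (ift b) h) :=
        fun b hb => (ih h hh E M b hb (by omega)).1
      have hew := orthoPair_single hij
      have hrot := conv_weak_rot ha hij hw hh2 hg2 hP
      set e : E3 := EuclideanSpace.single i 1
      set v : E3 := EuclideanSpace.single j 1
      set P := E + (E + D + w.length) with hPdef
      have hb : ∀ θ, Mult E ϱ M (fun ξ => a (Rot e v θ ξ)) := fun θ => ha.comp_isometry (rotL hew θ)
      have hfun : conv (ift a) g = ∑ n ∈ Finset.range (2 * P + 1), fun x => -dweight P n *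
          conv (ift fun ξ => a (Rot e v (node P n) ξ)) h (Rot e v (-node P n) x) := by
        funext x; rw [hrot x, Finset.sum_apply]
      constructor
      · rw [hfun]
        have : (∑ n ∈ Finset.range (2 * P + 1), fun x => -dweight P n *
          conv (ift fun ξ => a (Rot e v (node P n) ξ)) h (Rot e v (-node P n) x)) =
          fun x => ∑ n ∈ Finset.range (2 * P + 1), -dweight P n *
          conv (ift fun ξ => a (Rot e v (node P n) ξ)) h (Rot e v (-node P n) x) := by
          funext x; rw [Finset.sum_apply]
        rw [this]
        exact AngDeg.sum _ fun n _ => (((hP _ (hb _)).comp_isometry (rotL hew _)).mono (by omega)).const_mul _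
      · rw [hfun]
        set B : ℝ≥0∞ := ENNReal.ofReal ((ϱ + (2 * Q + 1) * Q) ^ w.length * M) * eLpNorm f 2 volume
        have hmeas : ∀ n, AEStronglyMeasurable (conv (ift fun ξ => a (Rot e v (node P n) ξ)) h) volume := by
          intro n
          obtain ⟨K, hK, -⟩ := (hb (node P n)).kernel
          rw [← hK]
          exact aestronglyMeasurable_conv K hh2.1
        have hterm : ∀ n ∈ Finset.range (2 * P + 1), eLpNorm (fun x => -dweight P n *
          conv (ift fun ξ => a (Rot e v (node P n) ξ)) h (Rot e v (-node P n) x)) 2 volume ≤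
            ENNReal.ofReal P * B := by
          intro n _
          refine (eLpNorm_const_smul_le (c := -dweight P n) (f := fun x => conv (ift fun ξ => a (Rot e v (node P n) ξ)) h (Rot e v (-node P n) x))).trans ?_
          have e1 := eLpNorm_comp_measurePreserving (p := 2) (hmeas n) (measurePreserving_Rot hew (-node P n))
          rw [show (fun x => conv (ift fun ξ => a (Rot e v (node P n) ξ)) h (Rot e v (-node P n) x)) =
            conv (ift fun ξ => a (Rot e v (node P n) ξ)) h ∘ Rot e v (-node P n) from rfl, e1]
          gcongr
          · rw [enorm_neg, ← ofReal_norm]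
            exact ENNReal.ofReal_le_ofReal (norm_dweight_le P n)
          · exact (ih h hh E M _ (hb _) (by omega)).2
        refine (eLpNorm_sum_le (fun n _ => ?_) (by norm_num)).trans ((Finset.sum_le_sum hterm).trans ?_)
        · exact ((hmeas n).comp_measurePreserving (measurePreserving_Rot hew _)).const_mul _
        · rw [Finset.sum_const, Finset.card_range, nsmul_eq_mul]
          have hPQ : (P : ℝ) ≤ Q := by exact_mod_cast (by omega : P ≤ Q)
          have e2 : ((2 * P + 1 : ℕ) : ℝ≥0∞) * (ENNReal.ofReal P * B) =
              ENNReal.ofReal (((2 * P + 1) * P : ℝ) * ((ϱ + (2 * Q + 1) * Q) ^ w.length * M)) * eLpNorm f 2 volume := by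
            simp only [B]
            rw [← mul_assoc, ← mul_assoc, ENNReal.ofReal_mul (by positivity : (0 : ℝ) ≤ (2 * P + 1) * P),
              ENNReal.ofReal_mul (by positivity : (0 : ℝ) ≤ 2 * P + 1)]
            congr 3
            rw [← ENNReal.ofReal_natCast]
            congr 1
            push_cast; ring
          rw [e2]
          have h9 : (2 * (P : ℝ) + 1) * P ≤ ϱ + (2 * Q + 1) * Q := by
            have : (2 * (P : ℝ) + 1) * P ≤ (2 * Q + 1) * Q := by gcongr
            linarith
          have h3 : (0 : ℝ) ≤ (2 * Q + 1) * Q := by positivity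
          generalize ϱ + (2 * (Q : ℝ) + 1) * Q = b at h9 ⊢
          have h4 : 0 ≤ b := le_trans (by positivity) h9
          have h5 : (2 * (P : ℝ) + 1) * P * (b ^ w.length * M) ≤ b ^ (w.length + 1) * M := by
            calc _ ≤ b * (b ^ w.length * M) := mul_le_mul_of_nonneg_right h9 (by positivity)
              _ = _ := by ring
          exact mul_le_mul' (ENNReal.ofReal_le_ofReal h5) le_rfl

end MKG

namespace MKG

open Topology Filter Real

/-! ### Spherical coordinates -/

/-- The point with spherical coordinates `(ρ, θ, φ)` with respect to an orthonormal basis. -/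
noncomputable def sphPt (b : OrthonormalBasis (Fin 3) ℝ E3) (φ ρ θ : ℝ) : E3 :=
  ρ • (cos θ • b 0 + sin θ • (cos φ • b 1 + sin φ • b 2))

/-- The radial measure `ρ² dρ`. -/
noncomputable def radMeas : Measure ℝ :=
  (volume.restrict (Set.Ioi 0)).withDensity fun ρ => ENNReal.ofReal (ρ ^ 2)

/-- The polar angle measure `sin θ dθ` on `(0, π)`. -/
noncomputable def angMeas : Measure ℝ :=
  (volume.restrict (Set.Ioo 0 π)).withDensity fun θ => ENNReal.ofReal (sin θ)

instance : SFinite radMeas := by unfold radMeas; infer_instance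
instance : SFinite angMeas := by unfold angMeas; infer_instance

lemma lintegral_basis (b : OrthonormalBasis (Fin 3) ℝ E3) {h : E3 → ℝ≥0∞} (hh : Measurable h) :
    ∫⁻ x, h x = ∫⁻ z : ℝ, ∫⁻ p : ℝ × ℝ, h (z • b 0 + p.1 • b 1 + p.2 • b 2) := by
  have h1 := b.measurePreserving_repr_symm
  have h2 := PiLp.volume_preserving_toLp (Fin 3)
  have h3 := (volume_preserving_piFinSuccAbove (fun _ : Fin 3 => ℝ) 0).symm
  have h4 := (volume_preserving_finTwoArrow ℝ).symm
  rw [← h1.lintegral_comp hh, ← h2.lintegral_comp (by fun_prop), ← h3.lintegral_comp (by fun_prop)]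
  rw [Measure.volume_eq_prod, lintegral_prod _ (by fun_prop)]
  refine lintegral_congr fun z => ?_
  rw [← h4.lintegral_comp (by fun_prop)]
  refine lintegral_congr fun p => ?_
  congr 1
  rw [← OrthonormalBasis.sum_repr_symm, Fin.sum_univ_three]
  simp [MeasurableEquiv.piFinSuccAbove, Fin.insertNthEquiv, MeasurableEquiv.finTwoArrow]

lemma continuous_sphPt (b : OrthonormalBasis (Fin 3) ℝ E3) :
    Continuous fun p : ℝ × ℝ × ℝ => sphPt b p.1 p.2.1 p.2.2 := by
  unfold sphPt; fun_prop

/-- Polar coordinates in the half plane of fixed azimuth, s being the distance to the axis. The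
weight s = ρ sin θ and the Jacobian ρ combine to ρ² sin θ. -/
lemma lintegral_half_plane (b : OrthonormalBasis (Fin 3) ℝ E3) (φ : ℝ) {h : E3 → ℝ≥0∞} (hh : Measurable h) :
    ∫⁻ z : ℝ, ∫⁻ s in Set.Ioi (0 : ℝ), ENNReal.ofReal s *
      h (z • b 0 + (s * cos φ) • b 1 + (s * sin φ) • b 2) =
    ∫⁻ ρ, ∫⁻ θ, h (sphPt b φ ρ θ) ∂angMeas ∂radMeas := by
  set k : ℝ × ℝ → ℝ≥0∞ := fun p => (Set.Ioi (0 : ℝ)).indicator (fun s => ENNReal.ofReal s *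
    h (p.1 • b 0 + (s * cos φ) • b 1 + (s * sin φ) • b 2)) p.2 with hk
  have hkm : Measurable k := by
    have : k = (Set.indicator {p : ℝ × ℝ | 0 < p.2} (fun p => ENNReal.ofReal p.2 *
      h (p.1 • b 0 + (p.2 * cos φ) • b 1 + (p.2 * sin φ) • b 2))) := by
      funext p; simp [hk, Set.indicator]
    rw [this]
    exact (by fun_prop : Measurable _).indicator (measurableSet_lt measurable_const measurable_snd)
  have hS : Measurable fun p : ℝ × ℝ => h (sphPt b φ p.1 p.2) := by
    have := (continuous_sphPt b).comp (by fun_prop : Continuous fun p : ℝ × ℝ => (φ, p.1, p.2))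
    exact hh.comp this.measurable
  have e1 : ∫⁻ z : ℝ, ∫⁻ s in Set.Ioi (0 : ℝ), ENNReal.ofReal s *
      h (z • b 0 + (s * cos φ) • b 1 + (s * sin φ) • b 2) = ∫⁻ p, k p := by
    rw [Measure.volume_eq_prod, lintegral_prod _ hkm.aemeasurable]
    refine lintegral_congr fun z => ?_
    rw [← lintegral_indicator measurableSet_Ioi]
  have hm1 : Measurable fun ρ => ∫⁻ θ, h (sphPt b φ ρ θ) ∂angMeas := hS.lintegral_prod_right'
  rw [e1, ← lintegral_comp_polarCoord_symm, polarCoord_target, Measure.volume_eq_prod,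
    ← Measure.prod_restrict, lintegral_prod]
  · unfold radMeas
    rw [lintegral_withDensity_eq_lintegral_mul _ (by fun_prop) hm1]
    refine setLIntegral_congr_fun measurableSet_Ioi fun ρ hρ => ?_
    simp only [Set.mem_Ioi] at hρ
    simp only [Pi.mul_apply, smul_eq_mul]
    unfold angMeas
    have hm2 : Measurable fun θ => h (sphPt b φ ρ θ) := hS.comp (by fun_prop : Measurable fun θ : ℝ => (ρ, θ))
    rw [lintegral_withDensity_eq_lintegral_mul _ (by fun_prop) hm2,
      ← lintegral_const_mul _ (Measurable.mul (by fun_prop) hm2),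
      ← lintegral_indicator measurableSet_Ioo, ← lintegral_indicator measurableSet_Ioo]
    refine lintegral_congr fun θ => ?_
    simp only [Set.indicator, Set.mem_Ioo, hk, polarCoord_symm_apply, Set.mem_Ioi, Pi.mul_apply]
    by_cases h0 : 0 < θ
    · by_cases hp : θ < π
      · have hs := sin_pos_of_pos_of_lt_pi h0 hp
        have hrs : 0 < ρ * sin θ := mul_pos hρ hs
        rw [if_pos ⟨by linarith [pi_pos], hp⟩, if_pos hrs, if_pos (And.intro h0 hp)]
        rw [ENNReal.ofReal_mul hρ.le, pow_two, ENNReal.ofReal_mul hρ.le]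
        have : sphPt b φ ρ θ = (ρ * cos θ) • b 0 + (ρ * sin θ * cos φ) • b 1 + (ρ * sin θ * sin φ) • b 2 := by
          unfold sphPt; module
        rw [this]; ring
      · rw [if_neg (fun h => hp h.2), if_neg (fun h => hp h.2)]
    · rw [if_neg (fun h : 0 < θ ∧ θ < π => h0 h.1)]
      split_ifs with h1 h2
      · exact absurd h2 (not_lt.mpr (mul_nonpos_of_nonneg_of_nonpos hρ.le
          (sin_nonpos_of_nonpos_of_neg_pi_le (not_lt.mp h0) h1.1.le)))
      · simp
      · rfl
  · exact (Measurable.mul (by fun_prop) (hkm.comp continuous_polarCoord_symm.measurable)).aemeasurable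

/-- Polar coordinates in the plane orthogonal to the axis supply the weight s required by
`lintegral_half_plane`. -/
lemma lintegral_sphPt (b : OrthonormalBasis (Fin 3) ℝ E3) {h : E3 → ℝ≥0∞} (hh : Measurable h) :
    ∫⁻ φ in Set.Ioo (-π) π, ∫⁻ ρ, ∫⁻ θ, h (sphPt b φ ρ θ) ∂angMeas ∂radMeas = ∫⁻ x, h x := by
  rw [lintegral_basis b hh]
  simp_rw [← lintegral_half_plane b _ hh]
  have hm : Measurable fun q : ℝ × ℝ × ℝ => ENNReal.ofReal q.2.2 *
      h (q.2.1 • b 0 + (q.2.2 * cos q.1) • b 1 + (q.2.2 * sin q.1) • b 2) := by fun_prop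
  rw [lintegral_lintegral_swap]
  · refine lintegral_congr fun z => ?_
    rw [← lintegral_comp_polarCoord_symm (fun p => h (z • b 0 + p.1 • b 1 + p.2 • b 2)), polarCoord_target,
      Measure.volume_eq_prod, ← Measure.prod_restrict, lintegral_prod_symm]
    · rfl
    · refine Measurable.aemeasurable ?_
      simp only [smul_eq_mul]
      refine Measurable.mul (by fun_prop) ?_
      have := continuous_polarCoord_symm.measurable
      fun_prop
  · exact (Measurable.lintegral_prod_right' (f := fun q : (ℝ × ℝ) × ℝ => ENNReal.ofReal q.2 *
      h (q.1.2 • b 0 + (q.2 * cos q.1.1) • b 1 + (q.2 * sin q.1.1) • b 2)) (by fun_prop)).aemeasurable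

/-- Spherical coordinates as a measure preserving map. -/
lemma measurePreserving_sphPt (b : OrthonormalBasis (Fin 3) ℝ E3) :
    MeasurePreserving (fun p : ℝ × ℝ × ℝ => sphPt b p.1 p.2.1 p.2.2)
      ((volume.restrict (Set.Ioo (-π) π)).prod (radMeas.prod angMeas)) volume := by
  have hc := (continuous_sphPt b).measurable
  refine ⟨hc, Measure.ext fun s hs => ?_⟩
  have h1 : Measurable (s.indicator (1 : E3 → ℝ≥0∞)) := measurable_one.indicator hs
  rw [← lintegral_indicator_one hs, ← lintegral_indicator_one hs, lintegral_map h1 hc,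
    ← lintegral_sphPt b h1]
  refine (lintegral_prod _ (h1.comp hc).aemeasurable).trans ?_
  refine lintegral_congr fun φ => ?_
  have h2 : Measurable fun q : ℝ × ℝ => s.indicator (1 : E3 → ℝ≥0∞) (sphPt b φ q.1 q.2) :=
    (h1.comp hc).comp (by fun_prop : Measurable fun q : ℝ × ℝ => (φ, q.1, q.2))
  exact lintegral_prod _ h2.aemeasurable

lemma orthoPair_basis (b : OrthonormalBasis (Fin 3) ℝ E3) {i j : Fin 3} (h : i ≠ j) :
    OrthoPair (b i) (b j) :=
  ⟨b.norm_eq_one i, b.norm_eq_one j, b.inner_eq_zero h⟩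

lemma orthoPair_equator (b : OrthonormalBasis (Fin 3) ℝ E3) (φ : ℝ) :
    OrthoPair (b 0) (cos φ • b 1 + sin φ • b 2) := by
  have h01 : inner ℝ (b 0) (b 1) = (0 : ℝ) := b.inner_eq_zero (by decide)
  have h02 : inner ℝ (b 0) (b 2) = (0 : ℝ) := b.inner_eq_zero (by decide)
  have h12 : inner ℝ (b 1) (b 2) = (0 : ℝ) := b.inner_eq_zero (by decide)
  have h21 : inner ℝ (b 2) (b 1) = (0 : ℝ) := b.inner_eq_zero (by decide)
  have h11 : inner ℝ (b 1) (b 1) = (1 : ℝ) := b.inner_eq_one 1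
  have h22 : inner ℝ (b 2) (b 2) = (1 : ℝ) := b.inner_eq_one 2
  refine ⟨b.norm_eq_one 0, ?_, ?_⟩
  · rw [← pow_eq_one_iff_of_nonneg (norm_nonneg _) two_ne_zero, ← real_inner_self_eq_norm_sq]
    simp only [inner_add_left, inner_add_right, inner_smul_left, inner_smul_right, h12, h21, h11, h22]
    simp only [conj_trivial]
    linear_combination sin_sq_add_cos_sq φ
  · simp only [inner_add_right, inner_smul_right, h01, h02]; ring

lemma sphPt_eq_Rot (b : OrthonormalBasis (Fin 3) ℝ E3) (φ ρ θ : ℝ) :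
    sphPt b φ ρ θ = Rot (b 0) (cos φ • b 1 + sin φ • b 2) θ (ρ • b 0) :=
  (Rot_self (orthoPair_equator b φ) θ ρ).symm

lemma norm_sphPt (b : OrthonormalBasis (Fin 3) ℝ E3) (φ ρ θ : ℝ) : ‖sphPt b φ ρ θ‖ = |ρ| := by
  rw [sphPt_eq_Rot, norm_Rot (orthoPair_equator b φ), norm_smul, b.norm_eq_one, mul_one, Real.norm_eq_abs]

lemma sphPt_neg (b : OrthonormalBasis (Fin 3) ℝ E3) (φ ρ θ : ℝ) :
    sphPt b φ ρ (-θ) = Rot (b 1) (b 2) π (sphPt b φ ρ θ) := by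
  have h10 : inner ℝ (b 1) (b 0) = (0 : ℝ) := b.inner_eq_zero (by decide)
  have h12 : inner ℝ (b 1) (b 2) = (0 : ℝ) := b.inner_eq_zero (by decide)
  have h20 : inner ℝ (b 2) (b 0) = (0 : ℝ) := b.inner_eq_zero (by decide)
  have h21 : inner ℝ (b 2) (b 1) = (0 : ℝ) := b.inner_eq_zero (by decide)
  have h11 : inner ℝ (b 1) (b 1) = (1 : ℝ) := b.inner_eq_one 1
  have h22 : inner ℝ (b 2) (b 2) = (1 : ℝ) := b.inner_eq_one 2
  simp only [Rot, sphPt, inner_smul_right, inner_add_right, h10, h12, h20, h21, h11, h22, cos_pi, sin_pi,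
    cos_neg, sin_neg]
  module

/-- Letting θ run over a whole circle covers space twice, since changing the sign of θ is a half
turn about the axis. Whole circles are needed because the bounds for trigonometric polynomials
involve their norm over a full period. -/
lemma lintegral_sphPt_full (b : OrthonormalBasis (Fin 3) ℝ E3) {h : E3 → ℝ≥0∞} (hh : Measurable h) :
    ∫⁻ φ in Set.Ioo (-π) π, ∫⁻ ρ, (∫⁻ θ in Set.Ioo (-π) π,
      h (sphPt b φ ρ θ) * ENNReal.ofReal |sin θ|) ∂radMeas = 2 * ∫⁻ x, h x := by
  have hS : Measurable fun q : ℝ × ℝ × ℝ => h (sphPt b q.1 q.2.1 q.2.2) := hh.comp (continuous_sphPt b).measurable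
  have hS' : Measurable fun q : ℝ × ℝ × ℝ => h (sphPt b q.1 q.2.1 (-q.2.2)) :=
    hS.comp (by fun_prop : Measurable fun q : ℝ × ℝ × ℝ => (q.1, q.2.1, -q.2.2))
  have key : ∀ φ ρ, ∫⁻ θ in Set.Ioo (-π) π, h (sphPt b φ ρ θ) * ENNReal.ofReal |sin θ| =
      ∫⁻ θ, h (sphPt b φ ρ θ) ∂angMeas + ∫⁻ θ, h (sphPt b φ ρ (-θ)) ∂angMeas := by
    intro φ ρ
    have m1 : Measurable fun θ => h (sphPt b φ ρ θ) := hS.comp (by fun_prop : Measurable fun θ : ℝ => (φ, ρ, θ))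
    have m2 : Measurable fun θ => h (sphPt b φ ρ (-θ)) := hS'.comp (by fun_prop : Measurable fun θ : ℝ => (φ, ρ, θ))
    unfold angMeas
    rw [lintegral_withDensity_eq_lintegral_mul _ (by fun_prop) m1,
      lintegral_withDensity_eq_lintegral_mul _ (by fun_prop) m2]
    have e1 : Set.Ioo (-π) π =ᵐ[volume] (Set.Ioo (-π) 0 ∪ Set.Ioo 0 π : Set ℝ) := by
      have : Set.Ioo (-π) π = Set.Ioo (-π) 0 ∪ Set.Ico 0 π :=
        (Set.Ioo_union_Ico_eq_Ioo (by linarith [pi_pos]) pi_pos.le).symm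
      rw [this]
      exact (ae_eq_refl _).union Ioo_ae_eq_Ico.symm
    rw [setLIntegral_congr e1, lintegral_union measurableSet_Ioo
      (Set.disjoint_left.mpr fun x hx hx' => absurd hx.2 (not_lt.mpr hx'.1.le)), add_comm]
    congr 1
    · refine setLIntegral_congr_fun measurableSet_Ioo fun θ hθ => ?_
      simp only [Pi.mul_apply]
      rw [abs_of_pos (sin_pos_of_pos_of_lt_pi hθ.1 hθ.2), mul_comm]
    · rw [← lintegral_indicator measurableSet_Ioo, ← lintegral_indicator measurableSet_Ioo,
        ← lintegral_neg_eq_self]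
      refine lintegral_congr fun θ => ?_
      simp only [Set.indicator, Set.mem_Ioo, Pi.mul_apply, sin_neg, abs_neg]
      by_cases h0 : 0 < θ ∧ θ < π
      · rw [if_pos ⟨by linarith, by linarith⟩, if_pos h0, abs_of_pos (sin_pos_of_pos_of_lt_pi h0.1 h0.2), mul_comm]
      · rw [if_neg (fun h => h0 ⟨by linarith [h.2], by linarith [h.1]⟩), if_neg h0]
  simp_rw [key]
  have n1 : ∀ φ, Measurable fun ρ => ∫⁻ θ, h (sphPt b φ ρ θ) ∂angMeas := fun φ =>
    (hS.comp (by fun_prop : Measurable fun q : ℝ × ℝ => (φ, q.1, q.2))).lintegral_prod_right'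
  have n2 : Measurable fun φ => ∫⁻ ρ, ∫⁻ θ, h (sphPt b φ ρ θ) ∂angMeas ∂radMeas := by
    have h1 := (hS.comp (by fun_prop : Measurable fun q : (ℝ × ℝ) × ℝ => (q.1.1, q.1.2, q.2))).lintegral_prod_right'
      (ν := angMeas)
    exact h1.lintegral_prod_right' (ν := radMeas)
  simp_rw [lintegral_add_left (n1 _)]
  rw [lintegral_add_left n2, lintegral_sphPt b hh]
  simp_rw [sphPt_neg]
  have hew := orthoPair_basis b (show (1 : Fin 3) ≠ 2 by decide)
  have hR := measurePreserving_Rot hew π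
  rw [lintegral_sphPt b (h := fun x => h (Rot (b 1) (b 2) π x)) (hh.comp hR.measurable), hR.lintegral_comp hh, two_mul]

/-- An integral bound in spherical coordinates from bounds along the polar angle. -/
lemma enorm_integral_le_of_sphPt (b : OrthonormalBasis (Fin 3) ℝ E3) {g : E3 → ℂ} {h : E3 → ℝ≥0∞}
    (hh : Measurable h) {K : ℝ≥0∞}
    (hK : ∀ φ ρ, 0 < ρ → ‖∫ θ, g (sphPt b φ ρ θ) ∂angMeas‖ₑ ≤
      K * ∫⁻ θ in Set.Ioo (-π) π, h (sphPt b φ ρ θ) * ENNReal.ofReal |sin θ|) :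
    ‖∫ x, g x‖ₑ ≤ 2 * K * ∫⁻ x, h x := by
  -- A non-integrable g has integral zero by convention, and the bound is trivial.
  by_cases hg : Integrable g volume
  swap
  · rw [integral_undef hg]; simp
  have hmp := measurePreserving_sphPt b
  have hgi := (hmp.integrable_comp hg.1).mpr hg
  have hS : Measurable fun q : ℝ × ℝ × ℝ => h (sphPt b q.1 q.2.1 q.2.2) * ENNReal.ofReal |sin q.2.2| :=
    (hh.comp (continuous_sphPt b).measurable).mul (by fun_prop)
  have h0 : ∫ x, g x = ∫ φ in Set.Ioo (-π) π, ∫ q : ℝ × ℝ, g (sphPt b φ q.1 q.2) ∂(radMeas.prod angMeas) := by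
    rw [← integral_prod (fun q : ℝ × ℝ × ℝ => g (sphPt b q.1 q.2.1 q.2.2)) hgi, ← hmp.map_eq, integral_map hmp.measurable.aemeasurable (by rw [hmp.map_eq]; exact hg.1)]
  rw [h0]
  have hpos : ∀ᵐ ρ ∂radMeas, 0 < ρ := by
    unfold radMeas
    exact (withDensity_absolutelyContinuous _ _).ae_le (ae_restrict_mem measurableSet_Ioi)
  calc ‖∫ φ in Set.Ioo (-π) π, ∫ q : ℝ × ℝ, g (sphPt b φ q.1 q.2) ∂(radMeas.prod angMeas)‖ₑ
      ≤ ∫⁻ φ in Set.Ioo (-π) π, ‖∫ q : ℝ × ℝ, g (sphPt b φ q.1 q.2) ∂(radMeas.prod angMeas)‖ₑ :=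
        enorm_integral_le_lintegral_enorm _
    _ ≤ ∫⁻ φ in Set.Ioo (-π) π, ∫⁻ ρ, (K * ∫⁻ θ in Set.Ioo (-π) π,
          h (sphPt b φ ρ θ) * ENNReal.ofReal |sin θ|) ∂radMeas := by
        refine lintegral_mono_ae ?_
        filter_upwards [hgi.prod_right_ae] with φ hφ
        simp only [Function.comp_def] at hφ
        rw [integral_prod _ hφ]
        refine (enorm_integral_le_lintegral_enorm _).trans (lintegral_mono_ae ?_)
        filter_upwards [hpos] with ρ hρ
        exact hK φ ρ hρ
    _ = 2 * K * ∫⁻ x, h x := by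
        have n1 : ∀ φ, Measurable fun ρ => ∫⁻ θ in Set.Ioo (-π) π, h (sphPt b φ ρ θ) * ENNReal.ofReal |sin θ| :=
          fun φ => (hS.comp (by fun_prop : Measurable fun q : ℝ × ℝ => (φ, q.1, q.2))).lintegral_prod_right'
        have n2 : Measurable fun φ => ∫⁻ ρ, (∫⁻ θ in Set.Ioo (-π) π,
            h (sphPt b φ ρ θ) * ENNReal.ofReal |sin θ|) ∂radMeas := by
          have h1 := (hS.comp (by fun_prop : Measurable fun q : (ℝ × ℝ) × ℝ => (q.1.1, q.1.2, q.2))).lintegral_prod_right'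
            (ν := volume.restrict (Set.Ioo (-π) π))
          exact h1.lintegral_prod_right' (ν := radMeas)
        simp_rw [lintegral_const_mul K (n1 _)]
        rw [lintegral_const_mul K n2, lintegral_sphPt_full b hh]
        ring

/-! ### Integration over the sphere -/

/-- The area measure of the unit sphere. -/
noncomputable abbrev sphMeas : Measure (Metric.sphere (0 : E3) 1) := (volume : Measure E3).toSphere

lemma map_volumeIoiPow : Measure.map Subtype.val (Measure.volumeIoiPow 2) = radMeas := by
  ext s hs
  rw [Measure.map_apply measurable_subtype_coe hs, Measure.volumeIoiPow,
    withDensity_apply _ (measurable_subtype_coe hs),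
    setLIntegral_subtype measurableSet_Ioi _ fun a : ℝ ↦ ENNReal.ofReal (a ^ 2), radMeas, withDensity_apply _ hs,
    Measure.restrict_restrict hs, Subtype.image_preimage_coe, Set.inter_comm]

lemma measurePreserving_sphere :
    MeasurePreserving (fun p : Metric.sphere (0 : E3) 1 × ℝ => p.2 • (p.1 : E3)) (sphMeas.prod radMeas) volume := by
  have h1 := (Measure.measurePreserving_homeomorphUnitSphereProd (volume : Measure E3))
  have hdim : Module.finrank ℝ E3 - 1 = 2 := by simp
  rw [hdim] at h1
  have h2 : MeasurePreserving (homeomorphUnitSphereProd E3).toMeasurableEquiv.symm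
    (sphMeas.prod (Measure.volumeIoiPow 2)) (volume.comap (Subtype.val : ({0}ᶜ : Set E3) → E3)) :=
    MeasurePreserving.symm (homeomorphUnitSphereProd E3).toMeasurableEquiv h1
  have h3 : MeasurePreserving (Subtype.val : ({0}ᶜ : Set E3) → E3) (volume.comap Subtype.val) volume := by
    have := measurePreserving_subtype_coe (μa := (volume : Measure E3)) (measurableSet_singleton (0 : E3)).compl
    rwa [restrict_compl_singleton] at this
  have h4 := h3.comp h2
  have h5 : MeasurePreserving (Subtype.val : Set.Ioi (0 : ℝ) → ℝ) (Measure.volumeIoiPow 2) radMeas :=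
    ⟨measurable_subtype_coe, map_volumeIoiPow⟩
  have h6 := (MeasurePreserving.id sphMeas).prod h5
  have hm : Measurable (fun p : Metric.sphere (0 : E3) 1 × ℝ => p.2 • (p.1 : E3)) := by fun_prop
  refine ⟨hm, ?_⟩
  rw [← h6.map_eq, Measure.map_map hm h6.measurable, ← h4.map_eq]
  rfl

lemma lintegral_sphere {h : E3 → ℝ≥0∞} (hh : Measurable h) :
    ∫⁻ r, ∫⁻ u : Metric.sphere (0 : E3) 1, h (r • (u : E3)) ∂sphMeas ∂radMeas = ∫⁻ x, h x := by
  rw [← measurePreserving_sphere.lintegral_comp hh, lintegral_prod_symm']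
  exact hh.comp measurePreserving_sphere.measurable

lemma radMeas_Ioo : radMeas (Set.Ioo 0 1) = ENNReal.ofReal (1 / 3) := by
  have hp : Subtype.val ⁻¹' (Set.Ioo (0 : ℝ) 1) = Set.Iio (⟨1, Set.mem_Ioi.mpr one_pos⟩ : Set.Ioi (0 : ℝ)) := by
    ext x
    simp [← Subtype.coe_lt_coe, x.2.out]
  rw [← map_volumeIoiPow, Measure.map_apply measurable_subtype_coe measurableSet_Ioo, hp,
    Measure.volumeIoiPow_apply_Iio]
  norm_num

lemma ae_radMeas_pos : ∀ᵐ ρ ∂radMeas, 0 < ρ := by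
  unfold radMeas
  exact (withDensity_absolutelyContinuous _ _).ae_le (ae_restrict_mem measurableSet_Ioi)

lemma measurable_indicator_unit : Measurable ((Set.Ioo (0 : ℝ) 1).indicator (1 : ℝ → ℝ≥0∞)) :=
  measurable_one.indicator measurableSet_Ioo

/-- Spreading a function on the sphere over the shell 0 < r < 1 turns statements about volume into
statements about area. -/
lemma exists_shell {F : E3 → ℝ≥0∞} (hF : Measurable F) : ∃ h : E3 → ℝ≥0∞, Measurable h ∧
    ∀ v : E3, ‖v‖ = 1 → ∀ r : ℝ, 0 < r → h (r • v) = F v * (Set.Ioo (0 : ℝ) 1).indicator 1 r := by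
  refine ⟨(norm ⁻¹' (Set.Ioo (0 : ℝ) 1)).indicator (fun x : E3 => F (‖x‖⁻¹ • x)),
    (hF.comp (by fun_prop)).indicator (measurable_norm measurableSet_Ioo), fun v hv r h0 => ?_⟩
  have : ‖r • v‖ = r := by rw [norm_smul, hv, mul_one, Real.norm_of_nonneg h0.le]
  simp only [Set.indicator, Set.mem_preimage, this]
  split_ifs
  · rw [smul_smul, inv_mul_cancel₀ h0.ne', one_smul]; simp
  · simp

lemma lintegral_shell_sphere {F h : E3 → ℝ≥0∞} (hF : Measurable F) (hm : Measurable h)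
    (hunit : ∀ v : E3, ‖v‖ = 1 → ∀ r : ℝ, 0 < r → h (r • v) = F v * (Set.Ioo (0 : ℝ) 1).indicator 1 r) :
    ∫⁻ x, h x = (∫⁻ u : Metric.sphere (0 : E3) 1, F u ∂sphMeas) * radMeas (Set.Ioo 0 1) := by
  rw [← lintegral_sphere hm, ← lintegral_indicator_one measurableSet_Ioo,
    ← lintegral_const_mul _ measurable_indicator_unit]
  refine lintegral_congr_ae ?_
  filter_upwards [ae_radMeas_pos] with r hr
  rw [← lintegral_mul_const _ (show Measurable fun u : Metric.sphere (0 : E3) 1 => F u from hF.comp measurable_subtype_coe)]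
  exact lintegral_congr fun u => hunit u (by simp) r hr

lemma lintegral_shell_sphPt (b : OrthonormalBasis (Fin 3) ℝ E3) {F h : E3 → ℝ≥0∞} (hF : Measurable F) (hm : Measurable h)
    (hunit : ∀ v : E3, ‖v‖ = 1 → ∀ r : ℝ, 0 < r → h (r • v) = F v * (Set.Ioo (0 : ℝ) 1).indicator 1 r) :
    ∫⁻ x, h x = (∫⁻ φ in Set.Ioo (-π) π, ∫⁻ θ, F (sphPt b φ 1 θ) ∂angMeas) * radMeas (Set.Ioo 0 1) := by
  have hS : Measurable fun q : ℝ × ℝ => F (sphPt b q.1 1 q.2) := by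
    refine hF.comp (Continuous.measurable ?_)
    unfold sphPt; fun_prop
  have hSφ : ∀ φ, Measurable fun θ => F (sphPt b φ 1 θ) := by
    intro φ
    refine hF.comp (Continuous.measurable ?_)
    unfold sphPt; fun_prop
  rw [← lintegral_sphPt b hm, ← lintegral_mul_const _ hS.lintegral_prod_right']
  refine lintegral_congr fun φ => ?_
  rw [← lintegral_indicator_one measurableSet_Ioo, ← lintegral_const_mul _ measurable_indicator_unit]
  refine lintegral_congr_ae ?_
  filter_upwards [ae_radMeas_pos] with r hr
  rw [← lintegral_mul_const _ (hSφ φ)]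
  refine lintegral_congr fun θ => ?_
  have : sphPt b φ r θ = r • sphPt b φ 1 θ := by simp [sphPt]
  rw [this]
  exact hunit _ (by rw [norm_sphPt, abs_one]) r hr

/-- The shell integral is computed with the area measure and in spherical coordinates; the radial
factor is 1/3 in both and cancels. -/
lemma lintegral_sphMeas (b : OrthonormalBasis (Fin 3) ℝ E3) {F : E3 → ℝ≥0∞} (hF : Measurable F) :
    ∫⁻ u : Metric.sphere (0 : E3) 1, F u ∂sphMeas =
      ∫⁻ φ in Set.Ioo (-π) π, ∫⁻ θ, F (sphPt b φ 1 θ) ∂angMeas := by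
  obtain ⟨h, hm, hunit⟩ := exists_shell hF
  have e1 := (lintegral_shell_sphere hF hm hunit).symm.trans (lintegral_shell_sphPt b hF hm hunit)
  rw [radMeas_Ioo] at e1
  exact (ENNReal.mul_left_inj (by simp) (by simp)).mp e1

end MKG

namespace MKG

open Topology Filter Real

/-! ### Legendre polynomials -/

/-- W = (X² - 1)^q satisfies (X² - 1)W' = 2qXW. Differentiating this relation n + 1 times gives the
claim. -/
lemma rodrigues_ode (q n : ℕ) :
    (X ^ 2 - 1) * derivative^[n + 2] ((X ^ 2 - 1 : ℝ[X]) ^ q) =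
      C (2 * ((q : ℝ) - n - 1)) * X * derivative^[n + 1] ((X ^ 2 - 1 : ℝ[X]) ^ q) +
      C (((n : ℝ) + 1) * (2 * q - n)) * derivative^[n] ((X ^ 2 - 1 : ℝ[X]) ^ q) := by
  set w : ℝ[X] := (X ^ 2 - 1) ^ q
  have h0 : (X ^ 2 - 1) * derivative w = C (2 * (q : ℝ)) * X * w := by
    rcases q with _ | q
    · simp [w]
    · have hd : derivative (X ^ 2 - 1 : ℝ[X]) = 2 * X := by simp; norm_num
      rw [show derivative w = C ((q + 1 : ℕ) : ℝ) * (X ^ 2 - 1) ^ q * derivative (X ^ 2 - 1 : ℝ[X]) from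
        derivative_pow_succ _ _ |>.trans (by push_cast; rfl), hd]
      simp only [w, map_mul, map_natCast, map_ofNat, pow_succ]
      ring
  induction n with
  | zero =>
    have h1 := congrArg derivative h0
    simp only [derivative_mul, derivative_sub, derivative_pow, derivative_X, derivative_one, derivative_C] at h1
    simp only [Function.iterate_succ, Function.comp_apply, Function.iterate_zero, id_eq]
    simp only [map_mul, map_sub, map_natCast, map_ofNat, Nat.cast_zero, map_zero, map_add, map_one, Nat.cast_ofNat] at h1 ⊢
    linear_combination h1
  | succ n ih =>
    have h1 := congrArg derivative ih
    simp only [derivative_mul, derivative_add, derivative_sub, derivative_pow, derivative_X, derivative_one,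
      derivative_C, ← Function.iterate_succ_apply' (f := derivative)] at h1
    simp only [map_mul, map_sub, map_natCast, map_ofNat, map_add, map_one, Nat.cast_succ] at h1 ⊢
    linear_combination h1

lemma legendre_ode (q n : ℕ) :
    (1 - X ^ 2) * derivative^[n + 2] (legendre q) =
      C (2 * ((n : ℝ) + 1)) * X * derivative^[n + 1] (legendre q) -
      C (((q : ℝ) - n) * (q + n + 1)) * derivative^[n] (legendre q) := by
  have h := rodrigues_ode q (n + q)
  simp only [legendre, iterate_derivative_C_mul, ← Function.iterate_add_apply]
  rw [show n + 2 + q = n + q + 2 by ring, show n + 1 + q = n + q + 1 by ring]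
  simp only [map_mul, map_sub, map_natCast, map_ofNat, map_add, map_one, Nat.cast_add] at h ⊢
  linear_combination -(C (2 ^ q * (q.factorial : ℝ))⁻¹) * h

/-- For s = ±1 the base factors as (X - s)^q (X + s)^q. At s only the Leibniz term in which all q
derivatives fall on the first factor survives. -/
lemma legendre_eval_sq (q : ℕ) (s : ℝ) (hs : s ^ 2 = 1) : ((legendre q).eval s) ^ 2 = 1 := by
  have h1 : (X ^ 2 - 1 : ℝ[X]) ^ q = (X - C s) ^ q * (X + C s) ^ q := by
    rw [← mul_pow]; congr 1
    have : (C s) ^ 2 = (1 : ℝ[X]) := by rw [← C_pow, hs, C_1]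
    linear_combination this
  have h2 : (derivative^[q] ((X ^ 2 - 1 : ℝ[X]) ^ q)).eval s = q.factorial * (2 * s) ^ q := by
    rw [h1, iterate_derivative_mul, eval_finsetSum, Finset.sum_eq_single 0]
    · simp [iterate_derivative_X_sub_pow_self]
      simp only [two_mul, true_or]
    · intro k hk hk0
      have : (eval s) (derivative^[q - k] ((X - C s) ^ q)) = 0 := by
        rw [iterate_derivative_X_sub_pow]
        simp only [Finset.mem_range] at hk
        rw [show q - (q - k) = k by omega]
        simp [hk0]
      simp [eval_mul, this]
    · simp
  rw [legendre, eval_mul, eval_C, h2]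
  have : (q.factorial : ℝ) ≠ 0 := by positivity
  have h3 : (s ^ q) ^ 2 = 1 := by rw [← pow_mul, mul_comm, pow_mul, hs, one_pow]
  field_simp
  rw [mul_pow, mul_pow, h3]; ring

/-- With p = P_q and c = q(q+1), the function V = c p² + (1 - x²)p'² has derivative 2x p'² by
Legendre's equation. It decreases on [-1,0], increases on [0,1] and equals c at both ends; hence c
p² ≤ V ≤ c. -/
lemma legendre_sq_le_one (q : ℕ) (x : ℝ) (hx : x ∈ Set.Icc (-1 : ℝ) 1) : ((legendre q).eval x) ^ 2 ≤ 1 := by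
  rcases q with _ | q
  · simp [legendre]
  set p := legendre (q + 1)
  set c : ℝ := ((q + 1 : ℕ) : ℝ) * ((q + 1 : ℕ) + 1) with hc
  have hcpos : 0 < c := by positivity
  set V : ℝ[X] := C c * p ^ 2 + (1 - X ^ 2) * (derivative p) ^ 2
  have hode := legendre_ode (q + 1) 0
  have hV : derivative V = 2 * X * (derivative p) ^ 2 := by
    simp only [Function.iterate_succ, Function.comp_apply, Function.iterate_zero, id_eq, Nat.cast_zero, zero_add, mul_one,
      sub_zero, add_zero, ← hc] at hode
    simp only [V, derivative_add, derivative_mul, derivative_C, derivative_pow, derivative_sub, derivative_one,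
      derivative_X, Nat.cast_ofNat]
    simp only [map_ofNat] at hode ⊢
    linear_combination 2 * derivative p * hode
  have hd : ∀ y, HasDerivAt (fun y => V.eval y) (2 * y * ((derivative p).eval y) ^ 2) y := fun y => by
    have := V.hasDerivAt y
    rw [hV] at this; simpa using this
  have hVx : c * (p.eval x) ^ 2 ≤ V.eval x := by
    have : 0 ≤ (1 - x ^ 2) * ((derivative p).eval x) ^ 2 := by
      have : x ^ 2 ≤ 1 := by nlinarith [hx.1, hx.2]
      exact mul_nonneg (by linarith) (sq_nonneg _)
    simp only [V, eval_add, eval_mul, eval_C, eval_pow, eval_sub, eval_one, eval_X]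
    linarith
  have hend : ∀ s : ℝ, s ^ 2 = 1 → V.eval s = c := by
    intro s hs
    have := legendre_eval_sq (q + 1) s hs
    simp only [V, eval_add, eval_mul, eval_C, eval_pow, eval_sub, eval_one, eval_X, hs]
    rw [this]; ring
  have hle : V.eval x ≤ c := by
    rcases le_total 0 x with h | h
    · have hm : MonotoneOn (fun y => V.eval y) (Set.Ici 0) := by
        refine monotoneOn_of_deriv_nonneg (convex_Ici 0) V.continuous.continuousOn
          (V.differentiable.differentiableOn) fun y hy => ?_
        rw [(hd y).deriv]
        rw [interior_Ici] at hy
        have : (0 : ℝ) < y := hy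
        positivity
      rw [← hend 1 (by norm_num)]
      exact hm (Set.mem_Ici.mpr h) (Set.mem_Ici.mpr zero_le_one) hx.2
    · have hm : AntitoneOn (fun y => V.eval y) (Set.Iic 0) := by
        refine antitoneOn_of_deriv_nonpos (convex_Iic 0) V.continuous.continuousOn
          (V.differentiable.differentiableOn) fun y hy => ?_
        rw [(hd y).deriv]
        rw [interior_Iic] at hy
        have : y < (0 : ℝ) := hy
        exact mul_nonpos_of_nonpos_of_nonneg (by linarith) (sq_nonneg _)
      rw [← hend (-1) (by norm_num)]
      exact hm (Set.mem_Iic.mpr (by norm_num)) (Set.mem_Iic.mpr h) hx.1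
  by_contra hcon
  push Not at hcon
  nlinarith

/-- The weighted `L²` norm of a derivative of a Legendre polynomial. -/
noncomputable def legendreInt (q n : ℕ) : ℝ :=
  ∫ x in (-1 : ℝ)..1, (1 - x ^ 2) ^ n * ((derivative^[n] (legendre q)).eval x) ^ 2

/-- Integrate the derivative of (1 - x²)^{n+1} p p', with p the n-th derivative: the boundary values
vanish and the Legendre equation evaluates the rest. -/
lemma legendreInt_succ (q n : ℕ) :
    legendreInt q (n + 1) = ((q : ℝ) - n) * (q + n + 1) * legendreInt q n := by
  set p := derivative^[n] (legendre q)
  have h1 : derivative^[n + 1] (legendre q) = derivative p := Function.iterate_succ_apply' _ _ _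
  have h2 : derivative^[n + 2] (legendre q) = derivative (derivative p) := by
    rw [Function.iterate_succ_apply', h1]
  have hode := legendre_ode q n
  rw [h1, h2] at hode
  set c : ℝ := ((q : ℝ) - n) * (q + n + 1)
  set V : ℝ[X] := (1 - X ^ 2) ^ (n + 1) * derivative p * p
  have hV : derivative V = (1 - X ^ 2) ^ (n + 1) * (derivative p) ^ 2 - C c * ((1 - X ^ 2) ^ n * p ^ 2) := by
    simp only [V, derivative_mul, derivative_pow, derivative_sub, derivative_one, derivative_X, Nat.add_sub_cancel]
    simp only [map_natCast, map_mul, map_add, map_one, map_ofNat, Nat.cast_add, Nat.cast_one, Nat.cast_ofNat] at hode ⊢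
    linear_combination ((1 - X ^ 2) ^ n * p) * hode
  have h3 : ∫ x in (-1 : ℝ)..1, (derivative V).eval x = 0 := by
    rw [intervalIntegral.integral_eq_sub_of_hasDerivAt (fun x _ => V.hasDerivAt x)
      ((derivative V).continuous.intervalIntegrable _ _)]
    simp [V]
  have h4 : ∀ x, (derivative V).eval x = (1 - x ^ 2) ^ (n + 1) * ((derivative p).eval x) ^ 2 -
      c * ((1 - x ^ 2) ^ n * (p.eval x) ^ 2) := fun x => by rw [hV]; simp
  simp only [h4] at h3
  rw [intervalIntegral.integral_sub, intervalIntegral.integral_const_mul] at h3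
  · unfold legendreInt
    rw [h1]
    linarith
  · exact Continuous.intervalIntegrable (by fun_prop) _ _
  · exact Continuous.intervalIntegrable (by fun_prop) _ _

/-- The factorials in the normalization cancel the recursion of `legendreInt_succ` exactly, so the
bound for n = 0, which only uses |P_q| ≤ 1, persists. -/
lemma legendreInt_le (q n : ℕ) (h : n ≤ q) :
    ((q - n).factorial : ℝ) / ((q + n).factorial : ℝ) * legendreInt q n ≤ 2 := by
  induction n with
  | zero =>
    have h0 : legendreInt q 0 ≤ 2 := by
      unfold legendreInt
      have : ∫ x in (-1 : ℝ)..1, (1 - x ^ 2) ^ 0 * ((derivative^[0] (legendre q)).eval x) ^ 2 ≤ ∫ x in (-1 : ℝ)..1, (1 : ℝ) := by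
        refine intervalIntegral.integral_mono_on (by norm_num) (Continuous.intervalIntegrable (by fun_prop) _ _)
          (by simp) fun x hx => ?_
        simpa using legendre_sq_le_one q x hx
      refine this.trans (by norm_num)
    have : (q.factorial : ℝ) ≠ 0 := by positivity
    simpa [div_self this] using h0
  | succ n ih =>
    have h1 := ih (by omega)
    rw [legendreInt_succ]
    obtain ⟨r, rfl⟩ : ∃ r, q = n + 1 + r := ⟨q - (n + 1), by omega⟩
    have e1 : n + 1 + r - (n + 1) = r := by omega
    have e2 : n + 1 + r - n = r + 1 := by omega
    rw [e2, Nat.factorial_succ] at h1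
    rw [e1, show n + 1 + r + (n + 1) = (n + 1 + r + n) + 1 by ring, Nat.factorial_succ]
    refine le_trans (le_of_eq ?_) h1
    have : ((n + 1 + r + n).factorial : ℝ) ≠ 0 := by positivity
    have : ((r : ℕ).factorial : ℝ) ≠ 0 := by positivity
    push_cast
    have : (n + 1 + r + n + 1 : ℝ) ≠ 0 := by positivity
    field_simp
    ring

lemma natDegree_legendre_le (q n : ℕ) : (derivative^[n] (legendre q)).natDegree ≤ q - n := by
  refine (natDegree_iterate_derivative _ _).trans (Nat.sub_le_sub_right ?_ n)
  refine (natDegree_C_mul_le _ _).trans ((natDegree_iterate_derivative _ _).trans ?_)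
  have : ((X ^ 2 - 1 : ℝ[X]) ^ q).natDegree ≤ q * 2 := by
    refine natDegree_pow_le_of_le q ?_
    compute_degree
  omega

end MKG

namespace MKG

open Topology Filter Real

/-! ### Spherical harmonics and the projections `S_l` -/

/-- The orthonormal basis whose first vector is the third coordinate axis. -/
noncomputable def axisBasis : OrthonormalBasis (Fin 3) ℝ E3 :=
  (EuclideanSpace.basisFun (Fin 3) ℝ).reindex (Equiv.addRight (1 : Fin 3))

lemma continuous_Y (q : ℕ) (n : ℤ) : Continuous (Y q n) := by
  unfold Y
  have h : ∀ i : Fin 3, Continuous fun x : E3 => ((x i : ℝ) : ℂ) := fun i => by fun_prop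
  have h2 : Continuous fun x : E3 => (((derivative^[n.natAbs] (legendre q)).eval (x 2) : ℝ) : ℂ) :=
    Complex.continuous_ofReal.comp ((Polynomial.continuous _).comp (by fun_prop))
  exact (continuous_const.mul (((h 0).add (continuous_const.mul (h 1))).pow _)).mul h2

/-- The square of the modulus of a spherical harmonic. -/
lemma norm_Y_sq (q : ℕ) (n : ℤ) (x : E3) : ‖Y q n x‖ ^ 2 =
    (2 * q + 1) / (4 * π) * (((q - n.natAbs).factorial : ℝ) / ((q + n.natAbs).factorial : ℝ)) *
      ((x 0 ^ 2 + x 1 ^ 2) ^ n.natAbs * ((derivative^[n.natAbs] (legendre q)).eval (x 2)) ^ 2) := by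
  unfold Y
  have h1 : ‖((x 0 : ℝ) : ℂ) + (if 0 ≤ n then 1 else -1) * Complex.I * ((x 1 : ℝ) : ℂ)‖ ^ 2 = x 0 ^ 2 + x 1 ^ 2 := by
    rw [← Complex.normSq_eq_norm_sq, Complex.normSq_apply]
    split_ifs <;> simp <;> ring
  rw [norm_mul, norm_mul, norm_pow, mul_pow, mul_pow, ← pow_mul, mul_comm n.natAbs 2, pow_mul, h1,
    Complex.norm_real, Complex.norm_real, norm_eq_abs, norm_eq_abs, sq_abs, sq_abs, sq_sqrt (by positivity)]
  ring

/-- A crude form of the normalization. It is enough because powers of 2^l are harmless in the final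
estimate, and it avoids the orthogonality relations altogether. -/
lemma lintegral_norm_Y (q : ℕ) (n : ℤ) (hn : n.natAbs ≤ q) :
    ∫⁻ u : Metric.sphere (0 : E3) 1, ‖Y q n u‖ₑ ^ (2 : ℝ) ∂sphMeas ≤ ENNReal.ofReal (2 * q + 1) := by
  have hm : Measurable fun x : E3 => ‖Y q n x‖ₑ ^ (2 : ℝ) := by
    have := (continuous_Y q n).measurable; fun_prop
  rw [lintegral_sphMeas axisBasis hm]
  set a := n.natAbs
  set c : ℝ := (2 * q + 1) / (4 * π) * (((q - a).factorial : ℝ) / ((q + a).factorial : ℝ)) with hc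
  have hc0 : 0 ≤ c := by positivity
  set W : ℝ → ℝ := fun y => (1 - y ^ 2) ^ a * ((derivative^[a] (legendre q)).eval y) ^ 2 with hW
  have hWc : Continuous W := by fun_prop
  have hcoord : ∀ φ θ, (sphPt axisBasis φ 1 θ) 0 ^ 2 + (sphPt axisBasis φ 1 θ) 1 ^ 2 = 1 - cos θ ^ 2 ∧
      (sphPt axisBasis φ 1 θ) 2 = cos θ := by
    intro φ θ
    have e0 : axisBasis 0 = EuclideanSpace.single 2 1 := by
      simp [axisBasis, OrthonormalBasis.reindex_apply]; rfl
    have e1 : axisBasis 1 = EuclideanSpace.single 0 1 := by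
      simp [axisBasis, OrthonormalBasis.reindex_apply]
    have e2 : axisBasis 2 = EuclideanSpace.single 1 1 := by
      simp [axisBasis, OrthonormalBasis.reindex_apply]; rfl
    constructor
    · simp [sphPt, e0, e1, e2]
      nlinarith [sin_sq_add_cos_sq θ, sin_sq_add_cos_sq φ]
    · simp [sphPt, e0, e1, e2]
  have hpt : ∀ φ θ, ‖Y q n (sphPt axisBasis φ 1 θ)‖ₑ ^ (2 : ℝ) = ENNReal.ofReal (c * W (cos θ)) := by
    intro φ θ
    rw [ENNReal.rpow_two, ← ofReal_norm, ← ENNReal.ofReal_pow (norm_nonneg _), norm_Y_sq, (hcoord φ θ).1, (hcoord φ θ).2]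
  simp_rw [hpt]
  have hW0 : ∀ θ, 0 ≤ W (cos θ) := fun θ =>
    mul_nonneg (pow_nonneg (by nlinarith [sin_sq_add_cos_sq θ, sq_nonneg (sin θ)]) _) (sq_nonneg _)
  have hin : ∫⁻ θ, ENNReal.ofReal (c * W (cos θ)) ∂angMeas = ENNReal.ofReal (c * legendreInt q a) := by
    unfold angMeas
    rw [lintegral_withDensity_eq_lintegral_mul _ (by fun_prop) (by fun_prop)]
    have hs : ∀ θ ∈ Set.Ioo 0 π, ((fun θ => ENNReal.ofReal (sin θ)) * fun θ => ENNReal.ofReal (c * W (cos θ))) θ =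
        ENNReal.ofReal (sin θ * (c * W (cos θ))) := fun θ hθ => by
      rw [Pi.mul_apply, ← ENNReal.ofReal_mul (sin_pos_of_pos_of_lt_pi hθ.1 hθ.2).le]
    rw [setLIntegral_congr_fun measurableSet_Ioo hs, ← ofReal_integral_eq_lintegral_ofReal]
    · congr 1
      rw [← integral_Ioc_eq_integral_Ioo, ← intervalIntegral.integral_of_le pi_pos.le]
      have h1 := intervalIntegral.integral_comp_mul_deriv (a := 0) (b := π) (f := cos) (f' := fun θ => - sin θ) (g := W)
        (fun x _ => hasDerivAt_cos x) (by fun_prop) hWc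
      rw [cos_zero, cos_pi, intervalIntegral.integral_symm (-1) 1, eq_comm, neg_eq_iff_eq_neg] at h1
      unfold legendreInt
      rw [show (∫ x in (-1 : ℝ)..1, (1 - x ^ 2) ^ a * eval x (derivative^[a] (legendre q)) ^ 2) = ∫ x in (-1 : ℝ)..1, W x from rfl,
        h1, ← intervalIntegral.integral_neg, ← intervalIntegral.integral_const_mul]
      refine intervalIntegral.integral_congr fun θ _ => ?_
      simp only [Function.comp_apply]
      ring
    · exact ((by fun_prop : Continuous fun θ => sin θ * (c * W (cos θ))).integrableOn_Icc).mono_set Set.Ioo_subset_Icc_self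
    · refine (ae_restrict_iff' measurableSet_Ioo).mpr (ae_of_all _ fun θ hθ => ?_)
      exact mul_nonneg (sin_pos_of_pos_of_lt_pi hθ.1 hθ.2).le (mul_nonneg hc0 (hW0 θ))
  rw [hin, lintegral_const, Measure.restrict_apply_univ, Real.volume_Ioo, ← ENNReal.ofReal_mul']
  · refine ENNReal.ofReal_le_ofReal ?_
    have := legendreInt_le q a hn
    have hp := pi_pos
    have e : c * legendreInt q a * (π - -π) = (2 * q + 1) / 2 *
        (((q - a).factorial : ℝ) / ((q + a).factorial : ℝ) * legendreInt q a) := by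
      rw [hc]; field_simp; ring
    rw [e]
    calc _ ≤ (2 * (q : ℝ) + 1) / 2 * 2 := by gcongr
      _ = _ := by ring
  · linarith [pi_pos]

/-- The factor (x₀ ± i x₁)^{|n|} has degree |n|, and the derivative of the Legendre polynomial has
degree at most q - |n|. -/
lemma angDeg_Y (q : ℕ) (n : ℤ) (hn : n.natAbs ≤ q) : AngDeg q (fun x => Y q n (‖x‖⁻¹ • x)) := by
  have hc : ∀ i : Fin 3, AngDeg 1 (fun x : E3 => (((‖x‖⁻¹ • x) i : ℝ) : ℂ)) := fun i => by
    have := (AngDeg.radial (D := 0) (fun r => ((r⁻¹ : ℝ) : ℂ))).mul (AngDeg.coord i)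
    simpa using this
  set a := n.natAbs
  have h1 : AngDeg a (fun x : E3 => ((((‖x‖⁻¹ • x) 0 : ℝ) : ℂ) + (if 0 ≤ n then 1 else -1) * Complex.I *
      (((‖x‖⁻¹ • x) 1 : ℝ) : ℂ)) ^ a) := by
    have := ((hc 0).add ((hc 1).const_mul ((if 0 ≤ n then 1 else -1) * Complex.I))).pow a
    simpa using this
  have h2 : AngDeg (q - a) (fun x : E3 => (((derivative^[a] (legendre q)).eval ((‖x‖⁻¹ • x) 2) : ℝ) : ℂ)) := by
    set p := derivative^[a] (legendre q)
    have : (fun x : E3 => ((p.eval ((‖x‖⁻¹ • x) 2) : ℝ) : ℂ)) = fun x =>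
        ∑ i ∈ Finset.range (q - a + 1), ((p.coeff i : ℝ) : ℂ) * (((‖x‖⁻¹ • x) 2 : ℝ) : ℂ) ^ i := by
      funext x
      rw [eval_eq_sum_range' (Nat.lt_succ_of_le (natDegree_legendre_le q a))]
      push_cast; rfl
    rw [this]
    refine AngDeg.sum _ fun i hi => ?_
    have := ((hc 2).pow i).mono (show i * 1 ≤ q - a by simp only [Finset.mem_range] at hi; omega)
    exact this.const_mul _
  have h3 := ((h1.const_mul ((Real.sqrt ((2 * q + 1) / (4 * Real.pi) *
      (((q - n.natAbs).factorial : ℝ) / ((q + n.natAbs).factorial : ℝ))) : ℝ) : ℂ)).mul h2)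
  exact h3.mono (by omega)

/-- The multiplier of `S_l`. -/
noncomputable def angWeight (φ : ℝ → ℝ) (l q : ℕ) : ℝ := if l = 0 then phiLe φ 0 q else phiK φ l q

lemma angWeight_eq_zero {φ : ℝ → ℝ} (hφ : IsCutoff φ) {l q : ℕ} (h : 2 ^ (l + 1) ≤ q) : angWeight φ l q = 0 := by
  have hq : (2 : ℝ) ^ (l + 1) ≤ q := by exact_mod_cast h
  have key : ∀ y : ℝ, 8 / 5 < y → φ y = 0 := fun y hy => by
    by_contra h0
    have := hφ.supp y h0
    rw [abs_of_pos (by linarith)] at this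
    linarith
  have h1 : φ ((q : ℝ) / 2 ^ (l : ℤ)) = 0 := key _ (by
    rw [zpow_natCast, lt_div_iff₀ (by positivity)]
    rw [pow_succ] at hq
    have : (0 : ℝ) < 2 ^ l := by positivity
    linarith)
  have h2 : φ ((q : ℝ) / 2 ^ ((l : ℤ) - 1)) = 0 := key _ (by
    rw [zpow_sub₀ two_ne_zero, zpow_natCast, zpow_one, lt_div_iff₀ (by positivity)]
    rw [pow_succ] at hq
    have : (0 : ℝ) < 2 ^ l := by positivity
    linarith)
  unfold angWeight phiLe phiK
  split_ifs with h0
  · subst h0; simpa using h1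
  · rw [h1, h2, sub_zero]

lemma abs_angWeight_le {φ : ℝ → ℝ} (hφ : IsCutoff φ) (l q : ℕ) : |angWeight φ l q| ≤ 1 := by
  unfold angWeight phiLe phiK
  rw [abs_le]
  split_ifs
  · constructor <;> linarith [hφ.nonneg ((q : ℝ) / 2 ^ (0 : ℤ)), hφ.le_one ((q : ℝ) / 2 ^ (0 : ℤ))]
  · constructor <;> linarith [hφ.nonneg ((q : ℝ) / 2 ^ (l : ℤ)), hφ.le_one ((q : ℝ) / 2 ^ (l : ℤ)),
      hφ.nonneg ((q : ℝ) / 2 ^ ((l : ℤ) - 1)), hφ.le_one ((q : ℝ) / 2 ^ ((l : ℤ) - 1))]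

lemma S_eq_sum {φ : ℝ → ℝ} (hφ : IsCutoff φ) (l : ℕ) (f : E3 → ℂ) : S φ l f = fun x =>
    ∑ q ∈ Finset.range (2 ^ (l + 1)), ∑ n ∈ Finset.Icc (-(q : ℤ)) q,
      ((angWeight φ l q : ℝ) : ℂ) * sphCoeff f q n ‖x‖ * Y q n (‖x‖⁻¹ • x) := by
  funext x
  unfold S
  rw [tsum_eq_sum (s := Finset.range (2 ^ (l + 1)))]
  · rfl
  · intro q hq
    have := angWeight_eq_zero hφ (l := l) (q := q) (by simpa using hq)
    unfold angWeight at this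
    simp [this]

lemma angDeg_S {φ : ℝ → ℝ} (hφ : IsCutoff φ) (l : ℕ) (f : E3 → ℂ) : AngDeg (2 ^ (l + 1)) (S φ l f) := by
  rw [S_eq_sum hφ]
  refine AngDeg.sum _ fun q hq => AngDeg.sum _ fun n hn => ?_
  simp only [Finset.mem_range, Finset.mem_Icc] at hq hn
  have h := (AngDeg.radial (D := 0) (fun r => ((angWeight φ l q : ℝ) : ℂ) * sphCoeff f q n r)).mul
    (angDeg_Y q n (by omega))
  exact h.mono (by omega)

lemma eLpNorm_Y (q : ℕ) (n : ℤ) (hn : n.natAbs ≤ q) :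
    eLpNorm (fun u : Metric.sphere (0 : E3) 1 => Y q n u) 2 sphMeas * eLpNorm (fun u : Metric.sphere (0 : E3) 1 => Y q n u) 2 sphMeas
      ≤ ENNReal.ofReal (2 * q + 1) := by
  have h1 := eLpNorm_nnreal_pow_eq_lintegral (f := fun u : Metric.sphere (0 : E3) 1 => Y q n u) (μ := sphMeas)
    (p := 2) two_ne_zero
  have h2 := lintegral_norm_Y q n hn
  simp only [NNReal.coe_ofNat, ENNReal.coe_ofNat] at h1
  rw [← pow_two, ← ENNReal.rpow_two, h1]
  exact h2

lemma enorm_sphCoeff_le (f : E3 → ℂ) (q : ℕ) (n : ℤ) (r : ℝ)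
    (hf : AEStronglyMeasurable (fun u : Metric.sphere (0 : E3) 1 => f (r • (u : E3))) sphMeas) :
    ‖sphCoeff f q n r‖ₑ ≤ eLpNorm (fun u : Metric.sphere (0 : E3) 1 => f (r • (u : E3))) 2 sphMeas *
      eLpNorm (fun u : Metric.sphere (0 : E3) 1 => Y q n u) 2 sphMeas := by
  have hY : AEStronglyMeasurable (fun u : Metric.sphere (0 : E3) 1 => (starRingEnd ℂ) (Y q n u)) sphMeas :=
    (Complex.continuous_conj.comp ((continuous_Y q n).comp continuous_subtype_val)).aestronglyMeasurable
  have h1 := eLpNorm_smul_le_mul_eLpNorm (p := 2) (q := 2) (r := 1) hY hf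
  have h2 : eLpNorm (fun u : Metric.sphere (0 : E3) 1 => (starRingEnd ℂ) (Y q n u)) 2 sphMeas =
      eLpNorm (fun u : Metric.sphere (0 : E3) 1 => Y q n u) 2 sphMeas :=
    eLpNorm_congr_norm_ae (ae_of_all _ fun u => by simp)
  rw [h2, eLpNorm_one_eq_lintegral_enorm] at h1
  exact (enorm_integral_le_lintegral_enorm _).trans h1

/-- The triangle inequality over at most 2^{l+1} degrees q and, for each, at most 2^{l+2} values of
n. By Cauchy-Schwarz each term has operator norm at most 2q + 1 ≤ 2^{l+2}; the three exponents add
up to 3l + 5. -/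
lemma eLpNorm_S_sphere {φ : ℝ → ℝ} (hφ : IsCutoff φ) (l : ℕ) (f : E3 → ℂ) {r : ℝ} (hr : 0 < r)
    (hf : AEStronglyMeasurable (fun u : Metric.sphere (0 : E3) 1 => f (r • (u : E3))) sphMeas) :
    eLpNorm (fun u : Metric.sphere (0 : E3) 1 => S φ l f (r • (u : E3))) 2 sphMeas ≤
      ENNReal.ofReal (2 ^ (3 * l + 5)) * eLpNorm (fun u : Metric.sphere (0 : E3) 1 => f (r • (u : E3))) 2 sphMeas := by
  set Nf := eLpNorm (fun u : Metric.sphere (0 : E3) 1 => f (r • (u : E3))) 2 sphMeas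
  have h1 : (fun u : Metric.sphere (0 : E3) 1 => S φ l f (r • (u : E3))) =
      ∑ q ∈ Finset.range (2 ^ (l + 1)), ∑ n ∈ Finset.Icc (-(q : ℤ)) q,
        fun u : Metric.sphere (0 : E3) 1 => (((angWeight φ l q : ℝ) : ℂ) * sphCoeff f q n r) * Y q n u := by
    funext u
    have hn : ‖r • (u : E3)‖ = r := by rw [norm_smul, norm_eq_of_mem_sphere, mul_one, norm_of_nonneg hr.le]
    rw [S_eq_sum hφ]
    simp only [Finset.sum_apply, hn, smul_smul, inv_mul_cancel₀ hr.ne', one_smul]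
  have hYm : ∀ (q : ℕ) (n : ℤ) (c : ℂ), AEStronglyMeasurable (fun u : Metric.sphere (0 : E3) 1 => c * Y q n u) sphMeas :=
    fun q n c => ((continuous_const.mul ((continuous_Y q n).comp continuous_subtype_val)) :
      Continuous fun u : Metric.sphere (0 : E3) 1 => c * Y q n u).aestronglyMeasurable
  have hterm : ∀ q ∈ Finset.range (2 ^ (l + 1)), ∀ n ∈ Finset.Icc (-(q : ℤ)) q,
      eLpNorm (fun u : Metric.sphere (0 : E3) 1 => (((angWeight φ l q : ℝ) : ℂ) * sphCoeff f q n r) * Y q n u) 2 sphMeas ≤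
        ENNReal.ofReal (2 ^ (l + 2)) * Nf := by
    intro q hq n hn
    simp only [Finset.mem_range, Finset.mem_Icc] at hq hn
    refine (eLpNorm_const_smul_le (c := ((angWeight φ l q : ℝ) : ℂ) * sphCoeff f q n r)
      (f := fun u : Metric.sphere (0 : E3) 1 => Y q n u)).trans ?_
    rw [enorm_mul]
    have e1 : ‖((angWeight φ l q : ℝ) : ℂ)‖ₑ ≤ 1 := by
      rw [← ofReal_norm, Complex.norm_real, ← ENNReal.ofReal_one]
      exact ENNReal.ofReal_le_ofReal (abs_angWeight_le hφ l q)
    have e2 := enorm_sphCoeff_le f q n r hf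
    have e3 := eLpNorm_Y q n (by omega)
    set y := eLpNorm (fun u : Metric.sphere (0 : E3) 1 => Y q n u) 2 sphMeas
    have hq' : (q : ℝ) + 1 ≤ 2 ^ (l + 1) := by exact_mod_cast hq
    calc ‖((angWeight φ l q : ℝ) : ℂ)‖ₑ * ‖sphCoeff f q n r‖ₑ * y ≤ 1 * (Nf * y) * y := by gcongr
      _ = (y * y) * Nf := by ring
      _ ≤ ENNReal.ofReal (2 ^ (l + 2)) * Nf := by
        gcongr
        refine e3.trans (ENNReal.ofReal_le_ofReal ?_)
        rw [pow_succ]; linarith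
  rw [h1]
  refine (eLpNorm_sum_le (fun q _ => Finset.aestronglyMeasurable_sum _ fun n _ => hYm q n _) (by norm_num)).trans ?_
  have hq : ∀ q ∈ Finset.range (2 ^ (l + 1)), eLpNorm (∑ n ∈ Finset.Icc (-(q : ℤ)) q,
      fun u : Metric.sphere (0 : E3) 1 => (((angWeight φ l q : ℝ) : ℂ) * sphCoeff f q n r) * Y q n u) 2 sphMeas ≤
        ENNReal.ofReal (2 ^ (l + 2)) * (ENNReal.ofReal (2 ^ (l + 2)) * Nf) := by
    intro q hq
    refine (eLpNorm_sum_le (fun n _ => hYm q n _) (by norm_num)).trans ((Finset.sum_le_sum (hterm q hq)).trans ?_)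
    rw [Finset.sum_const, nsmul_eq_mul, Int.card_Icc]
    gcongr
    rw [← ENNReal.ofReal_natCast]
    refine ENNReal.ofReal_le_ofReal ?_
    have : ((q : ℤ) + 1 - -(q : ℤ)).toNat = 2 * q + 1 := by omega
    rw [this]
    simp only [Finset.mem_range] at hq
    have : 2 * q + 1 ≤ 2 ^ (l + 2) := by rw [pow_succ]; omega
    exact_mod_cast this
  refine (Finset.sum_le_sum hq).trans (le_of_eq ?_)
  rw [Finset.sum_const, nsmul_eq_mul, Finset.card_range, ← ENNReal.ofReal_natCast, ← mul_assoc, ← mul_assoc,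
    ← ENNReal.ofReal_mul (by positivity), ← ENNReal.ofReal_mul (by positivity)]
  congr 2
  push_cast
  ring

lemma eLpNorm_sq_sphere {f : E3 → ℂ} (hf : AEStronglyMeasurable f volume) :
    eLpNorm f 2 volume ^ (2 : ℝ) =
      ∫⁻ r, eLpNorm (fun u : Metric.sphere (0 : E3) 1 => f (r • (u : E3))) 2 sphMeas ^ (2 : ℝ) ∂radMeas := by
  have h1 : ∀ {α : Type} [MeasurableSpace α] (μ : Measure α) (g : α → ℂ),
      eLpNorm g 2 μ ^ (2 : ℝ) = ∫⁻ x, ‖g x‖ₑ ^ (2 : ℝ) ∂μ := fun μ g => by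
    have := eLpNorm_nnreal_pow_eq_lintegral (f := g) (μ := μ) (p := 2) two_ne_zero
    simpa only [NNReal.coe_ofNat, ENNReal.coe_ofNat] using this
  have h2 := eLpNorm_comp_measurePreserving (p := 2) hf measurePreserving_sphere
  have h3 := hf.comp_measurePreserving measurePreserving_sphere
  rw [← h2, h1, lintegral_prod_symm]
  · refine lintegral_congr fun r => ?_
    rw [h1]; rfl
  · exact h3.enorm.pow_const _

lemma eLpNorm_S_le {φ : ℝ → ℝ} (hφ : IsCutoff φ) (l : ℕ) {f : E3 → ℂ} (hf : AEStronglyMeasurable f volume)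
    (hS : AEStronglyMeasurable (S φ l f) volume) :
    eLpNorm (S φ l f) 2 volume ≤ ENNReal.ofReal (2 ^ (3 * l + 5)) * eLpNorm f 2 volume := by
  have h0 : (0 : ℝ) < 2 := two_pos
  rw [← ENNReal.rpow_le_rpow_iff h0, ENNReal.mul_rpow_of_nonneg _ _ h0.le, eLpNorm_sq_sphere hS, eLpNorm_sq_sphere hf,
    ← lintegral_const_mul' _ _ (by simp)]
  refine lintegral_mono_ae ?_
  have h3 := (hf.comp_measurePreserving measurePreserving_sphere).prod_swap.prodMk_left
  filter_upwards [ae_radMeas_pos, h3] with r hr hm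
  rw [← ENNReal.mul_rpow_of_nonneg _ _ h0.le]
  gcongr
  exact eLpNorm_S_sphere hφ l f hr hm

end MKG

namespace MKG

open Topology Filter FourierTransform

/-! ### Radial cutoffs -/

section Cutoff

variable {φ : ℝ → ℝ}

lemma IsCutoff.eq_zero (hφ : IsCutoff φ) {y : ℝ} (hy : 8 / 5 < y) : φ y = 0 := by
  by_contra h0
  have := hφ.supp y h0
  rw [abs_of_pos (by linarith)] at this
  linarith

lemma IsCutoff.eq_one_of_nonneg (hφ : IsCutoff φ) {y : ℝ} (h0 : 0 ≤ y) (hy : y ≤ 5 / 4) : φ y = 1 :=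
  hφ.eq_one y (by rwa [abs_of_nonneg h0])

lemma contDiff_cutoff_norm (hφ : IsCutoff φ) {s : ℝ} (hs : 0 < s) :
    ContDiff ℝ (⊤ : ℕ∞) (fun ξ : E3 => φ (‖ξ‖ / s)) := by
  obtain ⟨B, hB, -⟩ := hφ.gevrey
  rw [contDiff_iff_contDiffAt]
  intro x
  by_cases hx : x = 0
  · have : (fun ξ : E3 => φ (‖ξ‖ / s)) =ᶠ[𝓝 x] fun _ => 1 := by
      subst hx
      filter_upwards [Metric.ball_mem_nhds (0 : E3) hs] with y hy
      rw [mem_ball_zero_iff] at hy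
      refine hφ.eq_one_of_nonneg (by positivity) ?_
      rw [div_le_iff₀ hs]; linarith
    exact contDiffAt_const.congr_of_eventuallyEq this
  · exact hB.contDiffAt.comp x ((contDiffAt_norm ℝ hx).div_const s)

lemma abs_cutoff_sub_le (hφ : IsCutoff φ) (x y : ℝ) : |φ x - φ y| ≤ 1 := by
  rw [abs_le]
  constructor <;> linarith [hφ.nonneg x, hφ.nonneg y, hφ.le_one x, hφ.le_one y]

lemma phiK_eq_zero_of_lt (hφ : IsCutoff φ) {k : ℤ} {r : ℝ} (h : (2 : ℝ) ^ (k + 1) < r) : phiK φ k r = 0 := by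
  have h2 : (0 : ℝ) < 2 ^ k := by positivity
  rw [zpow_add_one₀ two_ne_zero] at h
  unfold phiK
  rw [hφ.eq_zero, hφ.eq_zero, sub_zero]
  · rw [zpow_sub_one₀ two_ne_zero, lt_div_iff₀ (by positivity)]; linarith
  · rw [lt_div_iff₀ h2]; linarith

lemma phiK_eq_zero_of_le (hφ : IsCutoff φ) {k : ℤ} {r : ℝ} (h0 : 0 ≤ r) (h : r ≤ (2 : ℝ) ^ (k - 1)) : phiK φ k r = 0 := by
  have h2 : (0 : ℝ) < 2 ^ k := by positivity
  rw [zpow_sub_one₀ two_ne_zero] at h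
  unfold phiK
  rw [hφ.eq_one_of_nonneg, hφ.eq_one_of_nonneg, sub_self]
  · positivity
  · rw [zpow_sub_one₀ two_ne_zero, div_le_iff₀ (by positivity)]; linarith
  · positivity
  · rw [div_le_iff₀ h2]; linarith

/-- The sum of the five cutoffs telescopes. -/
lemma phiBand_eq (φ : ℝ → ℝ) (k : ℤ) (r : ℝ) :
    phiBand φ k r = φ (r / 2 ^ (k + 2)) - φ (r / 2 ^ (k - 3)) := by
  have : Finset.Icc (k - 2) (k + 2) = {k - 2, k - 1, k, k + 1, k + 2} := by
    ext n; simp; omega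
  unfold phiBand phiK
  rw [this, Finset.sum_insert, Finset.sum_insert, Finset.sum_insert, Finset.sum_insert, Finset.sum_singleton]
  · rw [show k - 2 - 1 = k - 3 by ring, show k - 1 - 1 = k - 2 by ring, show k + 1 - 1 = k by ring,
      show k + 2 - 1 = k + 1 by ring]
    ring
  all_goals simp
  all_goals omega

lemma phiBand_eq_zero_of_lt (hφ : IsCutoff φ) {k : ℤ} {r : ℝ} (h : (2 : ℝ) ^ (k + 3) < r) : phiBand φ k r = 0 := by
  have h2 : (0 : ℝ) < 2 ^ k := by positivity
  rw [zpow_add₀ two_ne_zero] at h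
  rw [phiBand_eq, hφ.eq_zero, hφ.eq_zero, sub_zero]
  · rw [zpow_sub₀ two_ne_zero, lt_div_iff₀ (by positivity)]
    norm_num at h ⊢; linarith
  · rw [zpow_add₀ two_ne_zero, lt_div_iff₀ (by positivity)]
    norm_num at h ⊢; linarith

lemma phiBand_eq_zero_of_le (hφ : IsCutoff φ) {k : ℤ} {r : ℝ} (h0 : 0 ≤ r) (h : r ≤ (2 : ℝ) ^ (k - 3)) :
    phiBand φ k r = 0 := by
  have h2 : (0 : ℝ) < 2 ^ k := by positivity
  rw [zpow_sub₀ two_ne_zero] at h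
  rw [phiBand_eq, hφ.eq_one_of_nonneg, hφ.eq_one_of_nonneg, sub_self]
  · positivity
  · rw [zpow_sub₀ two_ne_zero, div_le_iff₀ (by positivity)]
    norm_num at h ⊢; linarith
  · positivity
  · rw [zpow_add₀ two_ne_zero, div_le_iff₀ (by positivity)]
    norm_num at h ⊢; linarith

lemma abs_phiBand_le (hφ : IsCutoff φ) (k : ℤ) (r : ℝ) : |phiBand φ k r| ≤ 1 := by
  rw [phiBand_eq]; exact abs_cutoff_sub_le hφ _ _

lemma mult_phiK (hφ : IsCutoff φ) (k : ℤ) :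
    Mult 0 (2 ^ (k + 1)) 1 (fun ξ : E3 => ((phiK φ k ‖ξ‖ : ℝ) : ℂ)) where
  smooth := Complex.ofRealCLM.contDiff.comp ((contDiff_cutoff_norm hφ (by positivity)).sub (contDiff_cutoff_norm hφ (by positivity)))
  supp ξ hξ := by
    by_contra h
    exact hξ (by rw [phiK_eq_zero_of_lt hφ (not_le.mp h)]; simp)
  nonneg := by positivity
  bound ξ := by rw [Complex.norm_real]; exact abs_cutoff_sub_le hφ _ _
  ang := AngDeg.radial (fun r => ((phiK φ k r : ℝ) : ℂ))

lemma mult_phiBand (hφ : IsCutoff φ) (k : ℤ) :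
    Mult 0 (2 ^ (k + 3)) 1 (fun ξ : E3 => ((phiBand φ k ‖ξ‖ : ℝ) : ℂ)) where
  smooth := by
    simp only [phiBand_eq]
    exact Complex.ofRealCLM.contDiff.comp ((contDiff_cutoff_norm hφ (by positivity)).sub (contDiff_cutoff_norm hφ (by positivity)))
  supp ξ hξ := by
    by_contra h
    exact hξ (by rw [phiBand_eq_zero_of_lt hφ (not_le.mp h)]; simp)
  nonneg := by positivity
  bound ξ := by rw [Complex.norm_real]; exact abs_phiBand_le hφ _ _
  ang := AngDeg.radial (fun r => ((phiBand φ k r : ℝ) : ℂ))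

lemma abs_phiJK_le (hφ : IsCutoff φ) (j : ℕ) (k : ℤ) (r : ℝ) : |phiJK φ j k r| ≤ 1 := by
  unfold phiJK phiLe
  split_ifs
  · rw [abs_of_nonneg (hφ.nonneg _)]; exact hφ.le_one _
  · exact abs_cutoff_sub_le hφ _ _

lemma phiJK_eq_zero (hφ : IsCutoff φ) {j : ℕ} {k : ℤ} {r : ℝ} (h : (2 : ℝ) ^ (j + 1) < r) : phiJK φ j k r = 0 := by
  have h' : (2 : ℝ) ^ ((j : ℤ) + 1) < r := by exact_mod_cast h
  unfold phiJK phiLe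
  split_ifs
  · refine hφ.eq_zero ?_
    rw [lt_div_iff₀ (by positivity), zpow_natCast]
    rw [pow_succ] at h
    have : (0 : ℝ) < 2 ^ j := by positivity
    linarith
  · exact phiK_eq_zero_of_lt hφ h'

lemma continuous_phiJK (hφ : IsCutoff φ) (j : ℕ) (k : ℤ) : Continuous (phiJK φ j k) := by
  obtain ⟨B, hB, -⟩ := hφ.gevrey
  have := hB.continuous
  unfold phiJK phiLe phiK
  split_ifs <;> fun_prop

end Cutoff

/-! ### Fourier transforms of spatially localized functions -/

lemma angDeg_ft {E : ℕ} {a : E3 → ℂ} (ha : AngDeg E a) (hi : Integrable a) : AngDeg E (ft a) := by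
  have h1 := (angDeg_ift ha hi).const_mul ((((2 * Real.pi) ^ 3 : ℝ)) : ℂ)
  have h2 := h1.comp_isometry (LinearIsometryEquiv.neg ℝ)
  convert h2 using 2 with ξ
  unfold ift ft
  rw [← mul_assoc, ← Complex.ofReal_mul, mul_inv_cancel₀ (by have := Real.pi_pos; positivity), Complex.ofReal_one, one_mul]
  refine integral_congr_ae (ae_of_all _ fun x => ?_)
  simp [real_inner_comm]

/-- Each derivative in frequency brings down a factor x, and |x| ≤ ϱ on the support. -/
lemma ft_smooth {q : E3 → ℂ} (hq : Integrable q) {ϱ : ℝ} (hϱ : 0 ≤ ϱ) (hs : ∀ x, q x ≠ 0 → ‖x‖ ≤ ϱ) :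
    ContDiff ℝ (⊤ : ℕ∞) (ft q) ∧
      ∀ (i : ℕ) (ξ : E3), ‖iteratedFDeriv ℝ i (ft q) ξ‖ ≤ (∫ x, ‖q x‖) * ϱ ^ i := by
  have hpi := Real.pi_pos
  have hb : ∀ (n : ℕ) x, ‖x‖ ^ n * ‖q x‖ ≤ ϱ ^ n * ‖q x‖ := fun n x => by
    by_cases h0 : q x = 0
    · simp [h0]
    · have := hs x h0
      gcongr
  have hint : ∀ n : ℕ, (n : ℕ∞) ≤ (⊤ : ℕ∞) → Integrable (fun x => ‖x‖ ^ n * ‖q x‖) := fun n _ => by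
    refine (hq.norm.const_mul (ϱ ^ n)).mono' ?_ (ae_of_all _ fun x => ?_)
    · exact (Continuous.aestronglyMeasurable (by fun_prop)).mul hq.1.norm
    · rw [Real.norm_of_nonneg (by positivity)]; exact hb n x
  have h1 : ContDiff ℝ (⊤ : ℕ∞) (𝓕 q) := Real.contDiff_fourier hint
  set L : E3 →L[ℝ] E3 := (2 * Real.pi)⁻¹ • ContinuousLinearMap.id ℝ E3
  have hL : ‖L‖ ≤ (2 * Real.pi)⁻¹ := by
    refine ContinuousLinearMap.opNorm_le_bound _ (by positivity) fun x => ?_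
    simp only [L, smul_apply, ContinuousLinearMap.id_apply, norm_smul, Real.norm_eq_abs]
    rw [abs_of_pos (by positivity)]
  have h2 : ft q = 𝓕 q ∘ L := by
    funext ξ; rw [ft_eq_fourier]; rfl
  refine ⟨by rw [h2]; exact h1.comp L.contDiff, fun i ξ => ?_⟩
  rw [h2, L.iteratedFDeriv_comp_right h1 ξ (by exact_mod_cast le_top), Real.iteratedFDeriv_fourier hint hq.1 le_top]
  refine (ContinuousMultilinearMap.norm_compContinuousLinearMap_le _ _).trans ?_
  rw [Finset.prod_const, Finset.card_univ, Fintype.card_fin]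
  have h3 : ‖𝓕 (fun v => VectorFourier.fourierPowSMulRight (innerSL ℝ) q v i) (L ξ)‖ ≤
      ∫ x, (2 * Real.pi) ^ i * (ϱ ^ i * ‖q x‖) := by
    refine (VectorFourier.norm_fourierIntegral_le_integral_norm _ _ _ _ _).trans ?_
    refine integral_mono_of_nonneg (ae_of_all _ fun _ => norm_nonneg _) ((hq.norm.const_mul _).const_mul _) (ae_of_all _ fun x => ?_)
    refine (VectorFourier.norm_fourierPowSMulRight_le _ _ _ _).trans ?_
    have h4 : ‖innerSL ℝ (E := E3)‖ ≤ 1 := norm_innerSL_le ℝ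
    have h5 : (2 * Real.pi * ‖innerSL ℝ (E := E3)‖) ^ i ≤ (2 * Real.pi) ^ i := by
      refine pow_le_pow_left₀ (by positivity) ?_ _
      exact mul_le_of_le_one_right (by positivity) h4
    rw [mul_assoc]
    exact mul_le_mul h5 (hb i x) (by positivity) (by positivity)
  rw [integral_const_mul, integral_const_mul] at h3
  calc _ ≤ ((2 * Real.pi) ^ i * (ϱ ^ i * ∫ x, ‖q x‖)) * ((2 * Real.pi)⁻¹) ^ i := by gcongr
    _ = _ := by rw [inv_pow]; field_simp

lemma ft_conv (K : 𝓢(E3, ℂ)) {q : E3 → ℂ} (hq : Integrable q) (ξ : E3) :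
    ft (conv K q) ξ = 𝓕 K ((2 * Real.pi)⁻¹ • ξ) * ft q ξ := by
  have h := Real.fourier_mul_convolution_eq K.integrable hq ((2 * Real.pi)⁻¹ • ξ)
  rw [ft_eq_fourier, ft_eq_fourier]
  refine Eq.trans ?_ h
  have : conv K q = convolution K q (ContinuousLinearMap.mul ℂ ℂ) volume := by
    funext x
    rw [convolution_eq_swap]
    simp [conv]
  rw [this]

/-- Cauchy-Schwarz on a ball. -/
lemma lintegral_enorm_le_of_ball {q : E3 → ℂ} (hq : AEStronglyMeasurable q volume) {ϱ : ℝ} (hϱ : 0 ≤ ϱ)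
    (hs : ∀ x, q x ≠ 0 → ‖x‖ ≤ ϱ) {M : ℝ} (hM : 0 ≤ M) (h2 : eLpNorm q 2 volume ≤ ENNReal.ofReal M) :
    ∫⁻ x, ‖q x‖ₑ ≤ ENNReal.ofReal (3 * (1 + ϱ) ^ 2 * M) := by
  have hpi := Real.pi_pos
  set U : Set E3 := Metric.closedBall 0 ϱ
  have hsupp : ∀ x ∉ U, q x = 0 := fun x hx => by
    by_contra h0
    exact hx (by simpa [U] using hs x h0)
  have h1 : ∫⁻ x, ‖q x‖ₑ = ∫⁻ x in U, ‖q x‖ₑ := by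
    rw [← lintegral_indicator Metric.isClosed_closedBall.measurableSet]
    refine lintegral_congr fun x => ?_
    by_cases hx : x ∈ U
    · rw [Set.indicator_of_mem hx]
    · rw [Set.indicator_of_notMem hx, hsupp x hx, enorm_zero]
  have h3 := eLpNorm_le_eLpNorm_mul_rpow_measure_univ (p := 1) (q := 2) (by norm_num) hq.restrict (μ := volume.restrict U)
  rw [Measure.restrict_apply_univ, eLpNorm_one_eq_lintegral_enorm] at h3
  -- A perfect square is chosen as the bound for the volume, so that its square root is 3(1+ϱ)².
  have hv : volume U ≤ ENNReal.ofReal (9 * (1 + ϱ) ^ 4) := by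
    rw [EuclideanSpace.volume_closedBall_fin_three, ← ENNReal.ofReal_pow hϱ, ← ENNReal.ofReal_mul (by positivity)]
    refine ENNReal.ofReal_le_ofReal ?_
    have h4 : ϱ ^ 3 ≤ (1 + ϱ) ^ 4 := by nlinarith [pow_nonneg hϱ 2, pow_nonneg hϱ 3, pow_nonneg hϱ 4]
    have h5 : Real.pi * 4 / 3 ≤ 9 := by linarith [Real.pi_le_four]
    calc _ ≤ (1 + ϱ) ^ 4 * 9 := by gcongr
      _ = _ := by ring
  rw [h1]
  refine h3.trans ?_
  have e : (1 / (1 : ℝ≥0∞).toReal - 1 / (2 : ℝ≥0∞).toReal) = (1 / 2 : ℝ) := by norm_num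
  rw [e]
  calc eLpNorm q 2 (volume.restrict U) * volume U ^ (1 / 2 : ℝ)
      ≤ ENNReal.ofReal M * (ENNReal.ofReal (9 * (1 + ϱ) ^ 4)) ^ (1 / 2 : ℝ) := by
        gcongr
        exact (eLpNorm_restrict_le _ _ _ _).trans h2
    _ = _ := by
        rw [ENNReal.ofReal_rpow_of_nonneg (by positivity) (by norm_num), ← ENNReal.ofReal_mul hM, ← Real.sqrt_eq_rpow,
          show 9 * (1 + ϱ) ^ 4 = (3 * (1 + ϱ) ^ 2) ^ 2 by ring, Real.sqrt_sq (by positivity)]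
        congr 1; ring

lemma eLpNorm_ft {q : E3 → ℂ} (h1 : Integrable q) (h2 : MemLp q 2 volume) :
    eLpNorm (ft q) 2 volume ≤ ENNReal.ofReal 64 * eLpNorm q 2 volume := by
  have hpi := Real.pi_pos
  have hc : (2 * Real.pi)⁻¹ ≠ 0 := by positivity
  have h0 : (0 : ℝ) < 2 := two_pos
  have hsq : ∀ g : E3 → ℂ, eLpNorm g 2 volume ^ (2 : ℝ) = ∫⁻ x, ‖g x‖ₑ ^ (2 : ℝ) := fun g => by
    have := eLpNorm_nnreal_pow_eq_lintegral (f := g) (μ := (volume : Measure E3)) (p := 2) two_ne_zero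
    simpa only [NNReal.coe_ofNat, ENNReal.coe_ofNat] using this
  rw [← ENNReal.rpow_le_rpow_iff h0, ENNReal.mul_rpow_of_nonneg _ _ h0.le, ← eLpNorm_fourier h1 h2, hsq, hsq]
  have h3 : (fun x => ‖ft q x‖ₑ ^ (2 : ℝ)) = fun x => (fun y => ‖𝓕 q y‖ₑ ^ (2 : ℝ)) ((2 * Real.pi)⁻¹ • x) := by
    funext x; rw [ft_eq_fourier]
  have h4 := (Homeomorph.smulOfNeZero (2 * Real.pi)⁻¹ hc).measurableEmbedding.lintegral_map
    (μ := (volume : Measure E3)) (fun y => ‖𝓕 q y‖ₑ ^ (2 : ℝ))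
  have h5 := Measure.map_addHaar_smul (volume : Measure E3) hc
  have h6 : ∫⁻ x, (fun y => ‖𝓕 q y‖ₑ ^ (2 : ℝ)) ((2 * Real.pi)⁻¹ • x) =
      ENNReal.ofReal |(((2 * Real.pi)⁻¹ ^ Module.finrank ℝ E3)⁻¹)| * ∫⁻ y, ‖𝓕 q y‖ₑ ^ (2 : ℝ) := by
    refine h4.symm.trans ?_
    have : (Homeomorph.smulOfNeZero (2 * Real.pi)⁻¹ hc : E3 → E3) = ((2 * Real.pi)⁻¹ • ·) := rfl
    rw [this, h5, lintegral_smul_measure, smul_eq_mul]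
  rw [h3, h6]
  gcongr
  have hf : Module.finrank ℝ E3 = 3 := by simp
  rw [hf, abs_of_pos (by positivity), ENNReal.rpow_two, ← ENNReal.ofReal_pow (by norm_num), inv_pow, inv_inv]
  refine ENNReal.ofReal_le_ofReal ?_
  have : 2 * Real.pi ≤ 8 := by linarith [Real.pi_le_four]
  calc (2 * Real.pi) ^ 3 ≤ 8 ^ 3 := by gcongr
    _ ≤ _ := by norm_num

end MKG

/-! ### Structure of the localized pieces -/

namespace MKG

open Topology Filter FourierTransform

/-- A function whose Fourier transform is a frequency cutoff times a smooth function `h` of bounded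
angular degree. -/
structure PieceData (φ : ℝ → ℝ) (D j : ℕ) (k : ℤ) (M : ℝ) (F h : E3 → ℂ) : Prop where
  ft_eq : ∀ ξ, ft F ξ = ((phiBand φ k ‖ξ‖ : ℝ) : ℂ) * h ξ
  ang : AngDeg D h
  smooth : ContDiff ℝ (⊤ : ℕ∞) h
  bound : ∀ (i : ℕ) (ξ : E3), ‖iteratedFDeriv ℝ i h ξ‖ ≤ 3 * (1 + 2 ^ (j + 1)) ^ 2 * M * (2 ^ (j + 1)) ^ i
  lintegral_le : ∫⁻ ξ, ‖ft F ξ‖ₑ ≤ ENNReal.ofReal (192 * (1 + 2 ^ (k + 3)) ^ 2 * M)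

/-- The bound for the mass of a piece. -/
noncomputable def pieceMass (k : ℤ) (l : ℕ) : ℝ := (10 ^ 7 * (1 + 2 ^ k) * 4 ^ l) ^ 502 * 2 ^ (3 * l + 5)

lemma pieceMass_nonneg (k : ℤ) (l : ℕ) : 0 ≤ pieceMass k l := by unfold pieceMass; positivity

lemma IsGamma.memLp_base : ∀ {w : List VField} {f g : E3 → ℂ}, IsGamma w f g → MemLp f 2 volume := by
  intro w
  induction w with
  | nil => intro f g h; exact (memLp_congr_ae h.2).mp h.1
  | cons Z w ih => intro f g ⟨h, hh, _⟩; exact ih hh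

/-- The bound of `conv_isGamma` with E = 0 and D = 2^{l+1}. A word of length at most 502 = N/2 + 2
needs the budget 3 · 502 = 1506 beyond D, and the base is quadratic in 2^l, whence 4^l. -/
lemma gamma_factor_le (k : ℤ) (l s : ℕ) (hs : s ≤ 502) :
    ((2 : ℝ) ^ (k + 1) + (2 * ((2 ^ (l + 1) + 1506 : ℕ) : ℝ) + 1) * ((2 ^ (l + 1) + 1506 : ℕ) : ℝ)) ^ s ≤
      (10 ^ 7 * (1 + 2 ^ k) * 4 ^ l) ^ 502 := by
  have hk : (0 : ℝ) < 2 ^ k := by positivity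
  have hl : (1 : ℝ) ≤ 2 ^ l := one_le_pow₀ (by norm_num)
  have h4 : (4 : ℝ) ^ l = 2 ^ l * 2 ^ l := by rw [← mul_pow]; norm_num
  set x : ℝ := 2 ^ l
  set y : ℝ := 2 ^ k
  have hx2 : 1 ≤ x * x := by nlinarith
  have hQ : ((2 ^ (l + 1) + 1506 : ℕ) : ℝ) ≤ 1508 * x := by
    push_cast; rw [pow_succ]; change x * 2 + 1506 ≤ _; linarith
  set Qn : ℝ := ((2 ^ (l + 1) + 1506 : ℕ) : ℝ)
  have hQ0 : 0 ≤ Qn := by positivity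
  have hQ2 : Qn * Qn ≤ (1508 * x) * (1508 * x) := by gcongr
  have hbase : (2 : ℝ) ^ (k + 1) + (2 * Qn + 1) * Qn ≤ 10 ^ 7 * (1 + y) * 4 ^ l := by
    rw [zpow_add_one₀ two_ne_zero, h4]
    change y * 2 + _ ≤ _
    nlinarith [mul_le_mul_of_nonneg_left hx2 hk.le, mul_le_mul hQ hl zero_le_one (by positivity)]
  have h1 : 1 ≤ 10 ^ 7 * (1 + y) * 4 ^ l := by rw [h4]; nlinarith [mul_le_mul_of_nonneg_left hx2 hk.le]
  calc _ ≤ (10 ^ 7 * (1 + y) * 4 ^ l) ^ s := by gcongr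
    _ ≤ _ := pow_le_pow_right₀ h1 hs

/-- The structure of the pieces `(Γ^β S_l f)_{jk}^*`. -/
theorem IsPiece.pieceData {φ : ℝ → ℝ} (hφ : IsCutoff φ) {β : List VField} {l j : ℕ} {k : ℤ} {f F : E3 → ℂ}
    (hF : IsPiece φ β l j k f F) (hβ : β.length ≤ 502) (hf : AEStronglyMeasurable f volume) {ε : ℝ} (hε : 0 ≤ ε)
    (hfε : eLpNorm f 2 volume ≤ ENNReal.ofReal ε) :
    ∃ h, PieceData φ (2 ^ (l + 1) + 502) j k (pieceMass k l * ε) F h := by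
  obtain ⟨g, hg, rfl⟩ := hF
  have hS2 := hg.memLp_base
  have hgL := hg.memLp
  set M := pieceMass k l * ε
  have hM : 0 ≤ M := mul_nonneg (pieceMass_nonneg k l) hε
  -- The multiplier of P_k is radial, so the induction starts at E = 0.
  obtain ⟨hang, hL2⟩ := conv_isGamma (angDeg_S hφ l f) (2 ^ (l + 1) + 1506) β g hg 0 1 _ (mult_phiK hφ k) (by omega)
  set p : E3 → ℂ := conv (ift fun ξ => ((phiK φ k ‖ξ‖ : ℝ) : ℂ)) g with hp
  have hpM : eLpNorm p 2 volume ≤ ENNReal.ofReal M := by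
    refine hL2.trans ?_
    have h1 := eLpNorm_S_le hφ l hf hS2.1
    calc _ ≤ ENNReal.ofReal ((10 ^ 7 * (1 + 2 ^ k) * 4 ^ l) ^ 502) *
          (ENNReal.ofReal (2 ^ (3 * l + 5)) * ENNReal.ofReal ε) := by
          refine mul_le_mul' (ENNReal.ofReal_le_ofReal ?_) (h1.trans (mul_le_mul' le_rfl hfε))
          rw [mul_one]; exact gamma_factor_le k l _ hβ
      _ = ENNReal.ofReal M := by
          rw [← ENNReal.ofReal_mul (by positivity), ← ENNReal.ofReal_mul (by positivity), ← mul_assoc]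
          rfl
  clear_value M
  have hpm : AEStronglyMeasurable p volume := by
    obtain ⟨K, hK, -⟩ := (mult_phiK hφ k).kernel
    rw [hp, ← hK]
    exact aestronglyMeasurable_conv K hgL.1
  -- The radial cutoff in space keeps the angular degree and confines q to the ball of radius
  -- 2^{j+1}. Its transform is therefore smooth with rate 2^{j+1}, and it is the h of the statement.
  set q : E3 → ℂ := Q φ j k g
  have hqp : ∀ x, q x = ((phiJK φ j k ‖x‖ : ℝ) : ℂ) * p x := fun x => rfl
  have hqm : AEStronglyMeasurable q volume := by
    refine AEStronglyMeasurable.mul ?_ hpm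
    have := continuous_phiJK hφ j k
    exact (Complex.continuous_ofReal.comp (this.comp continuous_norm)).aestronglyMeasurable
  have hqM : eLpNorm q 2 volume ≤ ENNReal.ofReal M := by
    refine (eLpNorm_mono fun x => ?_).trans hpM
    rw [hqp, norm_mul, Complex.norm_real]
    exact mul_le_of_le_one_left (norm_nonneg _) (abs_phiJK_le hφ j k _)
  have hq2 : MemLp q 2 volume := ⟨hqm, hqM.trans_lt ENNReal.ofReal_lt_top⟩
  have hqs : ∀ x, q x ≠ 0 → ‖x‖ ≤ 2 ^ (j + 1) := fun x hx => by
    by_contra h0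
    exact hx (by rw [hqp, phiJK_eq_zero hφ (not_le.mp h0)]; simp)
  have hq1 := lintegral_enorm_le_of_ball hqm (by positivity) hqs hM hqM
  have hqi : Integrable q volume := ⟨hqm, hq1.trans_lt ENNReal.ofReal_lt_top⟩
  have hqa : AngDeg (2 ^ (l + 1) + 502) q := by
    have := (AngDeg.radial (D := 0) (fun r => ((phiJK φ j k r : ℝ) : ℂ))).mul hang
    exact this.mono (by omega)
  obtain ⟨hsm, hbd⟩ := ft_smooth hqi (by positivity) hqs
  have hqn : ∫ x, ‖q x‖ ≤ 3 * (1 + 2 ^ (j + 1)) ^ 2 * M := by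
    rw [integral_norm_eq_lintegral_enorm hqm]
    exact ENNReal.toReal_le_of_le_ofReal (by positivity) hq1
  have hfe : ∀ ξ, ft (Qstar φ j k g) ξ = ((phiBand φ k ‖ξ‖ : ℝ) : ℂ) * ft q ξ := by
    intro ξ
    obtain ⟨K, hK, hKf⟩ := (mult_phiBand hφ k).kernel
    have h1 : Qstar φ j k g = conv K q := by rw [hK]; rfl
    rw [h1, ft_conv K hqi, hKf, smul_smul, mul_inv_cancel₀ (by have := Real.pi_pos; positivity),
      one_smul]
  have hcont : Continuous (ft (Qstar φ j k g)) := by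
    rw [funext hfe]
    exact (mult_phiBand hφ k).smooth.continuous.mul hsm.continuous
  refine ⟨ft q, hfe, angDeg_ft hqa hqi, hsm, fun i ξ => (hbd i ξ).trans ?_, ?_⟩
  · gcongr
  · have h1 : eLpNorm (ft (Qstar φ j k g)) 2 volume ≤ ENNReal.ofReal (64 * M) := by
      have h2 : eLpNorm (ft (Qstar φ j k g)) 2 volume ≤ eLpNorm (ft q) 2 volume := eLpNorm_mono fun ξ => by
        rw [hfe, norm_mul, Complex.norm_real]
        exact mul_le_of_le_one_left (norm_nonneg _) (abs_phiBand_le hφ k _)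
      refine h2.trans ((eLpNorm_ft hqi hq2).trans ?_)
      rw [ENNReal.ofReal_mul (by norm_num)]
      gcongr
    have h3 := lintegral_enorm_le_of_ball hcont.aestronglyMeasurable (ϱ := 2 ^ (k + 3)) (by positivity) (fun ξ hξ => by
      by_contra h0
      exact hξ (by rw [hfe, phiBand_eq_zero_of_lt hφ (not_le.mp h0)]; simp)) (by positivity : 0 ≤ 64 * M) h1
    refine h3.trans (ENNReal.ofReal_le_ofReal (le_of_eq ?_))
    ring

/-- The basic consequence of the bound for the `X` norm. -/
lemma eLpNorm_le_of_xNorm {φ : ℝ → ℝ} {K₀ ε : ℝ} {f : E3 → ℂ} (h : xNorm φ K₀ f ≤ ENNReal.ofReal ε) :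
    AEStronglyMeasurable f volume ∧ eLpNorm f 2 volume ≤ ENNReal.ofReal ε := by
  -- Only the empty word is used, that is, the plain L² part of the norm X.
  have h1 : ⨅ g : E3 → ℂ, ⨅ _ : IsGamma [] f g, eLpNorm g 2 volume ≤ ENNReal.ofReal ε := by
    refine le_trans ?_ (le_self_add.trans h)
    exact le_iSup₂_of_le (f := fun (w : List VField) (_ : w.length ≤ N) =>
      ⨅ g : E3 → ℂ, ⨅ _ : IsGamma w f g, eLpNorm g 2 volume) [] (by simp) le_rfl
  -- The infimum over an empty set would be infinite, so a finite norm forces f to be in L².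
  have h2 : ∃ g, IsGamma [] f g := by
    by_contra hcon
    push Not at hcon
    have : (⨅ g : E3 → ℂ, ⨅ _ : IsGamma [] f g, eLpNorm g 2 volume) = ⊤ := by
      simp only [iInf_eq_top]
      exact fun g hg => absurd hg (hcon g)
    rw [this] at h1
    exact absurd h1 (by simp)
  obtain ⟨g, hg, hgf⟩ := h2
  refine ⟨hg.1.congr hgf, le_trans ?_ h1⟩
  refine le_iInf₂ fun u hu => ?_
  exact (eLpNorm_congr_ae hu.2).ge

end MKG

namespace MKG

open Topology Filter Real

/-! ### Derivative bounds along a circle -/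

lemma abs_iteratedDeriv_sin_cos_le (k : ℕ) (x : ℝ) :
    |iteratedDeriv k sin x| ≤ 1 ∧ |iteratedDeriv k cos x| ≤ 1 := by
  induction k with
  | zero => simpa using ⟨abs_sin_le_one x, abs_cos_le_one x⟩
  | succ k ih =>
    rw [iteratedDeriv_add_one_sin, iteratedDeriv_add_one_cos]
    exact ⟨ih.2, by simpa using ih.1⟩

lemma EB.cos (n : ℕ) (x : ℝ) : EB n Real.cos x 1 1 :=
  ⟨contDiff_cos.contDiffAt, fun k _ => by simpa using (abs_iteratedDeriv_sin_cos_le k x).2⟩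

lemma EB.sin_one (n : ℕ) (x : ℝ) : EB n Real.sin x 1 1 :=
  ⟨contDiff_sin.contDiffAt, fun k _ => by simpa using (abs_iteratedDeriv_sin_cos_le k x).1⟩

/-- Bounds for `f` at a point from bounds for the value and for the derivative. -/
lemma EB.of_deriv_bound {F : Type*} [NormedAddCommGroup F] [NormedSpace ℝ F] {n : ℕ} {f : ℝ → F} {x M L : ℝ}
    (hf : ContDiffAt ℝ (⊤ : ℕ∞) f x) (h0 : ‖f x‖ ≤ M) (h : EB n (_root_.deriv f) x (M * L) L) :
    EB n f x M L := by
  rcases n with _ | n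
  · refine ⟨hf, fun k hk => ?_⟩
    obtain rfl : k = 0 := by omega
    simpa using h0
  · exact EB.of_deriv hf h0 (h.mono_order (by omega))

/-- The small value sin x is kept as the size of the function. The price is the rate l, which
dominates 1/sin x, in place of 1. -/
lemma EB.sin {n : ℕ} {x l : ℝ} (hs : 0 < Real.sin x) (hl : 1 ≤ l * Real.sin x) : EB n Real.sin x (Real.sin x) l := by
  have h1 : 1 ≤ l := by nlinarith [sin_le_one x]
  refine EB.of_deriv_bound contDiff_sin.contDiffAt (by rw [norm_eq_abs, abs_of_pos hs]) ?_
  rw [Real.deriv_sin]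
  exact (EB.cos n x).mono (by linarith) zero_le_one h1

/-- The squared distance between a point at distance `R` on the axis and a point at distance `ρ` and
polar angle `θ`. -/
noncomputable def distSq (R ρ θ : ℝ) : ℝ := R ^ 2 + ρ ^ 2 - 2 * R * ρ * Real.cos θ

/-- The standing assumptions on the parameters of the circle. -/
structure CircleData (n : ℕ) (R ρ l θ : ℝ) : Prop where
  order : 1 ≤ n
  R_pos : 0 < R
  ρ_pos : 0 < ρ
  sin_pos : 0 < Real.sin θ
  one_le : 1 ≤ l * Real.sin θ

namespace CircleData

variable {n : ℕ} {R ρ l θ : ℝ} (h : CircleData n R ρ l θ)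

include h

lemma one_le_l : 1 ≤ l := by nlinarith [sin_le_one θ, h.one_le, h.sin_pos]

omit h in
-- The distance between two points is at least the distance from either one to the line through the
-- origin and the other.
lemma distSq_ge (R ρ θ : ℝ) : (ρ * Real.sin θ) ^ 2 ≤ distSq R ρ θ ∧ (R * Real.sin θ) ^ 2 ≤ distSq R ρ θ := by
  unfold distSq
  constructor
  · nlinarith [sq_nonneg (R - ρ * Real.cos θ), sin_sq_add_cos_sq θ]
  · nlinarith [sq_nonneg (ρ - R * Real.cos θ), sin_sq_add_cos_sq θ]

lemma distSq_pos : 0 < distSq R ρ θ :=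
  lt_of_lt_of_le (by have := h.ρ_pos; have := h.sin_pos; positivity) (distSq_ge R ρ θ).1

omit h in
lemma le_dist (R ρ θ : ℝ) : ρ * Real.sin θ ≤ √(distSq R ρ θ) ∧ R * Real.sin θ ≤ √(distSq R ρ θ) :=
  ⟨le_sqrt_of_sq_le (distSq_ge R ρ θ).1, le_sqrt_of_sq_le (distSq_ge R ρ θ).2⟩

lemma ρ_le : ρ ≤ l * √(distSq R ρ θ) := by
  have h1 := (le_dist R ρ θ).1
  have h2 := h.one_le_l
  have h3 := h.one_le
  have h4 := h.ρ_pos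
  calc ρ ≤ ρ * (l * Real.sin θ) := le_mul_of_one_le_right h4.le h3
    _ = l * (ρ * Real.sin θ) := by ring
    _ ≤ _ := by gcongr

lemma R_le : R ≤ l * √(distSq R ρ θ) := by
  have h1 := (le_dist R ρ θ).2
  have h2 := h.one_le_l
  have h3 := h.one_le
  have h4 := h.R_pos
  calc R ≤ R * (l * Real.sin θ) := le_mul_of_one_le_right h4.le h3
    _ = l * (R * Real.sin θ) := by ring
    _ ≤ _ := by gcongr

omit h in
lemma _root_.MKG.hasDerivAt_distSq (R ρ θ : ℝ) : HasDerivAt (distSq R ρ) (2 * R * ρ * Real.sin θ) θ := by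
  unfold distSq
  have := ((hasDerivAt_cos θ).const_mul (2 * R * ρ)).const_sub (R ^ 2 + ρ ^ 2)
  convert! this using 1
  ring

omit h in
lemma _root_.MKG.contDiff_distSq (R ρ : ℝ) : ContDiff ℝ (⊤ : ℕ∞) (distSq R ρ) := by
  unfold distSq
  exact contDiff_const.sub (contDiff_const.mul contDiff_cos)

lemma cross_le : R * ρ * Real.sin θ ≤ distSq R ρ θ * l := by
  have h1 := (le_dist R ρ θ).2
  have h2 := h.ρ_le
  have h3 := h.ρ_pos
  have h4 : √(distSq R ρ θ) * √(distSq R ρ θ) = distSq R ρ θ := mul_self_sqrt h.distSq_pos.le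
  calc R * ρ * Real.sin θ = (R * Real.sin θ) * ρ := by ring
    _ ≤ √(distSq R ρ θ) * (l * √(distSq R ρ θ)) := by gcongr
    _ = _ := by linear_combination l * h4

lemma eb_deriv_distSq : EB n (fun θ => 2 * R * ρ * Real.sin θ) θ (2 * (R * ρ * Real.sin θ)) l := by
  have h1 := (EB.sin (n := n) h.sin_pos h.one_le).const_mul (2 * R * ρ)
  have h2 := h.R_pos
  have h3 := h.ρ_pos
  rw [norm_of_nonneg (by positivity)] at h1
  exact h1.mono (by linarith) (by linarith [h.one_le_l]) le_rfl

/-- The quantity `c² |ξ-η|² + b²`. -/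
lemma eb_quad {c b : ℝ} (hc : 0 < c) :
    EB n (fun θ => c ^ 2 * distSq R ρ θ + b ^ 2) θ (2 * (c ^ 2 * distSq R ρ θ + b ^ 2)) l := by
  have hS := h.distSq_pos
  have hl := h.one_le_l
  refine EB.of_deriv_bound ((contDiff_const.mul (contDiff_distSq R ρ)).add contDiff_const).contDiffAt ?_ ?_
  · rw [norm_of_nonneg (by positivity)]
    have : 0 ≤ c ^ 2 * distSq R ρ θ + b ^ 2 := by positivity
    linarith
  · have h1 : deriv (fun θ => c ^ 2 * distSq R ρ θ + b ^ 2) = fun θ => c ^ 2 * (2 * R * ρ * Real.sin θ) := by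
      funext x
      exact (((hasDerivAt_distSq R ρ x).const_mul (c ^ 2)).add_const (b ^ 2)).deriv
    rw [h1]
    have h2 := h.eb_deriv_distSq.const_mul (c ^ 2)
    rw [norm_of_nonneg (by positivity)] at h2
    refine h2.mono ?_ (by linarith) le_rfl
    have h3 := mul_le_mul_of_nonneg_left h.cross_le (by positivity : 0 ≤ 2 * c ^ 2)
    have : 0 ≤ b ^ 2 * l := by positivity
    nlinarith

/-- The logarithmic derivative of the dispersion relation. -/
lemma eb_logDeriv {c b : ℝ} (hc : 0 < c) :
    EB n (fun θ => c ^ 2 * (R * ρ * Real.sin θ) * (c ^ 2 * distSq R ρ θ + b ^ 2)⁻¹) θ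
      (c ^ 2 * (R * ρ * Real.sin θ) * (c ^ 2 * distSq R ρ θ + b ^ 2)⁻¹) (5 * n * l) := by
  have hS := h.distSq_pos
  have hl := h.one_le_l
  have hn : (1 : ℝ) ≤ n := by exact_mod_cast h.order
  have hR := h.R_pos
  have hρ := h.ρ_pos
  have hs := h.sin_pos
  have hq : 0 < c ^ 2 * distSq R ρ θ + b ^ 2 := by positivity
  have h1 := (h.eb_quad (b := b) hc).inv hq (by norm_num) (by linarith) (le_abs_self _)
  have h2 := ((EB.sin (n := n) h.sin_pos h.one_le).const_mul (c ^ 2 * (R * ρ))).mul h1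
  rw [norm_of_nonneg (by positivity)] at h2
  have h3 := h2.mono (M' := c ^ 2 * (R * ρ * Real.sin θ) * (c ^ 2 * distSq R ρ θ + b ^ 2)⁻¹) (L' := 5 * n * l)
    (le_of_eq (by ring)) (by positivity) (by nlinarith)
  refine h3.congr (Eventually.of_forall fun x => ?_)
  simp only; ring

lemma logDeriv_le {c b : ℝ} (hc : 0 < c) :
    c ^ 2 * (R * ρ * Real.sin θ) * (c ^ 2 * distSq R ρ θ + b ^ 2)⁻¹ ≤ l := by
  have hS := h.distSq_pos
  have hl := h.one_le_l
  have hq : 0 < c ^ 2 * distSq R ρ θ + b ^ 2 := by positivity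
  rw [← div_eq_mul_inv, div_le_iff₀ hq]
  have h3 := mul_le_mul_of_nonneg_left h.cross_le (by positivity : 0 ≤ c ^ 2)
  have : 0 ≤ b ^ 2 * l := by positivity
  nlinarith

lemma disp_aux {c b : ℝ} (hc : 0 < c) : ∀ᶠ x in 𝓝 θ, 0 < c ^ 2 * distSq R ρ x + b ^ 2 := by
  have hS := h.distSq_pos
  have hcont : Continuous fun x => c ^ 2 * distSq R ρ x + b ^ 2 :=
    (continuous_const.mul (contDiff_distSq R ρ).continuous).add continuous_const
  exact hcont.continuousAt.eventually (lt_mem_nhds (by positivity))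

omit h in
lemma hasDerivAt_disp {c b : ℝ} {x : ℝ} (hx : 0 < c ^ 2 * distSq R ρ x + b ^ 2) :
    HasDerivAt (fun θ => √(c ^ 2 * distSq R ρ θ + b ^ 2))
      (c ^ 2 * (R * ρ * Real.sin x) * (c ^ 2 * distSq R ρ x + b ^ 2)⁻¹ * √(c ^ 2 * distSq R ρ x + b ^ 2)) x := by
  have h1 := (((hasDerivAt_distSq R ρ x).const_mul (c ^ 2)).add_const (b ^ 2)).sqrt hx.ne'
  convert! h1 using 1
  have h2 : √(c ^ 2 * distSq R ρ x + b ^ 2) ≠ 0 := (sqrt_pos.mpr hx).ne'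
  have h3 := sq_sqrt hx.le
  field_simp
  rw [h3]

lemma contDiffAt_disp {c b : ℝ} (hc : 0 < c) :
    ContDiffAt ℝ (⊤ : ℕ∞) (fun θ => √(c ^ 2 * distSq R ρ θ + b ^ 2)) θ :=
  (((contDiff_const.mul (contDiff_distSq R ρ)).add contDiff_const).contDiffAt).sqrt
    (by have := h.distSq_pos; positivity)

/-- The dispersion relation `√(c² |ξ-η|² + b²)`. -/
lemma eb_disp {c b : ℝ} (hc : 0 < c) :
    EB n (fun θ => √(c ^ 2 * distSq R ρ θ + b ^ 2)) θ √(c ^ 2 * distSq R ρ θ + b ^ 2) (6 * n ^ 2 * l) := by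
  have hl := h.one_le_l
  have hn : (1 : ℝ) ≤ n := by exact_mod_cast h.order
  -- The dispersion relation solves f' = zf with z its logarithmic derivative, and z ≤ l. The
  -- relative rate thus involves n and l alone, uniformly in R, ρ, b and c.
  have h1 := EB.ode (h.contDiffAt_disp (b := b) hc) ((h.eb_logDeriv hc).mono (h.logDeriv_le hc) (by positivity) le_rfl)
    (by positivity) (by
      filter_upwards [h.disp_aux (b := b) hc] with x hx
      exact (hasDerivAt_disp hx).deriv)
  rw [norm_of_nonneg (sqrt_nonneg _)] at h1
  refine h1.mono le_rfl (by positivity) ?_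
  nlinarith [mul_le_mul_of_nonneg_right (one_le_pow₀ hn (n := 2)) (by linarith : 0 ≤ l)]

/-- The derivative of the dispersion relation. -/
lemma eb_deriv_disp {c b : ℝ} (hc : 0 < c) :
    EB n (deriv fun θ => √(c ^ 2 * distSq R ρ θ + b ^ 2)) θ
      (c ^ 2 * (R * ρ * Real.sin θ) / √(c ^ 2 * distSq R ρ θ + b ^ 2)) (11 * n ^ 2 * l) := by
  have hl := h.one_le_l
  have hn : (1 : ℝ) ≤ n := by exact_mod_cast h.order
  have hS := h.distSq_pos
  have hq : 0 < c ^ 2 * distSq R ρ θ + b ^ 2 := by positivity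
  have h1 := (h.eb_logDeriv (b := b) hc).mul (h.eb_disp (b := b) hc)
  have h2 := h1.mono (M' := c ^ 2 * (R * ρ * Real.sin θ) / √(c ^ 2 * distSq R ρ θ + b ^ 2)) (L' := 11 * n ^ 2 * l)
    (by
      have h2 : √(c ^ 2 * distSq R ρ θ + b ^ 2) ≠ 0 := (sqrt_pos.mpr hq).ne'
      have h3 := sq_sqrt hq.le
      refine le_of_eq ?_
      field_simp
      rw [h3]) (by positivity)
    (by nlinarith [mul_le_mul_of_nonneg_left hn (by positivity : 0 ≤ (n : ℝ) * l)])
  refine h2.congr ?_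
  filter_upwards [h.disp_aux (b := b) hc] with x hx
  exact (hasDerivAt_disp hx).deriv.symm

lemma eb_inv_sin : EB n (fun θ => (Real.sin θ)⁻¹) θ (Real.sin θ)⁻¹ (2 * n * l) := by
  have h1 := (EB.sin (n := n) h.sin_pos h.one_le).mono (M' := 1 * Real.sin θ) (by linarith) (by linarith [h.one_le_l]) le_rfl
  have h2 := h1.inv h.sin_pos le_rfl (by linarith [h.one_le_l]) (le_abs_self _)
  exact h2.mono le_rfl (by have := h.one_le_l; positivity) (by linarith)

/-- The reciprocal of the derivative of the dispersion relation. -/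
lemma eb_disp_div_sin {c b : ℝ} (hc : 0 < c) :
    EB n (fun θ => √(c ^ 2 * distSq R ρ θ + b ^ 2) * (Real.sin θ)⁻¹) θ
      (√(c ^ 2 * distSq R ρ θ + b ^ 2) * (Real.sin θ)⁻¹) (8 * n ^ 2 * l) := by
  have hl := h.one_le_l
  have hn : (1 : ℝ) ≤ n := by exact_mod_cast h.order
  refine ((h.eb_disp (b := b) hc).mul h.eb_inv_sin).mono le_rfl (by positivity) ?_
  nlinarith [mul_le_mul_of_nonneg_left hn (by positivity : 0 ≤ (n : ℝ) * l)]

omit h in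
lemma dist_eq (R ρ θ : ℝ) : √(distSq R ρ θ) = √(1 ^ 2 * distSq R ρ θ + 0 ^ 2) := by norm_num

/-- The distance. -/
lemma eb_dist : EB n (fun θ => √(distSq R ρ θ)) θ √(distSq R ρ θ) (6 * n ^ 2 * l) := by
  simp only [dist_eq R ρ]
  exact h.eb_disp one_pos

lemma contDiffAt_dist : ContDiffAt ℝ (⊤ : ℕ∞) (fun θ => √(distSq R ρ θ)) θ := h.eb_dist.1

lemma eb_deriv_dist : EB n (deriv fun θ => √(distSq R ρ θ)) θ (R * ρ * Real.sin θ / √(distSq R ρ θ)) (11 * n ^ 2 * l) := by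
  have := h.eb_deriv_disp (b := 0) one_pos
  simp only [← dist_eq R ρ] at this
  simpa using this

lemma deriv_dist_le : R * ρ * Real.sin θ / √(distSq R ρ θ) ≤ ρ := by
  have := h.ρ_pos
  rw [div_le_iff₀ (sqrt_pos.mpr h.distSq_pos)]
  nlinarith [(le_dist R ρ θ).2]

/-- The derivative of the direction angle of `ξ - η`. -/
lemma eb_dirDeriv : EB n (fun θ => ρ * (ρ - R * Real.cos θ) * (distSq R ρ θ)⁻¹) θ
    (ρ / √(distSq R ρ θ)) (5 * n * l) := by
  have hS := h.distSq_pos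
  have hl := h.one_le_l
  have hn : (1 : ℝ) ≤ n := by exact_mod_cast h.order
  have hr : 0 < √(distSq R ρ θ) := sqrt_pos.mpr hS
  have hsq := sq_sqrt hS.le
  -- The squared distance equals (ρ - R cos θ)² + (R sin θ)², so ρ - R cos θ is at most the
  -- distance; its derivative R sin θ is bounded by R ≤ l times the distance.
  have h1 : EB n (fun θ => ρ - R * Real.cos θ) θ √(distSq R ρ θ) l := by
    refine EB.of_deriv_bound (contDiff_const.sub (contDiff_const.mul contDiff_cos)).contDiffAt ?_ ?_
    · rw [norm_eq_abs]
      refine abs_le_sqrt ?_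
      unfold distSq
      nlinarith [sin_sq_add_cos_sq θ, sq_nonneg (R * Real.sin θ)]
    · have : deriv (fun θ => ρ - R * Real.cos θ) = fun θ => R * Real.sin θ := by
        funext x
        have := ((hasDerivAt_cos x).const_mul R).const_sub ρ
        rw [this.deriv]; ring
      rw [this]
      have h2 := (EB.sin_one n θ).const_mul R
      rw [norm_of_nonneg h.R_pos.le, mul_one] at h2
      exact h2.mono (by linarith [h.R_le]) zero_le_one hl
  have h2 := (h.eb_quad (b := 0) one_pos).inv (δ := 1 ^ 2 * distSq R ρ θ + 0 ^ 2) (by positivity) (K := 2)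
    (by norm_num) (by linarith) (le_abs_self _)
  have h3 := ((h1.const_mul ρ).mul h2).mono (M' := ρ / √(distSq R ρ θ)) (L' := 5 * n * l) (by
    rw [norm_of_nonneg h.ρ_pos.le]
    refine le_of_eq ?_
    rw [one_pow, one_mul, zero_pow two_ne_zero, add_zero]
    field_simp
    rw [hsq]) (by positivity) (by nlinarith)
  refine h3.congr (Eventually.of_forall fun x => ?_)
  simp

end CircleData

end MKG

namespace MKG

open Topology Filter Real

/-! ### The factors of the amplitude -/

lemma GevreyBound.nonneg {V W : Type*} [NormedAddCommGroup V] [NormedSpace ℝ V] [NormedAddCommGroup W] [NormedSpace ℝ W]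
    {s : ℕ} {B : ℝ} {f : V → W} (h : GevreyBound s B f) : 0 ≤ B := by
  have := (norm_nonneg _).trans (h.2 0 0)
  simpa using this

/-- Up to order n the factorial (si)! is at most (sn)^{si}, which turns the Gevrey bound into a
geometric one. For s = 6 and n = m this costs m^6 at each integration by parts. -/
lemma GevreyBound.norm_le {V W : Type*} [NormedAddCommGroup V] [NormedSpace ℝ V] [NormedAddCommGroup W] [NormedSpace ℝ W]
    {s : ℕ} {B : ℝ} {f : V → W} (h : GevreyBound s B f) {n i : ℕ} (hi : i ≤ n) (x : V) :
    ‖iteratedFDeriv ℝ i f x‖ ≤ B * (B * ((s : ℝ) * n) ^ s) ^ i := by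
  have hB := h.nonneg
  refine (h.2 i x).trans ?_
  have h1 : ((s * i).factorial : ℝ) ≤ ((s : ℝ) * n) ^ (s * i) := by
    calc ((s * i).factorial : ℝ) ≤ ((s * i : ℕ) : ℝ) ^ (s * i) := by exact_mod_cast Nat.factorial_le_pow _
      _ ≤ _ := by push_cast; gcongr
  rw [pow_succ', mul_assoc, mul_pow, ← pow_mul]
  gcongr

lemma EB.clm_const {V W : Type} [NormedAddCommGroup V] [NormedSpace ℝ V] [NormedAddCommGroup W] [NormedSpace ℝ W]
    {n : ℕ} {x M L : ℝ} {v : ℝ → V} (T : V →L[ℝ] W) (hv : EB n v x M L) :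
    EB n (fun y => T (v y)) x (‖T‖ * M) L := by
  have := (EB.const (n := n) (x := x) T le_rfl).clm_apply hv
  simpa using this

lemma EB.smul_vec {V : Type} [NormedAddCommGroup V] [NormedSpace ℝ V] {n : ℕ} {x M L : ℝ} {f : ℝ → ℝ}
    (hf : EB n f x M L) {v : V} (hv : ‖v‖ = 1) : EB n (fun y => f y • v) x M L := by
  have := EB.clm_const (ContinuousLinearMap.toSpanSingleton ℝ v) hf
  rw [ContinuousLinearMap.norm_toSpanSingleton, hv, one_mul] at this
  simpa using this

lemma EB.const_smul {V : Type} [NormedAddCommGroup V] [NormedSpace ℝ V] {n : ℕ} {x M L : ℝ} {v : ℝ → V}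
    (c : ℝ) (hv : EB n v x M L) (hL : 0 ≤ L) : EB n (fun y => c • v y) x (|c| * M) L := by
  have h1 := EB.clm_const (c • ContinuousLinearMap.id ℝ V) hv
  refine h1.mono ?_ hL le_rfl
  refine mul_le_mul_of_nonneg_right ?_ hv.nonneg
  rw [norm_smul, norm_eq_abs]
  exact mul_le_of_le_one_right (abs_nonneg _) ContinuousLinearMap.norm_id_le

/-- Uniform motion along a great circle. -/
lemma eb_circle {e w : E3} (h : OrthoPair e w) (n : ℕ) (x : ℝ) :
    EB n (fun θ => Real.cos θ • e + Real.sin θ • w) x 1 1 := by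
  -- Differentiation along the circle is a shift by a quarter turn, so every derivative is again a
  -- unit vector.
  have hd : ∀ a θ : ℝ, HasDerivAt (fun θ => Real.cos (θ + a) • e + Real.sin (θ + a) • w)
      (Real.cos (θ + (a + π / 2)) • e + Real.sin (θ + (a + π / 2)) • w) θ := by
    intro a θ
    have h1 := ((hasDerivAt_cos (θ + a)).comp_add_const θ a).smul_const e
    have h2 := ((hasDerivAt_sin (θ + a)).comp_add_const θ a).smul_const w
    rw [← add_assoc, Real.cos_add_pi_div_two, Real.sin_add_pi_div_two]
    exact h1.add h2
  have hi : ∀ (k : ℕ) (a : ℝ), ‖iteratedDeriv k (fun θ => Real.cos (θ + a) • e + Real.sin (θ + a) • w) x‖ ≤ 1 := by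
    intro k
    induction k with
    | zero =>
      intro a
      have := norm_Rot h (x + a) ((1 : ℝ) • e)
      rw [Rot_self h, one_smul, one_smul, h.norm_left] at this
      rw [iteratedDeriv_zero, this]
    | succ k ih =>
      intro a
      rw [iteratedDeriv_succ', funext fun θ => (hd a θ).deriv]
      exact ih _
  refine ⟨?_, fun k _ => ?_⟩
  · exact ((contDiff_cos.smul contDiff_const).add (contDiff_sin.smul contDiff_const)).contDiffAt
  · simpa using hi k 0

lemma deriv_circle (e w : E3) : deriv (fun θ => Real.cos θ • e + Real.sin θ • w) =
    fun θ => Real.cos θ • w + Real.sin θ • (-e) := by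
  funext θ
  have := ((hasDerivAt_cos θ).smul_const e).add ((hasDerivAt_sin θ).smul_const w)
  refine this.deriv.trans ?_
  module

/-- A profile evaluated along a circle. -/
lemma eb_profile {e ω : E3} (h : OrthoPair e ω) {s : ℕ} {B : ℝ} {w : E3 → ℂ} (hw : GevreyBound s B w) (n : ℕ) (x : ℝ)
    (v : E3) (a : ℝ) :
    EB n (fun θ => w (v + a • (Real.cos θ • e + Real.sin θ • ω))) x B (B * ((s : ℝ) * n) ^ s * |a| + n) := by
  have hB := hw.nonneg
  have h' : OrthoPair ω (-e) := ⟨h.norm_right, by rw [norm_neg, h.norm_left], by rw [inner_neg_right, real_inner_comm, h.inner_eq, neg_zero]⟩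
  have h1 : ContDiff ℝ (⊤ : ℕ∞) (fun θ => v + a • (Real.cos θ • e + Real.sin θ • ω)) :=
    contDiff_iff_contDiffAt.mpr fun y => contDiffAt_const.add ((eb_circle h 0 y).1.const_smul a)
  have h2 : deriv (fun θ => v + a • (Real.cos θ • e + Real.sin θ • ω)) =
      fun θ => a • (Real.cos θ • ω + Real.sin θ • (-e)) := by
    funext θ
    rw [← congrFun (deriv_circle e ω) θ]
    have hd : DifferentiableAt ℝ (fun θ => Real.cos θ • e + Real.sin θ • ω) θ :=
      (eb_circle h 0 θ).1.differentiableAt (by simp)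
    exact ((hd.hasDerivAt.const_smul a).const_add v).deriv
  have h3 := (eb_circle h' n x).const_smul a zero_le_one
  rw [← h2, mul_one] at h3
  have h4 := EB.comp h1.contDiffAt h3 zero_le_one (by positivity : 0 ≤ B * ((s : ℝ) * n) ^ s) hw.1
    (M := B) (fun i hi => hw.norm_le hi _)
  simpa using h4

lemma eb_comp_sin {s : ℕ} {B : ℝ} {ψ : ℝ → ℂ} (hψ : GevreyBound s B ψ) (n : ℕ) (x a : ℝ) :
    EB n (fun θ => ψ (a * Real.sin θ)) x B (B * ((s : ℝ) * n) ^ s * |a| + n) := by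
  have hB := hψ.nonneg
  have h1 : ContDiff ℝ (⊤ : ℕ∞) (fun θ => a * Real.sin θ) := contDiff_const.mul contDiff_sin
  have h2 : deriv (fun θ => a * Real.sin θ) = fun θ => a * Real.cos θ :=
    funext fun θ => ((hasDerivAt_sin θ).const_mul a).deriv
  have h3 := (EB.cos n x).const_mul a
  rw [← h2, mul_one, norm_eq_abs] at h3
  have h4 := EB.comp h1.contDiffAt h3 zero_le_one (by positivity : 0 ≤ B * ((s : ℝ) * n) ^ s) hψ.1
    (M := B) (fun i hi => hψ.norm_le hi _)
  simpa using h4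

namespace CircleData

variable {n : ℕ} {R ρ l θ : ℝ} (h : CircleData n R ρ l θ)

include h

lemma eb_comp_phase {c b : ℝ} (hc : 0 < c) {s : ℕ} {B : ℝ} {ψ : ℝ → ℂ} (hψ : GevreyBound s B ψ) {K σ : ℝ} (hK : 0 ≤ K)
    (hσ : |σ| = 1) (a : ℝ) :
    EB n (fun θ => ψ (K * (a - σ * √(c ^ 2 * distSq R ρ θ + b ^ 2)))) θ B
      (B * ((s : ℝ) * n) ^ s * (K * (c ^ 2 * (R * ρ * Real.sin θ) / √(c ^ 2 * distSq R ρ θ + b ^ 2))) +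
        n * (11 * n ^ 2 * l)) := by
  have hB := hψ.nonneg
  have hl := h.one_le_l
  have h0 := h.contDiffAt_disp (b := b) hc
  have h1 : ContDiffAt ℝ (⊤ : ℕ∞) (fun θ => K * (a - σ * √(c ^ 2 * distSq R ρ θ + b ^ 2))) θ :=
    contDiffAt_const.mul (contDiffAt_const.sub (contDiffAt_const.mul h0))
  have h2 : (fun θ => (-(K * σ)) * deriv (fun θ => √(c ^ 2 * distSq R ρ θ + b ^ 2)) θ) =ᶠ[𝓝 θ]
      deriv (fun θ => K * (a - σ * √(c ^ 2 * distSq R ρ θ + b ^ 2))) := by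
    filter_upwards [h.disp_aux (b := b) hc] with x hx
    have hd := hasDerivAt_disp hx
    rw [hd.deriv, (((hd.const_mul σ).const_sub a).const_mul K).deriv]
    ring
  have h3 := ((h.eb_deriv_disp (b := b) hc).const_mul (-(K * σ))).congr h2
  rw [norm_neg, norm_mul, norm_eq_abs, norm_eq_abs, hσ, mul_one, abs_of_nonneg hK] at h3
  exact EB.comp h1 h3 (by positivity) (by positivity) hψ.1 (M := B) (fun i hi => hψ.norm_le hi _)

lemma eb_comp_dist {V : Type} [NormedAddCommGroup V] [NormedSpace ℝ V] {v : V} (hv : ‖v‖ = 1) {w : V → ℂ}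
    {M B : ℝ} (hB : 0 ≤ B) (hw : ContDiff ℝ (⊤ : ℕ∞) w) (hb : ∀ i ≤ n, ∀ x, ‖iteratedFDeriv ℝ i w x‖ ≤ M * B ^ i) :
    EB n (fun θ => w (√(distSq R ρ θ) • v)) θ M
      (B * (R * ρ * Real.sin θ / √(distSq R ρ θ)) + n * (11 * n ^ 2 * l)) := by
  have hl := h.one_le_l
  have h0 := h.contDiffAt_dist
  have h1 : ContDiffAt ℝ (⊤ : ℕ∞) (fun θ => √(distSq R ρ θ) • v) θ := h0.smul contDiffAt_const
  have h2 : (fun θ => deriv (fun θ => √(distSq R ρ θ)) θ • v) =ᶠ[𝓝 θ] deriv (fun θ => √(distSq R ρ θ) • v) := by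
    filter_upwards [h.disp_aux (b := 0) one_pos] with x hx
    have hd := hasDerivAt_disp hx
    simp only [← dist_eq R ρ] at hd
    rw [hd.deriv, (hd.smul_const v).deriv]
  have h3 := (h.eb_deriv_dist.smul_vec hv).congr h2
  exact EB.comp h1 h3 (by positivity) hB hw (fun i hi => hb i hi _)

/-- The unit complex number describing the direction of `ξ - η` in the plane of the circle. -/
lemma eb_dir_zpow (p : ℤ) :
    EB n (fun θ => (((R : ℂ) - ρ * Complex.exp (θ * Complex.I)) / ((√(distSq R ρ θ) : ℝ) : ℂ)) ^ p) θ 1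
      (|(p : ℝ)| * (ρ / √(distSq R ρ θ)) + n * (5 * n * l)) := by
  have hS := h.distSq_pos
  have hl := h.one_le_l
  set u : ℝ → ℂ := fun θ => ((R : ℂ) - ρ * Complex.exp (θ * Complex.I)) / ((√(distSq R ρ θ) : ℝ) : ℂ) with hu
  have hpos := h.disp_aux (b := 0) one_pos
  simp only [one_pow, one_mul, ne_eq, OfNat.ofNat_ne_zero, not_false_eq_true, zero_pow, add_zero] at hpos
  have hexp : ∀ x : ℝ, Complex.exp (x * Complex.I) = ((Real.cos x : ℝ) : ℂ) + ((Real.sin x : ℝ) : ℂ) * Complex.I := fun x => by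
    rw [Complex.exp_mul_I]; push_cast; rfl
  have hnorm : ∀ x, 0 < distSq R ρ x → ‖u x‖ = 1 := by
    intro x hx
    have h1 : ‖(R : ℂ) - ρ * Complex.exp (x * Complex.I)‖ = √(distSq R ρ x) := by
      rw [← sqrt_sq (norm_nonneg _), ← Complex.normSq_eq_norm_sq, Complex.normSq_apply, hexp]
      congr 1
      have hcs := sin_sq_add_cos_sq x
      unfold distSq
      generalize Real.cos x = C at *
      generalize Real.sin x = S at *
      simp
      linear_combination ρ ^ 2 * hcs
    simp only [hu]
    rw [norm_div, h1, Complex.norm_real, norm_of_nonneg (sqrt_nonneg _), div_self (sqrt_pos.mpr hx).ne']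
  have hne : ∀ x, 0 < distSq R ρ x → u x ≠ 0 := fun x hx h0 => by
    have := hnorm x hx
    rw [h0, norm_zero] at this
    exact zero_ne_one this
  have hcd : ContDiffAt ℝ (⊤ : ℕ∞) u θ := by
    have h1 : ContDiff ℝ (⊤ : ℕ∞) (fun x : ℝ => (R : ℂ) - ρ * Complex.exp (x * Complex.I)) :=
      contDiff_const.sub (contDiff_const.mul ((Complex.ofRealCLM.contDiff.mul contDiff_const).cexp))
    have h2 : ContDiffAt ℝ (⊤ : ℕ∞) (fun x => ((√(distSq R ρ x) : ℝ) : ℂ)) θ :=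
      Complex.ofRealCLM.contDiff.contDiffAt.comp θ h.contDiffAt_dist
    simp only [hu, div_eq_mul_inv]
    exact h1.contDiffAt.mul (h2.inv (by exact_mod_cast (sqrt_pos.mpr hS).ne'))
  -- The unit complex number u rotates: u' = i · (angular velocity) · u. Every power of u then
  -- solves a linear equation to which `EB.ode` applies.
  have hder : ∀ x, 0 < distSq R ρ x → HasDerivAt u
      ((Complex.I * ((ρ * (ρ - R * Real.cos x) * (distSq R ρ x)⁻¹ : ℝ) : ℂ)) * u x) x := by
    intro x hx
    have hr := sqrt_pos.mpr hx
    have hsq := sq_sqrt hx.le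
    have h1 : HasDerivAt (fun x : ℝ => (R : ℂ) - ρ * Complex.exp (x * Complex.I))
        (-(ρ * (Complex.exp (x * Complex.I) * Complex.I))) x := by
      have := ((((hasDerivAt_id x).ofReal_comp).mul_const Complex.I).cexp.const_mul (ρ : ℂ)).const_sub (R : ℂ)
      simpa using this
    have h2 := hasDerivAt_disp (R := R) (ρ := ρ) (c := 1) (b := 0) (x := x) (by simpa using hx)
    simp only [← dist_eq R ρ] at h2
    have h3 := h1.div h2.ofReal_comp (by exact_mod_cast hr.ne')
    refine h3.congr_deriv ?_
    have hSx : ((√(distSq R ρ x) : ℝ) : ℂ) ^ 2 = (R : ℂ) ^ 2 + ρ ^ 2 - 2 * R * ρ * ((Real.cos x : ℝ) : ℂ) := by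
      rw [← Complex.ofReal_pow, hsq]; unfold distSq; push_cast; ring
    have hS0 : ((distSq R ρ x : ℝ) : ℂ) = (R : ℂ) ^ 2 + ρ ^ 2 - 2 * R * ρ * ((Real.cos x : ℝ) : ℂ) := by
      unfold distSq; push_cast; ring
    have hr0 : ((√(distSq R ρ x) : ℝ) : ℂ) ≠ 0 := by exact_mod_cast hr.ne'
    have hcs : ((Real.sin x : ℝ) : ℂ) ^ 2 + ((Real.cos x : ℝ) : ℂ) ^ 2 = 1 := by
      exact_mod_cast sin_sq_add_cos_sq x
    have hS1 : ((distSq R ρ x : ℝ) : ℂ) ≠ 0 := by exact_mod_cast hx.ne'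
    have hrS : ((√(distSq R ρ x) : ℝ) : ℂ) ^ 2 = ((distSq R ρ x : ℝ) : ℂ) := by rw [hSx, hS0]
    simp only [hu, hexp]
    push_cast
    simp only [one_pow, one_mul, ne_eq, OfNat.ofNat_ne_zero, not_false_eq_true, zero_pow, add_zero]
    generalize ((√(distSq R ρ x) : ℝ) : ℂ) = r at *
    rw [← hrS]
    field_simp
    push_cast at *
    generalize Complex.sin x = S at *
    generalize Complex.cos x = C at *
    have hI := Complex.I_sq
    linear_combination (ρ : ℂ) * (-(Complex.I * (C + S * Complex.I)) * hSx - S * R ^ 2 * hI +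
      R * ρ * (Complex.I * hcs + C * S * hI))
  have hzpow : ContDiffAt ℝ (⊤ : ℕ∞) (fun x => u x ^ p) θ := by
    cases p with
    | ofNat m => simpa using hcd.pow m
    | negSucc m =>
      simp only [zpow_negSucc]
      exact (hcd.pow (m + 1)).inv (pow_ne_zero _ (hne θ hS))
  have hode := EB.ode (n := n) (f := fun x => u x ^ p) (x := θ)
    (z := fun x => (p : ℂ) * (Complex.I * ((ρ * (ρ - R * Real.cos x) * (distSq R ρ x)⁻¹ : ℝ) : ℂ)))
    (Z := |(p : ℝ)| * (ρ / √(distSq R ρ θ))) (L := 5 * n * l)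
    hzpow ?_ (by positivity) ?_
  · rwa [norm_zpow, hnorm θ hS, one_zpow] at hode
  · have h1 := (h.eb_dirDeriv.ofReal.const_mul Complex.I).const_mul (p : ℂ)
    rw [Complex.norm_I, one_mul, Complex.norm_intCast] at h1
    exact h1
  · filter_upwards [hpos] with x hx
    have h1 := (hasDerivAt_zpow p (u x) (Or.inl (hne x hx))).comp x (hder x hx)
    refine h1.deriv.trans ?_
    have : u x ^ p = u x ^ (p - 1) * u x := by rw [← zpow_add_one₀ (hne x hx)]; congr 1; ring
    simp only [this]
    ring

end CircleData

end MKG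

namespace MKG

open Topology Filter Real

/-! ### Oscillatory integrals over a half circle -/

lemma Rot_unit_eq {e ω : E3} (h : OrthoPair e ω) (τ r : ℝ) : Rot e ω τ (r • e) = r • Rot e ω τ e := by
  have := Rot_self h τ 1
  rw [one_smul, one_smul] at this
  rw [Rot_self h, this]

lemma echar_eq_zpow (p : ℤ) (α : ℝ) : echar p α = Complex.exp (α * Complex.I) ^ p := by
  rw [← Complex.exp_int_mul, echar]; congr 1; push_cast; ring

/-- Expansion of a function of bounded angular degree at `ξ - η` along a circle. -/
lemma angular_expansion {D : ℕ} {f : E3 → ℂ} (hf : AngDeg D f) {e ω : E3} (hew : OrthoPair e ω) {R ρ θ : ℝ}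
    (hS : 0 < distSq R ρ θ) :
    f (R • e - ρ • (Real.cos θ • e + Real.sin θ • ω)) =
      ∑ j ∈ Finset.range (2 * D + 1), ∑ p ∈ Finset.Icc (-(D : ℤ)) D,
        (((2 * D + 1 : ℕ) : ℂ)⁻¹ * echar (-p) (node D j)) *
        ((((R : ℂ) - ρ * Complex.exp (θ * Complex.I)) / ((√(distSq R ρ θ) : ℝ) : ℂ)) ^ p *
          f (√(distSq R ρ θ) • Rot e ω (node D j) e)) := by
  have hr := sqrt_pos.mpr hS
  set r := √(distSq R ρ θ)
  set u : ℂ := ((R : ℂ) - ρ * Complex.exp (θ * Complex.I)) / ((r : ℝ) : ℂ) with hu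
  have hexp : Complex.exp (θ * Complex.I) = ((Real.cos θ : ℝ) : ℂ) + ((Real.sin θ : ℝ) : ℂ) * Complex.I := by
    rw [Complex.exp_mul_I]; push_cast; rfl
  have hru : (r : ℂ) * u = ((R - ρ * Real.cos θ : ℝ) : ℂ) + ((-(ρ * Real.sin θ) : ℝ) : ℂ) * Complex.I := by
    rw [hu, mul_div_cancel₀ _ (by exact_mod_cast hr.ne'), hexp]; push_cast; ring
  have hnorm : ‖u‖ = 1 := by
    have h1 : ‖(r : ℂ) * u‖ = r := by
      rw [hru, ← sqrt_sq (norm_nonneg _), ← Complex.normSq_eq_norm_sq, Complex.normSq_add_mul_I]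
      congr 1
      unfold distSq
      linear_combination ρ ^ 2 * sin_sq_add_cos_sq θ
    rw [norm_mul, Complex.norm_real, norm_of_nonneg hr.le] at h1
    exact mul_left_cancel₀ hr.ne' (h1.trans (mul_one r).symm)
  -- The angle α is the direction of ξ - η in the plane of the circle. Sampling in α leaves f on
  -- fixed rays at the distance |ξ - η|, with coefficients that are powers of u = e^{iα}.
  obtain ⟨α, hα⟩ : ∃ α : ℝ, u = Complex.exp (α * Complex.I) :=
    ⟨u.arg, by
      have h1 := Complex.norm_mul_exp_arg_mul_I u
      rw [hnorm, Complex.ofReal_one, one_mul] at h1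
      exact h1.symm⟩
  have hα2 : Complex.exp (α * Complex.I) = ((Real.cos α : ℝ) : ℂ) + ((Real.sin α : ℝ) : ℂ) * Complex.I := by
    rw [Complex.exp_mul_I]; push_cast; rfl
  have hre : R - ρ * Real.cos θ = r * Real.cos α ∧ -(ρ * Real.sin θ) = r * Real.sin α := by
    rw [hα, hα2] at hru
    have h1 := congrArg Complex.re hru
    have h2 := congrArg Complex.im hru
    simp only [Complex.add_re, Complex.mul_re, Complex.ofReal_re, Complex.ofReal_im, Complex.I_re, Complex.I_im,
      Complex.add_im, Complex.mul_im] at h1 h2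
    constructor <;> linarith
  have hpt : R • e - ρ • (Real.cos θ • e + Real.sin θ • ω) = Rot e ω α (r • e) := by
    rw [Rot_self hew]
    have h1 : R • e - ρ • (Real.cos θ • e + Real.sin θ • ω) = (R - ρ * Real.cos θ) • e + (-(ρ * Real.sin θ)) • ω := by module
    rw [h1, hre.1, hre.2]; module
  rw [hpt, (hf e ω hew (r • e)).sample α]
  refine Finset.sum_congr rfl fun j _ => ?_
  rw [dker, Finset.mul_sum, Finset.sum_mul, Rot_unit_eq hew]
  refine Finset.sum_congr rfl fun p _ => ?_
  rw [sub_eq_add_neg, echar_add_right, hα, ← echar_eq_zpow]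
  have : echar p (-node D j) = echar (-p) (node D j) := by simp [echar]
  rw [this]; ring

namespace CircleData

variable {n : ℕ} {R ρ l θ : ℝ} (h : CircleData n R ρ l θ)

include h

/-- In `angular_expansion` the direction varies with rate at most D times ρ over the distance, the
values on rays with rate B times the derivative of the distance. The remaining 16n³l collects 5n²l
and 11n³l. The 2D+1 nodes and 2D+1 frequencies against the coefficient 1/(2D+1) leave the factor
2D+1. -/
lemma eb_angular {D : ℕ} {f : E3 → ℂ} (hf : AngDeg D f) {e ω : E3} (hew : OrthoPair e ω) {M B : ℝ} (hB : 0 ≤ B)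
    (hw : ContDiff ℝ (⊤ : ℕ∞) f) (hb : ∀ (i : ℕ) x, ‖iteratedFDeriv ℝ i f x‖ ≤ M * B ^ i) :
    EB n (fun θ => f (R • e - ρ • (Real.cos θ • e + Real.sin θ • ω))) θ ((2 * D + 1) * M)
      (D * (ρ / √(distSq R ρ θ)) + B * (R * ρ * Real.sin θ / √(distSq R ρ θ)) + 16 * n ^ 3 * l) := by
  have hl := h.one_le_l
  have hn : (1 : ℝ) ≤ n := by exact_mod_cast h.order
  have hρ := h.ρ_pos
  have hR := h.R_pos
  have hs := h.sin_pos
  have hM : 0 ≤ M := by simpa using (norm_nonneg _).trans (hb 0 0)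
  have hev : (fun θ => ∑ j ∈ Finset.range (2 * D + 1), ∑ p ∈ Finset.Icc (-(D : ℤ)) D,
        (((2 * D + 1 : ℕ) : ℂ)⁻¹ * echar (-p) (node D j)) *
        ((((R : ℂ) - ρ * Complex.exp (θ * Complex.I)) / ((√(distSq R ρ θ) : ℝ) : ℂ)) ^ p *
          f (√(distSq R ρ θ) • Rot e ω (node D j) e))) =ᶠ[𝓝 θ]
      fun θ => f (R • e - ρ • (Real.cos θ • e + Real.sin θ • ω)) := by
    filter_upwards [h.disp_aux (b := 0) one_pos] with x hx
    exact (angular_expansion hf hew (by simpa using hx)).symm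
  refine EB.congr ?_ hev
  have hL : 0 ≤ D * (ρ / √(distSq R ρ θ)) + B * (R * ρ * Real.sin θ / √(distSq R ρ θ)) + 16 * n ^ 3 * l := by positivity
  have hterm : ∀ j ∈ Finset.range (2 * D + 1), ∀ p ∈ Finset.Icc (-(D : ℤ)) D,
      EB n (fun θ => (((2 * D + 1 : ℕ) : ℂ)⁻¹ * echar (-p) (node D j)) *
        ((((R : ℂ) - ρ * Complex.exp (θ * Complex.I)) / ((√(distSq R ρ θ) : ℝ) : ℂ)) ^ p *
          f (√(distSq R ρ θ) • Rot e ω (node D j) e))) θ ((2 * (D : ℝ) + 1)⁻¹ * M)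
      (D * (ρ / √(distSq R ρ θ)) + B * (R * ρ * Real.sin θ / √(distSq R ρ θ)) + 16 * n ^ 3 * l) := by
    intro j _ p hp
    have hv : ‖Rot e ω (node D j) e‖ = 1 := by rw [norm_Rot hew, hew.norm_left]
    have h1 := ((h.eb_dir_zpow p).mul (h.eb_comp_dist hv hB hw (fun i _ x => hb i x))).const_mul
      (((2 * D + 1 : ℕ) : ℂ)⁻¹ * echar (-p) (node D j))
    have hp' : |(p : ℝ)| ≤ D := by
      rw [Finset.mem_Icc] at hp
      rw [abs_le]
      exact ⟨by exact_mod_cast hp.1, by exact_mod_cast hp.2⟩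
    refine h1.mono ?_ (by positivity) ?_
    · rw [norm_mul, norm_echar, norm_inv, Complex.norm_natCast, mul_one, one_mul]
      push_cast; rfl
    · have h3 : |(p : ℝ)| * (ρ / √(distSq R ρ θ)) ≤ D * (ρ / √(distSq R ρ θ)) := by gcongr
      have h4 : (n : ℝ) * (5 * n * l) ≤ 5 * n ^ 3 * l := by
        nlinarith [mul_le_mul_of_nonneg_left hn (by positivity : 0 ≤ (n : ℝ) ^ 2 * l)]
      linarith
  refine (EB.sum _ hL fun j hj => EB.sum _ hL fun p hp => hterm j hj p hp).mono ?_ hL le_rfl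
  rw [Finset.sum_const, Finset.sum_const, Finset.card_range, card_Icc_neg, nsmul_eq_mul, nsmul_eq_mul]
  push_cast
  refine le_of_eq ?_
  field_simp

lemma eb_cutoff_dist {s : ℕ} {B : ℝ} {φ : ℝ → ℝ} (hφ : GevreyBound s B φ) {a : ℝ} (ha : 0 < a) :
    EB n (fun θ => φ (√(distSq R ρ θ) / a)) θ B
      (B * ((s : ℝ) * n) ^ s * (a⁻¹ * (R * ρ * Real.sin θ / √(distSq R ρ θ))) + n * (11 * n ^ 2 * l)) := by
  have hB := hφ.nonneg
  have hl := h.one_le_l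
  have h1 : ContDiffAt ℝ (⊤ : ℕ∞) (fun θ => √(distSq R ρ θ) / a) θ := h.contDiffAt_dist.div_const a
  have h2 : (fun θ => a⁻¹ * deriv (fun θ => √(distSq R ρ θ)) θ) =ᶠ[𝓝 θ] deriv (fun θ => √(distSq R ρ θ) / a) := by
    filter_upwards [h.disp_aux (b := 0) one_pos] with x hx
    have hd := hasDerivAt_disp hx
    simp only [← dist_eq R ρ] at hd
    rw [hd.deriv, (hd.div_const a).deriv]
    ring
  have h3 := (h.eb_deriv_dist.const_mul a⁻¹).congr h2
  rw [norm_of_nonneg (by positivity)] at h3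
  exact EB.comp h1 h3 (by positivity) (by positivity) hφ.1 (M := B) (fun i hi => hφ.norm_le hi _)

/-- The derivative of the distance is at most ρ, hence at most l times the distance, hence at most
2^{k+3} l. Divided by the smallest dilation 2^{k-3}, this gives 64 l. -/
lemma eb_band {B : ℝ} {φ : ℝ → ℝ} (hφ : GevreyBound 4 B φ) {k : ℤ} (hr : √(distSq R ρ θ) ≤ 2 ^ (k + 3)) :
    EB n (fun θ => ((phiBand φ k √(distSq R ρ θ) : ℝ) : ℂ)) θ (2 * B) (B * (4 * n) ^ 4 * (64 * l) + 11 * n ^ 3 * l) := by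
  have hB := hφ.nonneg
  have hl := h.one_le_l
  have hρ := h.ρ_pos
  have hR := h.R_pos
  have hs := h.sin_pos
  simp only [phiBand_eq]
  have key : ∀ i : ℤ, k - 3 ≤ i → ((2 : ℝ) ^ i)⁻¹ * (R * ρ * Real.sin θ / √(distSq R ρ θ)) ≤ 64 * l := by
    intro i hi
    have h1 : R * ρ * Real.sin θ / √(distSq R ρ θ) ≤ l * 2 ^ (k + 3) :=
      h.deriv_dist_le.trans (h.ρ_le.trans (by gcongr))
    have h2 : ((2 : ℝ) ^ i)⁻¹ ≤ (2 ^ (k - 3))⁻¹ := by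
      gcongr
      exact one_le_two
    calc _ ≤ ((2 : ℝ) ^ (k - 3))⁻¹ * (l * 2 ^ (k + 3)) := by gcongr
      _ = 64 * l := by
        rw [show k + 3 = (k - 3) + 6 by ring, zpow_add₀ two_ne_zero]
        field_simp
        norm_num
  have h1 := fun i : ℤ => h.eb_cutoff_dist hφ (a := 2 ^ i) (by positivity)
  have h2 : ∀ i : ℤ, k - 3 ≤ i → EB n (fun θ => φ (√(distSq R ρ θ) / 2 ^ i)) θ B (B * (4 * n) ^ 4 * (64 * l) + 11 * n ^ 3 * l) := by
    intro i hi
    refine (h1 i).mono le_rfl (by positivity) ?_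
    have := key i hi
    push_cast
    have h3 : B * (4 * (n : ℝ)) ^ 4 * ((2 ^ i)⁻¹ * (R * ρ * Real.sin θ / √(distSq R ρ θ))) ≤ B * (4 * n) ^ 4 * (64 * l) := by gcongr
    linarith
  exact (((h2 (k + 2) (by omega)).sub (h2 (k - 3) le_rfl)).mono (by linarith) (by positivity) le_rfl).ofReal

end CircleData

/-- Integration by parts `n` times over a half circle. -/
theorem norm_integral_circle_le {n : ℕ} (hn : 1 ≤ n) {R ρ : ℝ} (hR : 0 < R) (hρ : 0 < ρ) {e ω : E3} (hew : OrthoPair e ω)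
    {b c σ t a₀ : ℝ} (hb : 0 < b) (hc : 0 < c) (hσ : |σ| = 1) (ht : t ≠ 0)
    {B₁ : ℝ} {ψ₁ : ℝ → ℂ} (hψ₁ : GevreyBound 6 B₁ ψ₁) {K₁ : ℝ} (hK₁ : 0 ≤ K₁)
    {B₂ : ℝ} {ψ₂ : ℝ → ℂ} (hψ₂ : GevreyBound 6 B₂ ψ₂) {c₀ : ℝ} (hc₀ : 1 ≤ c₀)
    (hψ₂s : ∀ z, ψ₂ z ≠ 0 → c₀⁻¹ ≤ |z| ∧ |z| ≤ c₀) {K₂ : ℝ} (hK₂ : 0 < K₂)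
    {φ : ℝ → ℝ} (hφ : IsCutoff φ) {B : ℝ} (hφB : GevreyBound 4 B φ) (k : ℤ)
    {W : ℝ → ℂ} {MW LW : ℝ} (hLW : 0 ≤ LW)
    (hW : ∀ θ, CircleData n R ρ (c₀ * K₂) θ → √(distSq R ρ θ) ≤ 2 ^ (k + 3) → EB n W θ MW LW)
    {D₁ : ℕ} {f : E3 → ℂ} (hf : AngDeg D₁ f) {M₁ Bf : ℝ} (hBf : 0 ≤ Bf) (hfs : ContDiff ℝ (⊤ : ℕ∞) f)
    (hfb : ∀ (i : ℕ) x, ‖iteratedFDeriv ℝ i f x‖ ≤ M₁ * Bf ^ i)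
    {D₂ : ℕ} {v : ℝ → ℂ} (hv : TrigPoly D₂ v) {H Λ : ℝ}
    (hH : ∀ θ, CircleData n R ρ (c₀ * K₂) θ → (2 : ℝ) ^ (k - 3) ≤ √(distSq R ρ θ) → √(distSq R ρ θ) ≤ 2 ^ (k + 3) →
      √(c ^ 2 * distSq R ρ θ + b ^ 2) * (Real.sin θ)⁻¹ * (|t| * c ^ 2 * (R * ρ))⁻¹ ≤ H)
    (hΛ : ∀ θ, CircleData n R ρ (c₀ * K₂) θ → c₀ * K₂ * Real.sin θ ≤ c₀ ^ 2 → (2 : ℝ) ^ (k - 3) ≤ √(distSq R ρ θ) →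
      √(distSq R ρ θ) ≤ 2 ^ (k + 3) →
      B₁ * (6 * n) ^ 6 * (K₁ * (c ^ 2 * (R * ρ * Real.sin θ) / √(c ^ 2 * distSq R ρ θ + b ^ 2))) +
        (LW + (B₂ * (6 * n) ^ 6 * K₂ + n) + B * (4 * n) ^ 4 * (64 * (c₀ * K₂)) +
        (D₁ * (ρ / √(distSq R ρ θ)) + Bf * (R * ρ * Real.sin θ / √(distSq R ρ θ))) + D₂ +
          38 * n ^ 3 * (c₀ * K₂)) ≤ Λ) :
    ‖∫ θ in (0 : ℝ)..π, Complex.exp (Complex.I * ((t * (a₀ - σ * √(c ^ 2 * distSq R ρ θ + b ^ 2)) : ℝ) : ℂ)) *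
      (ψ₁ (K₁ * (a₀ - σ * √(c ^ 2 * distSq R ρ θ + b ^ 2))) * W θ * ψ₂ (K₂ * Real.sin θ) *
        ((phiBand φ k √(distSq R ρ θ) : ℝ) : ℂ) *
        f (R • e - ρ • (Real.cos θ • e + Real.sin θ • ω)) * v θ)‖ ≤
      π * (B₁ * |MW| * B₂ * (2 * B) * ((2 * D₁ + 1) * M₁) * ((2 * D₂ + 1) * ∫ θ in (-π)..π, ‖v θ‖) *
        (|H| * ((n + 1) * |Λ|)) ^ n) := by
  have hc₀K : 0 < c₀ * K₂ := by positivity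
  have hB₁ := hψ₁.nonneg
  have hB₂ := hψ₂.nonneg
  have hB := hφB.nonneg
  have hM₁ : 0 ≤ M₁ := by simpa using (norm_nonneg _).trans (hfb 0 0)
  have hσ0 : σ ≠ 0 := fun h0 => by rw [h0, abs_zero] at hσ; exact zero_ne_one hσ
  set l := c₀ * K₂ with hl
  have hdpos : ∀ x, 0 < c ^ 2 * distSq R ρ x + b ^ 2 := fun x => by
    have : 0 ≤ distSq R ρ x := by
      unfold distSq
      nlinarith [sq_nonneg (R - ρ), cos_le_one x, mul_pos hR hρ]
    positivity
  set E : ℝ → ℂ := fun θ => Complex.exp (Complex.I * ((t * (a₀ - σ * √(c ^ 2 * distSq R ρ θ + b ^ 2)) : ℝ) : ℂ)) with hE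
  set a : ℝ → ℂ := fun θ => ψ₁ (K₁ * (a₀ - σ * √(c ^ 2 * distSq R ρ θ + b ^ 2))) * W θ * ψ₂ (K₂ * Real.sin θ) *
        ((phiBand φ k √(distSq R ρ θ) : ℝ) : ℂ) *
        f (R • e - ρ • (Real.cos θ • e + Real.sin θ • ω)) * v θ with ha
  -- The sine is positive again beyond 2π, so the amplitude is truncated to confine its support to
  -- (0, π).
  set a' : ℝ → ℂ := (Set.Ioo 0 π).indicator a with ha'
  -- T is closed, because l sin θ ≥ 1 keeps θ away from 0 and π. The truncated amplitude therefore
  -- vanishes in a neighbourhood of each point outside T.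
  set T : Set ℝ := {θ | θ ∈ Set.Ioo 0 π ∧ 1 ≤ l * Real.sin θ ∧ l * Real.sin θ ≤ c₀ ^ 2 ∧
    (2 : ℝ) ^ (k - 3) ≤ √(distSq R ρ θ) ∧ √(distSq R ρ θ) ≤ 2 ^ (k + 3)} with hT
  have hTd : ∀ θ ∈ T, CircleData n R ρ l θ := fun θ hθ =>
    ⟨hn, hR, hρ, sin_pos_of_pos_of_lt_pi hθ.1.1 hθ.1.2, hθ.2.1⟩
  have hcd : Continuous fun θ => √(distSq R ρ θ) := continuous_sqrt.comp (contDiff_distSq R ρ).continuous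
  have hTc : IsClosed T := by
    have h1 : T = Set.Icc 0 π ∩ {θ | 1 ≤ l * Real.sin θ ∧ l * Real.sin θ ≤ c₀ ^ 2 ∧
        (2 : ℝ) ^ (k - 3) ≤ √(distSq R ρ θ) ∧ √(distSq R ρ θ) ≤ 2 ^ (k + 3)} := by
      ext θ
      constructor
      · exact fun h => ⟨Set.Ioo_subset_Icc_self h.1, h.2⟩
      · rintro ⟨h1, h2⟩
        refine ⟨⟨lt_of_le_of_ne h1.1 fun h0 => ?_, lt_of_le_of_ne h1.2 fun h0 => ?_⟩, h2⟩
        · have := h2.1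
          rw [← h0, Real.sin_zero, mul_zero] at this; linarith
        · have := h2.1
          rw [h0, Real.sin_pi, mul_zero] at this; linarith
    rw [h1]
    have hls : Continuous fun θ => l * Real.sin θ := continuous_const.mul Real.continuous_sin
    exact isClosed_Icc.inter ((isClosed_le continuous_const hls).inter ((isClosed_le hls continuous_const).inter
      ((isClosed_le continuous_const hcd).inter (isClosed_le hcd continuous_const))))
  have hzero : ∀ θ ∉ T, a' θ = 0 := by
    intro θ hθ
    by_cases hI : θ ∈ Set.Ioo 0 π
    swap
    · exact Set.indicator_of_notMem hI _
    rw [ha', Set.indicator_of_mem hI]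
    have hs := sin_pos_of_pos_of_lt_pi hI.1 hI.2
    by_contra hne
    have hψ : ψ₂ (K₂ * Real.sin θ) ≠ 0 := fun h0 => hne (by simp [ha, h0])
    have hband : phiBand φ k √(distSq R ρ θ) ≠ 0 := fun h0 => hne (by simp [ha, h0])
    obtain ⟨h1, h2⟩ := hψ₂s _ hψ
    rw [abs_of_pos (by positivity)] at h1 h2
    refine hθ ⟨hI, ?_, ?_, ?_, ?_⟩
    · rw [inv_le_iff_one_le_mul₀ (by positivity)] at h1
      rw [hl]; linarith
    · rw [hl]
      calc c₀ * K₂ * Real.sin θ = c₀ * (K₂ * Real.sin θ) := by ring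
        _ ≤ c₀ * c₀ := by gcongr
        _ = _ := by ring
    · by_contra h0
      exact hband (phiBand_eq_zero_of_le hφ (sqrt_nonneg _) (not_le.mp h0).le)
    · by_contra h0
      exact hband (phiBand_eq_zero_of_lt hφ (not_le.mp h0))
  -- The reciprocal of the logarithmic derivative of E, so that E = hE' on T.
  set h : ℝ → ℂ := fun θ => (Complex.I * ((-(t * σ * (c ^ 2 * (R * ρ))) : ℝ) : ℂ))⁻¹ *
    ((√(c ^ 2 * distSq R ρ θ + b ^ 2) * (Real.sin θ)⁻¹ : ℝ) : ℂ) with hh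
  set E' : ℝ → ℂ := fun θ => Complex.I * ((-(t * σ * (c ^ 2 * (R * ρ * Real.sin θ) *
    (c ^ 2 * distSq R ρ θ + b ^ 2)⁻¹ * √(c ^ 2 * distSq R ρ θ + b ^ 2))) : ℝ) : ℂ) * E θ with hE'
  have hEd : ∀ x, HasDerivAt E (E' x) x := by
    intro x
    have h1 := (((CircleData.hasDerivAt_disp (hdpos x)).const_mul σ).const_sub a₀).const_mul t
    have h2 := (h1.ofReal_comp.const_mul Complex.I).cexp
    refine h2.congr_deriv ?_
    simp only [hE', hE]
    push_cast; ring
  have hEc : Continuous E := continuous_iff_continuousAt.mpr fun x => (hEd x).continuousAt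
  have hE'c : Continuous E' := by
    have h1 : Continuous fun θ => c ^ 2 * distSq R ρ θ + b ^ 2 :=
      (continuous_const.mul (contDiff_distSq R ρ).continuous).add continuous_const
    refine (continuous_const.mul (Complex.continuous_ofReal.comp (Continuous.neg (continuous_const.mul ?_)))).mul hEc
    exact ((continuous_const.mul (continuous_const.mul Real.continuous_sin)).mul
      (h1.inv₀ fun x => (hdpos x).ne')).mul (continuous_sqrt.comp h1)
  have hE1 : ∀ x, ‖E x‖ ≤ 1 := fun x => by
    simp only [hE]; rw [mul_comm, Complex.norm_exp_ofReal_mul_I]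
  have hEh : ∀ x ∈ T, E' x * h x = E x := by
    intro x hx
    have hs := (hTd x hx).sin_pos
    have hq := hdpos x
    have hsq := mul_self_sqrt hq.le
    have h1 : (-(t * σ * (c ^ 2 * (R * ρ))))⁻¹ * (√(c ^ 2 * distSq R ρ x + b ^ 2) * (Real.sin x)⁻¹) *
        (-(t * σ * (c ^ 2 * (R * ρ * Real.sin x) *
        (c ^ 2 * distSq R ρ x + b ^ 2)⁻¹ * √(c ^ 2 * distSq R ρ x + b ^ 2)))) = 1 := by
      have hsq' : √(c ^ 2 * distSq R ρ x + b ^ 2) ^ 2 = c ^ 2 * distSq R ρ x + b ^ 2 := sq_sqrt hq.le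
      have := hq.ne'
      field_simp
      rw [hsq']
    have h2 := congrArg (fun y : ℝ => (y : ℂ)) h1
    have hI : Complex.I * Complex.I⁻¹ = 1 := mul_inv_cancel₀ Complex.I_ne_zero
    simp only [hE', hh, mul_inv]
    push_cast at h2 ⊢
    linear_combination E x * Complex.I * Complex.I⁻¹ * h2 + E x * hI
  have hL8 : ∀ θ ∈ T, 0 ≤ 38 * (n : ℝ) ^ 3 * l := fun θ hθ => by
    have := (hTd θ hθ).one_le_l
    positivity
  have hn1 : (1 : ℝ) ≤ n := by exact_mod_cast hn
  -- The 38 is 11 + 11 + 16, the contributions of ψ₁ composed with the phase, of the band cutoff and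
  -- of the function f.
  have hsum : ∀ θ ∈ T, B₁ * (6 * n) ^ 6 * (K₁ * (c ^ 2 * (R * ρ * Real.sin θ) / √(c ^ 2 * distSq R ρ θ + b ^ 2))) +
        (LW + (B₂ * (6 * n) ^ 6 * K₂ + n) + B * (4 * n) ^ 4 * (64 * l) +
        (D₁ * (ρ / √(distSq R ρ θ)) + Bf * (R * ρ * Real.sin θ / √(distSq R ρ θ))) + D₂ + 38 * n ^ 3 * l) ≤ |Λ| :=
    fun θ hθ => (hΛ θ (hTd θ hθ) hθ.2.2.1 hθ.2.2.2.1 hθ.2.2.2.2).trans (le_abs_self _)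
  have hpos1 : ∀ θ ∈ T, 0 ≤ B₁ * (6 * n) ^ 6 * (K₁ * (c ^ 2 * (R * ρ * Real.sin θ) / √(c ^ 2 * distSq R ρ θ + b ^ 2))) ∧
      0 ≤ D₁ * (ρ / √(distSq R ρ θ)) + Bf * (R * ρ * Real.sin θ / √(distSq R ρ θ)) := fun θ hθ => by
    have := (hTd θ hθ).sin_pos
    constructor <;> positivity
  have hhT : ∀ θ ∈ T, EB n h θ H |Λ| := by
    intro θ hθ
    have hd := hTd θ hθ
    have hl1 := hd.one_le_l
    have h1 := (hd.eb_disp_div_sin (b := b) hc).ofReal.const_mul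
      (Complex.I * ((-(t * σ * (c ^ 2 * (R * ρ))) : ℝ) : ℂ))⁻¹
    refine h1.mono ?_ (by positivity) ?_
    · refine le_trans (le_of_eq ?_) (hH θ hd hθ.2.2.2.1 hθ.2.2.2.2)
      rw [norm_inv, norm_mul, Complex.norm_I, Complex.norm_real, norm_neg, norm_mul, norm_mul, norm_eq_abs, norm_eq_abs,
        hσ, norm_of_nonneg (by positivity : 0 ≤ c ^ 2 * (R * ρ))]
      ring
    · refine le_trans ?_ (hsum θ hθ)
      obtain ⟨p1, p2⟩ := hpos1 θ hθ
      have h3 : 8 * (n : ℝ) ^ 2 * l ≤ 38 * n ^ 3 * l := by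
        have : (n : ℝ) ^ 2 ≤ n ^ 3 := pow_le_pow_right₀ hn1 (by norm_num)
        have h5 : (n : ℝ) ^ 2 * l ≤ n ^ 3 * l := by gcongr
        have h6 : 0 ≤ (n : ℝ) ^ 3 * l := by positivity
        nlinarith
      have p3 : 0 ≤ B₂ * (6 * (n : ℝ)) ^ 6 * K₂ + n := by positivity
      have p4 : 0 ≤ B * (4 * (n : ℝ)) ^ 4 * (64 * l) := by positivity
      have p5 : (0 : ℝ) ≤ D₂ := by positivity
      linarith
  have haT : ∀ θ ∈ T, EB n a θ (B₁ * |MW| * B₂ * (2 * B) * ((2 * D₁ + 1) * M₁) * ((2 * D₂ + 1) * ∫ θ in (-π)..π, ‖v θ‖)) |Λ| := by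
    intro θ hθ
    have hd := hTd θ hθ
    have hl1 := hd.one_le_l
    have e1 := hd.eb_comp_phase (b := b) hc hψ₁ hK₁ hσ a₀
    have e2 := (hW θ hd hθ.2.2.2.2).mono (le_abs_self MW) hLW le_rfl
    have e3 := eb_comp_sin hψ₂ n θ K₂
    have e4 := hd.eb_band hφB hθ.2.2.2.2
    have e5 := hd.eb_angular hf hew hBf hfs hfb
    have e6 := hv.eb n θ
    rw [abs_of_pos hK₂] at e3
    have e := ((((e1.mul e2).mul e3).mul e4).mul e5).mul e6
    refine e.mono le_rfl ?_ ?_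
    · obtain ⟨p1, p2⟩ := hpos1 θ hθ
      positivity
    · refine le_trans (le_of_eq ?_) (hsum θ hθ)
      push_cast
      ring
  have ha'T : ∀ θ ∈ T, EB n a' θ (B₁ * |MW| * B₂ * (2 * B) * ((2 * D₁ + 1) * M₁) * ((2 * D₂ + 1) * ∫ θ in (-π)..π, ‖v θ‖)) |Λ| := by
    intro θ hθ
    refine (haT θ hθ).congr ?_
    filter_upwards [isOpen_Ioo.mem_nhds hθ.1] with x hx
    exact (Set.indicator_of_mem hx a).symm
  have hint : 0 ≤ ∫ θ in (-π)..π, ‖v θ‖ :=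
    intervalIntegral.integral_nonneg (by linarith [pi_pos]) fun _ _ => norm_nonneg _
  have key := norm_integral_le_of_ibp (lo := 0) (hi := π) pi_pos.le (fun θ hθ => hθ.1) hEd hE'c hE1 hEh (abs_nonneg Λ) n hhT
    n a' (B₁ * |MW| * B₂ * (2 * B) * ((2 * D₁ + 1) * M₁) * ((2 * D₂ + 1) * ∫ θ in (-π)..π, ‖v θ‖)) 0 (by omega) (by positivity)
    (fun θ hθ => by simpa using ha'T θ hθ)
    (fun θ hθ => by
      filter_upwards [hTc.isOpen_compl.mem_nhds hθ] with x hx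
      exact hzero x hx)
  rw [sub_zero] at key
  refine le_trans (le_of_eq ?_) key
  congr 1
  refine intervalIntegral.integral_congr fun θ hθ => ?_
  rw [Set.uIcc_of_le pi_pos.le] at hθ
  -- At the endpoints the sine vanishes, and so does the original amplitude; truncation does not
  -- change the integral.
  have h0 : ψ₂ 0 = 0 := by
    by_contra hne
    have := (hψ₂s 0 hne).1
    rw [abs_zero, inv_le_iff_one_le_mul₀ (by positivity)] at this
    linarith
  by_cases hI : θ ∈ Set.Ioo 0 π
  · simp only [ha', Set.indicator_of_mem hI, ha, hE]
  · have hs : Real.sin θ = 0 := by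
      rcases eq_or_lt_of_le hθ.1 with h1 | h1
      · rw [← h1, Real.sin_zero]
      · rcases eq_or_lt_of_le hθ.2 with h2 | h2
        · rw [h2, Real.sin_pi]
        · exact absurd ⟨h1, h2⟩ hI
    simp [ha', Set.indicator_of_notMem hI, hs, h0]

end MKG

namespace MKG

open Topology Filter Real

/-! ### The weight on a dyadic box -/

/-- The term of the weight with index `p`. -/
noncomputable def weightTerm (w : ℤ → ℤ → ℤ → Fin 20 → Fin 3 → E3 → ℂ) (ξ η : E3) (p : ℤ × ℤ × ℤ) : ℂ :=
  ∑ i : Fin 20, (((1 + (2 : ℝ) ^ (max p.1 (max p.2.1 p.2.2)) : ℝ)) : ℂ) *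
      w p.1 p.2.1 p.2.2 i 0 (((2 : ℝ) ^ p.1)⁻¹ • ξ) *
      w p.1 p.2.1 p.2.2 i 1 (((2 : ℝ) ^ p.2.1)⁻¹ • (ξ - η)) *
      w p.1 p.2.1 p.2.2 i 2 (((2 : ℝ) ^ p.2.2)⁻¹ • η)

/-- The indices at distance at most `q` from `(k, k₁, k₂)`. -/
noncomputable def dyadicBox (q k k₁ k₂ : ℤ) : Finset (ℤ × ℤ × ℤ) :=
  Finset.Icc (k - q) (k + q) ×ˢ Finset.Icc (k₁ - q) (k₁ + q) ×ˢ Finset.Icc (k₂ - q) (k₂ + q)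

/-- The part of the weight that matters for `|ξ| ≈ 2^k`, `|ξ-η| ≈ 2^{k₁}`, `|η| ≈ 2^{k₂}`. -/
noncomputable def weightBox (w : ℤ → ℤ → ℤ → Fin 20 → Fin 3 → E3 → ℂ) (q k k₁ k₂ : ℤ) (ξ η : E3) : ℂ :=
  ∑ p ∈ dyadicBox q k k₁ k₂, weightTerm w ξ η p

lemma mem_Icc_of_annulus {R r : ℝ} {q k p : ℤ} (hR : 0 < R) (hq : 8 * R ≤ 2 ^ q) (h1 : (2 : ℝ) ^ (k - 3) ≤ r)
    (h2 : r ≤ 2 ^ (k + 3)) (h3 : R⁻¹ ≤ ((2 : ℝ) ^ p)⁻¹ * r) (h4 : ((2 : ℝ) ^ p)⁻¹ * r ≤ R) :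
    p ∈ Finset.Icc (k - q) (k + q) := by
  have hp : (0 : ℝ) < 2 ^ p := by positivity
  have hq' : (2 : ℝ) ^ (q - 3) = 2 ^ q / 8 := by rw [zpow_sub₀ two_ne_zero]; norm_num
  have hRq : R ≤ 2 ^ (q - 3) := by rw [hq']; linarith
  rw [inv_mul_le_iff₀ hp] at h4
  rw [le_inv_mul_iff₀ hp, ← div_eq_mul_inv, div_le_iff₀ hR] at h3
  rw [Finset.mem_Icc]
  constructor
  · have : (2 : ℝ) ^ (k - 3) ≤ 2 ^ (p + (q - 3)) := by
      rw [zpow_add₀ two_ne_zero]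
      exact h1.trans (h4.trans (by gcongr))
    have := (zpow_le_zpow_iff_right₀ (one_lt_two (α := ℝ))).mp this
    omega
  · have : (2 : ℝ) ^ p ≤ 2 ^ (k + 3 + (q - 3)) := by
      rw [zpow_add₀ two_ne_zero]
      exact h3.trans (by gcongr)
    have := (zpow_le_zpow_iff_right₀ (one_lt_two (α := ℝ))).mp this
    omega

/-- A nonzero term has each index within q of the given one: 2^q ≥ 8R accounts for the annulus of
ratio R and for the factor 8 by which the shells are widened. -/
lemma weight_eq_weightBox {R B : ℝ} {w : ℤ → ℤ → ℤ → Fin 20 → Fin 3 → E3 → ℂ} (hw : IsWeightFamily R B w) (hR : 0 < R)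
    {q k k₁ k₂ : ℤ} (hq : 8 * R ≤ 2 ^ q) {ξ η : E3} (h1 : (2 : ℝ) ^ (k - 3) ≤ ‖ξ‖) (h2 : ‖ξ‖ ≤ 2 ^ (k + 3))
    (h3 : (2 : ℝ) ^ (k₁ - 3) ≤ ‖ξ - η‖) (h4 : ‖ξ - η‖ ≤ 2 ^ (k₁ + 3)) (h5 : (2 : ℝ) ^ (k₂ - 3) ≤ ‖η‖)
    (h6 : ‖η‖ ≤ 2 ^ (k₂ + 3)) : weight w ξ η = weightBox w q k k₁ k₂ ξ η := by
  refine tsum_eq_sum fun p hp => Finset.sum_eq_zero fun i _ => ?_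
  by_contra hne
  have hs : ∀ (r : Fin 3) (a : ℤ) (x : E3), w p.1 p.2.1 p.2.2 i r (((2 : ℝ) ^ a)⁻¹ • x) ≠ 0 →
      R⁻¹ ≤ ((2 : ℝ) ^ a)⁻¹ * ‖x‖ ∧ ((2 : ℝ) ^ a)⁻¹ * ‖x‖ ≤ R := fun r a x h0 => by
    have := (hw p.1 p.2.1 p.2.2 i r).2 _ h0
    rwa [norm_smul, norm_of_nonneg (by positivity)] at this
  have e0 := hs 0 p.1 ξ (fun h0 => hne (by rw [h0]; ring))
  have e1 := hs 1 p.2.1 (ξ - η) (fun h0 => hne (by rw [h0]; ring))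
  have e2 := hs 2 p.2.2 η (fun h0 => hne (by rw [h0]; ring))
  refine hp (Finset.mem_product.mpr ⟨mem_Icc_of_annulus hR hq h1 h2 e0.1 e0.2, Finset.mem_product.mpr
    ⟨mem_Icc_of_annulus hR hq h3 h4 e1.1 e1.2, mem_Icc_of_annulus hR hq h5 h6 e2.1 e2.2⟩⟩)

/-- The bound for the weight on a dyadic box. -/
noncomputable def weightMass (B : ℝ) (q k k₁ k₂ : ℤ) : ℝ :=
  (2 * q + 1) ^ 3 * (20 * ((1 + 2 ^ (max k (max k₁ k₂) + q)) * B ^ 3))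

lemma card_dyadicBox {q : ℤ} (hq : 0 ≤ q) (k k₁ k₂ : ℤ) : ((dyadicBox q k k₁ k₂).card : ℝ) = (2 * q + 1) ^ 3 := by
  have : ∀ a : ℤ, ((Finset.Icc (a - q) (a + q)).card : ℝ) = 2 * q + 1 := fun a => by
    rw [Int.card_Icc]
    have h : ((a + q + 1 - (a - q)).toNat : ℤ) = 2 * q + 1 := by omega
    exact_mod_cast congrArg (fun z : ℤ => (z : ℝ)) h
  rw [dyadicBox, Finset.card_product, Finset.card_product, Nat.cast_mul, Nat.cast_mul, this, this, this]
  ring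

lemma max_le_of_mem_dyadicBox {q k k₁ k₂ : ℤ} {p : ℤ × ℤ × ℤ} (hp : p ∈ dyadicBox q k k₁ k₂) :
    max p.1 (max p.2.1 p.2.2) ≤ max k (max k₁ k₂) + q := by
  simp only [dyadicBox, Finset.mem_product, Finset.mem_Icc] at hp
  omega

lemma norm_weightTerm_le {R B : ℝ} {w : ℤ → ℤ → ℤ → Fin 20 → Fin 3 → E3 → ℂ} (hw : IsWeightFamily R B w)
    {q k k₁ k₂ : ℤ} {p : ℤ × ℤ × ℤ} (hp : p ∈ dyadicBox q k k₁ k₂) (ξ η : E3) :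
    ‖weightTerm w ξ η p‖ ≤ 20 * ((1 + 2 ^ (max k (max k₁ k₂) + q)) * B ^ 3) := by
  have hmax := max_le_of_mem_dyadicBox hp
  have hB : 0 ≤ B := (hw 0 0 0 0 0).1.nonneg
  have hle : ∀ i r x, ‖w p.1 p.2.1 p.2.2 i r x‖ ≤ B := fun i r x => by
    simpa using (hw p.1 p.2.1 p.2.2 i r).1.norm_le (le_refl 0) x
  refine (norm_sum_le _ _).trans ((Finset.sum_le_card_nsmul _ _
    ((1 + 2 ^ (max k (max k₁ k₂) + q)) * B ^ 3) fun i _ => ?_).trans (le_of_eq ?_))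
  · rw [norm_mul, norm_mul, norm_mul, Complex.norm_real, norm_of_nonneg (by positivity)]
    calc _ ≤ (1 + (2 : ℝ) ^ (max k (max k₁ k₂) + q)) * B * B * B := by
          gcongr
          · exact one_le_two
          · exact hle _ _ _
          · exact hle _ _ _
          · exact hle _ _ _
      _ = _ := by ring
  · simp

lemma norm_weightBox_le {R B : ℝ} {w : ℤ → ℤ → ℤ → Fin 20 → Fin 3 → E3 → ℂ} (hw : IsWeightFamily R B w)
    {q : ℤ} (hq : 0 ≤ q) (k k₁ k₂ : ℤ) (ξ η : E3) : ‖weightBox w q k k₁ k₂ ξ η‖ ≤ weightMass B q k k₁ k₂ := by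
  refine (norm_sum_le _ _).trans ((Finset.sum_le_card_nsmul _ _ _ fun p hp => norm_weightTerm_le hw hp ξ η).trans (le_of_eq ?_))
  rw [nsmul_eq_mul, card_dyadicBox hq]; rfl

lemma continuous_weightBox {R B : ℝ} {w : ℤ → ℤ → ℤ → Fin 20 → Fin 3 → E3 → ℂ} (hw : IsWeightFamily R B w)
    (q k k₁ k₂ : ℤ) (ξ : E3) : Continuous (weightBox w q k k₁ k₂ ξ) := by
  have hc : ∀ k k₁ k₂ i r, Continuous (w k k₁ k₂ i r) := fun k k₁ k₂ i r => (hw k k₁ k₂ i r).1.1.continuous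
  refine continuous_finsetSum _ fun p _ => continuous_finsetSum _ fun i _ => ?_
  exact (continuous_const.mul ((hc _ _ _ _ _).comp (by fun_prop))).mul ((hc _ _ _ _ _).comp (by fun_prop))

/-- The weight along a circle. -/
lemma CircleData.eb_weightBox {n : ℕ} {R ρ l θ : ℝ} (h : CircleData n R ρ l θ) {S B : ℝ}
    {w : ℤ → ℤ → ℤ → Fin 20 → Fin 3 → E3 → ℂ} (hw : IsWeightFamily S B w) {q : ℤ} (hq : 0 ≤ q) (k k₁ k₂ : ℤ)
    {e ω : E3} (hew : OrthoPair e ω) (hρ₂ : ρ ≤ 2 ^ (k₂ + 3)) (hr : √(distSq R ρ θ) ≤ 2 ^ (k₁ + 3)) :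
    EB n (fun θ => weightBox w q k k₁ k₂ (R • e) (ρ • (Real.cos θ • e + Real.sin θ • ω))) θ
      (weightMass B q k k₁ k₂) (2 * (B * (6 * n) ^ 6 * (2 ^ (q + 3) * l) + n)) := by
  have hl := h.one_le_l
  have hρ := h.ρ_pos
  have hB : 0 ≤ B := (hw 0 0 0 0 0).1.nonneg
  have hL : 0 ≤ 2 * (B * (6 * (n : ℝ)) ^ 6 * (2 ^ (q + 3) * l) + n) := by positivity
  -- For the profile in ξ - η the velocity ρ is compared with 2^{k₁} through ρ ≤ l |ξ - η|; for the
  -- profile in η, ρ is itself of size 2^{k₂}, and l ≥ 1.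
  have hscale : ∀ (a j : ℤ), a ∈ Finset.Icc (j - q) (j + q) → ρ ≤ l * 2 ^ (j + 3) →
      ((2 : ℝ) ^ a)⁻¹ * ρ ≤ 2 ^ (q + 3) * l := by
    intro a j ha hj
    rw [Finset.mem_Icc] at ha
    rw [inv_mul_le_iff₀ (by positivity)]
    have : (2 : ℝ) ^ (j + 3) ≤ 2 ^ a * 2 ^ (q + 3) := by
      rw [← zpow_add₀ two_ne_zero]
      exact zpow_le_zpow_right₀ one_le_two (by omega)
    calc ρ ≤ l * 2 ^ (j + 3) := hj
      _ ≤ l * (2 ^ a * 2 ^ (q + 3)) := by gcongr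
      _ = _ := by ring
  have hterm : ∀ p ∈ dyadicBox q k k₁ k₂, ∀ i : Fin 20,
      EB n (fun θ => (((1 + (2 : ℝ) ^ (max p.1 (max p.2.1 p.2.2)) : ℝ)) : ℂ) *
        w p.1 p.2.1 p.2.2 i 0 (((2 : ℝ) ^ p.1)⁻¹ • (R • e)) *
        w p.1 p.2.1 p.2.2 i 1 (((2 : ℝ) ^ p.2.1)⁻¹ • (R • e - (ρ • (Real.cos θ • e + Real.sin θ • ω)))) *
        w p.1 p.2.1 p.2.2 i 2 (((2 : ℝ) ^ p.2.2)⁻¹ • (ρ • (Real.cos θ • e + Real.sin θ • ω)))) θ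
      ((1 + 2 ^ (max k (max k₁ k₂) + q)) * B ^ 3) (2 * (B * (6 * n) ^ 6 * (2 ^ (q + 3) * l) + n)) := by
    intro p hp i
    have hmax := max_le_of_mem_dyadicBox hp
    simp only [dyadicBox, Finset.mem_product] at hp
    have hw1 := eb_profile hew (hw p.1 p.2.1 p.2.2 i 1).1 n θ (((2 : ℝ) ^ p.2.1)⁻¹ • (R • e)) (-(((2 : ℝ) ^ p.2.1)⁻¹ * ρ))
    have hw2 := eb_profile hew (hw p.1 p.2.1 p.2.2 i 2).1 n θ 0 (((2 : ℝ) ^ p.2.2)⁻¹ * ρ)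
    rw [abs_neg, abs_of_nonneg (by positivity)] at hw1
    rw [abs_of_nonneg (by positivity)] at hw2
    have s1 := hscale p.2.1 k₁ hp.2.1 (h.ρ_le.trans (by gcongr))
    have s2 := hscale p.2.2 k₂ hp.2.2 (hρ₂.trans (le_mul_of_one_le_left (by positivity) hl))
    have he := ((hw1.const_mul ((((1 + (2 : ℝ) ^ (max p.1 (max p.2.1 p.2.2)) : ℝ)) : ℂ) *
        w p.1 p.2.1 p.2.2 i 0 (((2 : ℝ) ^ p.1)⁻¹ • (R • e)))).mul hw2)
    refine (he.mono ?_ (by positivity) ?_).congr (Eventually.of_forall fun x => ?_)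
    · rw [norm_mul, Complex.norm_real, norm_of_nonneg (by positivity)]
      have h0 : ‖w p.1 p.2.1 p.2.2 i 0 (((2 : ℝ) ^ p.1)⁻¹ • (R • e))‖ ≤ B := by
        simpa using (hw p.1 p.2.1 p.2.2 i 0).1.norm_le (le_refl 0) (((2 : ℝ) ^ p.1)⁻¹ • (R • e))
      calc _ ≤ (1 + (2 : ℝ) ^ (max k (max k₁ k₂) + q)) * B * B * B := by
            gcongr
            exact one_le_two
        _ = _ := by ring
    · push_cast
      have t1 : B * (6 * (n : ℝ)) ^ 6 * (((2 : ℝ) ^ p.2.1)⁻¹ * ρ) ≤ B * (6 * n) ^ 6 * (2 ^ (q + 3) * l) := by gcongr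
      have t2 : B * (6 * (n : ℝ)) ^ 6 * (((2 : ℝ) ^ p.2.2)⁻¹ * ρ) ≤ B * (6 * n) ^ 6 * (2 ^ (q + 3) * l) := by gcongr
      linarith
    · simp only
      congr 3
      · module
      · module
  have he := EB.sum (dyadicBox q k k₁ k₂) hL fun p hp => EB.sum Finset.univ hL fun i _ => hterm p hp i
  refine he.mono ?_ hL le_rfl
  rw [Finset.sum_const, Finset.sum_const, nsmul_eq_mul, nsmul_eq_mul, card_dyadicBox hq, Finset.card_univ, Fintype.card_fin]
  refine le_of_eq ?_
  rw [weightMass]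
  push_cast; ring

end MKG

namespace MKG

open Topology Filter Real

/-! ### Size of the phase derivative and of the amplitude -/

lemma disp_le {b c r u : ℝ} (hb : 0 < b) (hc : 0 < c) (hr : 0 ≤ r) (hru : r ≤ 8 * u) :
    √(c ^ 2 * r ^ 2 + b ^ 2) ≤ (8 * c + b) * max 1 u := by
  have h1 : 1 ≤ max 1 u := le_max_left _ _
  have h2 : u ≤ max 1 u := le_max_right _ _
  rw [sqrt_le_left (by positivity)]
  have h3 : c * r ≤ 8 * c * max 1 u := by nlinarith
  have h4 : b ≤ b * max 1 u := le_mul_of_one_le_right hb.le h1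
  have h5 : 0 ≤ c * r := by positivity
  nlinarith [mul_le_mul h3 h3 h5 (by positivity), mul_le_mul h4 h4 hb.le (by positivity), mul_nonneg h5 hb.le,
    (by positivity : 0 ≤ 8 * c * max 1 u * (b * max 1 u))]

lemma le_disp {b c r u : ℝ} (hb : 0 < b) (hc : 0 < c) (hru : u / 8 ≤ r) :
    min b (c / 8) * max 1 u ≤ √(c ^ 2 * r ^ 2 + b ^ 2) := by
  have hm : 0 < min b (c / 8) := by positivity
  rcases max_cases 1 u with ⟨h, h'⟩ | ⟨h, h'⟩
  · rw [h, mul_one]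
    refine (min_le_left _ _).trans (le_sqrt_of_sq_le ?_)
    nlinarith [sq_nonneg (c * r)]
  · rw [h]
    have h1 : min b (c / 8) * u ≤ c * r :=
      (mul_le_mul_of_nonneg_right (min_le_right _ _) (by linarith)).trans (by nlinarith)
    refine h1.trans (le_sqrt_of_sq_le ?_)
    nlinarith [sq_nonneg b]

/-- The constant in the bound for the reciprocal of the derivative of the phase. -/
noncomputable def recipConst (b c c₀ : ℝ) : ℝ := (8 * c + b) * c₀ * (16 * c₀) / c ^ 2

/-- Here u, u₁, u₂ stand for 2^k, 2^{k₁}, 2^{k₂}, x for 2^υ and M for 2^m. The dispersion relation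
has size max(1, u₁), and the lower bound on the sine gives the factor x. -/
lemma recip_phase_le {b c c₀ t M R ρ r u u₁ u₂ x s : ℝ} (hb : 0 < b) (hc : 0 < c) (hc₀ : 1 ≤ c₀) (hM : 0 < M) (hu : 0 < u)
    (hu₂ : 0 < u₂) (hx : 0 < x) (ht : c₀⁻¹ * M ≤ |t|) (hR : u / 2 ≤ R) (hρ : u₂ / 8 ≤ ρ) (hr0 : 0 ≤ r) (hr : r ≤ 8 * u₁)
    (hs : 0 < s) (hs1 : 1 ≤ c₀ * x * s) :
    √(c ^ 2 * r ^ 2 + b ^ 2) * s⁻¹ * (|t| * c ^ 2 * (R * ρ))⁻¹ ≤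
      recipConst b c c₀ * (max 1 u₁ * x / (M * u * u₂)) := by
  have h1 := disp_le hb hc hr0 hr
  have h2 : s⁻¹ ≤ c₀ * x := by rw [inv_le_iff_one_le_mul₀ hs]; linarith
  have hP : 0 < max 1 u₁ := by positivity
  have hR0 : 0 < R := by linarith
  have hρ0 : 0 < ρ := by linarith
  have h3 : (|t| * c ^ 2 * (R * ρ))⁻¹ ≤ (c₀⁻¹ * M * c ^ 2 * (u / 2 * (u₂ / 8)))⁻¹ := by
    gcongr
  calc _ ≤ ((8 * c + b) * max 1 u₁) * (c₀ * x) * (c₀⁻¹ * M * c ^ 2 * (u / 2 * (u₂ / 8)))⁻¹ := by gcongr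
    _ = _ := by
      rw [recipConst]
      field_simp
      norm_num

/-- The quantity that controls the derivatives of the amplitude. -/
noncomputable def ampScale (x y P u u₁ u₂ J L₁ L₂ : ℝ) : ℝ :=
  x + y * u * u₂ / (x * P) + L₁ * u₂ / u₁ + J * u * u₂ / (u₁ * x) + L₂

/-- The constant in the bound for the derivatives of the amplitude. -/
noncomputable def ampConst (b c c₀ B₁ B₂ B Bw Q a : ℝ) : ℝ :=
  B₁ * 6 ^ 6 * (16 * c ^ 2 * c₀ / min b (c / 8)) +
    (2 * (Bw * 6 ^ 6 * (Q * c₀) + c₀) + (B₂ * 6 ^ 6 + c₀) + B * 4 ^ 4 * (64 * c₀) + 38 * c₀ + 64 * a + 256 * c₀ + a)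

/-- The upper bound s ≤ c₀/x compensates the large factors wherever a derivative of |ξ - η| produces
a sine. In `ampScale` the five terms come from the weight and cutoffs, from ψ₁, from the angular
degree of F, from its spatial support, and from the angular degree of G. -/
lemma amplitude_le {b c c₀ R ρ r u u₁ u₂ x y s n B₁ B₂ B Bw Q a D₁ D₂ L₁ L₂ J : ℝ} (hb : 0 < b) (hc : 0 < c) (hc₀ : 1 ≤ c₀)
    (hB₁ : 0 ≤ B₁) (hB₂ : 0 ≤ B₂) (hB : 0 ≤ B) (hBw : 0 ≤ Bw) (hQ : 0 ≤ Q) (ha : 0 ≤ a)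
    (hn : 1 ≤ n) (hu : 0 < u) (hu₁ : 0 < u₁) (hu₂ : 0 < u₂) (hx : 0 < x) (hy : 0 < y) (hR : R ≤ 2 * u)
    (hρ0 : 0 < ρ) (hρ : ρ ≤ 8 * u₂) (hr0 : u₁ / 8 ≤ r) (hs : 0 < s) (hs1 : 1 ≤ c₀ * x * s)
    (hs2 : c₀ * x * s ≤ c₀ ^ 2) (hsle : s ≤ 1) (hL₁ : 0 ≤ L₁) (hL₂ : 0 ≤ L₂) (hJ : 0 ≤ J) (hD₁ : D₁ ≤ a * L₁)
    (hD₂ : D₂ ≤ a * L₂) :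
    B₁ * (6 * n) ^ 6 * (y * (c ^ 2 * (R * ρ * s) / √(c ^ 2 * r ^ 2 + b ^ 2))) +
        (2 * (Bw * (6 * n) ^ 6 * (Q * (c₀ * x)) + n) + (B₂ * (6 * n) ^ 6 * x + n) + B * (4 * n) ^ 4 * (64 * (c₀ * x)) +
        (D₁ * (ρ / r) + 2 * J * (R * ρ * s / r)) + D₂ + 38 * n ^ 3 * (c₀ * x)) ≤
      ampConst b c c₀ B₁ B₂ B Bw Q a * n ^ 6 * ampScale x y (max 1 u₁) u u₁ u₂ J L₁ L₂ := by
  have hr : 0 < r := by linarith [div_pos hu₁ (by norm_num : (0 : ℝ) < 8)]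
  have hP : 0 < max 1 u₁ := by positivity
  have hmin : 0 < min b (c / 8) := by positivity
  have hΨ := le_disp hb hc hr0
  have hsx : s ≤ c₀ / x := by
    rw [le_div_iff₀ hx]
    nlinarith
  have hcx : 1 ≤ c₀ * x := by nlinarith
  have hn6 : 1 ≤ n ^ 6 := one_le_pow₀ hn
  have hn61 : n ≤ n ^ 6 := le_self_pow₀ hn (by norm_num)
  have hn63 : n ^ 3 ≤ n ^ 6 := pow_le_pow_right₀ hn (by norm_num)
  have hn64 : n ^ 4 ≤ n ^ 6 := pow_le_pow_right₀ hn (by norm_num)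
  have t1 : c ^ 2 * (R * ρ * s) / √(c ^ 2 * r ^ 2 + b ^ 2) ≤ c ^ 2 * (2 * u * (8 * u₂) * (c₀ / x)) / (min b (c / 8) * max 1 u₁) := by
    gcongr
  have t5 : ρ / r ≤ 8 * u₂ / (u₁ / 8) := by gcongr
  have t6 : R * ρ * s / r ≤ 2 * u * (8 * u₂) * (c₀ / x) / (u₁ / 8) := by gcongr
  have hnx : n ≤ n ^ 6 * (c₀ * x) := hn61.trans (le_mul_of_one_le_right (by positivity) hcx)
  have T1 : B₁ * (6 * n) ^ 6 * (y * (c ^ 2 * (R * ρ * s) / √(c ^ 2 * r ^ 2 + b ^ 2))) ≤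
      B₁ * 6 ^ 6 * (16 * c ^ 2 * c₀ / min b (c / 8)) * n ^ 6 * (y * u * u₂ / (x * max 1 u₁)) := by
    calc _ ≤ B₁ * (6 * n) ^ 6 * (y * (c ^ 2 * (2 * u * (8 * u₂) * (c₀ / x)) / (min b (c / 8) * max 1 u₁))) := by gcongr
      _ = _ := by field_simp; ring
  have T5 : D₁ * (ρ / r) ≤ 64 * a * n ^ 6 * (L₁ * u₂ / u₁) := by
    calc D₁ * (ρ / r) ≤ a * L₁ * (8 * u₂ / (u₁ / 8)) := by gcongr
      _ = 64 * a * 1 * (L₁ * u₂ / u₁) := by field_simp; ring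
      _ ≤ _ := by gcongr
  have T6 : 2 * J * (R * ρ * s / r) ≤ 256 * c₀ * n ^ 6 * (J * u * u₂ / (u₁ * x)) := by
    calc _ ≤ 2 * J * (2 * u * (8 * u₂) * (c₀ / x) / (u₁ / 8)) := by gcongr
      _ = 256 * c₀ * 1 * (J * u * u₂ / (u₁ * x)) := by field_simp; ring
      _ ≤ _ := by gcongr
  have T7 : D₂ ≤ a * n ^ 6 * L₂ := by
    calc D₂ ≤ a * 1 * L₂ := by linarith
      _ ≤ _ := by gcongr
  have T2 : 2 * (Bw * (6 * n) ^ 6 * (Q * (c₀ * x)) + n) + (B₂ * (6 * n) ^ 6 * x + n) + B * (4 * n) ^ 4 * (64 * (c₀ * x)) +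
      38 * n ^ 3 * (c₀ * x) ≤
      (2 * (Bw * 6 ^ 6 * (Q * c₀) + c₀) + (B₂ * 6 ^ 6 + c₀) + B * 4 ^ 4 * (64 * c₀) + 38 * c₀) * n ^ 6 * x := by
    have e1 : B * (4 * n) ^ 4 * (64 * (c₀ * x)) ≤ B * 4 ^ 4 * (64 * c₀) * n ^ 6 * x := by
      calc _ = B * 4 ^ 4 * (64 * c₀) * n ^ 4 * x := by ring
        _ ≤ _ := by gcongr
    have e2 : 38 * n ^ 3 * (c₀ * x) ≤ 38 * c₀ * n ^ 6 * x := by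
      calc _ = 38 * c₀ * n ^ 3 * x := by ring
        _ ≤ _ := by gcongr
    linarith
  unfold ampConst ampScale
  set α := B₁ * 6 ^ 6 * (16 * c ^ 2 * c₀ / min b (c / 8))
  set β := 2 * (Bw * 6 ^ 6 * (Q * c₀) + c₀) + (B₂ * 6 ^ 6 + c₀) + B * 4 ^ 4 * (64 * c₀) + 38 * c₀ with hβ
  have hα : 0 ≤ α := by positivity
  have hβ0 : 0 ≤ β := by positivity
  set X₁ := y * u * u₂ / (x * max 1 u₁)
  set X₂ := L₁ * u₂ / u₁
  set X₃ := J * u * u₂ / (u₁ * x)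
  have hX₁ : 0 ≤ X₁ := by positivity
  have hX₂ : 0 ≤ X₂ := by positivity
  have hX₃ : 0 ≤ X₃ := by positivity
  set C := α + (β + 64 * a + 256 * c₀ + a) with hC
  have hs1 : α * n ^ 6 * X₁ ≤ C * n ^ 6 * X₁ := by
    gcongr; rw [hC]; linarith
  have hs2 : β * n ^ 6 * x ≤ C * n ^ 6 * x := by
    gcongr; rw [hC]; linarith
  have hs3 : 64 * a * n ^ 6 * X₂ ≤ C * n ^ 6 * X₂ := by
    gcongr; rw [hC]; linarith
  have hs4 : 256 * c₀ * n ^ 6 * X₃ ≤ C * n ^ 6 * X₃ := by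
    gcongr; rw [hC]; linarith
  have hs5 : a * n ^ 6 * L₂ ≤ C * n ^ 6 * L₂ := by
    gcongr; rw [hC]; linarith
  have : C * n ^ 6 * (x + X₁ + X₂ + X₃ + L₂) = C * n ^ 6 * X₁ + C * n ^ 6 * x + C * n ^ 6 * X₂ + C * n ^ 6 * X₃ + C * n ^ 6 * L₂ := by ring
  rw [this]
  linarith

lemma recip_mul_ampScale {x y P u u₁ u₂ J L₁ L₂ M E : ℝ} (hx : 0 < x) (hP : 0 < P) (hu : 0 < u) (hu₁ : 0 < u₁)
    (hu₂ : 0 < u₂) (hM : 0 < M) (h1 : P * x ^ 2 / (M * u * u₂) ≤ E) (h2 : y / M ≤ E)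
    (h3 : L₁ * P * x / (M * u * u₁) ≤ E) (h4 : J * P / (M * u₁) ≤ E) (h5 : L₂ * P * x / (M * u * u₂) ≤ E) :
    P * x / (M * u * u₂) * ampScale x y P u u₁ u₂ J L₁ L₂ ≤ 5 * E := by
  have : P * x / (M * u * u₂) * ampScale x y P u u₁ u₂ J L₁ L₂ = P * x ^ 2 / (M * u * u₂) + y / M +
      L₁ * P * x / (M * u * u₁) + J * P / (M * u₁) + L₂ * P * x / (M * u * u₂) := by
    unfold ampScale
    field_simp
  linarith

end MKG

namespace MKG

open Topology Filter Real

/-! ### Comparison of the exponents -/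

/-- The three frequency configurations for real exponents and the logarithmic margin `L`. -/
def RealConfig (m k k₁ k₂ l υ L : ℝ) : Prop :=
  (|k₁ - k₂| ≤ 6 ∧ υ < (m + k) / 2 - max 0 (max k₁ k₂) - L ∧ 2 * l < m + k - L) ∨
  (|k - k₁| ≤ 6 ∧ υ < (m + k₂) / 2 - max 0 (max k₁ k₂) - L ∧ 2 * l < m + k₂ - L) ∨
  (|k - k₂| ≤ 6 ∧ |k₁| < (m - l) / 2 - L ∧ υ < (m - l) / 2 - L)

/-- The logarithms of three of the five terms, and a cap on the frequencies. In the first two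
configurations the cap holds because υ is bounded below while it is less than (m + k)/2 or (m +
k₂)/2 minus max(0, k₁, k₂); in the third it holds because k₂ ≤ k₁ + υ + O(1), and both |k₁| and υ
are below (m - l)/2. -/
lemma exponent_bounds {m k k₁ k₂ l₁ l₂ υ L s Q : ℝ} (hs : 0 ≤ s) (hQ : 0 ≤ Q) (hL : 0 ≤ L) (hυ : -s ≤ υ)
    (hk₂ : k₂ ≤ k₁ + υ + (6 + s)) (t0 : k ≤ max k₁ k₂ + 5) (t1 : k₂ ≤ max k k₁ + 7) (t2 : k₁ ≤ max k k₂ + 7)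
    (hmax : -2 * Q ≤ max k₁ k₂) (hl₁ : 0 ≤ l₁) (hl : max l₁ l₂ < m / 10)
    (hcfg : RealConfig m k k₁ k₂ (max l₁ l₂) υ L) :
    max 0 k₁ + 2 * υ - m - k - k₂ ≤ 100 + 10 * Q + 10 * s - L ∧
    l₁ + max 0 k₁ + υ - m - k - k₁ ≤ 100 + 10 * Q + 10 * s - L ∧
    l₂ + max 0 k₁ + υ - m - k - k₂ ≤ 100 + 10 * Q + 10 * s - L ∧
    max k (max k₁ k₂) ≤ m + (100 + 10 * Q + 10 * s) := by
  have hle1 : l₁ ≤ max l₁ l₂ := le_max_left _ _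
  have hle2 : l₂ ≤ max l₁ l₂ := le_max_right _ _
  set l := max l₁ l₂
  have hb0 : 0 ≤ max 0 (max k₁ k₂) := le_max_left _ _
  have hb : max k₁ k₂ ≤ max 0 (max k₁ k₂) := le_max_right _ _
  have hp : max 0 k₁ ≤ max 0 (max k₁ k₂) := max_le_max le_rfl (le_max_left _ _)
  have hM1 : k₁ ≤ max k₁ k₂ := le_max_left _ _
  have hM2 : k₂ ≤ max k₁ k₂ := le_max_right _ _
  have hkM : max k (max k₁ k₂) ≤ max k₁ k₂ + 5 := max_le t0 (by linarith)
  rcases hcfg with ⟨h1, h2, h3⟩ | ⟨h1, h2, h3⟩ | ⟨h1, h2, h3⟩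
  · rw [abs_le] at h1
    have e1 : -2 * Q - 6 ≤ k₁ := by rcases max_cases k₁ k₂ with h | h <;> linarith
    have e2 : -2 * Q - 6 ≤ k₂ := by rcases max_cases k₁ k₂ with h | h <;> linarith
    generalize max 0 (max k₁ k₂) = z at *
    refine ⟨?_, ?_, ?_, ?_⟩ <;> linarith
  · rw [abs_le] at h1
    have e0 : k₂ ≤ k₁ + 13 := by rcases max_cases k k₁ with h | h <;> linarith
    have e1 : -2 * Q - 13 ≤ k₁ := by rcases max_cases k₁ k₂ with h | h <;> linarith
    generalize max 0 (max k₁ k₂) = z at *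
    refine ⟨?_, ?_, ?_, ?_⟩ <;> linarith
  · rw [abs_le] at h1
    rw [abs_lt] at h2
    have e0 : k₁ ≤ k₂ + 13 := by rcases max_cases k k₂ with h | h <;> linarith
    have e1 : -2 * Q - 13 ≤ k₂ := by rcases max_cases k₁ k₂ with h | h <;> linarith
    have e2 : max 0 k₁ ≤ k₂ + 13 + 2 * Q + 13 := max_le (by linarith) (by linarith)
    have e3 : max k₁ k₂ ≤ m + (6 + s) := max_le (by linarith) (by linarith)
    generalize max 0 k₁ = z at *
    refine ⟨?_, ?_, ?_, ?_⟩ <;> linarith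

/-- For k₁ ≤ 0 the quantity is j - m - k₁. For k₁ > 0 it is j - m, which is controlled either by j <
m - L directly or by j - k₁ < m - L together with k₁ ≤ Q. -/
lemma exponent_bounds_space {m k₁ j L s Q : ℝ} (hs : 0 ≤ s) (hQ : 0 ≤ Q) (hL : 0 ≤ L)
    (h1 : j - k₁ < m - L) (h2 : k₁ ≤ Q ∨ j < m - L) :
    j + max 0 k₁ - m - k₁ ≤ 100 + 10 * Q + 10 * s - L ∧ j ≤ m + (100 + 10 * Q + 10 * s) := by
  rcases max_cases 0 k₁ with ⟨h, h'⟩ | ⟨h, h'⟩ <;> rw [h] <;> rcases h2 with h2 | h2 <;> constructor <;> linarith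

/-- Consequences of the support properties at one point of the circle. -/
lemma dyadic_relations {n : ℕ} {R ρ c₀ υ θ : ℝ} {k k₁ k₂ : ℤ} (hc₀ : 1 ≤ c₀) (h : CircleData n R ρ (c₀ * 2 ^ υ) θ)
    (hR1 : (2 : ℝ) ^ (k - 1) ≤ R) (hR2 : R ≤ 2 ^ (k + 1)) (hρ1 : (2 : ℝ) ^ (k₂ - 3) ≤ ρ) (hρ2 : ρ ≤ 2 ^ (k₂ + 3))
    (hr1 : (2 : ℝ) ^ (k₁ - 3) ≤ √(distSq R ρ θ)) (hr2 : √(distSq R ρ θ) ≤ 2 ^ (k₁ + 3)) :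
    -logb 2 c₀ ≤ υ ∧ (k₂ : ℝ) ≤ k₁ + υ + (6 + logb 2 c₀) ∧ (k : ℝ) ≤ max (k₁ : ℝ) k₂ + 5 ∧
      (k₂ : ℝ) ≤ max (k : ℝ) k₁ + 7 ∧ (k₁ : ℝ) ≤ max (k : ℝ) k₂ + 7 := by
  have hc0 : 0 < c₀ := by linarith
  have hlog : (2 : ℝ) ^ logb 2 c₀ = c₀ := rpow_logb two_pos (by norm_num) hc0
  have hS := h.distSq_pos
  set r := √(distSq R ρ θ) with hr
  have hrr : r ^ 2 = distSq R ρ θ := sq_sqrt hS.le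
  have hr0 : 0 ≤ r := sqrt_nonneg _
  have hR := h.R_pos
  have hρ := h.ρ_pos
  have hcos := neg_one_le_cos θ
  have hcos' := cos_le_one θ
  have hRρ := mul_pos hR hρ
  -- Triangle inequalities, from the law of cosines and |cos θ| ≤ 1.
  have tri1 : R ≤ ρ + r := by
    by_contra hlt
    push Not at hlt
    have : (R - ρ) ^ 2 ≤ r ^ 2 := by rw [hrr]; unfold distSq; nlinarith
    nlinarith
  have tri2 : ρ ≤ R + r := by
    by_contra hlt
    push Not at hlt
    have : (R - ρ) ^ 2 ≤ r ^ 2 := by rw [hrr]; unfold distSq; nlinarith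
    nlinarith
  have tri3 : r ≤ R + ρ := by
    have : r ^ 2 ≤ (R + ρ) ^ 2 := by rw [hrr]; unfold distSq; nlinarith
    exact le_of_sq_le_sq this (by positivity)
  have sum_le : ∀ a b d : ℤ, ∀ x y : ℝ, x ≤ 2 ^ a → y ≤ 2 ^ b → (2 : ℝ) ^ d ≤ x + y → d ≤ max a b + 1 := by
    intro a b d x y hx hy hd
    have h1 : (2 : ℝ) ^ a ≤ 2 ^ (max a b) := zpow_le_zpow_right₀ one_le_two (le_max_left _ _)
    have h2 : (2 : ℝ) ^ b ≤ 2 ^ (max a b) := zpow_le_zpow_right₀ one_le_two (le_max_right _ _)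
    have h3 : (2 : ℝ) ^ d ≤ 2 ^ (max a b + 1) := by rw [zpow_add_one₀ two_ne_zero]; linarith
    exact (zpow_le_zpow_iff_right₀ one_lt_two).mp h3
  refine ⟨?_, ?_, ?_, ?_, ?_⟩
  · have h1 := h.one_le_l
    rw [← hlog, ← rpow_add two_pos] at h1
    by_contra hlt
    exact absurd (rpow_lt_one_of_one_lt_of_neg one_lt_two (by linarith)) (not_lt.mpr h1)
  -- Beyond the triangle inequality: since sin θ is at least 1/l, η is at most l times longer than ξ
  -- - η.
  · have h1 := (hρ1.trans h.ρ_le).trans (mul_le_mul_of_nonneg_left hr2 (by positivity))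
    rw [← hlog, ← rpow_intCast, ← rpow_intCast, ← rpow_add two_pos, ← rpow_add two_pos] at h1
    have := (rpow_le_rpow_left_iff one_lt_two).mp h1
    push_cast at this
    linarith
  · have := sum_le _ _ _ _ _ hρ2 hr2 (hR1.trans tri1)
    have h1 : k ≤ max k₁ k₂ + 5 := by omega
    exact_mod_cast h1
  · have := sum_le _ _ _ _ _ hR2 hr2 (hρ1.trans tri2)
    have h1 : k₂ ≤ max k k₁ + 7 := by omega
    exact_mod_cast h1
  · have := sum_le _ _ _ _ _ hR2 hρ2 (hr1.trans tri3)
    have h1 : k₁ ≤ max k k₂ + 7 := by omega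
    exact_mod_cast h1

end MKG

/-! ### The gain from one integration by parts -/

namespace MKG

open Topology Filter Real

lemma ampScale_nonneg {x y P u u₁ u₂ J L₁ L₂ : ℝ} (hx : 0 ≤ x) (hy : 0 ≤ y) (hP : 0 ≤ P) (hu : 0 ≤ u) (hu₁ : 0 ≤ u₁)
    (hu₂ : 0 ≤ u₂) (hJ : 0 ≤ J) (hL₁ : 0 ≤ L₁) (hL₂ : 0 ≤ L₂) : 0 ≤ ampScale x y P u u₁ u₂ J L₁ L₂ := by
  unfold ampScale; positivity

lemma max_one_zpow (k : ℤ) : max 1 ((2 : ℝ) ^ k) = 2 ^ max (0 : ℝ) k := by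
  rcases le_total 0 k with h | h
  · rw [max_eq_right (one_le_zpow₀ one_le_two h), max_eq_right (by exact_mod_cast h), rpow_intCast]
  · rw [max_eq_left (zpow_le_one_of_nonpos₀ one_le_two h), max_eq_left (by exact_mod_cast h), rpow_zero]

/-- The gain from one integration by parts. -/
lemma recip_mul_ampScale_le {m j₁ l₁ l₂ : ℕ} {k k₁ k₂ : ℤ} {υ κ E : ℝ}
    (h1 : max 0 (k₁ : ℝ) + 2 * υ - m - k - k₂ ≤ E) (h2 : κ - m ≤ E) (h3 : l₁ + max 0 (k₁ : ℝ) + υ - m - k - k₁ ≤ E)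
    (h4 : j₁ + max 0 (k₁ : ℝ) - m - k₁ ≤ E) (h5 : l₂ + max 0 (k₁ : ℝ) + υ - m - k - k₂ ≤ E) :
    max 1 ((2 : ℝ) ^ k₁) * 2 ^ υ / (2 ^ m * 2 ^ k * 2 ^ k₂) *
      ampScale (2 ^ υ) (2 ^ κ) (max 1 (2 ^ k₁)) (2 ^ k) (2 ^ k₁) (2 ^ k₂) (2 ^ j₁) (2 ^ l₁) (2 ^ l₂) ≤ 5 * 2 ^ E := by
  refine recip_mul_ampScale (by positivity) (by positivity) (by positivity) (by positivity) (by positivity) (by positivity)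
    ?_ ?_ ?_ ?_ ?_ <;> rw [← rpow_natCast 2 m] <;> try rw [max_one_zpow]
  · rw [← rpow_intCast 2 k, ← rpow_intCast 2 k₂, pow_two, ← rpow_add two_pos, ← rpow_add two_pos, ← rpow_add two_pos,
      ← rpow_add two_pos, ← rpow_sub two_pos]
    exact rpow_le_rpow_of_exponent_le one_le_two (by linarith)
  · rw [← rpow_sub two_pos]
    exact rpow_le_rpow_of_exponent_le one_le_two (by linarith)
  · rw [← rpow_intCast 2 k, ← rpow_intCast 2 k₁, ← rpow_natCast 2 l₁, ← rpow_add two_pos, ← rpow_add two_pos,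
      ← rpow_add two_pos, ← rpow_add two_pos, ← rpow_sub two_pos]
    exact rpow_le_rpow_of_exponent_le one_le_two (by linarith)
  · rw [← rpow_intCast 2 k₁, ← rpow_natCast 2 j₁, ← rpow_add two_pos, ← rpow_add two_pos, ← rpow_sub two_pos]
    exact rpow_le_rpow_of_exponent_le one_le_two (by linarith)
  · rw [← rpow_intCast 2 k, ← rpow_intCast 2 k₂, ← rpow_natCast 2 l₂, ← rpow_add two_pos, ← rpow_add two_pos,
      ← rpow_add two_pos, ← rpow_add two_pos, ← rpow_sub two_pos]
    exact rpow_le_rpow_of_exponent_le one_le_two (by linarith)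

/-- The exponent loss that is independent of the scales. -/
noncomputable def exponentConst (c₀ Q : ℝ) : ℝ := 100 + 10 * Q + 10 * logb 2 c₀

/-- A dichotomy. If the circle has a point in the support, that point yields the dyadic relations
and with them the exponent inequalities, valid along the whole circle. Otherwise nothing can be said
about the exponents, but the circle contributes nothing. -/
lemma exists_phase_bounds {b c c₀ Q B₁ B₂ B Bw L : ℝ} (hb : 0 < b) (hc : 0 < c) (hc₀ : 1 ≤ c₀) (hQ : 0 ≤ Q)
    (hB₁ : 0 ≤ B₁) (hB₂ : 0 ≤ B₂) (hB : 0 ≤ B) (hBw : 0 ≤ Bw) (q : ℤ) {m j₁ l₁ l₂ D₁ D₂ : ℕ} {k k₁ k₂ : ℤ} {υ κ t R ρ : ℝ}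
    (hm : 1 ≤ m) (hL : 0 ≤ L) (ht : c₀⁻¹ * 2 ^ m ≤ |t|)
    (hR1 : (2 : ℝ) ^ (k - 1) ≤ R) (hR2 : R ≤ 2 ^ (k + 1)) (hρ1 : (2 : ℝ) ^ (k₂ - 3) ≤ ρ) (hρ2 : ρ ≤ 2 ^ (k₂ + 3))
    (hD₁ : (D₁ : ℝ) ≤ 505 * 2 ^ l₁) (hD₂ : (D₂ : ℝ) ≤ 505 * 2 ^ l₂)
    (hmax : -2 * Q ≤ max (k₁ : ℝ) k₂) (hκ : κ < m - L) (hl : max (l₁ : ℝ) l₂ < m / 10) (hj : (j₁ : ℝ) - k₁ < m - L)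
    (hj' : (k₁ : ℝ) ≤ Q ∨ (j₁ : ℝ) < m - L) (hcfg : RealConfig m k k₁ k₂ (max l₁ l₂) υ L) :
    ∃ H Λ : ℝ, (∀ θ, CircleData m R ρ (c₀ * 2 ^ υ) θ → (2 : ℝ) ^ (k₁ - 3) ≤ √(distSq R ρ θ) →
        √(distSq R ρ θ) ≤ 2 ^ (k₁ + 3) →
        √(c ^ 2 * distSq R ρ θ + b ^ 2) * (Real.sin θ)⁻¹ * (|t| * c ^ 2 * (R * ρ))⁻¹ ≤ H) ∧
      (∀ θ, CircleData m R ρ (c₀ * 2 ^ υ) θ → c₀ * 2 ^ υ * Real.sin θ ≤ c₀ ^ 2 → (2 : ℝ) ^ (k₁ - 3) ≤ √(distSq R ρ θ) →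
        √(distSq R ρ θ) ≤ 2 ^ (k₁ + 3) →
        B₁ * (6 * m) ^ 6 * (2 ^ κ * (c ^ 2 * (R * ρ * Real.sin θ) / √(c ^ 2 * distSq R ρ θ + b ^ 2))) +
        (2 * (Bw * (6 * m) ^ 6 * (2 ^ (q + 3) * (c₀ * 2 ^ υ)) + m) + (B₂ * (6 * m) ^ 6 * 2 ^ υ + m) +
          B * (4 * m) ^ 4 * (64 * (c₀ * 2 ^ υ)) +
        (D₁ * (ρ / √(distSq R ρ θ)) + 2 ^ (j₁ + 1) * (R * ρ * Real.sin θ / √(distSq R ρ θ))) + D₂ +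
          38 * m ^ 3 * (c₀ * 2 ^ υ)) ≤ Λ) ∧
      |H| * ((m + 1) * |Λ|) ≤ 10 * (recipConst b c c₀ * ampConst b c c₀ B₁ B₂ B Bw (2 ^ (q + 3)) 505) *
        2 ^ exponentConst c₀ Q * (m ^ 7 * 2 ^ (-L)) ∧ max (k : ℝ) (max k₁ k₂) ≤ m + exponentConst c₀ Q ∨
    ∀ θ, ¬ (CircleData m R ρ (c₀ * 2 ^ υ) θ ∧ (2 : ℝ) ^ (k₁ - 3) ≤ √(distSq R ρ θ) ∧ √(distSq R ρ θ) ≤ 2 ^ (k₁ + 3)) := by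
  by_cases hex : ∃ θ, CircleData m R ρ (c₀ * 2 ^ υ) θ ∧ (2 : ℝ) ^ (k₁ - 3) ≤ √(distSq R ρ θ) ∧ √(distSq R ρ θ) ≤ 2 ^ (k₁ + 3)
  swap
  · exact ⟨0, 0, Or.inr (not_exists.mp hex)⟩
  obtain ⟨θ₀, h0, h01, h02⟩ := hex
  have hs0 : 0 ≤ logb 2 c₀ := logb_nonneg one_lt_two hc₀
  obtain ⟨d1, d2, d3, d4, d5⟩ := dyadic_relations hc₀ h0 hR1 hR2 hρ1 hρ2 h01 h02
  obtain ⟨e1, e2, e3, e4⟩ := exponent_bounds hs0 hQ hL d1 d2 d3 d4 d5 hmax (Nat.cast_nonneg l₁) hl hcfg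
  obtain ⟨e5, e6⟩ := exponent_bounds_space hs0 hQ hL hj hj'
  have hprod := recip_mul_ampScale_le (κ := κ) (E := exponentConst c₀ Q - L) e1
    (by unfold exponentConst; linarith) e2 e5 e3
  have hm1 : (1 : ℝ) ≤ m := by exact_mod_cast hm
  have hk1 : (2 : ℝ) ^ (k - 1) = 2 ^ k / 2 := by rw [zpow_sub_one₀ two_ne_zero]; ring
  have hk2 : (2 : ℝ) ^ (k + 1) = 2 * 2 ^ k := by rw [zpow_add_one₀ two_ne_zero]; ring
  have hz1 : ∀ a : ℤ, (2 : ℝ) ^ (a - 3) = 2 ^ a / 8 := fun a => by rw [zpow_sub₀ two_ne_zero]; norm_num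
  have hz2 : ∀ a : ℤ, (2 : ℝ) ^ (a + 3) = 8 * 2 ^ a := fun a => by
    rw [zpow_add₀ two_ne_zero, mul_comm]; norm_num
  have hmin : 0 < min b (c / 8) := by positivity
  have hrc : 0 ≤ recipConst b c c₀ := by unfold recipConst; positivity
  have hac : 0 ≤ ampConst b c c₀ B₁ B₂ B Bw (2 ^ (q + 3)) 505 := by unfold ampConst; positivity
  have hsc : 0 ≤ ampScale (2 ^ υ) (2 ^ κ) (max 1 (2 ^ k₁)) (2 ^ k) (2 ^ k₁) (2 ^ k₂) (2 ^ j₁) (2 ^ l₁) (2 ^ l₂) :=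
    ampScale_nonneg (by positivity) (by positivity) (by positivity) (by positivity) (by positivity) (by positivity)
      (by positivity) (by positivity) (by positivity)
  refine ⟨recipConst b c c₀ * (max 1 ((2 : ℝ) ^ k₁) * 2 ^ υ / (2 ^ m * 2 ^ k * 2 ^ k₂)),
    ampConst b c c₀ B₁ B₂ B Bw (2 ^ (q + 3)) 505 * m ^ 6 *
      ampScale (2 ^ υ) (2 ^ κ) (max 1 (2 ^ k₁)) (2 ^ k) (2 ^ k₁) (2 ^ k₂) (2 ^ j₁) (2 ^ l₁) (2 ^ l₂),
    Or.inl ⟨?_, ?_, ?_, e4⟩⟩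
  · intro θ h h1 h2
    rw [← sq_sqrt h.distSq_pos.le]
    exact recip_phase_le hb hc hc₀ (by positivity) (by positivity) (by positivity) (by positivity) ht
      (by linarith) (by rw [← hz1]; exact hρ1) (sqrt_nonneg _) (by rw [← hz2]; exact h2) h.sin_pos h.one_le
  · intro θ h h3 h1 h2
    rw [← sq_sqrt h.distSq_pos.le]
    rw [sqrt_sq (sqrt_nonneg _), pow_succ' (2 : ℝ) j₁]
    exact amplitude_le hb hc hc₀ hB₁ hB₂ hB hBw (by positivity) (by norm_num) hm1 (by positivity) (by positivity)
      (by positivity) (by positivity) (by positivity) (by linarith) h.ρ_pos (by rw [← hz2]; exact hρ2)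
      (by rw [← hz1]; exact h1) h.sin_pos h.one_le h3 (sin_le_one θ) (by positivity) (by positivity) (by positivity) hD₁ hD₂
  · rw [abs_of_nonneg (by positivity), abs_of_nonneg (by positivity)]
    set S := ampScale (2 ^ υ) (2 ^ κ) (max 1 (2 ^ k₁)) (2 ^ k) (2 ^ k₁) (2 ^ k₂) (2 ^ j₁) (2 ^ l₁) (2 ^ l₂)
    set Z := max 1 ((2 : ℝ) ^ k₁) * 2 ^ υ / (2 ^ m * 2 ^ k * 2 ^ k₂)
    -- The constant 10 is this 2 times the 5 from the five terms; the power m^7 is m^6 times this m.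
    have hm2 : (m : ℝ) + 1 ≤ 2 * m := by linarith
    calc _ = recipConst b c c₀ * ampConst b c c₀ B₁ B₂ B Bw (2 ^ (q + 3)) 505 * m ^ 6 * (m + 1) * (Z * S) := by ring
      _ ≤ recipConst b c c₀ * ampConst b c c₀ B₁ B₂ B Bw (2 ^ (q + 3)) 505 * m ^ 6 * (2 * m) * (5 * 2 ^ (exponentConst c₀ Q - L)) := by
        gcongr
      _ = _ := by
        rw [sub_eq_add_neg, rpow_add two_pos]
        ring

end MKG

namespace MKG

open Topology Filter Real

/-! ### Summation of the constants -/

lemma pieceMass_le {k : ℤ} {l : ℕ} {V : ℝ} (hV : 1 ≤ V) (hk : (2 : ℝ) ^ k ≤ V) (hl : (2 : ℝ) ^ l ≤ V) :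
    pieceMass k l ≤ (2 * 10 ^ 7 : ℝ) ^ 502 * 32 * V ^ 1509 := by
  have h4 : (4 : ℝ) ^ l ≤ V ^ 2 := by
    have : (4 : ℝ) ^ l = (2 ^ l) ^ 2 := by rw [← pow_mul, mul_comm, pow_mul]; norm_num
    rw [this]; gcongr
  have h8 : (2 : ℝ) ^ (3 * l + 5) ≤ 32 * V ^ 3 := by
    have : (2 : ℝ) ^ (3 * l + 5) = 32 * (2 ^ l) ^ 3 := by rw [pow_add, mul_comm 3 l, pow_mul]; norm_num; ring
    rw [this]; gcongr
  have h1 : 10 ^ 7 * (1 + (2 : ℝ) ^ k) * 4 ^ l ≤ (2 * 10 ^ 7) * V ^ 3 := by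
    calc _ ≤ 10 ^ 7 * (V + V) * V ^ 2 := by gcongr
      _ = _ := by ring
  unfold pieceMass
  -- The exponent 1509 is 3 · 502 + 3: each of the 502 fields costs V³, and S_l costs another V³.
  generalize hn : (502 : ℕ) = n
  have hn' : (1509 : ℕ) = 3 * n + 3 := by omega
  rw [hn', pow_add V, pow_mul V]
  calc _ ≤ ((2 * 10 ^ 7) * V ^ 3) ^ n * (32 * V ^ 3) := by gcongr
    _ = _ := by rw [mul_pow]; ring

/-- The constant in the crude bound for the amplitude. -/
noncomputable def prefactorConst (Bw : ℝ) (q : ℤ) : ℝ :=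
  (2 * q + 1) ^ 3 * (40 * 2 ^ q * Bw ^ 3) * 1011 ^ 2 * 27 * 15552 * ((2 * 10 ^ 7 : ℝ) ^ 502 * 32) ^ 2

/-- The exponent is 3025 = 1 + 2(1 + 2 + 1509): one V for the weight, and for each of F and G one
for the angular degree, two for a Cauchy-Schwarz inequality on a ball, and 1509 for the mass of the
piece. -/
lemma prefactor_le {Bw V : ℝ} {q k k₁ k₂ : ℤ} {j₁ l₁ l₂ D₁ D₂ : ℕ} (hBw : 0 ≤ Bw) (hq : 0 ≤ q) (hV : 1 ≤ V)
    (hk : (2 : ℝ) ^ (max k (max k₁ k₂)) ≤ V) (hj : (2 : ℝ) ^ j₁ ≤ V) (hl₁ : (2 : ℝ) ^ l₁ ≤ V) (hl₂ : (2 : ℝ) ^ l₂ ≤ V)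
    (hD₁ : (D₁ : ℝ) ≤ 505 * 2 ^ l₁) (hD₂ : (D₂ : ℝ) ≤ 505 * 2 ^ l₂) :
    weightMass Bw q k k₁ k₂ * ((2 * D₁ + 1) * (3 * (1 + 2 ^ (j₁ + 1)) ^ 2 * pieceMass k₁ l₁)) *
      ((2 * D₂ + 1) * (192 * (1 + 2 ^ (k₂ + 3)) ^ 2 * pieceMass k₂ l₂)) ≤ prefactorConst Bw q * V ^ 3025 := by
  have hk₁ : (2 : ℝ) ^ k₁ ≤ V :=
    (zpow_le_zpow_right₀ one_le_two ((le_max_left _ _).trans (le_max_right _ _))).trans hk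
  have hk₂ : (2 : ℝ) ^ k₂ ≤ V :=
    (zpow_le_zpow_right₀ one_le_two ((le_max_right _ _).trans (le_max_right _ _))).trans hk
  have hp1 := pieceMass_le hV hk₁ hl₁
  have hp2 := pieceMass_le hV hk₂ hl₂
  have n1 := pieceMass_nonneg k₁ l₁
  have n2 := pieceMass_nonneg k₂ l₂
  have hq0 : (0 : ℝ) ≤ q := by exact_mod_cast hq
  have hq1 : (1 : ℝ) ≤ 2 ^ q := one_le_zpow₀ one_le_two hq
  have w1 : weightMass Bw q k k₁ k₂ ≤ (2 * q + 1) ^ 3 * (40 * 2 ^ q * Bw ^ 3) * V := by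
    have : 1 + (2 : ℝ) ^ (max k (max k₁ k₂) + q) ≤ 2 * 2 ^ q * V := by
      rw [zpow_add₀ two_ne_zero]
      nlinarith [mul_le_mul_of_nonneg_right hk (by positivity : (0 : ℝ) ≤ 2 ^ q), mul_le_mul hq1 hV zero_le_one (by positivity)]
    unfold weightMass
    calc _ ≤ (2 * (q : ℝ) + 1) ^ 3 * (20 * ((2 * 2 ^ q * V) * Bw ^ 3)) := by gcongr
      _ = _ := by ring
  have d1 : 2 * (D₁ : ℝ) + 1 ≤ 1011 * V := by linarith
  have d2 : 2 * (D₂ : ℝ) + 1 ≤ 1011 * V := by linarith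
  have j1 : 1 + (2 : ℝ) ^ (j₁ + 1) ≤ 3 * V := by rw [pow_succ]; linarith
  have j2 : 1 + (2 : ℝ) ^ (k₂ + 3) ≤ 9 * V := by
    rw [zpow_add₀ two_ne_zero]; norm_num; linarith
  unfold prefactorConst
  have hP : (0 : ℝ) ≤ (2 * 10 ^ 7 : ℝ) ^ 502 * 32 := by positivity
  generalize (2 * 10 ^ 7 : ℝ) ^ 502 * 32 = P at *
  generalize pieceMass k₁ l₁ = p₁ at *
  generalize pieceMass k₂ l₂ = p₂ at *
  generalize hn : (1509 : ℕ) = n at *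
  have hn' : (3025 : ℕ) = n + n + 7 := by omega
  rw [hn']
  have hW : 0 ≤ weightMass Bw q k k₁ k₂ := by unfold weightMass; positivity
  calc _ ≤ ((2 * q + 1) ^ 3 * (40 * 2 ^ q * Bw ^ 3) * V) * ((1011 * V) * (3 * (3 * V) ^ 2 * (P * V ^ n))) *
        ((1011 * V) * (192 * (9 * V) ^ 2 * (P * V ^ n))) := by gcongr
    _ = _ := by rw [pow_add, pow_add]; ring

/-- Since 12 log 2 > 8, the margin 12 log m gives 2^{-12 log m} ≤ m^{-8}. This determines the
admissible constant A. -/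
lemma pow_mul_two_rpow_log_le {m : ℕ} (hm : 1 ≤ m) : (m : ℝ) ^ 7 * 2 ^ (-(12 * Real.log m)) ≤ (m : ℝ)⁻¹ := by
  have hm0 : (0 : ℝ) < m := by exact_mod_cast hm
  have hlog : 0 ≤ Real.log m := Real.log_natCast_nonneg m
  have h1 : (2 : ℝ) ^ (-(12 * Real.log m)) ≤ ((m : ℝ) ^ 8)⁻¹ := by
    rw [rpow_def_of_pos two_pos, ← exp_log (by positivity : 0 < ((m : ℝ) ^ 8)⁻¹), log_inv, log_pow]
    refine exp_le_exp.mpr ?_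
    have := Real.log_two_gt_d9
    push_cast
    nlinarith
  calc _ ≤ (m : ℝ) ^ 7 * ((m : ℝ) ^ 8)⁻¹ := by gcongr
    _ = _ := by field_simp

/-- One term of the exponential series, with m! ≤ m^m. -/
lemma div_pow_self_le_exp {D : ℝ} (hD : 0 ≤ D) (m : ℕ) : (D / m) ^ m ≤ Real.exp D := by
  refine le_trans ?_ (Real.pow_div_factorial_le_exp D hD m)
  rw [div_pow]
  have : (m.factorial : ℝ) ≤ (m : ℝ) ^ m := by exact_mod_cast Nat.factorial_le_pow m
  gcongr

/-- The gain from `m` integrations by parts beats the crude bound for the amplitude. -/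
lemma prefactor_mul_gain_le {P C : ℝ} (hP : 0 ≤ P) (hC : 0 ≤ C) (e n : ℕ) {m : ℕ} (hm : 1 ≤ m) :
    P * (2 ^ (m + e)) ^ n * (C * ((m : ℝ) ^ 7 * 2 ^ (-(12 * Real.log m)))) ^ m ≤
      P * (2 ^ e) ^ n * Real.exp (2 ^ n * 2 ^ 20 * C) * 2 ^ (-(20 * (m : ℝ))) := by
  have h1 := pow_mul_two_rpow_log_le hm
  have h2 : (2 : ℝ) ^ (-(20 * (m : ℝ))) = ((2 ^ 20) ^ m)⁻¹ := by
    rw [rpow_neg two_pos.le, ← pow_mul, ← rpow_natCast]; push_cast; rfl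
  calc _ ≤ P * (2 ^ (m + e)) ^ n * (C * (m : ℝ)⁻¹) ^ m := by gcongr
    -- The losses 2^{nm} and 2^{20m} are m-th powers and join the constant inside (D/m)^m.
    _ = P * (2 ^ e) ^ n * ((2 ^ n * 2 ^ 20 * C / m) ^ m) * 2 ^ (-(20 * (m : ℝ))) := by
      rw [h2, pow_add, mul_pow, ← pow_mul, mul_comm m n, pow_mul, div_eq_mul_inv]
      simp only [mul_pow]
      have : ((2 : ℝ) ^ 20) ^ m ≠ 0 := by positivity
      field_simp
    _ ≤ _ := by
      gcongr
      exact div_pow_self_le_exp (by positivity) m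

end MKG

namespace MKG

open Topology Filter Real

/-! ### The bilinear integral in spherical coordinates -/

section Integrand

variable {d : ℕ} {b c : Fin d → ℝ} {φ : ℝ → ℝ} {σ μ ν : Fin d × ℤˣ} {w : ℤ → ℤ → ℤ → Fin 20 → Fin 3 → E3 → ℂ}
  {ψ₁ ψ₂ : ℝ → ℂ} {κ υ t : ℝ} {k k₁ k₂ q : ℤ} {F G f g : E3 → ℂ} {S Bw M₁ M₂ : ℝ} {D₁ D₂ j₁ j₂ : ℕ}

lemma PieceData.continuous (hφ : IsCutoff φ) (hF : PieceData φ D₁ j₁ k₁ M₁ F f) : Continuous (ft F) := by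
  rw [funext hF.ft_eq]
  exact (mult_phiBand hφ k₁).smooth.continuous.mul hF.smooth.continuous

lemma phiBand_ne_zero (hφ : IsCutoff φ) {r : ℝ} (hr : 0 ≤ r) (h : phiBand φ k r ≠ 0) :
    (2 : ℝ) ^ (k - 3) ≤ r ∧ r ≤ 2 ^ (k + 3) := by
  constructor
  · by_contra h0
    exact h (phiBand_eq_zero_of_le hφ hr (not_le.mp h0).le)
  · by_contra h0
    exact h (phiBand_eq_zero_of_lt hφ (not_le.mp h0))

lemma phiK_ne_zero (hφ : IsCutoff φ) {r : ℝ} (hr : 0 ≤ r) (h : phiK φ k r ≠ 0) :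
    (2 : ℝ) ^ (k - 1) ≤ r ∧ r ≤ 2 ^ (k + 1) := by
  constructor
  · by_contra h0
    exact h (phiK_eq_zero_of_le hφ hr (not_le.mp h0).le)
  · by_contra h0
    exact h (phiK_eq_zero_of_lt hφ (not_le.mp h0))

lemma integrand_eq (hφ : IsCutoff φ) (hw : IsWeightFamily S Bw w) (hS : 0 < S) (hq : 8 * S ≤ 2 ^ q)
    (hF : PieceData φ D₁ j₁ k₁ M₁ F f) (hG : PieceData φ D₂ j₂ k₂ M₂ G g) (ξ η : E3) :
    integrand b c φ σ μ ν w ψ₁ ψ₂ κ υ t k F G ξ η =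
      Complex.exp (Complex.I * ((t * Phase b c σ μ ν ξ η : ℝ) : ℂ)) *
        ψ₁ ((2 : ℝ) ^ κ * Phase b c σ μ ν ξ η) * ((phiK φ k ‖ξ‖ : ℝ) : ℂ) * weightBox w q k k₁ k₂ ξ η *
        ψ₂ ((2 : ℝ) ^ υ * Real.sin (InnerProductGeometry.angle ξ η)) * ft F (ξ - η) * ft G η := by
  unfold integrand
  by_cases h0 : phiK φ k ‖ξ‖ = 0
  · simp [h0]
  by_cases h1 : phiBand φ k₁ ‖ξ - η‖ = 0
  · simp [hF.ft_eq, h1]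
  by_cases h2 : phiBand φ k₂ ‖η‖ = 0
  · simp [hG.ft_eq, h2]
  obtain ⟨a1, a2⟩ := phiK_ne_zero hφ (norm_nonneg _) h0
  obtain ⟨a3, a4⟩ := phiBand_ne_zero hφ (norm_nonneg _) h1
  obtain ⟨a5, a6⟩ := phiBand_ne_zero hφ (norm_nonneg _) h2
  rw [weight_eq_weightBox (k := k) hw hS hq ((zpow_le_zpow_right₀ one_le_two (by omega)).trans a1)
    (a2.trans (zpow_le_zpow_right₀ one_le_two (by omega))) a3 a4 a5 a6]

lemma continuous_Phase (ξ : E3) : Continuous (Phase b c σ μ ν ξ) := by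
  unfold Phase Lam; fun_prop

/-- Every factor but the transform of G is bounded, and that transform is integrable. -/
lemma integrable_integrand (hφ : IsCutoff φ) (hw : IsWeightFamily S Bw w) (hS : 0 < S) (hq0 : 0 ≤ q) (hq : 8 * S ≤ 2 ^ q)
    {B₁ B₂ : ℝ} (hψ₁ : GevreyBound 6 B₁ ψ₁) (hψ₂ : GevreyBound 6 B₂ ψ₂)
    (hF : PieceData φ D₁ j₁ k₁ M₁ F f) (hG : PieceData φ D₂ j₂ k₂ M₂ G g) (ξ : E3) :
    Integrable (integrand b c φ σ μ ν w ψ₁ ψ₂ κ υ t k F G ξ) := by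
  have cF := hF.continuous hφ
  have cG := hG.continuous hφ
  have hGi : Integrable (ft G) := ⟨cG.aestronglyMeasurable, lt_of_le_of_lt hG.lintegral_le ENNReal.ofReal_lt_top⟩
  have hc1 := hψ₁.1.continuous
  have hc2 := hψ₂.1.continuous
  have hP := continuous_Phase (b := b) (c := c) (σ := σ) (μ := μ) (ν := ν) ξ
  have hW := continuous_weightBox hw q k k₁ k₂ ξ
  have hB₁ := hψ₁.nonneg
  have hB₂ := hψ₂.nonneg
  have hang : Measurable fun η => InnerProductGeometry.angle ξ η := by
    unfold InnerProductGeometry.angle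
    exact continuous_arccos.measurable.comp (by fun_prop)
  have hMW : 0 ≤ weightMass Bw q k k₁ k₂ := (norm_nonneg _).trans (norm_weightBox_le hw hq0 k k₁ k₂ ξ 0)
  have b1 : ∀ x, ‖ψ₁ x‖ ≤ B₁ := fun x => by simpa using hψ₁.norm_le (le_refl 0) x
  have b2 : ∀ x, ‖ψ₂ x‖ ≤ B₂ := fun x => by simpa using hψ₂.norm_le (le_refl 0) x
  have b3 : ∀ x, ‖ft F x‖ ≤ 3 * (1 + 2 ^ (j₁ + 1)) ^ 2 * M₁ := fun x => by
    rw [hF.ft_eq, norm_mul, Complex.norm_real]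
    have := hF.bound 0 x
    rw [norm_iteratedFDeriv_zero, pow_zero, mul_one] at this
    exact (mul_le_of_le_one_left (norm_nonneg _) (abs_phiBand_le hφ _ _)).trans this
  refine Integrable.mono' (g := fun η => (1 * B₁ * 1 * weightMass Bw q k k₁ k₂ * B₂ * (3 * (1 + 2 ^ (j₁ + 1)) ^ 2 * M₁)) * ‖ft G η‖)
    (hGi.norm.const_mul _) ?_ (ae_of_all _ fun η => ?_)
  · rw [funext (integrand_eq hφ hw hS hq hF hG ξ)]
    refine Measurable.aestronglyMeasurable ?_
    refine Measurable.mul (Measurable.mul (Measurable.mul (Continuous.measurable ?_) ?_) ?_) cG.measurable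
    · fun_prop
    · exact hc2.measurable.comp (by fun_prop)
    · exact (cF.comp (by fun_prop)).measurable
  · rw [integrand_eq hφ hw hS hq hF hG, norm_mul, norm_mul, norm_mul, norm_mul, norm_mul, norm_mul]
    gcongr
    · rw [mul_comm, Complex.norm_exp_ofReal_mul_I]
    · exact b1 _
    · rw [Complex.norm_real]; exact abs_cutoff_sub_le hφ _ _
    · exact norm_weightBox_le hw hq0 k k₁ k₂ ξ η
    · exact b2 _
    · exact b3 _

lemma norm_sub_circle {e ω : E3} (h : OrthoPair e ω) (R ρ θ : ℝ) :
    ‖R • e - ρ • (Real.cos θ • e + Real.sin θ • ω)‖ = √(distSq R ρ θ) := by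
  have h1 : R • e - ρ • (Real.cos θ • e + Real.sin θ • ω) = (R - ρ * Real.cos θ) • e + (-(ρ * Real.sin θ)) • ω := by module
  obtain ⟨i1, i2, i3⟩ := h.inner_self
  rw [← sqrt_sq (norm_nonneg _), ← real_inner_self_eq_norm_sq, h1]
  congr 1
  simp only [inner_add_left, inner_add_right, inner_smul_left, inner_smul_right, i1, i2, i3, h.inner_eq, conj_trivial]
  unfold distSq
  linear_combination ρ ^ 2 * sin_sq_add_cos_sq θ

lemma angle_circle {e ω : E3} (h : OrthoPair e ω) {R ρ θ : ℝ} (hR : 0 < R) (hρ : 0 < ρ) (h0 : 0 ≤ θ) (hπ : θ ≤ π) :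
    InnerProductGeometry.angle (R • e) (ρ • (Real.cos θ • e + Real.sin θ • ω)) = θ := by
  obtain ⟨i1, i2, i3⟩ := h.inner_self
  have hn : ‖Real.cos θ • e + Real.sin θ • ω‖ = 1 := by
    have := norm_Rot h θ ((1 : ℝ) • e)
    rwa [Rot_self h, one_smul, one_smul, h.norm_left] at this
  rw [InnerProductGeometry.angle_smul_right_of_pos _ _ hρ, InnerProductGeometry.angle_smul_left_of_pos _ _ hR,
    InnerProductGeometry.angle, h.norm_left, hn, inner_add_right, inner_smul_right, inner_smul_right, i1, h.inner_eq]
  simpa using arccos_cos h0 hπ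

lemma integral_angMeas (f : ℝ → ℂ) : ∫ θ, f θ ∂angMeas = ∫ θ in (0 : ℝ)..π, f θ * ((Real.sin θ : ℝ) : ℂ) := by
  rw [angMeas, integral_withDensity_eq_integral_toReal_smul (by fun_prop) (by simp),
    intervalIntegral.integral_of_le pi_pos.le, integral_Ioc_eq_integral_Ioo]
  refine setIntegral_congr_fun measurableSet_Ioo fun θ hθ => ?_
  rw [ENNReal.toReal_ofReal (sin_pos_of_pos_of_lt_pi hθ.1 hθ.2).le, Complex.real_smul, mul_comm]

lemma ofReal_integral_norm_eq {v : ℝ → ℂ} (hv : Continuous v) :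
    ENNReal.ofReal (∫ θ in (-π)..π, ‖v θ‖) = ∫⁻ θ in Set.Ioo (-π) π, ‖v θ‖ₑ := by
  have h1 : Integrable v (volume.restrict (Set.Ioc (-π) π)) := (hv.integrableOn_Icc).mono_set Set.Ioc_subset_Icc_self
  rw [intervalIntegral.integral_of_le (by linarith [pi_pos]), ofReal_integral_norm_eq_lintegral_enorm h1,
    restrict_Ioo_eq_restrict_Ioc]

end Integrand

end MKG

/-! ### The contribution of one half circle -/

namespace MKG

open Topology Filter Real

section Ray

variable {d : ℕ} {b c : Fin d → ℝ} {φ : ℝ → ℝ} {σ μ ν : Fin d × ℤˣ} {w : ℤ → ℤ → ℤ → Fin 20 → Fin 3 → E3 → ℂ}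
  {ψ₁ ψ₂ : ℝ → ℂ} {κ υ t : ℝ} {k k₁ k₂ q : ℤ} {F G f g : E3 → ℂ} {S Bw M₁ M₂ : ℝ} {D₁ D₂ j₁ j₂ : ℕ}

lemma abs_sign (s : ℤˣ) : |((s : ℤ) : ℝ)| = 1 := by
  rcases Int.units_eq_one_or s with h | h <;> simp [h]

lemma integral_ray_eq_zero (hφ : IsCutoff φ) (hG : PieceData φ D₂ j₂ k₂ M₂ G g) (B : OrthonormalBasis (Fin 3) ℝ E3)
    (ξ : E3) {τ ρ : ℝ} (hρ : 0 < ρ) (h : ¬((2 : ℝ) ^ (k₂ - 3) ≤ ρ ∧ ρ ≤ 2 ^ (k₂ + 3))) :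
    ∫ θ, integrand b c φ σ μ ν w ψ₁ ψ₂ κ υ t k F G ξ (sphPt B τ ρ θ) ∂angMeas = 0 := by
  have h0 : phiBand φ k₂ ρ = 0 := by
    by_contra hne
    exact h (phiBand_ne_zero hφ hρ.le hne)
  have : ∀ θ, integrand b c φ σ μ ν w ψ₁ ψ₂ κ υ t k F G ξ (sphPt B τ ρ θ) = 0 := fun θ => by
    unfold integrand
    rw [hG.ft_eq (sphPt B τ ρ θ), norm_sphPt, abs_of_pos hρ, h0]
    simp
  simp [this]

/-- The integral over a half circle of fixed radius and azimuth. -/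
lemma enorm_integral_ray_le (hφ : IsCutoff φ) {Bφ : ℝ} (hφB : GevreyBound 4 Bφ φ) (hw : IsWeightFamily S Bw w) (hS : 0 < S)
    (hq0 : 0 ≤ q) (hq : 8 * S ≤ 2 ^ q) (hb : 0 < b μ.1) (hc : 0 < c μ.1)
    {B₁ B₂ : ℝ} (hψ₁ : GevreyBound 6 B₁ ψ₁) (hψ₂ : GevreyBound 6 B₂ ψ₂) {c₀ : ℝ} (hc₀ : 1 ≤ c₀)
    (hψ₂s : ∀ z, ψ₂ z ≠ 0 → c₀⁻¹ ≤ |z| ∧ |z| ≤ c₀)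
    (hF : PieceData φ D₁ j₁ k₁ M₁ F f) (hG : PieceData φ D₂ j₂ k₂ M₂ G g) (B : OrthonormalBasis (Fin 3) ℝ E3)
    {R : ℝ} (hR : 0 < R) (τ : ℝ) {ρ : ℝ} (hρ : 0 < ρ) (hρ2 : ρ ≤ 2 ^ (k₂ + 3)) {m : ℕ} (hm : 1 ≤ m) (ht : t ≠ 0) {H Λ : ℝ}
    (hH : ∀ θ, CircleData m R ρ (c₀ * 2 ^ υ) θ → (2 : ℝ) ^ (k₁ - 3) ≤ √(distSq R ρ θ) → √(distSq R ρ θ) ≤ 2 ^ (k₁ + 3) →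
      √(c μ.1 ^ 2 * distSq R ρ θ + b μ.1 ^ 2) * (Real.sin θ)⁻¹ * (|t| * c μ.1 ^ 2 * (R * ρ))⁻¹ ≤ H)
    (hΛ : ∀ θ, CircleData m R ρ (c₀ * 2 ^ υ) θ → c₀ * 2 ^ υ * Real.sin θ ≤ c₀ ^ 2 → (2 : ℝ) ^ (k₁ - 3) ≤ √(distSq R ρ θ) →
      √(distSq R ρ θ) ≤ 2 ^ (k₁ + 3) →
      B₁ * (6 * m) ^ 6 * (2 ^ κ * (c μ.1 ^ 2 * (R * ρ * Real.sin θ) / √(c μ.1 ^ 2 * distSq R ρ θ + b μ.1 ^ 2))) +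
        (2 * (Bw * (6 * m) ^ 6 * (2 ^ (q + 3) * (c₀ * 2 ^ υ)) + m) + (B₂ * (6 * m) ^ 6 * 2 ^ υ + m) +
          Bφ * (4 * m) ^ 4 * (64 * (c₀ * 2 ^ υ)) +
        (D₁ * (ρ / √(distSq R ρ θ)) + 2 ^ (j₁ + 1) * (R * ρ * Real.sin θ / √(distSq R ρ θ))) + (D₂ + 1 : ℕ) +
          38 * m ^ 3 * (c₀ * 2 ^ υ)) ≤ Λ) :
    ‖∫ θ, integrand b c φ σ μ ν w ψ₁ ψ₂ κ υ t k F G (R • B 0) (sphPt B τ ρ θ) ∂angMeas‖ₑ ≤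
      ENNReal.ofReal (π * (B₁ * weightMass Bw q k k₁ k₂ * B₂ * (2 * Bφ) * ((2 * D₁ + 1) * (3 * (1 + 2 ^ (j₁ + 1)) ^ 2 * M₁)) *
        (2 * (D₂ + 1 : ℕ) + 1) * (|H| * ((m + 1) * |Λ|)) ^ m)) *
      ∫⁻ θ in Set.Ioo (-π) π, ‖ft G (sphPt B τ ρ θ)‖ₑ * ENNReal.ofReal |Real.sin θ| := by
  have hew := orthoPair_equator B τ
  set e := B 0 with he
  set ω := Real.cos τ • B 1 + Real.sin τ • B 2 with hω
  have hpt : ∀ θ, sphPt B τ ρ θ = ρ • (Real.cos θ • e + Real.sin θ • ω) := fun θ => rfl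
  have hB₁ := hψ₁.nonneg
  have hB₂ := hψ₂.nonneg
  have hBφ := hφB.nonneg
  have hBw : 0 ≤ Bw := (hw 0 0 0 0 0).1.nonneg
  have hMW : 0 ≤ weightMass Bw q k k₁ k₂ := (norm_nonneg _).trans (norm_weightBox_le hw hq0 k k₁ k₂ 0 0)
  have hM₁ : 0 ≤ 3 * (1 + (2 : ℝ) ^ (j₁ + 1)) ^ 2 * M₁ := by
    simpa using (norm_nonneg _).trans (hF.bound 0 0)
  -- The Jacobian sin θ is kept together with the transform of G. This raises the degree by one, and
  -- the L¹ norm over the circle becomes that of the measure |sin θ| dθ, which integrates to the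
  -- volume.
  have hv : TrigPoly (D₂ + 1) (fun θ => ft G (sphPt B τ ρ θ) * ((Real.sin θ : ℝ) : ℂ)) := by
    have h1 : ∀ θ, ft G (sphPt B τ ρ θ) = ((phiBand φ k₂ ρ : ℝ) : ℂ) * g (Rot e ω θ (ρ • e)) := fun θ => by
      rw [hG.ft_eq, norm_sphPt, abs_of_pos hρ, sphPt_eq_Rot]
    simp only [h1]
    exact ((hG.ang e ω hew (ρ • e)).const_mul _).mul TrigPoly.sin
  have hWE : ∀ θ, CircleData m R ρ (c₀ * 2 ^ υ) θ → √(distSq R ρ θ) ≤ 2 ^ (k₁ + 3) →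
      EB m (fun θ => ((phiK φ k R : ℝ) : ℂ) * weightBox w q k k₁ k₂ (R • e) (ρ • (Real.cos θ • e + Real.sin θ • ω))) θ
        (weightMass Bw q k k₁ k₂) (2 * (Bw * (6 * m) ^ 6 * (2 ^ (q + 3) * (c₀ * 2 ^ υ)) + m)) := by
    intro θ h hr
    have := (h.eb_weightBox hw hq0 k k₁ k₂ hew hρ2 hr).const_mul ((phiK φ k R : ℝ) : ℂ)
    refine this.mono ?_ (by positivity) le_rfl
    rw [Complex.norm_real]
    exact mul_le_of_le_one_left hMW (abs_cutoff_sub_le hφ _ _)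
  -- The number a₀ collects the part of the phase that is constant on the circle.
  have key := norm_integral_circle_le hm hR hρ hew (a₀ := Lam b c σ (R • e) - ((ν.2 : ℤ) : ℝ) * √(c ν.1 ^ 2 * ρ ^ 2 + b ν.1 ^ 2))
    hb hc (abs_sign μ.2) ht hψ₁ (K₁ := 2 ^ κ) (by positivity) hψ₂ hc₀ hψ₂s (K₂ := 2 ^ υ) (by positivity) hφ hφB k₁
    (by positivity) hWE hF.ang (by positivity) hF.smooth hF.bound hv hH hΛ
  have hint : ∫ θ, integrand b c φ σ μ ν w ψ₁ ψ₂ κ υ t k F G (R • e) (sphPt B τ ρ θ) ∂angMeas =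
      ∫ θ in (0 : ℝ)..π, Complex.exp (Complex.I * ((t * ((Lam b c σ (R • e) - ((ν.2 : ℤ) : ℝ) * √(c ν.1 ^ 2 * ρ ^ 2 + b ν.1 ^ 2)) -
        ((μ.2 : ℤ) : ℝ) * √(c μ.1 ^ 2 * distSq R ρ θ + b μ.1 ^ 2)) : ℝ) : ℂ)) *
      (ψ₁ (2 ^ κ * ((Lam b c σ (R • e) - ((ν.2 : ℤ) : ℝ) * √(c ν.1 ^ 2 * ρ ^ 2 + b ν.1 ^ 2)) -
        ((μ.2 : ℤ) : ℝ) * √(c μ.1 ^ 2 * distSq R ρ θ + b μ.1 ^ 2))) *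
        (((phiK φ k R : ℝ) : ℂ) * weightBox w q k k₁ k₂ (R • e) (ρ • (Real.cos θ • e + Real.sin θ • ω))) *
        ψ₂ (2 ^ υ * Real.sin θ) * ((phiBand φ k₁ √(distSq R ρ θ) : ℝ) : ℂ) *
        f (R • e - ρ • (Real.cos θ • e + Real.sin θ • ω)) * (ft G (sphPt B τ ρ θ) * ((Real.sin θ : ℝ) : ℂ))) := by
    rw [integral_angMeas]
    refine intervalIntegral.integral_congr fun θ hθ => ?_
    rw [Set.uIcc_of_le pi_pos.le] at hθ
    have hnR : ‖R • e‖ = R := by rw [norm_smul, hew.norm_left, mul_one, norm_of_nonneg hR.le]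
    have hnρ : ‖ρ • (Real.cos θ • e + Real.sin θ • ω)‖ = ρ := by
      rw [← hpt, norm_sphPt, abs_of_pos hρ]
    have hPh : Phase b c σ μ ν (R • e) (ρ • (Real.cos θ • e + Real.sin θ • ω)) =
        (Lam b c σ (R • e) - ((ν.2 : ℤ) : ℝ) * √(c ν.1 ^ 2 * ρ ^ 2 + b ν.1 ^ 2)) -
        ((μ.2 : ℤ) : ℝ) * √(c μ.1 ^ 2 * distSq R ρ θ + b μ.1 ^ 2) := by
      have hS0 : 0 ≤ distSq R ρ θ := (sq_nonneg _).trans (CircleData.distSq_ge R ρ θ).1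
      rw [Phase, Lam, Lam, Lam, norm_sub_circle hew, hnρ, sq_sqrt hS0]
      ring
    rw [integrand_eq hφ hw hS hq hF hG, hpt, hPh, hF.ft_eq, norm_sub_circle hew, angle_circle hew hR hρ hθ.1 hθ.2, hnR]
    ring
  rw [← hint] at key
  have hvc := hv.continuous
  have hI : ENNReal.ofReal (∫ θ in (-π)..π, ‖ft G (sphPt B τ ρ θ) * ((Real.sin θ : ℝ) : ℂ)‖) =
      ∫⁻ θ in Set.Ioo (-π) π, ‖ft G (sphPt B τ ρ θ)‖ₑ * ENNReal.ofReal |Real.sin θ| := by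
    rw [ofReal_integral_norm_eq hvc]
    refine lintegral_congr fun θ => ?_
    rw [enorm_mul]
    congr 1
    rw [← ofReal_norm, Complex.norm_real, norm_eq_abs]
  rw [← hI, ← ENNReal.ofReal_mul (by positivity), ← ofReal_norm]
  refine ENNReal.ofReal_le_ofReal (key.trans (le_of_eq ?_))
  rw [abs_of_nonneg hMW]
  ring

end Ray

end MKG

/-! ### The full bilinear integral -/

namespace MKG

open Topology Filter Real

lemma exists_basis_of_norm_one {e : E3} (he : ‖e‖ = 1) : ∃ B : OrthonormalBasis (Fin 3) ℝ E3, B 0 = e := by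
  obtain ⟨B, hB⟩ := Orthonormal.exists_orthonormalBasis_extension_of_card_eq (𝕜 := ℝ) (E := E3) (ι := Fin 3) (by simp)
    (v := fun _ => e) (s := {0}) (by
      rw [orthonormal_iff_ite]
      rintro ⟨i, hi⟩ ⟨j, hj⟩
      rw [Set.mem_singleton_iff] at hi hj
      subst hi hj
      simp [Set.domRestrict, he])
  exact ⟨B, hB 0 rfl⟩

/-- The constant in the gain from one integration by parts. -/
noncomputable def gainConst (b c c₀ Q B₁ B₂ Bφ Bw : ℝ) (q : ℤ) : ℝ :=
  10 * (recipConst b c c₀ * ampConst b c c₀ B₁ B₂ Bφ Bw (2 ^ (q + 3)) 505) * 2 ^ exponentConst c₀ Q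

lemma gainConst_nonneg {b c c₀ Q B₁ B₂ Bφ Bw : ℝ} {q : ℤ} (hb : 0 < b) (hc : 0 < c) (hc₀ : 1 ≤ c₀) (hB₁ : 0 ≤ B₁)
    (hB₂ : 0 ≤ B₂) (hBφ : 0 ≤ Bφ) (hBw : 0 ≤ Bw) : 0 ≤ gainConst b c c₀ Q B₁ B₂ Bφ Bw q := by
  have : 0 < min b (c / 8) := by positivity
  unfold gainConst recipConst ampConst
  positivity

section Main

variable {d : ℕ} {b c : Fin d → ℝ} {φ : ℝ → ℝ} {σ μ ν : Fin d × ℤˣ} {w : ℤ → ℤ → ℤ → Fin 20 → Fin 3 → E3 → ℂ}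
  {ψ₁ ψ₂ : ℝ → ℂ} {κ υ t : ℝ} {k k₁ k₂ q : ℤ} {F G f g : E3 → ℂ} {S Bw M₁ M₂ : ℝ} {j₁ j₂ l₁ l₂ D₁ D₂ : ℕ}

/-- The contribution of one half circle, under the hypotheses on the scales. -/
lemma ray_alternative (hφ : IsCutoff φ) {Bφ : ℝ} (hφB : GevreyBound 4 Bφ φ) (hw : IsWeightFamily S Bw w) (hS : 0 < S)
    (hq0 : 0 ≤ q) (hq : 8 * S ≤ 2 ^ q) (hb : 0 < b μ.1) (hc : 0 < c μ.1)
    {B₁ B₂ : ℝ} (hψ₁ : GevreyBound 6 B₁ ψ₁) (hψ₂ : GevreyBound 6 B₂ ψ₂) {c₀ Q L : ℝ} (hc₀ : 1 ≤ c₀) (hQ : 0 ≤ Q)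
    (hψ₂s : ∀ z, ψ₂ z ≠ 0 → c₀⁻¹ ≤ |z| ∧ |z| ≤ c₀)
    (hF : PieceData φ D₁ j₁ k₁ M₁ F f) (hG : PieceData φ D₂ j₂ k₂ M₂ G g) {m : ℕ} (hm : 1 ≤ m) (hL : 0 ≤ L)
    (ht : c₀⁻¹ * 2 ^ m ≤ |t|) (hD₁ : (D₁ : ℝ) ≤ 505 * 2 ^ l₁) (hD₂ : ((D₂ + 1 : ℕ) : ℝ) ≤ 505 * 2 ^ l₂)
    (hmax : -2 * Q ≤ max (k₁ : ℝ) k₂) (hκ : κ < m - L) (hl : max (l₁ : ℝ) l₂ < m / 10) (hj : (j₁ : ℝ) - k₁ < m - L)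
    (hj' : (k₁ : ℝ) ≤ Q ∨ (j₁ : ℝ) < m - L) (hcfg : RealConfig m k k₁ k₂ (max l₁ l₂) υ L)
    (B : OrthonormalBasis (Fin 3) ℝ E3) {R : ℝ} (hR1 : (2 : ℝ) ^ (k - 1) ≤ R) (hR2 : R ≤ 2 ^ (k + 1))
    (τ : ℝ) {ρ : ℝ} (hρ : 0 < ρ) :
    ∫ θ, integrand b c φ σ μ ν w ψ₁ ψ₂ κ υ t k F G (R • B 0) (sphPt B τ ρ θ) ∂angMeas = 0 ∨
    (max (k : ℝ) (max k₁ k₂) ≤ m + exponentConst c₀ Q ∧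
      ‖∫ θ, integrand b c φ σ μ ν w ψ₁ ψ₂ κ υ t k F G (R • B 0) (sphPt B τ ρ θ) ∂angMeas‖ₑ ≤
      ENNReal.ofReal (π * (B₁ * weightMass Bw q k k₁ k₂ * B₂ * (2 * Bφ) * ((2 * D₁ + 1) * (3 * (1 + 2 ^ (j₁ + 1)) ^ 2 * M₁)) *
        (2 * (D₂ + 1 : ℕ) + 1) * (gainConst (b μ.1) (c μ.1) c₀ Q B₁ B₂ Bφ Bw q * (m ^ 7 * 2 ^ (-L))) ^ m)) *
      ∫⁻ θ in Set.Ioo (-π) π, ‖ft G (sphPt B τ ρ θ)‖ₑ * ENNReal.ofReal |Real.sin θ|) := by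
  have hR : 0 < R := lt_of_lt_of_le (by positivity) hR1
  have ht0 : t ≠ 0 := fun h0 => by
    rw [h0, abs_zero] at ht
    have : 0 < c₀⁻¹ * 2 ^ m := by positivity
    linarith
  have hB₁ := hψ₁.nonneg
  have hB₂ := hψ₂.nonneg
  have hBφ := hφB.nonneg
  have hBw : 0 ≤ Bw := (hw 0 0 0 0 0).1.nonneg
  have hMW : 0 ≤ weightMass Bw q k k₁ k₂ := (norm_nonneg _).trans (norm_weightBox_le hw hq0 k k₁ k₂ 0 0)
  have hM₁ : 0 ≤ 3 * (1 + (2 : ℝ) ^ (j₁ + 1)) ^ 2 * M₁ := by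
    simpa using (norm_nonneg _).trans (hF.bound 0 0)
  by_cases hρ12 : (2 : ℝ) ^ (k₂ - 3) ≤ ρ ∧ ρ ≤ 2 ^ (k₂ + 3)
  swap
  · exact Or.inl (integral_ray_eq_zero hφ hG B _ hρ hρ12)
  obtain ⟨hρ1, hρ2⟩ := hρ12
  obtain ⟨H, Λ, h | h⟩ := exists_phase_bounds hb hc hc₀ hQ hB₁ hB₂ hBφ hBw q hm hL ht hR1 hR2 hρ1 hρ2 hD₁ hD₂ hmax hκ hl hj hj' hcfg
  · obtain ⟨hH, hΛ, hgain, hmx⟩ := h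
    refine Or.inr ⟨hmx, (enorm_integral_ray_le hφ hφB hw hS hq0 hq hb hc hψ₁ hψ₂ hc₀ hψ₂s hF hG B hR τ hρ hρ2 hm ht0 hH hΛ).trans ?_⟩
    replace hgain : _ ≤ gainConst (b μ.1) (c μ.1) c₀ Q B₁ B₂ Bφ Bw q * (m ^ 7 * 2 ^ (-L)) := hgain
    generalize gainConst (b μ.1) (c μ.1) c₀ Q B₁ B₂ Bφ Bw q * ((m : ℝ) ^ 7 * 2 ^ (-L)) = G₀ at hgain ⊢
    gcongr
  -- On a circle that misses the support the conditions on H and Λ are vacuous. Both may be taken to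
  -- be 0, and the bound contains 0^m = 0 because m ≥ 1.
  · left
    have key := enorm_integral_ray_le (σ := σ) (ν := ν) (κ := κ) (k := k) (H := 0) (Λ := 0) hφ hφB hw hS hq0 hq hb hc hψ₁ hψ₂ hc₀
      hψ₂s hF hG B hR τ hρ hρ2 hm ht0 (fun θ h1 h2 h3 => absurd ⟨h1, h2, h3⟩ (h θ)) (fun θ h1 _ h2 h3 => absurd ⟨h1, h2, h3⟩ (h θ))
    rw [abs_zero, zero_mul, zero_pow (by omega), mul_zero, mul_zero, ENNReal.ofReal_zero, zero_mul] at key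
    exact enorm_eq_zero.mp (le_zero_iff.mp key)

/-- The constant in the estimate for the bilinear integral. -/
noncomputable def bilinearConst (b c c₀ Q B₁ B₂ Bφ Bw : ℝ) (q : ℤ) : ℝ :=
  4 * π * B₁ * B₂ * Bφ * (prefactorConst Bw q * (2 ^ ⌈exponentConst c₀ Q⌉₊) ^ 3025 *
    Real.exp (2 ^ 3025 * 2 ^ 20 * gainConst b c c₀ Q B₁ B₂ Bφ Bw q))

/-- The polar axis is the direction of ξ and the number of integrations by parts is m. The bounds on
half circles have a common constant, so they integrate to a multiple of the L¹ norm of the transform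
of G. -/
theorem norm_integral_integrand_le (hφ : IsCutoff φ) {Bφ : ℝ} (hφB : GevreyBound 4 Bφ φ) (hw : IsWeightFamily S Bw w) (hS : 0 < S)
    (hq0 : 0 ≤ q) (hq : 8 * S ≤ 2 ^ q) (hb : 0 < b μ.1) (hc : 0 < c μ.1)
    {B₁ B₂ : ℝ} (hψ₁ : GevreyBound 6 B₁ ψ₁) (hψ₂ : GevreyBound 6 B₂ ψ₂) {c₀ Q L : ℝ} (hc₀ : 1 ≤ c₀) (hQ : 0 ≤ Q)
    (hψ₂s : ∀ z, ψ₂ z ≠ 0 → c₀⁻¹ ≤ |z| ∧ |z| ≤ c₀) {ε : ℝ} (hε : 0 ≤ ε)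
    (hF : PieceData φ D₁ j₁ k₁ (pieceMass k₁ l₁ * ε) F f) (hG : PieceData φ D₂ j₂ k₂ (pieceMass k₂ l₂ * ε) G g)
    {m : ℕ} (hm : 1 ≤ m) (hL : L = 12 * Real.log m)
    (ht : c₀⁻¹ * 2 ^ m ≤ |t|) (hD₁ : (D₁ : ℝ) ≤ 505 * 2 ^ l₁) (hD₂ : ((D₂ + 1 : ℕ) : ℝ) ≤ 505 * 2 ^ l₂)
    (hmax : -2 * Q ≤ max (k₁ : ℝ) k₂) (hκ : κ < m - L) (hl : max (l₁ : ℝ) l₂ < m / 10) (hj : (j₁ : ℝ) - k₁ < m - L)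
    (hj' : (k₁ : ℝ) ≤ Q ∨ (j₁ : ℝ) < m - L) (hcfg : RealConfig m k k₁ k₂ (max l₁ l₂) υ L) (ξ : E3) :
    ‖∫ η, integrand b c φ σ μ ν w ψ₁ ψ₂ κ υ t k F G ξ η‖ ≤
      bilinearConst (b μ.1) (c μ.1) c₀ Q B₁ B₂ Bφ Bw q * 2 ^ (-(20 * (m : ℝ))) * ε ^ 2 := by
  have hp1 := pieceMass_nonneg k₁ l₁
  have hp2 := pieceMass_nonneg k₂ l₂
  obtain ⟨p₁, hp₁⟩ : ∃ p, p = pieceMass k₁ l₁ := ⟨_, rfl⟩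
  obtain ⟨p₂, hp₂⟩ : ∃ p, p = pieceMass k₂ l₂ := ⟨_, rfl⟩
  rw [← hp₁] at hp1 hF
  rw [← hp₂] at hp2 hG
  have hB₁ := hψ₁.nonneg
  have hB₂ := hψ₂.nonneg
  have hBφ := hφB.nonneg
  have hBw : 0 ≤ Bw := (hw 0 0 0 0 0).1.nonneg
  have hMW : 0 ≤ weightMass Bw q k k₁ k₂ := (norm_nonneg _).trans (norm_weightBox_le hw hq0 k k₁ k₂ 0 0)
  have hL0 : 0 ≤ L := by rw [hL]; have := Real.log_natCast_nonneg m; positivity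
  have hgc := gainConst_nonneg (q := q) (Q := Q) hb hc hc₀ hB₁ hB₂ hBφ hBw
  have hq0' : (0 : ℝ) ≤ q := by exact_mod_cast hq0
  have hpc : 0 ≤ prefactorConst Bw q := by unfold prefactorConst; positivity
  have hbc : 0 ≤ bilinearConst (b μ.1) (c μ.1) c₀ Q B₁ B₂ Bφ Bw q := by unfold bilinearConst; positivity
  have hrhs : 0 ≤ bilinearConst (b μ.1) (c μ.1) c₀ Q B₁ B₂ Bφ Bw q * 2 ^ (-(20 * (m : ℝ))) * ε ^ 2 := by positivity
  by_cases h0 : phiK φ k ‖ξ‖ = 0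
  · have : ∀ η, integrand b c φ σ μ ν w ψ₁ ψ₂ κ υ t k F G ξ η = 0 := fun η => by simp [integrand, h0]
    simpa [this] using hrhs
  obtain ⟨hR1, hR2⟩ := phiK_ne_zero hφ (norm_nonneg _) h0
  have hR : 0 < ‖ξ‖ := lt_of_lt_of_le (by positivity) hR1
  obtain ⟨B, hB⟩ := exists_basis_of_norm_one (e := ‖ξ‖⁻¹ • ξ) (by
    rw [norm_smul, norm_inv, norm_norm, inv_mul_cancel₀ hR.ne'])
  have hξ : ‖ξ‖ • B 0 = ξ := by rw [hB, smul_smul, mul_inv_cancel₀ hR.ne', one_smul]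
  have hray := fun τ ρ (hρ : 0 < ρ) => ray_alternative (σ := σ) (ν := ν) hφ hφB hw hS hq0 hq hb hc hψ₁ hψ₂ hc₀ hQ hψ₂s hF hG hm hL0
    ht hD₁ hD₂ hmax hκ hl hj hj' hcfg B hR1 hR2 τ hρ
  rw [hξ] at hray
  have hmeas : Measurable fun η => ‖ft G η‖ₑ := (hG.continuous hφ).measurable.enorm
  -- If some frequency exceeds the cap, no half circle meets the support and the whole integral
  -- vanishes. Otherwise every dyadic scale is at most 2^(m+n).
  by_cases hmx : max (k : ℝ) (max k₁ k₂) ≤ m + exponentConst c₀ Q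
  swap
  · have key := enorm_integral_le_of_sphPt B (g := integrand b c φ σ μ ν w ψ₁ ψ₂ κ υ t k F G ξ) hmeas (K := 0) fun τ ρ hρ => by
      rcases hray τ ρ hρ with h | h
      · simp [h]
      · exact absurd h.1 hmx
    rw [mul_zero, zero_mul, le_zero_iff, enorm_eq_zero] at key
    rwa [key, norm_zero]
  set gain := gainConst (b μ.1) (c μ.1) c₀ Q B₁ B₂ Bφ Bw q * ((m : ℝ) ^ 7 * 2 ^ (-L)) with hgain
  have hgain0 : 0 ≤ gain := by positivity
  have key := enorm_integral_le_of_sphPt B (g := integrand b c φ σ μ ν w ψ₁ ψ₂ κ υ t k F G ξ) hmeas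
    (K := ENNReal.ofReal (π * (B₁ * weightMass Bw q k k₁ k₂ * B₂ * (2 * Bφ) *
      ((2 * D₁ + 1) * (3 * (1 + 2 ^ (j₁ + 1)) ^ 2 * (p₁ * ε))) *
        (2 * (D₂ + 1 : ℕ) + 1) * gain ^ m))) fun τ ρ hρ => by
      rcases hray τ ρ hρ with h | h
      · simp [h]
      · exact h.2
  have key2 := key.trans (mul_le_mul_right hG.lintegral_le _)
  have h2 : ∀ x, (2 : ℝ≥0∞) * ENNReal.ofReal x = ENNReal.ofReal (2 * x) := fun x => by
    rw [ENNReal.ofReal_mul zero_le_two, ENNReal.ofReal_ofNat]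
  rw [← ofReal_norm, h2, ← ENNReal.ofReal_mul (by positivity), ENNReal.ofReal_le_ofReal_iff (by positivity)] at key2
  refine key2.trans ?_
  have hs0 : 0 ≤ logb 2 c₀ := logb_nonneg one_lt_two hc₀
  set n := ⌈exponentConst c₀ Q⌉₊ with hn
  have hceil : exponentConst c₀ Q ≤ n := Nat.le_ceil _
  have hV : (1 : ℝ) ≤ 2 ^ (m + n) := one_le_pow₀ one_le_two
  have hkV : (2 : ℝ) ^ (max k (max k₁ k₂)) ≤ 2 ^ (m + n) := by
    have h1 : max k (max k₁ k₂) ≤ ((m + n : ℕ) : ℤ) := by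
      have : ((max k (max k₁ k₂) : ℤ) : ℝ) ≤ ((m + n : ℕ) : ℝ) := by push_cast; linarith
      exact_mod_cast this
    rw [← zpow_natCast]
    exact zpow_le_zpow_right₀ one_le_two h1
  have hjV : (2 : ℝ) ^ j₁ ≤ 2 ^ (m + n) := by
    obtain ⟨-, h2⟩ := exponent_bounds_space hs0 hQ hL0 hj hj'
    have : ((j₁ : ℕ) : ℝ) ≤ ((m + n : ℕ) : ℝ) := by push_cast; unfold exponentConst at hceil; linarith
    exact pow_le_pow_right₀ one_le_two (by exact_mod_cast this)
  have hm0 : (0 : ℝ) ≤ m := Nat.cast_nonneg m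
  have hl₁ : (2 : ℝ) ^ l₁ ≤ 2 ^ (m + n) := by
    have h1 : (l₁ : ℝ) ≤ m := by linarith [le_max_left (l₁ : ℝ) l₂]
    have h2 : l₁ ≤ m := by exact_mod_cast h1
    exact pow_le_pow_right₀ one_le_two (by omega)
  have hl₂ : (2 : ℝ) ^ l₂ ≤ 2 ^ (m + n) := by
    have h1 : (l₂ : ℝ) ≤ m := by linarith [le_max_right (l₁ : ℝ) l₂]
    have h2 : l₂ ≤ m := by exact_mod_cast h1
    exact pow_le_pow_right₀ one_le_two (by omega)
  have hpre := prefactor_le hBw hq0 hV hkV hjV hl₁ hl₂ hD₁ hD₂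
  rw [← hp₁, ← hp₂] at hpre
  rw [hL] at hgain
  unfold bilinearConst
  generalize (3025 : ℕ) = N at *
  have hfin := prefactor_mul_gain_le hpc hgc n N hm
  rw [← hgain] at hfin
  calc _ = 4 * π * B₁ * B₂ * Bφ * (weightMass Bw q k k₁ k₂ * ((2 * D₁ + 1) * (3 * (1 + 2 ^ (j₁ + 1)) ^ 2 * p₁)) *
      ((2 * (D₂ + 1 : ℕ) + 1) * (192 * (1 + 2 ^ (k₂ + 3)) ^ 2 * p₂)) * gain ^ m) * ε ^ 2 := by ring
    _ ≤ 4 * π * B₁ * B₂ * Bφ * (prefactorConst Bw q * (2 ^ (m + n)) ^ N * gain ^ m) * ε ^ 2 := by gcongr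
    _ ≤ 4 * π * B₁ * B₂ * Bφ * (prefactorConst Bw q * (2 ^ n) ^ N *
        Real.exp (2 ^ N * 2 ^ 20 * gainConst (b μ.1) (c μ.1) c₀ Q B₁ B₂ Bφ Bw q) * 2 ^ (-(20 * (m : ℝ)))) * ε ^ 2 := by gcongr
    _ = _ := by ring

end Main

end MKG

namespace MKG

lemma Config.realConfig {A : ℝ} {m : ℕ} {k k₁ k₂ : ℤ} {l₁ l₂ : ℕ} {υ : ℝ} (h : Config A m k k₁ k₂ l₁ l₂ υ) :
    RealConfig m k k₁ k₂ (max (l₁ : ℝ) l₂) υ (A * Real.log m) := by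
  rcases h with ⟨h1, h2, h3⟩ | ⟨h1, h2, h3⟩ | ⟨h1, h2, h3⟩
  · exact Or.inl ⟨by exact_mod_cast h1, h2, h3⟩
  · exact Or.inr (Or.inl ⟨by exact_mod_cast h1, h2, h3⟩)
  · exact Or.inr (Or.inr ⟨by exact_mod_cast h1, h2, h3⟩)

lemma angularDegree_le (l : ℕ) : ((2 ^ (l + 1) + 502 + 1 : ℕ) : ℝ) ≤ 505 * 2 ^ l := by
  have : (1 : ℝ) ≤ 2 ^ l := one_le_pow₀ one_le_two
  push_cast
  rw [pow_succ]
  linarith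

end MKG

theorem lemma5p1 :
    ∃ A : ℝ, 0 < A ∧ A ≤ 10 ^ 5 ∧
      ∀ (d : ℕ) (b c : Fin d → ℝ), (∀ α, 0 < b α) → (∀ α, 0 < c α) →
      ∀ φ : ℝ → ℝ, MKG.IsCutoff φ →
      ∀ K₀ c₀ R B : ℝ, 1 ≤ K₀ → 1 ≤ c₀ → 1 ≤ R → 1 ≤ B →
      ∀ ψ₁ : 𝓢(ℝ, ℂ), (∃ B₁ : ℝ, MKG.GevreyBound 6 B₁ (ψ₁ : ℝ → ℂ)) →
      ∀ ψ₂ : ℝ → ℂ, (∃ B₂ : ℝ, MKG.GevreyBound 6 B₂ ψ₂) →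
        (∀ z, ψ₂ z ≠ 0 → c₀⁻¹ ≤ |z| ∧ |z| ≤ c₀) →
      ∃ C : ℝ, 0 < C ∧
        ∀ (σ μ ν : Fin d × ℤˣ)
          (w : ℤ → ℤ → ℤ → Fin 20 → Fin 3 → MKG.E3 → ℂ), MKG.IsWeightFamily R B w →
        ∀ (ε₁ : ℝ), 0 < ε₁ →
        ∀ f g : MKG.E3 → ℂ,
          MKG.xNorm φ K₀ f ≤ ENNReal.ofReal ε₁ → MKG.xNorm φ K₀ g ≤ ENNReal.ofReal ε₁ →
        ∀ (m : ℕ) (k k₁ k₂ : ℤ) (j₁ j₂ l₁ l₂ : ℕ) (β₁ β₂ : List MKG.VField) (κ υ t : ℝ),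
          MKG.InJ j₁ k₁ → MKG.InJ j₂ k₂ →
          β₁.length + β₂.length ≤ MKG.N / 2 + 2 →
          c₀⁻¹ * 2 ^ m ≤ |t| → |t| ≤ c₀ * 2 ^ m →
          -2 * K₀ ^ 2 ≤ max (k₁ : ℝ) k₂ →
          MKG.Prec A m κ m →
          max (l₁ : ℝ) l₂ < (m : ℝ) / 10 →
          MKG.Prec A m ((j₁ : ℝ) - k₁) m →
          ((k₁ : ℝ) ≤ K₀ ^ 2 ∨ MKG.Prec A m j₁ m) →
          MKG.Config A m k k₁ k₂ l₁ l₂ υ →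
        ∀ F G : MKG.E3 → ℂ,
          MKG.IsPiece φ β₁ l₁ j₁ k₁ f F → MKG.IsPiece φ β₂ l₂ j₂ k₂ g G →
        ∀ ξ : MKG.E3,
          MeasureTheory.Integrable
              (MKG.integrand b c φ σ μ ν w ψ₁ ψ₂ κ υ t k F G ξ) MeasureTheory.volume ∧
            ‖∫ η : MKG.E3, MKG.integrand b c φ σ μ ν w ψ₁ ψ₂ κ υ t k F G ξ η‖ ≤
              C * (2 : ℝ) ^ (-(20 * (m : ℝ))) * ε₁ ^ 2 := by
  -- The value 12 comes from `pow_mul_two_rpow_log_le`.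
  refine ⟨12, by norm_num, by norm_num, ?_⟩
  intro d b c hb hc φ hφ K₀ c₀ R B hK₀ hc₀ hR hB ψ₁ hψ₁ ψ₂ hψ₂ hψ₂s
  obtain ⟨B₁, hψ₁⟩ := hψ₁
  obtain ⟨B₂, hψ₂⟩ := hψ₂
  obtain ⟨Bφ, hφB⟩ := hφ.gevrey
  obtain ⟨q, hq⟩ := pow_unbounded_of_one_lt (8 * R) (one_lt_two (α := ℝ))
  have hq' : 8 * R ≤ (2 : ℝ) ^ ((q : ℕ) : ℤ) := by rw [zpow_natCast]; exact hq.le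
  have hR0 : 0 < R := by linarith
  -- The constant depends on the indices only through the dispersion relation of μ, because the
  -- terms of σ and ν are constant on each circle. Summing over all species makes it uniform, and
  -- the 1 makes it positive.
  refine ⟨1 + ∑ α, |MKG.bilinearConst (b α) (c α) c₀ (K₀ ^ 2) B₁ B₂ Bφ B q|, by positivity, ?_⟩
  intro σ μ ν w hw ε₁ hε f g hf hg m k k₁ k₂ j₁ j₂ l₁ l₂ β₁ β₂ κ υ t _ _ hβ ht _ hmax hκ hl hj hj' hcfg F G hF hG ξ
  obtain ⟨hf1, hf2⟩ := MKG.eLpNorm_le_of_xNorm hf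
  obtain ⟨hg1, hg2⟩ := MKG.eLpNorm_le_of_xNorm hg
  have hN : MKG.N / 2 + 2 = 502 := rfl
  obtain ⟨F', hF'⟩ := hF.pieceData hφ (by omega) hf1 hε.le hf2
  obtain ⟨G', hG'⟩ := hG.pieceData hφ (by omega) hg1 hε.le hg2
  -- The case m = 0 is excluded because 0 ≤ l₁ ≤ max(l₁, l₂) < m/10.
  have hm : 1 ≤ m := by
    by_contra h
    obtain rfl : m = 0 := by omega
    have := le_max_left (l₁ : ℝ) l₂
    have := Nat.cast_nonneg (α := ℝ) l₁
    norm_num at hl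
    linarith
  refine ⟨MKG.integrable_integrand hφ hw hR0 (Int.natCast_nonneg q) hq' hψ₁ hψ₂ hF' hG' ξ, ?_⟩
  refine (MKG.norm_integral_integrand_le hφ hφB hw hR0 (Int.natCast_nonneg q) hq' (hb μ.1) (hc μ.1) hψ₁ hψ₂ hc₀
    (sq_nonneg K₀) hψ₂s hε.le hF' hG' hm rfl ht ?_ (MKG.angularDegree_le l₂) hmax hκ hl hj hj' hcfg.realConfig ξ).trans ?_
  · refine le_trans ?_ (MKG.angularDegree_le l₁)
    push_cast
    linarith
  · gcongr
    have h1 := Finset.single_le_sum (f := fun α => |MKG.bilinearConst (b α) (c α) c₀ (K₀ ^ 2) B₁ B₂ Bφ B q|)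
      (fun α _ => abs_nonneg _) (Finset.mem_univ μ.1)
    have h2 := le_abs_self (MKG.bilinearConst (b μ.1) (c μ.1) c₀ (K₀ ^ 2) B₁ B₂ Bφ B q)
    linarith
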